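/- **Setting.** Let $k$ be a perfect field. Fix a quality of power series: formal, convergent with respect to a real-valued absolute value $|\cdot|$ on $k$, or algebraic. Let $\mathcal A_\circ$ be the set of power series $y(t)$ in one variable $t$ over $k$ of this quality with $y(0)=0$, and let $\mathcal B$ be the ring of power series of this quality in $t,y_1,\dots,y_m$ (algebraic series are the series that are algebraic over the polynomial ring). For $f=(f_1,\dots,f_n)\in\mathcal B^n$ let $$\mathcal Y=\mathcal Y(f)=\{y\in\mathcal A_\circ^m : f(t,y(t))=0\},\qquad I=I_{\mathcal Y}=\{h\in\mathcal B : h(t,y(t))=0\text{ for all }y\in\mathcal Y\},$$ and for $y\in\mathcal A_\circ^m$ let $\mathcal P_y=\{h\in\mathcal B: h(t,y(t))=0\}$, a prime ideal. The arq.regular locus $\mathrm{Arq.Reg}(\mathcal Y)$ is the set of $y\in\mathcal Y$ for which $\mathcal B_{\mathcal P_y}/I\mathcal B_{\mathcal P_y}$ is a regular local ring, and $\mathrm{Arq.Sing}(\mathcal Y)=\mathcal Y\setminus\mathrm{Arq.Reg}(\mathcal Y)$. For $h\in\mathcal B^r$ and a choice $c$ of $r$ of the variables $y_i$, let $g$ be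 the corresponding $(r\times r)$-minor of the relative Jacobian matrix $\partial_y h$. If $h_1,\dots,h_r\in I$, call $g$ *adapted to* $\mathcal Y$ if the ideal $I\mathcal B_{\mathcal P_y}$ has height $r$ for every $y\in\mathcal Y$ with $g(t,y(t))\ne0$. For $d\in\mathbb N$ put $\mathcal Y_{g,d}=\{y\in\mathcal Y: g(t,y(t))\neq 0,\ \mathrm{ord}_t\, g(t,y(t))=d\}$. A map between sets of points described by coordinates in $k$ (for $\mathcal A_\circ^m$: the coefficients of the series) is *rationally textile* if every coordinate of the image is a rational function of finitely many coordinates of the argument, with a denominator vanishing nowhere on the source. A subset is *textile locally closed* if it is the difference of two zero sets of (possibly infinitely many) polynomials in the coordinates. Say that $\mathcal Y_{g,d}$ *factorizes* if it is textile locally closed in $\mathcal A_\circ^m$ and there are a Zariski locally closed (possibly empty or singular) subset $Z$ of the affine space $\mathbb A_k^{d(2m-r)}$ and a bijection $$\Phi:\mathcal Y_{g,d}\longrightarrow Z\times\mathcal A_\circ^{\,m-r}$$ that is rationally textile in both directions and whose first component is the remainder map, i.e. it sends $y$ to the list of the coefficients of $t,\dots,t^{d}$ in $y_i$ for the $r$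 variables $y_i$ in $c$ and of $t,\dots,t^{2d}$ in $y_i$ for the other $m-r$ variables; in the convergent case $\Phi$ is moreover required to have the following property. Write $k_\circ\{t\}_s$ for the series without constant term with finite $s$-norm $|\sum_j c_jt^j|_s=\sum_j|c_j|s^j$. For every $y_0\in\mathcal Y_{g,d}$ and all sufficiently small $s>0$ (depending on $y_0$), $y_0$ has finite $s$-norm and $\Phi$ maps some ball around $y_0$ in $\mathcal Y_{g,d}\cap k_\circ\{t\}_s^m$, for the $s$-norm, homeomorphically onto an open subset of $Z\times k_\circ\{t\}_s^{\,m-r}$. **Theorem (Structure of arquile varieties).** Let $\mathcal Y=\mathcal Y(f)$ be an arquile variety as above. 1. There are a finite system of generators $F_1,\dots,F_p$ of $I_{\mathcal Y}$ and finitely many minors $g_1,\dots,g_N$ of $\partial_yF$, where $g_j$ is of size $r_j$ and adapted to $\mathcal Y$, such that $\mathrm{Arq.Reg}(\mathcal Y)=\bigcup_j\mathcal U_j$ with $\mathcal U_j=\{y\in\mathcal Y: g_j(t,y(t))\neq0\}$. 2. If $I_{\mathcal Y}\mathcal B_{\mathcal P_y}$ has the same height $r$ for all $y\in\mathcal Y$,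 then for every finite system of generators $F$ of $I_{\mathcal Y}$ the $(r\times r)$-minors of $\partial_yF$ define $\mathrm{Arq.Sing}(\mathcal Y)$ in $\mathcal Y$. 3. For all $h_1,\dots,h_r\in I_{\mathcal Y}$, every $(r\times r)$-minor $g$ of $\partial_yh$ that is adapted to $\mathcal Y$, and every $d\in\mathbb N$, the stratum $\mathcal Y_{g,d}$ factorizes. In particular each $\mathcal Y_{jd}=\{y\in\mathcal U_j:\mathrm{ord}_t\,g_j(t,y(t))=d\}$ is isomorphic to $Z_{jd}\times\mathcal A_\circ^{\,m-r_j}$. 4. For every $(n\times n)$-minor $g$ of $\partial_yf$ and every $d\in\mathbb N$, the stratum $\mathcal Y_{g,d}$ of $\mathcal Y=\mathcal Y(f)$ factorizes (with $r=n$, and no condition on the ideal generated by $f$). -/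

import Mathlib

namespace Arquile

noncomputable section

/-! ### The rings of power series -/

/-- The quality of the power series under consideration: formal, convergent with respect to a
real valued absolute value `v` of the ground field, or algebraic. -/
inductive Quality (k : Type*) [Field k] where
  | formal : Quality k
  | convergent (v : AbsoluteValue k ℝ) : Quality k
  | algebraic : Quality k

/-- `f = ∑ cₙ xⁿ` converges absolutely on some polydisc of positive radius. -/
def IsConvergent {k : Type*} [Field k] (v : AbsoluteValue k ℝ) {ι : Type*}
    (f : MvPowerSeries ι k) : Prop :=
  ∃ r : ℝ, 0 < r ∧ Summable fun n : ι →₀ ℕ => v (MvPowerSeries.coeff n f) * r ^ n.degree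

theorem IsConvergent.mono {k : Type*} [Field k] {v : AbsoluteValue k ℝ} {ι : Type*}
    {f : MvPowerSeries ι k} {r s : ℝ} (hs : 0 ≤ s) (hsr : s ≤ r)
    (h : Summable fun n : ι →₀ ℕ => v (MvPowerSeries.coeff n f) * r ^ n.degree) :
    Summable fun n : ι →₀ ℕ => v (MvPowerSeries.coeff n f) * s ^ n.degree := by
  refine Summable.of_nonneg_of_le (fun n => ?_) (fun n => ?_) h
  · exact mul_nonneg (v.nonneg _) (pow_nonneg hs _)
  · exact mul_le_mul_of_nonneg_left (pow_le_pow_left₀ hs hsr _) (v.nonneg _)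

theorem IsConvergent.add {k : Type*} [Field k] {v : AbsoluteValue k ℝ} {ι : Type*}
    {f g : MvPowerSeries ι k} (hf : IsConvergent v f) (hg : IsConvergent v g) :
    IsConvergent v (f + g) := by
  obtain ⟨r, hr, hf⟩ := hf
  obtain ⟨s, hs, hg⟩ := hg
  have h0 : 0 < min r s := lt_min hr hs
  have hf' := IsConvergent.mono h0.le (min_le_left r s) hf
  have hg' := IsConvergent.mono h0.le (min_le_right r s) hg
  refine ⟨min r s, h0, Summable.of_nonneg_of_le (fun n => ?_) (fun n => ?_) (hf'.add hg')⟩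
  · exact mul_nonneg (v.nonneg _) (pow_nonneg h0.le _)
  · rw [← add_mul, map_add]
    exact mul_le_mul_of_nonneg_right (v.add_le _ _) (pow_nonneg h0.le _)

theorem IsConvergent.neg {k : Type*} [Field k] {v : AbsoluteValue k ℝ} {ι : Type*}
    {f : MvPowerSeries ι k} (hf : IsConvergent v f) : IsConvergent v (-f) := by
  obtain ⟨r, hr, hf⟩ := hf
  refine ⟨r, hr, ?_⟩
  simpa only [map_neg, v.map_neg] using hf

theorem IsConvergent.mul {k : Type*} [Field k] {v : AbsoluteValue k ℝ} {ι : Type*}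
    {f g : MvPowerSeries ι k} (hf : IsConvergent v f) (hg : IsConvergent v g) :
    IsConvergent v (f * g) := by
  classical
  obtain ⟨r, hr, hf⟩ := hf
  obtain ⟨s, hs, hg⟩ := hg
  obtain ⟨u, hu, hur, hus⟩ : ∃ u : ℝ, 0 < u ∧ u ≤ r ∧ u ≤ s :=
    ⟨min r s, lt_min hr hs, min_le_left r s, min_le_right r s⟩
  have hf' := IsConvergent.mono hu.le hur hf
  have hg' := IsConvergent.mono hu.le hus hg
  have hp := hf'.mul_of_nonneg hg'
    (fun n => mul_nonneg (v.nonneg _) (pow_nonneg hu.le _))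
    (fun n => mul_nonneg (v.nonneg _) (pow_nonneg hu.le _))
  have hq := summable_sum_mul_antidiagonal_of_summable_mul
    (f := fun n : ι →₀ ℕ => v (MvPowerSeries.coeff n f) * u ^ n.degree)
    (g := fun n : ι →₀ ℕ => v (MvPowerSeries.coeff n g) * u ^ n.degree) hp
  refine ⟨u, hu, Summable.of_nonneg_of_le (fun n => ?_) (fun n => ?_) hq⟩
  · exact mul_nonneg (v.nonneg _) (pow_nonneg hu.le _)
  · rw [MvPowerSeries.coeff_mul]
    refine (mul_le_mul_of_nonneg_right (v.sum_le _ _) (pow_nonneg hu.le _)).trans ?_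
    rw [Finset.sum_mul]
    refine Finset.sum_le_sum fun p hp => ?_
    have hn : n.degree = p.1.degree + p.2.degree := by
      rw [← Finset.HasAntidiagonal.mem_antidiagonal.mp hp, map_add]
    rw [hn, v.map_mul, pow_add]
    exact le_of_eq (mul_mul_mul_comm _ _ _ _)

theorem IsConvergent.one {k : Type*} [Field k] (v : AbsoluteValue k ℝ) {ι : Type*} :
    IsConvergent v (1 : MvPowerSeries ι k) := by
  classical
  refine ⟨1, one_pos, summable_of_ne_finset_zero (s := {0}) fun n hn => ?_⟩
  rw [MvPowerSeries.coeff_one, if_neg (by simpa using hn), map_zero, zero_mul]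

/-- The ring of power series of quality `q` in the variables `ι`: `k[[x]]`, `k{x}` or `k⟨x⟩`, the
last one being the algebraic closure of `k[x]` in `k[[x]]`. -/
def seriesRing {k : Type*} [Field k] (q : Quality k) (ι : Type*) : Subring (MvPowerSeries ι k) :=
  match q with
  | .formal => ⊤
  | .convergent v =>
      { carrier := {f | IsConvergent v f}
        mul_mem' := fun hf hg => IsConvergent.mul hf hg
        one_mem' := IsConvergent.one v
        add_mem' := fun hf hg => IsConvergent.add hf hg
        zero_mem' := ⟨1, one_pos, by simp⟩
        neg_mem' := fun hf => IsConvergent.neg hf }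
  | .algebraic =>
      (Subalgebra.algebraicClosure (MvPolynomial ι k) (MvPowerSeries ι k)).toSubring

/-- The ring `ℬ` of power series of quality `q` in the variables `t` (the index `none`) and
`y₁, …, yₘ` (the indices `some i`). -/
abbrev SeriesB {k : Type*} [Field k] (q : Quality k) (m : ℕ) : Type _ :=
  ↥(seriesRing q (Option (Fin m)))

/-- `𝒜ₒᵐ`: vectors of `m` power series of quality `q` in the variable `t` without constant term. -/
def Arc {k : Type*} [Field k] (q : Quality k) (m : ℕ) : Type _ :=
  {y : Fin m → PowerSeries k //
    ∀ i, y i ∈ seriesRing q Unit ∧ PowerSeries.constantCoeff (y i) = 0}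

variable {k : Type*} [Field k] {q : Quality k} {m : ℕ}

/-! ### Substitution, arquile varieties, regular points -/

/-- The assignment `t ↦ t`, `yᵢ ↦ yᵢ(t)`. -/
def Arc.assign (y : Arc q m) : Option (Fin m) → MvPowerSeries Unit k
  | none => (PowerSeries.X : PowerSeries k)
  | some i => y.1 i

theorem Arc.hasSubst (y : Arc q m) : MvPowerSeries.HasSubst y.assign := by
  refine MvPowerSeries.hasSubst_of_constantCoeff_zero fun s => ?_
  cases s with
  | none => exact PowerSeries.constantCoeff_X
  | some i => exact (y.2 i).2

/-- The substitution homomorphism `f(t, y) ↦ f(t, y(t))`. -/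
def Arc.eval (y : Arc q m) : MvPowerSeries (Option (Fin m)) k →+* PowerSeries k :=
  (MvPowerSeries.substAlgHom (R := k) y.hasSubst).toRingHom

/-- The prime ideal `𝒫_y` of `ℬ` of all series vanishing at `y`. -/
def Arc.relIdeal (y : Arc q m) : Ideal (SeriesB q m) :=
  RingHom.ker (y.eval.comp (seriesRing q (Option (Fin m))).subtype)

instance Arc.relIdeal_isPrime (y : Arc q m) : y.relIdeal.IsPrime :=
  RingHom.ker_isPrime _

/-- The arquile variety `𝒴(f)`. -/
def variety {n : ℕ} (f : Fin n → SeriesB q m) : Set (Arc q m) :=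
  {y | ∀ a, y.eval (f a : MvPowerSeries (Option (Fin m)) k) = 0}

/-- The ideal `I_𝒴` of all series in `ℬ` vanishing on `𝒴`. -/
def vanishingIdeal (Y : Set (Arc q m)) : Ideal (SeriesB q m) :=
  ⨅ y ∈ Y, Arc.relIdeal y

/-- The ideal `I_𝒴 · ℬ_{𝒫_y}` in the localization of `ℬ` at `𝒫_y`. -/
def localIdeal (Y : Set (Arc q m)) (y : Arc q m) : Ideal (Localization.AtPrime y.relIdeal) :=
  (vanishingIdeal Y).map (algebraMap (SeriesB q m) (Localization.AtPrime y.relIdeal))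

/-- The arquile regular locus. -/
def arqReg (Y : Set (Arc q m)) : Set (Arc q m) :=
  {y | y ∈ Y ∧ IsRegularLocalRing (Localization.AtPrime y.relIdeal ⧸ localIdeal Y y)}

/-- The arquile singular locus. -/
def arqSing (Y : Set (Arc q m)) : Set (Arc q m) :=
  Y \ arqReg Y

/-- The minor of size `r` of the relative Jacobian matrix `∂_y h` of `h = (h₁, …, h_r)` given by
the columns `c`. -/
def minor {r : ℕ} (h : Fin r → SeriesB q m) (c : Fin r → Fin m) :
    MvPowerSeries (Option (Fin m)) k :=
  (Matrix.of fun a b : Fin r =>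
    MvPowerSeries.pderiv k (some (c b)) (h a : MvPowerSeries (Option (Fin m)) k)).det

/-- The minor of `∂_y h` with columns `c`, of size `r`, is adapted to `𝒴`: at all points of `𝒴`
where it does not vanish, the ideal of `𝒴` has height `r`. -/
def IsAdapted (Y : Set (Arc q m)) {r : ℕ} (h : Fin r → SeriesB q m) (c : Fin r → Fin m) : Prop :=
  ∀ y ∈ Y, y.eval (minor h c) ≠ 0 → (localIdeal Y y).height = r

/-- The stratum of all `y ∈ 𝒴` for which `g(t, y(t))` is non-zero of order `d`. -/
def stratum (Y : Set (Arc q m)) (g : MvPowerSeries (Option (Fin m)) k) (d : ℕ) :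
    Set (Arc q m) :=
  {y | y ∈ Y ∧ (y.eval g).order = (d : ℕ∞)}

/-! ### Textile maps -/

/-- The coordinates of `y ∈ 𝒜ₒᵐ`: the index `(i, j)` gives the coefficient of `t^(j+1)` in `yᵢ`. -/
def Arc.coords (y : Arc q m) : Fin m × ℕ → k :=
  fun p => PowerSeries.coeff (p.2 + 1) (y.1 p.1)

/-- A subset of a space `X` with coordinates `cX` is locally closed if it is the difference of two
zero sets of (possibly infinitely many) polynomials in the coordinates, each of them depending on
finitely many coordinates only. -/
def IsPolyLocallyClosed {X ι : Type*} (cX : X → ι → k) (U : Set X) : Prop :=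
  ∃ S T : Set (MvPolynomial ι k),
    U = {x | ∀ P ∈ S, MvPolynomial.eval (cX x) P = 0} \
      {x | ∀ P ∈ T, MvPolynomial.eval (cX x) P = 0}

/-- Each coordinate of `φ x` is a rational function of finitely many of the coordinates of `x`,
with a denominator that vanishes nowhere on `X`. -/
def IsRationallyTextile {X W ι κ : Type*} (cX : X → ι → k) (cW : W → κ → k) (φ : X → W) : Prop :=
  ∀ l : κ, ∃ P Q : MvPolynomial ι k, ∀ x : X,
    MvPolynomial.eval (cX x) Q ≠ 0 ∧
      cW (φ x) l = MvPolynomial.eval (cX x) P / MvPolynomial.eval (cX x) Q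

/-! ### The finite dimensional part -/

open Classical in
/-- The degree of the remainder in the component `i`: it is `d` if `i` is one of the columns `c`,
and `2d` otherwise. -/
def remDegree {r : ℕ} (c : Fin r → Fin m) (d : ℕ) (i : Fin m) : ℕ :=
  if i ∈ Set.range c then d else 2 * d

/-- The index set of the coordinates of polynomial vectors without constant term whose `i`-th
component has degree at most `remDegree c d i`. For injective `c` it has `d(2m - r)` elements. -/
abbrev RemIndex {r : ℕ} (c : Fin r → Fin m) (d : ℕ) : Type :=
  (i : Fin m) × Fin (remDegree c d i)

/-- The coefficients of the remainder of the componentwise division of `y` by `t^(remDegree c d i)`,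
with quotient in `𝒜ₒᵐ`. -/
def remainder {r : ℕ} (c : Fin r → Fin m) (d : ℕ) (y : Arc q m) : RemIndex c d → k :=
  fun p => y.coords (p.1, p.2)

/-- The coordinates on `Z × 𝒜ₒⁿ`. -/
def prodCoords {N : Type*} {n : ℕ} {Z : Set (N → k)} (w : Z × Arc q n) : N ⊕ Fin n × ℕ → k :=
  Sum.elim w.1.1 w.2.coords

/-! ### The `s`-norm -/

/-- The `s`-norm `∑ |cₙ| sⁿ`, with value `⊤` if the sum is infinite. -/
def sNorm (v : AbsoluteValue k ℝ) (s : ℝ) (a : PowerSeries k) : ENNReal :=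
  ∑' n : ℕ, ENNReal.ofReal (v (PowerSeries.coeff n a) * s ^ n)

/-- The `s`-norm of vectors. -/
def Arc.sNorm (v : AbsoluteValue k ℝ) (s : ℝ) (y : Arc q m) : ENNReal :=
  ∑ i, Arquile.sNorm v s (y.1 i)

/-- The distance given by the `s`-norm. -/
def sDist (v : AbsoluteValue k ℝ) (s : ℝ) (y y' : Arc q m) : ENNReal :=
  ∑ i, sNorm v s (y.1 i - y'.1 i)

/-- The distance on `Z × 𝒜ₒⁿ` given by the absolute value and the `s`-norm. -/
def prodDist (v : AbsoluteValue k ℝ) (s : ℝ) {N : Type*} {n : ℕ} {Z : Set (N → k)}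
    (w w' : Z × Arc q n) : ENNReal :=
  max (⨆ l : N, ENNReal.ofReal (v (w.1.1 l - w'.1.1 l))) (sDist v s w.2 w'.2)

/-- Around every point `y₀` of `S` and for all sufficiently small radii `s`, the bijection `Φ` maps
some ball around `y₀` in the `s`-norm in `S ∩ k{t}ₛᵐ` homeomorphically onto an open subset of
`Z × (kₒ{t}ₛ)ⁿ`. -/
def IsLocalSNormHomeo (v : AbsoluteValue k ℝ) {N : Type*} {n : ℕ} {S : Set (Arc q m)}
    {Z : Set (N → k)} (Φ : S ≃ Z × Arc q n) : Prop :=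
  ∀ y₀ : S, ∃ s₀ : ℝ, 0 < s₀ ∧ ∀ s : ℝ, 0 < s → s ≤ s₀ →
    Arc.sNorm v s y₀.1 < ⊤ ∧
    ∃ ε : ENNReal, 0 < ε ∧ ∀ y : S, sDist v s y.1 y₀.1 < ε →
      Arc.sNorm v s (Φ y).2 < ⊤ ∧
      (∀ η : ENNReal, 0 < η → ∃ δ : ENNReal, 0 < δ ∧ ∀ y' : S,
        sDist v s y'.1 y.1 < δ → prodDist v s (Φ y') (Φ y) < η) ∧
      (∀ η : ENNReal, 0 < η → ∃ δ : ENNReal, 0 < δ ∧ ∀ w : Z × Arc q n,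
        prodDist v s w (Φ y) < δ → sDist v s (Φ.symm w).1 y.1 < η)

/-! ### Factorization -/

/-- The subset `S` of `𝒜ₒᵐ` is textile locally closed and factors as `Z × 𝒜ₒ^(m-r)`, where `Z` is a
Zariski locally closed subset of the affine space of remainders, by an isomorphism whose first
component is the remainder map and which is rationally textile in both directions. In the
convergent case it is moreover locally a homeomorphism in the `s`-norms. -/
def Factorizes {r : ℕ} (c : Fin r → Fin m) (d : ℕ) (S : Set (Arc q m)) : Prop :=
  IsPolyLocallyClosed Arc.coords S ∧
  ∃ (Z : Set (RemIndex c d → k)) (Φ : S ≃ Z × Arc q (m - r)),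
    IsPolyLocallyClosed id Z ∧
    (∀ y : S, (Φ y).1.1 = remainder c d y.1) ∧
    IsRationallyTextile (fun y : S => y.1.coords) prodCoords Φ ∧
    IsRationallyTextile prodCoords (fun y : S => y.1.coords) Φ.symm ∧
    ∀ v : AbsoluteValue k ℝ, q = Quality.convergent v → IsLocalSNormHomeo v Φ

end

end Arquile

/-!
The regular locus and the factorization of the strata rest on two independent arguments.

*Regular points.* The rings of series are Noetherian (`isNoetherianRing_seriesRing`), by Weierstrass
division, which respects convergence because division is a contraction for a weighted norm, and
algebraicity because the remainder modulo a separable polynomial is found by Lagrange interpolation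
at its roots. The localization at the prime ideal of an arc `y` is a regular local ring of dimension
`m` with regular system of parameters `yᵢ - yᵢ(t)`, and the matrix expressing elements of the ideal
by these parameters is the relative Jacobian matrix at `y` modulo the maximal ideal. So regularity
of a quotient of the localization can be read off from minors: if a minor of size the height of the
ideal does not vanish at `y`, then the quotient is regular and the rows of the minor generate the
ideal (`localIdeal_eq_and_mem_arqReg`); conversely, at a regular point such a minor exists. To get
adapted minors for varieties with components of different dimensions, the generators are multiplied
with elements that vanish on all but one of the components (`exists_adapted_minors`).

*Strata.* Let `g` be the minor of `∂_y h` with columns `c`, and let `g(t, y(t))` have order `d`. Write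
the arc as a base point, which consists of the remainder and of the quotients of the components not
in `c`, plus `t^(d+1) u` in the components `c`. After multiplication with the adjugate of the
Jacobian matrix and division by `t^(2d+1)`, the equation `h = 0` for `u` becomes `u = Ψ(u)` with a
`t`-adically contracting Newton operator `Ψ`, provided that finitely many coefficients at the base
point satisfy polynomial conditions, which involve only the remainder (`IsAdmissible`). Hence there
is exactly one solution over each admissible base point (`IsAdmissible.existsUnique`). Everything
works for coefficients in any commutative `k`-algebra `S` and is compatible with base change, and
the choice of `S` yields the various properties of this parametrization.

* For the algebra of rational functions in the coordinates of the base point, the solution has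
  rational coordinates (`exists_rational_solution`), so the factorization is rationally textile and
  the set of remainders is locally closed.
* For `S = k[τ]` it joins two points with the same remainder by a line of base points. As
  `k[τ][[t]]` is a domain, a series that lies locally at one of the points in the ideal of `h`
  vanishes at the other one (`eval_eq_zero_of_mul_mem_span`). Hence strata of adapted minors are
  unions of fibres of the remainder map on `h = 0`, and factorize (`factorizes_of_fibres`).
* For `S = k`, the Newton operator is a contraction in the `s`-norm for small `s`, which gives the
  convergence of the solution and its continuous dependence on the base point
  (`IsAdmissible.isConvergent_solution`, `IsAdmissible.exists_continuous`).

In the algebraic case the solution is algebraic: as many algebraic equations as unknowns, with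
nonvanishing Jacobian determinant at the arc, are a regular system of parameters there, and by a
count of transcendence degrees they satisfy a polynomial relation with `yᵢ` and `t`, which can be
specialized to the arc (`mem_algebraic_of_minor_ne_zero`).
-/

open scoped ENNReal NNReal

namespace Arquile

noncomputable section

/-! ### Weighted norms of power series -/

section WeightedNorm

variable {k : Type*} [Field k] {ι κ : Type*}

/-- The weighted monomial `∏ wᵢ^{nᵢ}`. -/
def wMon (w : ι → ℝ≥0∞) (n : ι →₀ ℕ) : ℝ≥0∞ :=
  n.prod fun i e => w i ^ e

theorem wMon_zero (w : ι → ℝ≥0∞) : wMon w 0 = 1 := Finsupp.prod_zero_index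

theorem wMon_add (w : ι → ℝ≥0∞) (n n' : ι →₀ ℕ) : wMon w (n + n') = wMon w n * wMon w n' := by
  classical
  exact Finsupp.prod_add_index' (fun _ => pow_zero _) (fun _ _ _ => pow_add _ _ _)

theorem wMon_single (w : ι → ℝ≥0∞) (i : ι) (e : ℕ) : wMon w (Finsupp.single i e) = w i ^ e :=
  Finsupp.prod_single_index (pow_zero _)

theorem wMon_const (r : ℝ≥0∞) (n : ι →₀ ℕ) : wMon (fun _ => r) n = r ^ n.degree := by
  rw [wMon, Finsupp.prod, Finset.prod_pow_eq_pow_sum, Finsupp.degree_apply]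

theorem wMon_mono {w w' : ι → ℝ≥0∞} (h : ∀ i, w i ≤ w' i) (n : ι →₀ ℕ) : wMon w n ≤ wMon w' n :=
  Finset.prod_le_prod' fun i _ => pow_le_pow_left' (h i) _

theorem wMon_ne_top {w : ι → ℝ≥0∞} (h : ∀ i, w i ≠ ∞) (n : ι →₀ ℕ) : wMon w n ≠ ∞ :=
  ENNReal.prod_ne_top fun i _ => ENNReal.pow_ne_top (h i)

theorem wMon_smul (c : ℝ≥0∞) (w : ι → ℝ≥0∞) (n : ι →₀ ℕ) :
    wMon (fun i => c * w i) n = c ^ n.degree * wMon w n := by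
  rw [← wMon_const, wMon, wMon, wMon, Finsupp.prod, Finsupp.prod, Finsupp.prod,
    ← Finset.prod_mul_distrib]
  exact Finset.prod_congr rfl fun i _ => mul_pow _ _ _

/-- The absolute value with values in `[0, ∞]`. -/
def eabs (v : AbsoluteValue k ℝ) (a : k) : ℝ≥0∞ := ENNReal.ofReal (v a)

variable (v : AbsoluteValue k ℝ)

theorem eabs_zero : eabs v 0 = 0 := by simp [eabs]

theorem eabs_one : eabs v 1 = 1 := by simp [eabs]

theorem eabs_ne_top (a : k) : eabs v a ≠ ∞ := ENNReal.ofReal_ne_top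

theorem eabs_eq_zero {a : k} : eabs v a = 0 ↔ a = 0 := by
  rw [eabs, ENNReal.ofReal_eq_zero]
  exact ⟨fun h => v.eq_zero.mp (le_antisymm h (v.nonneg _)), fun h => by simp [h]⟩

theorem eabs_mul (a b : k) : eabs v (a * b) = eabs v a * eabs v b := by
  rw [eabs, v.map_mul, ENNReal.ofReal_mul (v.nonneg _)]; rfl

theorem eabs_neg (a : k) : eabs v (-a) = eabs v a := by rw [eabs, v.map_neg]; rfl

theorem eabs_add_le (a b : k) : eabs v (a + b) ≤ eabs v a + eabs v b :=
  (ENNReal.ofReal_le_ofReal (v.add_le a b)).trans ENNReal.ofReal_add_le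

theorem eabs_sum_le {α : Type*} (s : Finset α) (f : α → k) :
    eabs v (∑ i ∈ s, f i) ≤ ∑ i ∈ s, eabs v (f i) := by
  classical
  induction s using Finset.induction_on with
  | empty => simp [eabs_zero]
  | insert a s ha ih =>
    rw [Finset.sum_insert ha, Finset.sum_insert ha]
    exact (eabs_add_le v _ _).trans (add_le_add le_rfl ih)

theorem eabs_finsum_le {α : Type*} (f : α → k) (hf : f.HasFiniteSupport) :
    eabs v (∑ᶠ i, f i) ≤ ∑' i, eabs v (f i) := by
  rw [finsum_eq_sum f hf]
  exact (eabs_sum_le v _ _).trans (ENNReal.sum_le_tsum _)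

/-- The weighted norm `∑ |cₙ| wⁿ` of a power series, with value `∞` if the sum diverges. -/
def wNorm (w : ι → ℝ≥0∞) (f : MvPowerSeries ι k) : ℝ≥0∞ :=
  ∑' n : ι →₀ ℕ, eabs v (MvPowerSeries.coeff n f) * wMon w n

variable {v} {w : ι → ℝ≥0∞}

theorem wNorm_zero : wNorm v w (0 : MvPowerSeries ι k) = 0 := by
  simp [wNorm, eabs_zero]

theorem wNorm_neg (f : MvPowerSeries ι k) : wNorm v w (-f) = wNorm v w f := by
  simp only [wNorm, map_neg, eabs_neg]

theorem wNorm_add_le (f g : MvPowerSeries ι k) :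
    wNorm v w (f + g) ≤ wNorm v w f + wNorm v w g := by
  rw [wNorm, wNorm, wNorm, ← ENNReal.tsum_add]
  refine ENNReal.tsum_le_tsum fun n => ?_
  rw [← add_mul, map_add]
  gcongr
  exact eabs_add_le v _ _

theorem wNorm_sub_le (f g : MvPowerSeries ι k) :
    wNorm v w (f - g) ≤ wNorm v w f + wNorm v w g := by
  rw [sub_eq_add_neg]
  exact (wNorm_add_le f (-g)).trans_eq (by rw [wNorm_neg])

theorem wNorm_sum_le {α : Type*} (s : Finset α) (f : α → MvPowerSeries ι k) :
    wNorm v w (∑ i ∈ s, f i) ≤ ∑ i ∈ s, wNorm v w (f i) := by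
  classical
  induction s using Finset.induction_on with
  | empty => simp [wNorm_zero]
  | insert a s ha ih =>
    rw [Finset.sum_insert ha, Finset.sum_insert ha]
    exact (wNorm_add_le _ _).trans (add_le_add le_rfl ih)

theorem wNorm_mono {w' : ι → ℝ≥0∞} (h : ∀ i, w i ≤ w' i) (f : MvPowerSeries ι k) :
    wNorm v w f ≤ wNorm v w' f :=
  ENNReal.tsum_le_tsum fun n => mul_le_mul' le_rfl (wMon_mono h n)

theorem wNorm_mul_le (f g : MvPowerSeries ι k) :
    wNorm v w (f * g) ≤ wNorm v w f * wNorm v w g := by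
  classical
  set F := fun n : ι →₀ ℕ => eabs v (MvPowerSeries.coeff n f) * wMon w n
  set G := fun n : ι →₀ ℕ => eabs v (MvPowerSeries.coeff n g) * wMon w n
  calc wNorm v w (f * g)
      ≤ ∑' n : ι →₀ ℕ, ∑ p ∈ Finset.HasAntidiagonal.antidiagonal n, F p.1 * G p.2 := by
        refine ENNReal.tsum_le_tsum fun n => ?_
        rw [MvPowerSeries.coeff_mul]
        refine (mul_le_mul' (eabs_sum_le v _ _) le_rfl).trans ?_
        rw [Finset.sum_mul]
        refine Finset.sum_le_sum fun p hp => ?_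
        rw [← Finset.HasAntidiagonal.mem_antidiagonal.mp hp, wMon_add, eabs_mul]
        exact (mul_mul_mul_comm _ _ _ _).le
    _ = ∑' n : ι →₀ ℕ, ∑' p : Finset.HasAntidiagonal.antidiagonal n, F p.1.1 * G p.1.2 := by
        refine tsum_congr fun n => ?_
        rw [Finset.tsum_subtype (Finset.HasAntidiagonal.antidiagonal n) fun p => F p.1 * G p.2]
    _ = ∑' p : (ι →₀ ℕ) × (ι →₀ ℕ), F p.1 * G p.2 := by
        rw [← ENNReal.tsum_sigma' fun x : (Σ n : ι →₀ ℕ, Finset.HasAntidiagonal.antidiagonal n) =>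
            F x.2.1.1 * G x.2.1.2,
          ← Finset.HasAntidiagonal.sigmaAntidiagonalEquivProd.tsum_eq fun p => F p.1 * G p.2]
        rfl
    _ = (∑' n, F n) * ∑' n, G n := by
        rw [ENNReal.tsum_prod (f := fun a b => F a * G b), ← ENNReal.tsum_mul_right]
        exact tsum_congr fun a => ENNReal.tsum_mul_left

theorem wNorm_monomial (n : ι →₀ ℕ) (c : k) :
    wNorm v w (MvPowerSeries.monomial n c) = eabs v c * wMon w n := by
  classical
  rw [wNorm, tsum_eq_single n]
  · rw [MvPowerSeries.coeff_monomial_same]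
  · intro b hb
    rw [MvPowerSeries.coeff_monomial_ne hb, eabs_zero, zero_mul]

theorem wNorm_C (c : k) : wNorm v w (MvPowerSeries.C c) = eabs v c := by
  rw [← MvPowerSeries.monomial_zero_eq_C_apply, wNorm_monomial, wMon_zero, mul_one]

theorem wNorm_one : wNorm v w (1 : MvPowerSeries ι k) = 1 := by
  rw [← map_one (MvPowerSeries.C (σ := ι) (R := k)), wNorm_C, eabs_one]

theorem wNorm_X (i : ι) : wNorm v w (MvPowerSeries.X i : MvPowerSeries ι k) = w i := by
  rw [MvPowerSeries.X, wNorm_monomial, eabs_one, one_mul, wMon_single, pow_one]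

theorem wNorm_pow_le (f : MvPowerSeries ι k) (e : ℕ) : wNorm v w (f ^ e) ≤ wNorm v w f ^ e := by
  induction e with
  | zero => rw [pow_zero, pow_zero, wNorm_one]
  | succ e ih =>
    rw [pow_succ, pow_succ]
    exact (wNorm_mul_le _ _).trans (mul_le_mul' ih le_rfl)

theorem wNorm_prod_le {α : Type*} (s : Finset α) (f : α → MvPowerSeries ι k) :
    wNorm v w (∏ i ∈ s, f i) ≤ ∏ i ∈ s, wNorm v w (f i) := by
  classical
  induction s using Finset.induction_on with
  | empty => simp [wNorm_one]
  | insert a s ha ih =>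
    rw [Finset.prod_insert ha, Finset.prod_insert ha]
    exact (wNorm_mul_le _ _).trans (mul_le_mul' le_rfl ih)

/-- The norm of a sum of multiples of power series that is finite in each coefficient. -/
theorem wNorm_le_tsum {α : Type*} (F : MvPowerSeries ι k) (c : α → k)
    (M : α → MvPowerSeries ι k)
    (hfin : ∀ e, (fun d => c d * MvPowerSeries.coeff e (M d)).HasFiniteSupport)
    (hF : ∀ e, MvPowerSeries.coeff e F = ∑ᶠ d, c d * MvPowerSeries.coeff e (M d)) :
    wNorm v w F ≤ ∑' d, eabs v (c d) * wNorm v w (M d) := by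
  calc wNorm v w F ≤ ∑' e, ∑' d, eabs v (c d) * eabs v (MvPowerSeries.coeff e (M d)) * wMon w e := by
        refine ENNReal.tsum_le_tsum fun e => ?_
        rw [hF e, ENNReal.tsum_mul_right]
        gcongr
        refine (eabs_finsum_le v _ (hfin e)).trans_eq (tsum_congr fun d => eabs_mul v _ _)
    _ = _ := by
        rw [ENNReal.tsum_comm]
        refine tsum_congr fun d => ?_
        rw [wNorm, ← ENNReal.tsum_mul_left]
        exact tsum_congr fun e => mul_assoc _ _ _

theorem wNorm_subst_le {a : κ → MvPowerSeries ι k} (ha : MvPowerSeries.HasSubst a)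
    (f : MvPowerSeries κ k) :
    wNorm v w (MvPowerSeries.subst a f) ≤ wNorm v (fun i => wNorm v w (a i)) f := by
  refine (wNorm_le_tsum _ (fun d => MvPowerSeries.coeff d f)
    (fun d => d.prod fun s e => a s ^ e) (fun e => ?_) (fun e => ?_)).trans ?_
  · simpa only [smul_eq_mul] using MvPowerSeries.coeff_subst_finite ha f e
  · simpa only [smul_eq_mul] using MvPowerSeries.coeff_subst ha f e
  · refine ENNReal.tsum_le_tsum fun d => mul_le_mul' le_rfl ?_
    refine (wNorm_prod_le _ _).trans ?_
    exact Finset.prod_le_prod' fun i _ => wNorm_pow_le _ _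

/-- Shrinking the weights by the factor `c ≤ 1` shrinks the norm of a series without constant term
by the same factor. -/
theorem wNorm_smul_le {c : ℝ≥0∞} (hc : c ≤ 1) {f : MvPowerSeries ι k}
    (hf : MvPowerSeries.constantCoeff f = 0) :
    wNorm v (fun i => c * w i) f ≤ c * wNorm v w f := by
  rw [wNorm, wNorm, ← ENNReal.tsum_mul_left]
  refine ENNReal.tsum_le_tsum fun n => ?_
  rw [wMon_smul]
  by_cases hn : n = 0
  · subst hn
    rw [MvPowerSeries.coeff_zero_eq_constantCoeff_apply, hf, eabs_zero]
    simp
  · have h1 : n.degree ≠ 0 := by simpa [Finsupp.degree_eq_zero_iff] using hn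
    have h2 : c ^ n.degree ≤ c := by
      calc c ^ n.degree ≤ c ^ 1 := pow_le_pow_right_of_le_one' hc (Nat.one_le_iff_ne_zero.mpr h1)
        _ = c := pow_one c
    calc eabs v (MvPowerSeries.coeff n f) * (c ^ n.degree * wMon w n)
        ≤ eabs v (MvPowerSeries.coeff n f) * (c * wMon w n) := by gcongr
      _ = _ := by ring

theorem isConvergent_iff {f : MvPowerSeries ι k} :
    IsConvergent v f ↔ ∃ r : ℝ≥0, 0 < r ∧ wNorm v (fun _ => (r : ℝ≥0∞)) f < ∞ := by
  have key : ∀ r : ℝ≥0, (Summable fun n : ι →₀ ℕ => v (MvPowerSeries.coeff n f) * (r : ℝ) ^ n.degree)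
      ↔ wNorm v (fun _ => (r : ℝ≥0∞)) f < ∞ := by
    intro r
    have h0 : ∀ n : ι →₀ ℕ, 0 ≤ v (MvPowerSeries.coeff n f) * (r : ℝ) ^ n.degree := fun n =>
      mul_nonneg (v.nonneg _) (pow_nonneg r.2 _)
    have h1 : wNorm v (fun _ => (r : ℝ≥0∞)) f =
        ∑' n : ι →₀ ℕ, ((v (MvPowerSeries.coeff n f) * (r : ℝ) ^ n.degree).toNNReal : ℝ≥0∞) := by
      refine tsum_congr fun n => ?_
      rw [wMon_const, eabs, ← ENNReal.ofReal_coe_nnreal, ← ENNReal.ofReal_pow (NNReal.coe_nonneg r),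
        ← ENNReal.ofReal_mul (v.nonneg _)]
      rfl
    rw [h1, lt_top_iff_ne_top, ENNReal.tsum_coe_ne_top_iff_summable, ← NNReal.summable_coe]
    exact summable_congr fun n => (Real.coe_toNNReal _ (h0 n)).symm
  constructor
  · rintro ⟨r, hr, h⟩
    exact ⟨⟨r, hr.le⟩, hr, (key ⟨r, hr.le⟩).mp h⟩
  · rintro ⟨r, hr, h⟩
    exact ⟨r, hr, (key r).mpr h⟩

theorem isConvergent_of_wNorm_lt_top [Finite ι] {f : MvPowerSeries ι k} (hw : ∀ i, w i ≠ 0)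
    (h : wNorm v w f < ∞) : IsConvergent v f := by
  cases nonempty_fintype ι
  obtain ⟨r, hr, hrw⟩ : ∃ r : ℝ≥0, 0 < r ∧ ∀ i, (r : ℝ≥0∞) ≤ w i := by
    classical
    have h1 : ∀ i, ∃ r : ℝ≥0, 0 < r ∧ (r : ℝ≥0∞) ≤ w i := fun i => by
      obtain ⟨r, hr, hr'⟩ := ENNReal.lt_iff_exists_nnreal_btwn.mp (pos_iff_ne_zero.mpr (hw i))
      exact ⟨r, by exact_mod_cast hr, hr'.le⟩
    choose ρ hρ hρw using h1
    rcases isEmpty_or_nonempty ι with hι | hι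
    · exact ⟨1, one_pos, fun i => hι.elim i⟩
    · obtain ⟨i₀, hi₀⟩ := Finite.exists_min ρ
      exact ⟨ρ i₀, hρ i₀, fun i => (ENNReal.coe_le_coe.mpr (hi₀ i)).trans (hρw i)⟩
  exact isConvergent_iff.mpr ⟨r, hr, (wNorm_mono hrw f).trans_lt h⟩

/-- A convergent series without constant term has arbitrarily small norms. -/
theorem IsConvergent.exists_wNorm_le {f : MvPowerSeries ι k} (hf : IsConvergent v f)
    (h0 : MvPowerSeries.constantCoeff f = 0) {ε : ℝ≥0∞} (hε : 0 < ε) :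
    ∃ r : ℝ≥0, 0 < r ∧ wNorm v (fun _ => (r : ℝ≥0∞)) f ≤ ε := by
  obtain ⟨r, hr, h⟩ := isConvergent_iff.mp hf
  obtain ⟨c, hc0, hc⟩ : ∃ c : ℝ≥0, 0 < c ∧ (c : ℝ≥0∞) * wNorm v (fun _ => (r : ℝ≥0∞)) f < ε := by
    obtain ⟨c, hc0, hc⟩ := ENNReal.exists_nnreal_pos_mul_lt h.ne hε.ne'
    exact ⟨c, hc0, hc⟩
  refine ⟨min c 1 * r, mul_pos (lt_min hc0 one_pos) hr, ?_⟩
  have h1 : ((min c 1 : ℝ≥0) : ℝ≥0∞) ≤ 1 := by exact_mod_cast min_le_right c 1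
  have h2 := wNorm_smul_le (v := v) (w := fun _ => (r : ℝ≥0∞)) h1 h0
  rw [ENNReal.coe_mul]
  refine h2.trans (le_trans ?_ hc.le)
  gcongr
  exact min_le_left c 1

end WeightedNorm

/-! ### Closure properties of the rings of power series -/

section Quality

variable {k : Type*} [Field k] {ι κ σ : Type*}

theorem mem_algebraic {f : MvPowerSeries ι k} :
    f ∈ seriesRing (Quality.algebraic : Quality k) ι ↔ IsAlgebraic (MvPolynomial ι k) f := Iff.rfl

theorem mem_formal (f : MvPowerSeries ι k) : f ∈ seriesRing (Quality.formal : Quality k) ι :=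
  Subring.mem_top f

theorem IsConvergent.subst [Finite κ] [Finite ι] {v : AbsoluteValue k ℝ} {f : MvPowerSeries κ k}
    (hf : IsConvergent v f) {a : κ → MvPowerSeries ι k} (ha : ∀ i, IsConvergent v (a i))
    (ha0 : ∀ i, MvPowerSeries.constantCoeff (a i) = 0) :
    IsConvergent v (MvPowerSeries.subst a f) := by
  cases nonempty_fintype κ
  obtain ⟨r, hr, hfr⟩ := isConvergent_iff.mp hf
  have h1 : ∀ i, ∃ ρ : ℝ≥0, 0 < ρ ∧ wNorm v (fun _ => (ρ : ℝ≥0∞)) (a i) ≤ r := fun i =>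
    (ha i).exists_wNorm_le (ha0 i) (by exact_mod_cast hr)
  choose ρ hρ hρa using h1
  obtain ⟨ρ₀, hρ₀, hle⟩ : ∃ ρ₀ : ℝ≥0, 0 < ρ₀ ∧ ∀ i, ρ₀ ≤ ρ i := by
    rcases isEmpty_or_nonempty κ with hκ | hκ
    · exact ⟨1, one_pos, fun i => hκ.elim i⟩
    · obtain ⟨i₀, hi₀⟩ := Finite.exists_min ρ
      exact ⟨ρ i₀, hρ i₀, hi₀⟩
  refine isConvergent_iff.mpr ⟨ρ₀, hρ₀, lt_of_le_of_lt ?_ hfr⟩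
  refine (wNorm_subst_le (MvPowerSeries.hasSubst_of_constantCoeff_zero ha0) f).trans ?_
  refine wNorm_mono (fun i => ?_) f
  refine le_trans (wNorm_mono (fun _ => ?_) _) (hρa i)
  exact_mod_cast hle i

theorem coe_mem_seriesRing (q : Quality k) (p : MvPolynomial ι k) :
    (p : MvPowerSeries ι k) ∈ seriesRing q ι := by
  match q with
  | .formal => exact mem_formal _
  | .algebraic => exact isAlgebraic_algebraMap p
  | .convergent v =>
    refine isConvergent_iff.mpr ⟨1, one_pos, ?_⟩
    rw [wNorm, tsum_eq_sum (s := p.support)]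
    · refine ENNReal.sum_lt_top.mpr fun n _ => ?_
      exact ENNReal.mul_lt_top ENNReal.ofReal_lt_top (wMon_ne_top (by simp) n).lt_top
    · intro n hn
      rw [MvPolynomial.coeff_coe, MvPolynomial.notMem_support_iff.mp hn, eabs_zero, zero_mul]

theorem X_mem_seriesRing (q : Quality k) (i : ι) :
    (MvPowerSeries.X i : MvPowerSeries ι k) ∈ seriesRing q ι := by
  rw [← MvPolynomial.coe_X]
  exact coe_mem_seriesRing q _

theorem C_mem_seriesRing (q : Quality k) (a : k) :
    (MvPowerSeries.C a : MvPowerSeries ι k) ∈ seriesRing q ι := by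
  rw [← MvPolynomial.coe_C]
  exact coe_mem_seriesRing q _

/-- Substitution of polynomials without constant term, when it is injective, preserves the quality
of power series. -/
theorem subst_mem_seriesRing [Finite κ] [Finite ι] (q : Quality k) {a : κ → MvPolynomial ι k}
    (ha0 : ∀ i, MvPolynomial.constantCoeff (a i) = 0)
    (hinj : Function.Injective
      (MvPowerSeries.subst (fun i => (a i : MvPowerSeries ι k)) (R := k)))
    {f : MvPowerSeries κ k} (hf : f ∈ seriesRing q κ) :
    MvPowerSeries.subst (fun i => (a i : MvPowerSeries ι k)) f ∈ seriesRing q ι := by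
  have h0 : ∀ i, MvPowerSeries.constantCoeff (a i : MvPowerSeries ι k) = 0 := fun i => by
    rw [← MvPowerSeries.coeff_zero_eq_constantCoeff_apply, MvPolynomial.coeff_coe]
    exact ha0 i
  have hs := MvPowerSeries.hasSubst_of_constantCoeff_zero h0
  match q, hf with
  | .formal, _ => exact mem_formal _
  | .convergent v, hf =>
    exact IsConvergent.subst hf (fun i => coe_mem_seriesRing (Quality.convergent v) (a i)) h0
  | .algebraic, hf =>
    have hf' : IsAlgebraic (MvPolynomial κ k) f := hf
    have hcoe : ∀ p : MvPolynomial κ k,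
        MvPowerSeries.substAlgHom (R := k) hs (p : MvPowerSeries κ k) =
          ((MvPolynomial.aeval a p : MvPolynomial ι k) : MvPowerSeries ι k) := by
      intro p
      rw [MvPowerSeries.substAlgHom_coe]
      have h2 := MvPolynomial.aeval_algebraMap_apply (R := k) (MvPowerSeries ι k) a p
      exact h2
    have h3 := hf'.ringHom_of_comp_eq (g := (MvPowerSeries.substAlgHom (R := k) hs).toRingHom)
      (f := (MvPolynomial.aeval (R := k) a).toRingHom) ?_ ?_
    · refine mem_algebraic.mpr ?_
      simpa using h3
    · intro p p' hpp
      have h4 := congrArg (fun x : MvPolynomial ι k => (x : MvPowerSeries ι k)) hpp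
      have h5 := (hcoe p).trans (h4.trans (hcoe p').symm)
      rw [MvPowerSeries.substAlgHom_apply, MvPowerSeries.substAlgHom_apply] at h5
      exact MvPolynomial.coe_injective _ _ (hinj h5)
    · exact RingHom.ext fun p => (hcoe p).symm

theorem rename_mem_seriesRing [Finite κ] [Finite ι] (q : Quality k) (e : κ ↪ ι)
    {f : MvPowerSeries κ k} (hf : f ∈ seriesRing q κ) :
    MvPowerSeries.rename e f ∈ seriesRing q ι := by
  have h : (fun i => ((MvPolynomial.X (e i) : MvPolynomial ι k) : MvPowerSeries ι k)) =
      MvPowerSeries.X ∘ e := by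
    ext1 i
    exact MvPolynomial.coe_X _
  have h1 := subst_mem_seriesRing q (a := fun i => MvPolynomial.X (e i)) (fun i => by simp)
    (f := f) ?_ hf
  · rw [h, ← MvPowerSeries.rename_eq_subst] at h1
    exact h1
  · rw [h]
    intro x y hxy
    rw [← MvPowerSeries.rename_eq_subst, ← MvPowerSeries.rename_eq_subst] at hxy
    exact MvPowerSeries.rename_injective e hxy

/-- An isomorphism of index sets induces an isomorphism of the rings of power series. -/
def seriesRingEquiv [Finite κ] [Finite ι] (q : Quality k) (e : κ ≃ ι) :
    seriesRing q κ ≃+* seriesRing q ι where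
  toFun f := ⟨MvPowerSeries.rename e f.1, rename_mem_seriesRing q e.toEmbedding f.2⟩
  invFun f := ⟨MvPowerSeries.rename e.symm f.1, rename_mem_seriesRing q e.symm.toEmbedding f.2⟩
  left_inv f := Subtype.ext (by simp)
  right_inv f := Subtype.ext (by simp)
  map_mul' f g := Subtype.ext (by simp)
  map_add' f g := Subtype.ext (by simp)

end Quality

/-! ### Weierstrass division -/

section Division

variable {k : Type*} [Field k] {ι σ : Type*}

theorem mem_span_range_X [Finite ι] {f : MvPowerSeries ι k}
    (hf : MvPowerSeries.constantCoeff f = 0) :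
    f ∈ Ideal.span (Set.range (MvPowerSeries.X : ι → MvPowerSeries ι k)) := by
  classical
  cases nonempty_fintype ι
  have hex : ∀ n : ι →₀ ℕ, n ≠ 0 → ∃ i, n i ≠ 0 := fun n hn => by
    by_contra! h
    exact hn (Finsupp.ext h)
  choose c hc using hex
  let g : ι → MvPowerSeries ι k := fun i n =>
    if h : n = 0 then 0 else if c n h = i then MvPowerSeries.coeff n f else 0
  have hg : ∀ i n, MvPowerSeries.coeff n (g i) =
      if h : n = 0 then 0 else if c n h = i then MvPowerSeries.coeff n f else 0 := fun i n => rfl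
  have hsum : f = ∑ i, g i := by
    ext n
    rw [map_sum]
    simp only [hg]
    by_cases hn : n = 0
    · subst hn
      simp [hf]
    · simp [hn]
  rw [hsum]
  refine Ideal.sum_mem _ fun i _ => ?_
  have hdvd : MvPowerSeries.X i ∣ g i := by
    rw [MvPowerSeries.X_dvd_iff]
    intro n hn
    rw [hg]
    split_ifs with h1 h2
    · rfl
    · exact absurd hn (h2 ▸ hc n h1)
    · rfl
  exact Ideal.mem_of_dvd _ hdvd (Ideal.subset_span ⟨i, rfl⟩)

theorem maximalIdeal_eq_span_range_X [Finite ι] :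
    IsLocalRing.maximalIdeal (MvPowerSeries ι k) =
      Ideal.span (Set.range (MvPowerSeries.X : ι → MvPowerSeries ι k)) := by
  apply le_antisymm
  · intro f hf
    refine mem_span_range_X ?_
    by_contra h
    exact (IsLocalRing.mem_maximalIdeal f).mp hf
      (MvPowerSeries.isUnit_iff_constantCoeff.mpr (isUnit_iff_ne_zero.mpr h))
  · rw [Ideal.span_le]
    rintro _ ⟨i, rfl⟩
    refine (IsLocalRing.mem_maximalIdeal _).mpr fun h => ?_
    have := MvPowerSeries.isUnit_iff_constantCoeff.mp h
    simp at this

instance instIsAdicCompleteMaximalIdeal [Finite ι] :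
    IsAdicComplete (IsLocalRing.maximalIdeal (MvPowerSeries ι k)) (MvPowerSeries ι k) := by
  rw [maximalIdeal_eq_span_range_X]
  infer_instance

/-- The power series in the variables `σ`, as a power series in the variables `Option σ`. -/
def lift (f : MvPowerSeries σ k) : MvPowerSeries (Option σ) k :=
  MvPowerSeries.rename (Function.Embedding.some : σ ↪ Option σ) f

theorem optionEquivLeft_lift (f : MvPowerSeries σ k) :
    MvPowerSeries.optionEquivLeft σ k (lift f) = PowerSeries.C f := by
  classical
  ext n x
  rw [MvPowerSeries.coeff_coeff_optionEquivLeft, PowerSeries.coeff_C, lift]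
  by_cases hn : n = 0
  · subst hn
    rw [if_pos rfl]
    have : x.optionElim 0 = Finsupp.embDomain Function.Embedding.some x := by
      ext i
      cases i with
      | none =>
        rw [Finsupp.optionElim_apply_none, Finsupp.embDomain_of_notMem_range]
        simp
      | some i =>
        rw [Finsupp.optionElim_apply_some]
        exact (Finsupp.embDomain_apply_self Function.Embedding.some x i).symm
    rw [this, MvPowerSeries.coeff_embDomain_rename]
  · rw [if_neg hn, map_zero]
    refine MvPowerSeries.coeff_rename_eq_zero _ _ ?_
    rintro ⟨y, hy⟩
    have h2 := DFunLike.congr_fun hy none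
    rw [Finsupp.optionElim_apply_none, Finsupp.mapDomain_of_notMem_range] at h2
    · exact hn h2.symm
    · simp

theorem coeff_eq_coeff_optionEquivLeft (f : MvPowerSeries (Option σ) k) (n : Option σ →₀ ℕ) :
    MvPowerSeries.coeff n f = MvPowerSeries.coeff n.some
      (PowerSeries.coeff (n none) (MvPowerSeries.optionEquivLeft σ k f)) := by
  rw [MvPowerSeries.coeff_coeff_optionEquivLeft, Finsupp.optionElim_some]

theorem optionEquivLeft_lift_mul_X_pow (r : MvPowerSeries σ k) (j : ℕ) :
    MvPowerSeries.optionEquivLeft σ k (lift r * MvPowerSeries.X none ^ j) =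
      PowerSeries.C r * PowerSeries.X ^ j := by
  rw [map_mul, map_pow, optionEquivLeft_lift, MvPowerSeries.optionEquivLeft_X_none]

theorem coeff_lift_mul_X_pow (r : MvPowerSeries σ k) (j : ℕ) (n : Option σ →₀ ℕ) :
    MvPowerSeries.coeff n (lift r * MvPowerSeries.X none ^ j) =
      if n none = j then MvPowerSeries.coeff n.some r else 0 := by
  rw [coeff_eq_coeff_optionEquivLeft, optionEquivLeft_lift_mul_X_pow,
    PowerSeries.coeff_C_mul_X_pow]
  split_ifs <;> simp

/-- The series `f` is regular of order `d` in the variable with index `none`. -/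
def IsRegularOfOrder (f : MvPowerSeries (Option σ) k) (d : ℕ) : Prop :=
  MvPowerSeries.coeff (Finsupp.single none d) f ≠ 0 ∧
    ∀ j < d, MvPowerSeries.coeff (Finsupp.single none j) f = 0

theorem exists_isRegularOfOrder {f : MvPowerSeries (Option σ) k} {j : ℕ}
    (h : MvPowerSeries.coeff (Finsupp.single none j) f ≠ 0) : ∃ d, IsRegularOfOrder f d := by
  classical
  have hex : ∃ d, MvPowerSeries.coeff (Finsupp.single none d) f ≠ 0 := ⟨j, h⟩
  exact ⟨Nat.find hex, Nat.find_spec hex, fun i hi => not_not.mp (Nat.find_min hex hi)⟩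

theorem residue_eq_zero_iff [Finite σ] (a : MvPowerSeries σ k) :
    IsLocalRing.residue (MvPowerSeries σ k) a = 0 ↔ MvPowerSeries.constantCoeff a = 0 := by
  rw [IsLocalRing.residue_eq_zero_iff, IsLocalRing.mem_maximalIdeal, mem_nonunits_iff,
    MvPowerSeries.isUnit_iff_constantCoeff, isUnit_iff_ne_zero, not_not]

theorem constantCoeff_coeff_optionEquivLeft (f : MvPowerSeries (Option σ) k) (j : ℕ) :
    MvPowerSeries.constantCoeff (PowerSeries.coeff j (MvPowerSeries.optionEquivLeft σ k f)) =
      MvPowerSeries.coeff (Finsupp.single none j) f := by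
  rw [← MvPowerSeries.coeff_zero_eq_constantCoeff_apply, MvPowerSeries.coeff_coeff_optionEquivLeft,
    Finsupp.optionElim_zero]

theorem IsRegularOfOrder.order_eq [Finite σ] {f : MvPowerSeries (Option σ) k} {d : ℕ}
    (hf : IsRegularOfOrder f d) :
    ((MvPowerSeries.optionEquivLeft σ k f).map
      (IsLocalRing.residue (MvPowerSeries σ k))).order = d := by
  rw [PowerSeries.order_eq_nat]
  refine ⟨?_, fun i hi => ?_⟩
  · rw [PowerSeries.coeff_map, Ne, residue_eq_zero_iff, constantCoeff_coeff_optionEquivLeft]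
    exact hf.1
  · rw [PowerSeries.coeff_map, residue_eq_zero_iff, constantCoeff_coeff_optionEquivLeft]
    exact hf.2 i hi

theorem IsRegularOfOrder.map_ne_zero [Finite σ] {f : MvPowerSeries (Option σ) k} {d : ℕ}
    (hf : IsRegularOfOrder f d) :
    (MvPowerSeries.optionEquivLeft σ k f).map (IsLocalRing.residue (MvPowerSeries σ k)) ≠ 0 := by
  intro h
  have := hf.order_eq
  rw [h, PowerSeries.order_zero] at this
  exact ENat.top_ne_natCast d this

/-- A polynomial over `k[[σ]]`, as a power series in `Option σ`. -/
theorem optionEquivLeft_symm_coe {d : ℕ} (r : Polynomial (MvPowerSeries σ k)) (hr : r.degree < d) :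
    (MvPowerSeries.optionEquivLeft σ k).symm (r : PowerSeries (MvPowerSeries σ k)) =
      ∑ j : Fin d, lift (r.coeff j) * MvPowerSeries.X none ^ (j : ℕ) := by
  rcases eq_or_ne r 0 with h | h
  · subst h
    simp [lift]
  rw [AlgEquiv.symm_apply_eq, map_sum]
  simp only [optionEquivLeft_lift_mul_X_pow]
  conv_lhs => rw [Polynomial.as_sum_range' r d
    ((Polynomial.natDegree_lt_iff_degree_lt h).mpr hr), Finset.sum_range]
  rw [← Polynomial.coeToPowerSeries.ringHom_apply, map_sum]
  refine Finset.sum_congr rfl fun j _ => ?_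
  rw [Polynomial.coeToPowerSeries.ringHom_apply, ← Polynomial.C_mul_X_pow_eq_monomial,
    Polynomial.coe_mul, Polynomial.coe_C, Polynomial.coe_pow, Polynomial.coe_X]

/-- Weierstrass division of formal power series in several variables. -/
theorem IsRegularOfOrder.exists_division [Finite σ] {f : MvPowerSeries (Option σ) k} {d : ℕ}
    (hf : IsRegularOfOrder f d) (g : MvPowerSeries (Option σ) k) :
    ∃ (Q : MvPowerSeries (Option σ) k) (r : Fin d → MvPowerSeries σ k),
      g = f * Q + ∑ j, lift (r j) * MvPowerSeries.X none ^ (j : ℕ) := by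
  set e := MvPowerSeries.optionEquivLeft σ k
  obtain ⟨Q, r, h⟩ := PowerSeries.exists_isWeierstrassDivision (e g) hf.map_ne_zero
  refine ⟨e.symm Q, fun j => r.coeff j, ?_⟩
  have hdeg : r.degree < d := by
    have h1 := h.degree_lt
    have h2 : (PowerSeries.map (Ideal.Quotient.mk (IsLocalRing.maximalIdeal (MvPowerSeries σ k)))
      (e f)).order = d := hf.order_eq
    rw [h2] at h1
    exact h1
  rw [← optionEquivLeft_symm_coe r hdeg]
  apply e.injective
  rw [map_add, map_mul, AlgEquiv.apply_symm_apply, AlgEquiv.apply_symm_apply]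
  exact h.eq_mul_add

/-- The part of a power series supported on the exponents satisfying `p`. -/
def filt (p : (ι →₀ ℕ) → Prop) [DecidablePred p] (f : MvPowerSeries ι k) : MvPowerSeries ι k :=
  fun n => if p n then MvPowerSeries.coeff n f else 0

theorem coeff_filt (p : (ι →₀ ℕ) → Prop) [DecidablePred p] (f : MvPowerSeries ι k) (n : ι →₀ ℕ) :
    MvPowerSeries.coeff n (filt p f) = if p n then MvPowerSeries.coeff n f else 0 := rfl

theorem wMon_option (w : Option σ → ℝ≥0∞) (n : Option σ →₀ ℕ) :
    wMon w n = w none ^ n none * wMon (fun i => w (some i)) n.some := by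
  classical
  exact Finsupp.prod_option_index n (fun i e => w i ^ e) (fun _ => pow_zero _)
    (fun _ _ _ => pow_add _ _ _)

theorem degree_option (n : Option σ →₀ ℕ) : n.degree = n none + n.some.degree := by
  classical
  have h := Finsupp.sum_option_index n (fun _ e => e) (fun _ => rfl) (fun _ _ _ => rfl)
  simpa [Finsupp.sum, Finsupp.degree_apply] using h

/-- For a regular convergent series `f`, the part of `f` different from its pure power of `x_none`
of lowest degree is dominated by this power, in suitable weights. -/
theorem IsRegularOfOrder.exists_weights [Finite σ] {v : AbsoluteValue k ℝ}
    {f g : MvPowerSeries (Option σ) k} {d : ℕ} (hf : IsRegularOfOrder f d) (hc : IsConvergent v f)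
    (hg : IsConvergent v g) :
    ∃ w : Option σ → ℝ≥0∞, (∀ i, w i ≠ 0) ∧ (∀ i, w i ≠ ∞) ∧ wNorm v w f < ∞ ∧ wNorm v w g < ∞ ∧
      2 * wNorm v w (f - MvPowerSeries.monomial (Finsupp.single none d)
        (MvPowerSeries.coeff (Finsupp.single none d) f)) ≤
        eabs v (MvPowerSeries.coeff (Finsupp.single none d) f) * w none ^ d := by
  classical
  set c := MvPowerSeries.coeff (Finsupp.single none d) f with hcdef
  have hc0 : eabs v c ≠ 0 := fun h => hf.1 ((eabs_eq_zero v).mp h)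
  obtain ⟨r₁, hr₁, hf₁⟩ := isConvergent_iff.mp hc
  obtain ⟨r₂, hr₂, hg₂⟩ := isConvergent_iff.mp hg
  set r := min r₁ r₂
  have hr : 0 < r := lt_min hr₁ hr₂
  have hr0 : (r : ℝ≥0∞) ≠ 0 := by exact_mod_cast hr.ne'
  have hfr : wNorm v (fun _ : Option σ => (r : ℝ≥0∞)) f < ∞ :=
    (wNorm_mono (fun _ => by exact_mod_cast min_le_left r₁ r₂) f).trans_lt hf₁
  have hgr : wNorm v (fun _ : Option σ => (r : ℝ≥0∞)) g < ∞ :=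
    (wNorm_mono (fun _ => by exact_mod_cast min_le_right r₁ r₂) g).trans_lt hg₂
  set M := wNorm v (fun _ : Option σ => (r : ℝ≥0∞)) f
  have hM : 4 * M ≠ ∞ := ENNReal.mul_ne_top (by simp) hfr.ne
  -- `lam` controls the higher powers of `x_none`, `th` the terms with other variables
  obtain ⟨lam₀, hlam₀, hlam₁⟩ := ENNReal.exists_nnreal_pos_mul_lt hM
    (mul_ne_zero hc0 (pow_ne_zero d hr0))
  set lam := min lam₀ 1
  have hlam : 0 < lam := lt_min hlam₀ one_pos
  have hlam0 : (lam : ℝ≥0∞) ≠ 0 := by exact_mod_cast hlam.ne'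
  have hlamle : (lam : ℝ≥0∞) ≤ 1 := by exact_mod_cast min_le_right lam₀ 1
  have hlam2 : (lam : ℝ≥0∞) * (4 * M) ≤ eabs v c * (r : ℝ≥0∞) ^ d := by
    refine le_trans ?_ hlam₁.le
    gcongr
    exact min_le_left _ _
  obtain ⟨th₀, hth₀, hth₁⟩ := ENNReal.exists_nnreal_pos_mul_lt hM
    (mul_ne_zero hc0 (pow_ne_zero d (mul_ne_zero hlam0 hr0)))
  set th := min th₀ 1
  have hth : 0 < th := lt_min hth₀ one_pos
  have hth0 : (th : ℝ≥0∞) ≠ 0 := by exact_mod_cast hth.ne'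
  have hthle : (th : ℝ≥0∞) ≤ 1 := by exact_mod_cast min_le_right th₀ 1
  have hth2 : (th : ℝ≥0∞) * (4 * M) ≤ eabs v c * ((lam : ℝ≥0∞) * r) ^ d := by
    refine le_trans ?_ hth₁.le
    gcongr
    exact min_le_left _ _
  let w : Option σ → ℝ≥0∞ := fun i => i.elim ((lam : ℝ≥0∞) * r) fun _ => th * ((lam : ℝ≥0∞) * r)
  have hwle : ∀ i, w i ≤ r := by
    intro i
    cases i with
    | none => exact mul_le_of_le_one_left zero_le hlamle
    | some i =>
      exact (mul_le_of_le_one_left zero_le hthle).trans (mul_le_of_le_one_left zero_le hlamle)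
  have hwmon : ∀ n : Option σ →₀ ℕ,
      wMon w n = (lam : ℝ≥0∞) ^ n.degree * (th : ℝ≥0∞) ^ n.some.degree * (r : ℝ≥0∞) ^ n.degree := by
    intro n
    rw [wMon_option]
    change ((lam : ℝ≥0∞) * r) ^ n none * wMon (fun _ : σ => th * ((lam : ℝ≥0∞) * r)) n.some = _
    rw [wMon_const, degree_option]
    ring
  refine ⟨w, ?_, ?_, (wNorm_mono hwle f).trans_lt hfr, (wNorm_mono hwle g).trans_lt hgr, ?_⟩
  · intro i
    cases i with
    | none => exact mul_ne_zero hlam0 hr0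
    | some i => exact mul_ne_zero hth0 (mul_ne_zero hlam0 hr0)
  · exact fun i => ne_top_of_le_ne_top ENNReal.coe_ne_top (hwle i)
  · have h1 : wNorm v w (f - MvPowerSeries.monomial (Finsupp.single none d) c) ≤
        ((th : ℝ≥0∞) + (lam : ℝ≥0∞) ^ (d + 1)) * M := by
      rw [wNorm, show M = ∑' n : Option σ →₀ ℕ, eabs v (MvPowerSeries.coeff n f) *
        wMon (fun _ => (r : ℝ≥0∞)) n from rfl, ← ENNReal.tsum_mul_left]
      refine ENNReal.tsum_le_tsum fun n => ?_
      rw [map_sub, MvPowerSeries.coeff_monomial]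
      split_ifs with hn
      · rw [hn, hcdef, sub_self, eabs_zero, zero_mul]
        exact zero_le
      rw [sub_zero, hwmon, wMon_const]
      by_cases hs : n.some = 0
      · have hns : n = Finsupp.single none (n none) := by
          conv_lhs => rw [← Finsupp.optionElim_some n, hs, Finsupp.optionElim_zero]
        rcases lt_trichotomy (n none) d with hlt | heq | hgt
        · rw [hns, hf.2 _ hlt, eabs_zero, zero_mul]
          exact zero_le
        · exact absurd (by rw [hns, heq]) hn
        · have h2 : (lam : ℝ≥0∞) ^ n.degree ≤ (lam : ℝ≥0∞) ^ (d + 1) := by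
            refine pow_le_pow_right_of_le_one' hlamle ?_
            rw [degree_option]
            lia
          calc eabs v (MvPowerSeries.coeff n f) *
                ((lam : ℝ≥0∞) ^ n.degree * (th : ℝ≥0∞) ^ n.some.degree * (r : ℝ≥0∞) ^ n.degree)
              ≤ eabs v (MvPowerSeries.coeff n f) *
                (((th : ℝ≥0∞) + (lam : ℝ≥0∞) ^ (d + 1)) * 1 * (r : ℝ≥0∞) ^ n.degree) := by
                gcongr
                · exact h2.trans le_add_self
                · exact pow_le_one' hthle _
            _ = _ := by ring
      · have h2 : (th : ℝ≥0∞) ^ n.some.degree ≤ (th : ℝ≥0∞) ^ 1 := by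
          refine pow_le_pow_right_of_le_one' hthle (Nat.one_le_iff_ne_zero.mpr ?_)
          rwa [Ne, Finsupp.degree_eq_zero_iff]
        rw [pow_one] at h2
        calc eabs v (MvPowerSeries.coeff n f) *
              ((lam : ℝ≥0∞) ^ n.degree * (th : ℝ≥0∞) ^ n.some.degree * (r : ℝ≥0∞) ^ n.degree)
            ≤ eabs v (MvPowerSeries.coeff n f) *
              (1 * ((th : ℝ≥0∞) + (lam : ℝ≥0∞) ^ (d + 1)) * (r : ℝ≥0∞) ^ n.degree) := by
              gcongr
              · exact pow_le_one' hlamle _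
              · exact h2.trans le_self_add
          _ = _ := by ring
    have h4 : (4 : ℝ≥0∞) ≠ 0 ∧ (4 : ℝ≥0∞) ≠ ∞ := by constructor <;> simp
    have h3 : 4 * ((lam : ℝ≥0∞) ^ (d + 1) * M) ≤ eabs v c * w none ^ d := by
      calc 4 * ((lam : ℝ≥0∞) ^ (d + 1) * M) = (lam : ℝ≥0∞) ^ d * (lam * (4 * M)) := by ring
        _ ≤ (lam : ℝ≥0∞) ^ d * (eabs v c * (r : ℝ≥0∞) ^ d) := by gcongr
        _ = eabs v c * ((lam : ℝ≥0∞) * r) ^ d := by ring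
    have h5 : 4 * ((th : ℝ≥0∞) * M) ≤ eabs v c * w none ^ d := by
      calc 4 * ((th : ℝ≥0∞) * M) = th * (4 * M) := by ring
        _ ≤ _ := hth2
    have h6 : 2 * (2 * wNorm v w (f - MvPowerSeries.monomial (Finsupp.single none d) c)) ≤
        2 * (eabs v c * w none ^ d) := by
      calc 2 * (2 * wNorm v w (f - MvPowerSeries.monomial (Finsupp.single none d) c))
          ≤ 2 * (2 * (((th : ℝ≥0∞) + (lam : ℝ≥0∞) ^ (d + 1)) * M)) := by gcongr
        _ = 4 * ((th : ℝ≥0∞) * M) + 4 * ((lam : ℝ≥0∞) ^ (d + 1) * M) := by ring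
        _ ≤ eabs v c * w none ^ d + eabs v c * w none ^ d := add_le_add h5 h3
        _ = _ := by ring
    exact (ENNReal.mul_le_mul_iff_right (by simp) (by simp)).mp h6

/-- The quotient of a Weierstrass division of convergent series is convergent: up to each order with
respect to suitable weights of the variables it is bounded by a fixed multiple of the dividend. -/
theorem IsRegularOfOrder.wNorm_quotient_lt_top [Finite σ] {v : AbsoluteValue k ℝ}
    {f g Q : MvPowerSeries (Option σ) k} {d : ℕ} (hf : IsRegularOfOrder f d)
    {r : Fin d → MvPowerSeries σ k}
    (hg : g = f * Q + ∑ j, lift (r j) * MvPowerSeries.X none ^ (j : ℕ))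
    {w : Option σ → ℝ≥0∞} (hw0 : ∀ i, w i ≠ 0) (hwt : ∀ i, w i ≠ ∞) (hgw : wNorm v w g < ∞)
    (hfw : 2 * wNorm v w (f - MvPowerSeries.monomial (Finsupp.single none d)
        (MvPowerSeries.coeff (Finsupp.single none d) f)) ≤
        eabs v (MvPowerSeries.coeff (Finsupp.single none d) f) * w none ^ d) :
    wNorm v w Q < ∞ := by
  classical
  cases nonempty_fintype σ
  set c := MvPowerSeries.coeff (Finsupp.single none d) f with hcdef
  set f₁ := f - MvPowerSeries.monomial (Finsupp.single none d) c with hf₁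
  set s : Option σ →₀ ℕ := Finsupp.single none d with hs
  set B := eabs v c * w none ^ d with hB
  have hB0 : B ≠ 0 :=
    mul_ne_zero (fun h => hf.1 ((eabs_eq_zero v).mp h)) (pow_ne_zero d (hw0 none))
  have hBt : B ≠ ∞ := ENNReal.mul_ne_top (eabs_ne_top v c) (ENNReal.pow_ne_top (hwt none))
  let om : (Option σ →₀ ℕ) → ℕ := fun n => n none + (d + 1) * n.some.degree
  have hom : ∀ a b, om (a + b) = om a + om b := by
    intro a b
    simp only [om, Finsupp.add_apply, Finsupp.some_add, map_add]
    ring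
  have hf₁om : ∀ a, MvPowerSeries.coeff a f₁ ≠ 0 → d + 1 ≤ om a := by
    intro a ha
    by_contra! hlt
    apply ha
    have hsome : a.some = 0 := by
      rw [← Finsupp.degree_eq_zero_iff]
      by_contra h
      have : (d + 1) * 1 ≤ (d + 1) * a.some.degree :=
        Nat.mul_le_mul_left _ (Nat.one_le_iff_ne_zero.mpr h)
      simp only [om] at hlt
      lia
    have hns : a = Finsupp.single none (a none) := by
      conv_lhs => rw [← Finsupp.optionElim_some a, hsome, Finsupp.optionElim_zero]
    have hle : a none ≤ d := by
      simp only [om] at hlt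
      lia
    rw [hf₁, map_sub, MvPowerSeries.coeff_monomial]
    split_ifs with h
    · rw [h, hcdef, sub_self]
    · rw [sub_zero, hns]
      refine hf.2 _ (lt_of_le_of_ne hle fun h2 => h ?_)
      rw [hns, h2]
  have hrec : ∀ n, c * MvPowerSeries.coeff n Q =
      MvPowerSeries.coeff (n + s) g - MvPowerSeries.coeff (n + s) (f₁ * Q) := by
    intro n
    have h1 : MvPowerSeries.coeff (n + s)
        (∑ j : Fin d, lift (r j) * MvPowerSeries.X none ^ (j : ℕ)) = 0 := by
      rw [map_sum]
      refine Finset.sum_eq_zero fun j _ => ?_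
      rw [coeff_lift_mul_X_pow, if_neg]
      rw [Finsupp.add_apply, hs, Finsupp.single_eq_same]
      have := j.2
      lia
    have h2 : f = MvPowerSeries.monomial s c + f₁ := by rw [hf₁]; ring
    rw [hg, map_add, h1, add_zero]
    nth_rewrite 1 [h2]
    rw [add_mul, map_add, add_sub_cancel_right, add_comm n s, MvPowerSeries.coeff_add_monomial_mul]
  let T : ℕ → MvPowerSeries (Option σ) k := fun N => filt (fun n => om n < N) Q
  have htrunc : ∀ N n, om n < N →
      MvPowerSeries.coeff (n + s) (f₁ * Q) = MvPowerSeries.coeff (n + s) (f₁ * T N) := by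
    intro N n hn
    rw [MvPowerSeries.coeff_mul, MvPowerSeries.coeff_mul]
    refine Finset.sum_congr rfl fun p hp => ?_
    by_cases ha : MvPowerSeries.coeff p.1 f₁ = 0
    · rw [ha, zero_mul, zero_mul]
    · have h1 := hf₁om _ ha
      have h2 := hom p.1 p.2
      rw [Finset.HasAntidiagonal.mem_antidiagonal.mp hp, hom] at h2
      have h3 : om s = d := by simp [om, hs]
      rw [coeff_filt, if_pos (by lia)]
  have hfinset : ∀ N, (Set.Finite {n : Option σ →₀ ℕ | om n < N}) := by
    intro N
    refine (Finsupp.finite_of_degree_lt N).subset fun n hn => ?_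
    have h1 : om n < N := hn
    have h2 : 1 * n.some.degree ≤ (d + 1) * n.some.degree :=
      Nat.mul_le_mul_right _ (Nat.succ_le_succ (Nat.zero_le d))
    simp only [om] at h1
    rw [Set.mem_ofPred_eq, degree_option]
    lia
  have hfin : ∀ N, wNorm v w (T N) ≠ ∞ := by
    intro N
    rw [wNorm, tsum_eq_sum (s := (hfinset N).toFinset)]
    · exact (ENNReal.sum_lt_top.mpr fun n _ =>
        ENNReal.mul_lt_top ENNReal.ofReal_lt_top (wMon_ne_top hwt n).lt_top).ne
    · intro n hn
      rw [coeff_filt, if_neg (by simpa using hn), eabs_zero, zero_mul]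
  have hbound : ∀ N, B * wNorm v w (T N) ≤ wNorm v w g + wNorm v w f₁ * wNorm v w (T N) := by
    intro N
    calc B * wNorm v w (T N)
        ≤ ∑' n : Option σ →₀ ℕ, eabs v (MvPowerSeries.coeff (n + s) (g - f₁ * T N)) *
            wMon w (n + s) := by
          rw [wNorm, ← ENNReal.tsum_mul_left]
          refine ENNReal.tsum_le_tsum fun n => ?_
          rw [coeff_filt]
          split_ifs with hn
          · rw [map_sub, ← htrunc N n hn, ← hrec n, eabs_mul, wMon_add, hs, wMon_single, hB]
            exact le_of_eq (by ring)
          · rw [eabs_zero, zero_mul, mul_zero]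
            exact zero_le
      _ ≤ wNorm v w (g - f₁ * T N) :=
          ENNReal.tsum_comp_le_tsum_of_injective (add_left_injective s)
            (fun n => eabs v (MvPowerSeries.coeff n (g - f₁ * T N)) * wMon w n)
      _ ≤ _ := (wNorm_sub_le _ _).trans (add_le_add le_rfl (wNorm_mul_le _ _))
  have hbound2 : ∀ N, wNorm v w (T N) ≤ 2 * wNorm v w g / B := by
    intro N
    have h1 : 2 * (B * wNorm v w (T N)) ≤ 2 * wNorm v w g + B * wNorm v w (T N) := by
      calc 2 * (B * wNorm v w (T N)) ≤ 2 * (wNorm v w g + wNorm v w f₁ * wNorm v w (T N)) := by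
            gcongr
            exact hbound N
        _ = 2 * wNorm v w g + (2 * wNorm v w f₁) * wNorm v w (T N) := by ring
        _ ≤ _ := by gcongr
    rw [two_mul (B * _)] at h1
    have h2 := (ENNReal.add_le_add_iff_right (ENNReal.mul_ne_top hBt (hfin N))).mp h1
    rw [ENNReal.le_div_iff_mul_le (Or.inl hB0) (Or.inl hBt), mul_comm]
    exact h2
  refine lt_of_le_of_lt ?_ (ENNReal.div_lt_top (ENNReal.mul_lt_top (ENNReal.ofNat_lt_top (n := 2)) hgw).ne hB0)
  rw [wNorm, ENNReal.tsum_eq_iSup_sum]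
  refine iSup_le fun S => ?_
  obtain ⟨N, hN⟩ : ∃ N, ∀ n ∈ S, om n < N :=
    ⟨S.sup om + 1, fun n hn => Nat.lt_succ_of_le (Finset.le_sup hn)⟩
  refine le_trans ?_ (hbound2 N)
  refine le_trans (Finset.sum_le_sum fun n hn => ?_) (ENNReal.sum_le_tsum S)
  rw [coeff_filt, if_pos (hN n hn)]

theorem IsConvergent.of_lift_sum [Finite σ] {v : AbsoluteValue k ℝ} {d : ℕ}
    {r : Fin d → MvPowerSeries σ k}
    (h : IsConvergent v (∑ j, lift (r j) * MvPowerSeries.X none ^ (j : ℕ))) (j : Fin d) :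
    IsConvergent v (r j) := by
  obtain ⟨ρ, hρ, hR⟩ := isConvergent_iff.mp h
  refine isConvergent_iff.mpr ⟨ρ, hρ, ?_⟩
  set R := ∑ j, lift (r j) * MvPowerSeries.X none ^ (j : ℕ) with hRdef
  have hcoeff : ∀ n : σ →₀ ℕ, MvPowerSeries.coeff (n.optionElim j) R = MvPowerSeries.coeff n (r j) := by
    intro n
    rw [hRdef, map_sum, Finset.sum_eq_single j]
    · rw [coeff_lift_mul_X_pow, Finsupp.optionElim_apply_none, if_pos rfl, Finsupp.some_optionElim]
    · intro i _ hij
      rw [coeff_lift_mul_X_pow, Finsupp.optionElim_apply_none, if_neg]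
      exact fun h => hij (Fin.ext h.symm)
    · exact fun h => absurd (Finset.mem_univ j) h
  have h1 : (ρ : ℝ≥0∞) ^ (j : ℕ) * wNorm v (fun _ => (ρ : ℝ≥0∞)) (r j) ≤
      wNorm v (fun _ => (ρ : ℝ≥0∞)) R := by
    rw [wNorm, ← ENNReal.tsum_mul_left]
    refine le_trans (ENNReal.tsum_le_tsum fun n => ?_) (ENNReal.tsum_comp_le_tsum_of_injective
      (f := fun n : σ →₀ ℕ => n.optionElim (j : ℕ)) (fun a b hab => ?_)
      (fun n => eabs v (MvPowerSeries.coeff n R) * wMon (fun _ => (ρ : ℝ≥0∞)) n))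
    · rw [hcoeff, wMon_option, Finsupp.optionElim_apply_none, Finsupp.some_optionElim]
      exact le_of_eq (by ring)
    · simpa using congrArg Finsupp.some hab
  by_contra htop
  rw [not_lt, top_le_iff] at htop
  rw [htop, ENNReal.mul_top (pow_ne_zero _ (by exact_mod_cast hρ.ne'))] at h1
  exact absurd (top_le_iff.mp h1) hR.ne

/-- The property that all series of quality `q` can be divided by `f`, with a remainder that is a
polynomial in `x_none`. -/
def IsDivisor (q : Quality k) (f : MvPowerSeries (Option σ) k) (d : ℕ) : Prop :=
  ∀ g ∈ seriesRing q (Option σ), ∃ Q ∈ seriesRing q (Option σ), ∃ r : Fin d → MvPowerSeries σ k,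
    (∀ j, r j ∈ seriesRing q σ) ∧
      g = f * Q + ∑ j, lift (r j) * MvPowerSeries.X none ^ (j : ℕ)

theorem lift_mem [Finite σ] (q : Quality k) {f : MvPowerSeries σ k} (hf : f ∈ seriesRing q σ) :
    lift f ∈ seriesRing q (Option σ) :=
  rename_mem_seriesRing q _ hf

/-- Weierstrass division of convergent series. -/
theorem IsRegularOfOrder.isDivisor_convergent [Finite σ] {v : AbsoluteValue k ℝ}
    {f : MvPowerSeries (Option σ) k} {d : ℕ} (hf : IsRegularOfOrder f d) (hc : IsConvergent v f) :
    IsDivisor (Quality.convergent v) f d := by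
  intro g hg
  obtain ⟨Q, r, h⟩ := hf.exists_division g
  obtain ⟨w, hw0, hwt, -, hgw, hfw⟩ := hf.exists_weights hc hg
  have hQ : IsConvergent v Q := isConvergent_of_wNorm_lt_top hw0
    (hf.wNorm_quotient_lt_top h hw0 hwt hgw hfw)
  refine ⟨Q, hQ, r, fun j => ?_, h⟩
  refine IsConvergent.of_lift_sum (d := d) ?_ j
  have h1 : ∑ j, lift (r j) * MvPowerSeries.X none ^ (j : ℕ) = g + -(f * Q) := by rw [h]; ring
  rw [h1]
  exact IsConvergent.add hg (IsConvergent.neg (IsConvergent.mul hc hQ))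

end Division

/-! ### Division of algebraic series -/

section AlgebraicDivision

open Polynomial

/-- Let `g` be algebraic over `P[X]`, and divide `g` by a polynomial `D` over a larger ring `A`.
The value of the remainder at a root `α` of `D` that is algebraic over `P` is algebraic over `P`:
it solves an algebraic equation of `g` evaluated at `X = α`, once the factors vanishing at `α` are
removed from that equation. -/
theorem isAlgebraic_aeval_remainder {P A Ω : Type*} [CommRing P] [IsDomain P]
    [UniqueFactorizationMonoid P] [CommRing A] [IsDomain A] [Algebra P A] [Field Ω] [Algebra A Ω]
    [Algebra P Ω] [IsScalarTower P A Ω] (hPA : Function.Injective (algebraMap P A))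
    (hPΩ : Function.Injective (algebraMap P Ω)) {D r : A[X]}
    (hdiv : ∀ s : A[X], (D : PowerSeries A) ∣ (s : PowerSeries A) → D ∣ s) {g : PowerSeries A}
    (hg : (D : PowerSeries A) ∣ g - r) {h : P[X][X]} (h0 : h ≠ 0)
    (hh : h.eval₂ ((coeToPowerSeries.ringHom (R := A)).comp (mapRingHom (algebraMap P A))) g = 0)
    {α : Ω} (hα : IsAlgebraic P α) (hD : aeval α D = 0) : IsAlgebraic P (aeval α r) := by
  classical
  let _ : IsGCDMonoid P := inferInstance
  set j : P[X] →+* PowerSeries A :=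
    (coeToPowerSeries.ringHom (R := A)).comp (mapRingHom (algebraMap P A)) with hj
  have hjinj : Function.Injective j := by
    intro a b hab
    rw [hj, RingHom.comp_apply, RingHom.comp_apply, coeToPowerSeries.ringHom_apply,
      coeToPowerSeries.ringHom_apply] at hab
    exact map_injective _ hPA (coe_injective A hab)
  set K := FractionRing P
  let _ : Algebra K Ω := (IsFractionRing.lift hPΩ).toAlgebra
  have : IsScalarTower P K Ω := IsScalarTower.of_algebraMap_eq fun x =>
    (IsFractionRing.lift_algebraMap hPΩ x).symm
  -- the polynomials vanishing at `α` are the multiples of one primitive polynomial `F`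
  obtain ⟨F, hF, hFα, hFdvd⟩ : ∃ F : P[X], Irreducible F ∧ aeval α F = 0 ∧
      ∀ p : P[X], aeval α p = 0 → F ∣ p := by
    have hprime : (RingHom.ker (aeval (R := P) α)).IsPrime := RingHom.ker_isPrime _
    obtain ⟨p, hp, hpα⟩ := hα
    obtain ⟨F, hFα, hF⟩ := hprime.exists_mem_prime_of_ne_bot
      (fun hbot => hp ((Submodule.mem_bot P[X]).mp (hbot ▸ (RingHom.mem_ker.mpr hpα))))
    rw [RingHom.mem_ker] at hFα
    refine ⟨F, hF.irreducible, hFα, fun p hp => ?_⟩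
    have hdeg : F.natDegree ≠ 0 := by
      intro hdeg
      rw [eq_C_of_natDegree_eq_zero hdeg, aeval_C] at hFα
      apply hF.ne_zero
      rw [eq_C_of_natDegree_eq_zero hdeg, (map_eq_zero_iff _ hPΩ).mp hFα, C_0]
    have hprim := hF.irreducible.isPrimitive hdeg
    have hirr := (hprim.irreducible_iff_irreducible_map_fraction_map (K := K)).mp hF.irreducible
    refine hprim.dvd_of_fraction_map_dvd_fraction_map (K := K) ?_
    have h1 : aeval α (F.map (algebraMap P K)) = 0 := by rwa [aeval_map_algebraMap]
    have h2 : aeval α (p.map (algebraMap P K)) = 0 := by rwa [aeval_map_algebraMap]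
    have h3 := minpoly.dvd K α h1
    have hint : IsIntegral K α := by
      refine IsAlgebraic.isIntegral ⟨F.map (algebraMap P K), hirr.ne_zero, h1⟩
    exact ((minpoly.irreducible hint).associated_of_dvd hirr h3).symm.dvd.trans (minpoly.dvd K α h2)
  have hCF : Irreducible (C F : P[X][X]) := (prime_C_iff.mpr hF.prime).irreducible
  obtain ⟨n, h₁, hndvd, rfl⟩ := WfDvdMonoid.max_power_factor h0 hCF
  have hh₁ : h₁.eval₂ j g = 0 := by
    rw [eval₂_mul, eval₂_pow, eval₂_C, mul_eq_zero] at hh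
    refine hh.resolve_left (pow_ne_zero n ?_)
    rw [Ne, map_eq_zero_iff _ hjinj]
    exact hF.ne_zero
  have hmap : h₁.map (aeval (R := P) α : P[X] →+* Ω) ≠ 0 := by
    intro hzero
    refine hndvd ((C_dvd_iff_dvd_coeff _ _).mpr fun i => hFdvd _ ?_)
    have := congrArg (fun p => coeff p i) hzero
    rw [coeff_map, coeff_zero] at this
    exact this
  -- the equation for `g` becomes an equation for the remainder modulo `D`
  have hDr : D ∣ h₁.eval₂ (mapRingHom (algebraMap P A)) r := by
    apply hdiv
    have h2 : ((h₁.eval₂ (mapRingHom (algebraMap P A)) r : A[X]) : PowerSeries A) =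
        h₁.eval₂ j (r : PowerSeries A) := by
      rw [← coeToPowerSeries.ringHom_apply, hom_eval₂, coeToPowerSeries.ringHom_apply]
    rw [h2]
    have h3 : g - r ∣ h₁.eval₂ j g - h₁.eval₂ j (r : PowerSeries A) := by
      rw [eval₂_eq_eval_map, eval₂_eq_eval_map]
      exact sub_dvd_eval_sub _ _ _
    rw [hh₁, zero_sub] at h3
    exact hg.trans ((dvd_neg).mp h3)
  have hroot : (h₁.map (aeval (R := P) α : P[X] →+* Ω)).eval (aeval α r) = 0 := by
    obtain ⟨s, hs⟩ := hDr
    have h2 : aeval α (h₁.eval₂ (mapRingHom (algebraMap P A)) r) = 0 := by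
      rw [hs, map_mul, hD, zero_mul]
    rw [← AlgHom.coe_toRingHom, hom_eval₂, eval₂_eq_eval_map] at h2
    refine Eq.trans (congrArg (fun φ => (h₁.map φ).eval _) ?_) h2
    refine Polynomial.ringHom_ext (fun p => ?_) ?_
    · simp [IsScalarTower.algebraMap_apply P A Ω]
    · simp
  set E := Subalgebra.algebraicClosure P Ω
  have hcoeff : h₁.map (aeval (R := P) α : P[X] →+* Ω) ∈ lifts (algebraMap E Ω) := by
    rw [lifts_iff_coeff_lifts]
    intro i
    rw [coeff_map]
    exact ⟨aeval (⟨α, hα⟩ : E) (h₁.coeff i),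
      (aeval_algebraMap_apply Ω (⟨α, hα⟩ : E) (h₁.coeff i)).symm⟩
  obtain ⟨p, hp⟩ := (mem_lifts _).mp hcoeff
  have hpE : IsAlgebraic E (aeval α r) := by
    refine ⟨p, ?_, ?_⟩
    · rintro rfl
      rw [Polynomial.map_zero] at hp
      exact hmap hp.symm
    · rw [aeval_def, eval₂_eq_eval_map, hp, hroot]
  exact hpE.restrictScalars P

/-- By interpolation, a polynomial with algebraic values at sufficiently many algebraic points has
algebraic coefficients. -/
theorem isAlgebraic_coeff_of_eval {P Ω : Type*} [CommRing P] [IsDomain P] [Field Ω] [Algebra P Ω]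
    {p : Polynomial Ω} {s : Finset Ω} (hs : ∀ a ∈ s, IsAlgebraic P a)
    (hp : ∀ a ∈ s, IsAlgebraic P (p.eval a)) (hdeg : p.degree < s.card) (i : ℕ) :
    IsAlgebraic P (p.coeff i) := by
  classical
  set E := Subalgebra.algebraicClosure P Ω
  have hC : ∀ a : Ω, IsAlgebraic P a → C a ∈ lifts (algebraMap E Ω) := fun a ha =>
    C_mem_lifts (algebraMap E Ω) (⟨a, ha⟩ : E)
  have hX : (X : Polynomial Ω) ∈ lifts (algebraMap E Ω) := X_mem_lifts _
  have hmem : p ∈ lifts (algebraMap E Ω) := by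
    rw [Lagrange.eq_interpolate (s := s) (v := id) (Set.injOn_id _) hdeg,
      Lagrange.interpolate_apply]
    refine sum_mem fun a ha => mul_mem (hC _ (hp a ha)) ?_
    refine prod_mem fun b hb => ?_
    refine mul_mem (hC _ (IsAlgebraic.inv ((hs a ha).sub (hs b (Finset.mem_of_mem_erase hb))))) ?_
    rw [sub_eq_add_neg, ← C_neg]
    exact add_mem hX (hC _ (hs b (Finset.mem_of_mem_erase hb)).neg)
  obtain ⟨x, hx⟩ := (lifts_iff_coeff_lifts p).mp hmem i
  rw [← hx]
  exact x.2

variable {k : Type*} [Field k] {σ : Type*}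

instance : IsDomain (MvPowerSeries σ k) := NoZeroDivisors.to_isDomain _

/-- A distinguished polynomial dividing a polynomial as a power series divides it as a polynomial.
-/
theorem _root_.Polynomial.IsDistinguishedAt.dvd_of_coe_dvd_coe {A : Type*} [CommRing A]
    [IsLocalRing A] [IsHausdorff (IsLocalRing.maximalIdeal A) A] {D : A[X]}
    (hD : D.IsDistinguishedAt (IsLocalRing.maximalIdeal A)) {s : A[X]}
    (h : (D : PowerSeries A) ∣ s) : D ∣ s := by
  have hmon := hD.monic
  have hne : (PowerSeries.map (IsLocalRing.residue A)) (D : PowerSeries A) ≠ 0 := by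
    rw [← polynomial_map_coe, Ne, coe_eq_zero_iff]
    exact (hmon.map _).ne_zero
  have hord : ((D : PowerSeries A).map
      (Ideal.Quotient.mk (IsLocalRing.maximalIdeal A))).order.toNat = D.natDegree := by
    have h1 := hD.degree_eq_coe_lift_order_map (D : PowerSeries A) 1
      (by simp)
      (by rw [mul_one])
    rw [degree_eq_natDegree hmon.ne_zero] at h1
    rw [ENat.lift_eq_toNat_of_lt_top] at h1
    exact_mod_cast h1.symm
  rw [← modByMonic_eq_zero_iff_dvd hmon]
  have hdvd : (D : PowerSeries A) ∣ (s %ₘ D : A[X]) := by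
    have h1 : s %ₘ D = s - D * (s /ₘ D) := by
      rw [eq_sub_iff_add_eq, modByMonic_add_div]
    rw [h1, coe_sub, coe_mul]
    exact dvd_sub h (dvd_mul_right _ _)
  obtain ⟨q, hq⟩ := hdvd
  have d1 : PowerSeries.IsWeierstrassDivision (s %ₘ D : A[X]) (D : PowerSeries A) q 0 :=
    ⟨by rw [degree_zero]; exact WithBot.bot_lt_coe _, by rw [hq, coe_zero, add_zero]⟩
  have d2 : PowerSeries.IsWeierstrassDivision (s %ₘ D : A[X]) (D : PowerSeries A) 0 (s %ₘ D) :=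
    ⟨by
      rw [hord, ← degree_eq_natDegree hmon.ne_zero]
      exact degree_modByMonic_lt s hmon, by rw [mul_zero, zero_add]⟩
  exact (d1.elim hne d2).2.symm

theorem optionEquivLeft_coe (p : MvPolynomial (Option σ) k) :
    MvPowerSeries.optionEquivLeft σ k (p : MvPowerSeries (Option σ) k) =
      ((MvPolynomial.optionEquivLeft k σ p).map
        (algebraMap (MvPolynomial σ k) (MvPowerSeries σ k)) : (MvPowerSeries σ k)[X]) := by
  induction p using MvPolynomial.induction_on with
  | C a =>
    rw [MvPolynomial.coe_C, MvPolynomial.optionEquivLeft_C, map_C, coe_C]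
    have := (MvPowerSeries.optionEquivLeft σ k).commutes a
    rw [MvPowerSeries.algebraMap_apply, Algebra.algebraMap_self_apply] at this
    rw [this, PowerSeries.algebraMap_apply]
    congr 1
    exact (MvPolynomial.coe_C a).symm
  | add p q hp hq => simp only [MvPolynomial.coe_add, map_add, hp, hq, Polynomial.map_add, coe_add]
  | mul_X p i hp =>
    rw [MvPolynomial.coe_mul, map_mul, hp, map_mul, Polynomial.map_mul, coe_mul, MvPolynomial.coe_X]
    congr 1
    cases i with
    | none => rw [MvPolynomial.optionEquivLeft_X_none, map_X, coe_X,
        MvPowerSeries.optionEquivLeft_X_none]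
    | some i =>
      rw [MvPolynomial.optionEquivLeft_X_some, map_C, coe_C, MvPowerSeries.optionEquivLeft_X_some]
      congr 1
      exact (MvPolynomial.coe_X i).symm

theorem algebraMap_mvPowerSeries_injective :
    Function.Injective (algebraMap (MvPolynomial σ k) (MvPowerSeries σ k)) :=
  MvPolynomial.coe_injective σ k

/-- Division of algebraic series by a series associated to a distinguished polynomial with distinct
algebraic roots. -/
theorem IsRegularOfOrder.isDivisor_algebraic [Finite σ] {f : MvPowerSeries (Option σ) k} {d : ℕ}
    (hf : IsRegularOfOrder f d) (hfa : f ∈ seriesRing Quality.algebraic (Option σ))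
    {D : (MvPowerSeries σ k)[X]}
    (hD : D.IsDistinguishedAt (IsLocalRing.maximalIdeal (MvPowerSeries σ k)))
    (hDf : (D : PowerSeries (MvPowerSeries σ k)) ∣ MvPowerSeries.optionEquivLeft σ k f)
    {Ω : Type*} [Field Ω] [Algebra (MvPowerSeries σ k) Ω] [Algebra (MvPolynomial σ k) Ω]
    [IsScalarTower (MvPolynomial σ k) (MvPowerSeries σ k) Ω]
    (hΩ : Function.Injective (algebraMap (MvPowerSeries σ k) Ω)) {s : Finset Ω} (hs : s.card = d)
    (hroot : ∀ a ∈ s, aeval a D = 0 ∧ IsAlgebraic (MvPolynomial σ k) a) :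
    IsDivisor Quality.algebraic f d := by
  classical
  intro g hg
  set e := MvPowerSeries.optionEquivLeft σ k
  set P := MvPolynomial σ k
  set A := MvPowerSeries σ k
  have hPΩ : Function.Injective (algebraMap P Ω) := by
    rw [IsScalarTower.algebraMap_eq P A Ω]
    exact hΩ.comp algebraMap_mvPowerSeries_injective
  obtain ⟨Q, r, h⟩ := hf.exists_division g
  set R : A[X] := ∑ j : Fin d, C (r j) * X ^ (j : ℕ) with hR
  have hRdeg : R.degree < d := degree_sum_fin_lt r
  have hRcoeff : ∀ j : Fin d, R.coeff j = r j := by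
    intro j
    rw [hR, finsetSum_coeff, Finset.sum_eq_single j]
    · simp
    · intro i _ hij
      rw [coeff_C_mul_X_pow, if_neg]
      exact fun h => hij (Fin.ext h.symm)
    · exact fun h => absurd (Finset.mem_univ j) h
  have heR : e (∑ j, lift (r j) * MvPowerSeries.X none ^ (j : ℕ)) = R := by
    rw [map_sum, hR, ← coeToPowerSeries.ringHom_apply, map_sum]
    refine Finset.sum_congr rfl fun j _ => ?_
    rw [optionEquivLeft_lift_mul_X_pow, coeToPowerSeries.ringHom_apply, coe_mul, coe_C, coe_pow,
      coe_X]
  obtain ⟨p, hp0, hp⟩ := mem_algebraic.mp hg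
  have hh : (p.map (MvPolynomial.optionEquivLeft k σ : _ →+* P[X])).eval₂
      ((coeToPowerSeries.ringHom (R := A)).comp (mapRingHom (algebraMap P A))) (e g) = 0 := by
    rw [eval₂_map]
    have h1 : (((coeToPowerSeries.ringHom (R := A)).comp (mapRingHom (algebraMap P A))).comp
        (MvPolynomial.optionEquivLeft k σ : _ →+* P[X])) =
        (e : _ →+* PowerSeries A).comp (algebraMap (MvPolynomial (Option σ) k)
          (MvPowerSeries (Option σ) k)) := by
      refine RingHom.ext fun x => ?_
      exact (optionEquivLeft_coe x).symm
    rw [h1]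
    have h2 := hom_eval₂ p (algebraMap (MvPolynomial (Option σ) k) (MvPowerSeries (Option σ) k))
      (e : _ →+* PowerSeries A) g
    rw [← aeval_def, hp, map_zero] at h2
    exact h2.symm
  have hh0 : p.map (MvPolynomial.optionEquivLeft k σ : _ →+* P[X]) ≠ 0 := by
    rw [Ne, Polynomial.map_eq_zero_iff]
    · exact hp0
    · exact (MvPolynomial.optionEquivLeft k σ).injective
  have hdvd : (D : PowerSeries A) ∣ e g - (R : PowerSeries A) := by
    rw [h, map_add, heR, add_sub_cancel_right, map_mul]
    exact hDf.mul_right _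
  have hr : ∀ j, r j ∈ seriesRing Quality.algebraic σ := by
    intro j
    rw [mem_algebraic, ← isAlgebraic_algebraMap_iff (A := Ω) hΩ, ← hRcoeff, ← coeff_map]
    refine isAlgebraic_coeff_of_eval (s := s) (fun a ha => (hroot a ha).2) (fun a ha => ?_) ?_ _
    · rw [← eval₂_eq_eval_map, ← aeval_def]
      exact isAlgebraic_aeval_remainder algebraMap_mvPowerSeries_injective hPΩ
        (fun _ => hD.dvd_of_coe_dvd_coe) hdvd hh0 hh (hroot a ha).2 (hroot a ha).1
    · rw [hs]
      exact degree_map_le.trans_lt hRdeg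
  refine ⟨Q, ?_, r, hr, h⟩
  have hf0 : f ≠ 0 := by
    rintro rfl
    exact hf.1 (map_zero _)
  refine mem_algebraic.mpr (IsAlgebraic.of_mul (mem_nonZeroDivisors_of_ne_zero hf0) hfa ?_)
  have h1 : f * Q = g - ∑ j, lift (r j) * MvPowerSeries.X none ^ (j : ℕ) := by rw [h]; ring
  rw [h1]
  refine IsAlgebraic.sub hg ?_
  exact Subring.sum_mem (seriesRing Quality.algebraic (Option σ)) fun j _ =>
    Subring.mul_mem _ (lift_mem _ (hr j)) (Subring.pow_mem _ (X_mem_seriesRing _ none) _)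

end AlgebraicDivision

/-! ### Noetherianity of the rings of power series -/

section Noetherian

variable {k : Type*} [Field k] {ι σ : Type*}

/-- A nonempty set of exponents has a unique element of minimal weight, for weights that are
multiples of `p` and grow sufficiently fast. -/
theorem exists_weight_isLeast (p : ℕ) (hp : 0 < p) (σ : Type*) [Finite σ] :
    ∀ S : Set (σ →₀ ℕ), S.Nonempty → ∃ w : σ → ℕ, (∀ i, p ∣ w i ∧ 0 < w i) ∧
      ∃ a ∈ S, ∀ b ∈ S, b ≠ a → Finsupp.weight w a < Finsupp.weight w b := by
  induction σ using Finite.induction_empty_option with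
  | of_equiv e ih =>
    intro S hS
    rename_i α β
    obtain ⟨w, hw, a, ha, h⟩ := ih (Finsupp.domCongr e.symm '' S) (hS.image _)
    have hwt : ∀ b : β →₀ ℕ, Finsupp.weight (w ∘ e.symm) b =
        Finsupp.weight w (Finsupp.domCongr e.symm b) := by
      intro b
      simp only [Finsupp.weight_apply]
      rw [Finsupp.domCongr_apply, Finsupp.equivMapDomain_eq_mapDomain, Finsupp.sum_mapDomain_index]
      · rfl
      · simp
      · intros; rw [add_smul]
    obtain ⟨a', ha', rfl⟩ := ha
    refine ⟨w ∘ e.symm, fun i => hw _, a', ha', fun b hb hba => ?_⟩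
    rw [hwt, hwt]
    exact h _ ⟨b, hb, rfl⟩ fun h => hba ((Finsupp.domCongr e.symm).injective h)
  | h_empty =>
    intro S hS
    obtain ⟨a, ha⟩ := hS
    exact ⟨fun _ => p, fun i => i.elim, a, ha, fun b _ hb => absurd (Subsingleton.elim b a) hb⟩
  | h_option ih =>
    intro S hS
    classical
    rename_i α _
    have hwt : ∀ (N : ℕ) (w : α → ℕ) (b : Option α →₀ ℕ),
        Finsupp.weight (fun i : Option α => i.elim N w) b = b none * N +
          Finsupp.weight w b.some := by
      intro N w b
      simp only [Finsupp.weight_apply]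
      exact Finsupp.sum_option_index_smul b _
    have hex : ∃ j, ∃ b ∈ S, b none = j := by
      obtain ⟨a, ha⟩ := hS
      exact ⟨_, a, ha, rfl⟩
    obtain ⟨b₀, hb₀, hb₁⟩ := Nat.find_spec hex
    obtain ⟨w, hw, a, ⟨a', ⟨ha', ha₀⟩, rfl⟩, h⟩ :=
      ih (Finsupp.some '' {b | b ∈ S ∧ b none = Nat.find hex}) ⟨_, b₀, ⟨hb₀, hb₁⟩, rfl⟩
    refine ⟨fun i => i.elim (p * (Finsupp.weight w a'.some + 1)) w, ?_, a', ha', fun b hb hba => ?_⟩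
    · rintro (_ | i)
      · exact ⟨dvd_mul_right _ _, Nat.mul_pos hp (Nat.succ_pos _)⟩
      · exact hw i
    · rw [hwt, hwt, ha₀]
      have h1 : Nat.find hex ≤ b none := Nat.find_min' hex ⟨b, hb, rfl⟩
      rcases h1.eq_or_lt with h2 | h2
      · rw [← h2]
        refine Nat.add_lt_add_left (h _ ⟨b, ⟨hb, h2.symm⟩, rfl⟩ fun h3 => hba ?_) _
        rw [← Finsupp.optionElim_some b, ← Finsupp.optionElim_some a', h3, ha₀, h2]
      · have h3 : (Nat.find hex + 1) * (p * (Finsupp.weight w a'.some + 1)) ≤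
            b none * (p * (Finsupp.weight w a'.some + 1)) := Nat.mul_le_mul_right _ h2
        have h4 : 1 * (Finsupp.weight w a'.some + 1) ≤ p * (Finsupp.weight w a'.some + 1) :=
          Nat.mul_le_mul_right _ hp
        rw [add_mul, one_mul] at h3
        lia

/-- The substitution `x_i ↦ x_i + c x_none ^ e_i`. -/
def shear (c : k) (e : σ → ℕ) : Option σ → MvPolynomial (Option σ) k
  | none => MvPolynomial.X none
  | some i => MvPolynomial.X (some i) + MvPolynomial.C c * MvPolynomial.X none ^ e i

theorem constantCoeff_shear {c : k} {e : σ → ℕ} (he : ∀ i, e i ≠ 0) (i : Option σ) :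
    MvPolynomial.constantCoeff (shear c e i) = 0 := by
  cases i <;> simp [shear, he]

theorem hasSubst_shear [Finite σ] {c : k} {e : σ → ℕ} (he : ∀ i, e i ≠ 0) :
    MvPowerSeries.HasSubst (fun i => (shear c e i : MvPowerSeries (Option σ) k)) := by
  refine MvPowerSeries.hasSubst_of_constantCoeff_zero fun i => ?_
  rw [← MvPowerSeries.coeff_zero_eq_constantCoeff_apply, MvPolynomial.coeff_coe]
  exact constantCoeff_shear he i

theorem aeval_shear_comp (c : k) (e : σ → ℕ) :
    (MvPolynomial.aeval (shear (-c) e)).comp (MvPolynomial.aeval (shear c e)) =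
      AlgHom.id k (MvPolynomial (Option σ) k) := by
  refine MvPolynomial.algHom_ext fun i => ?_
  cases i with
  | none => simp [shear]
  | some i => simp [shear]

theorem aeval_shear_shear (c : k) (e : σ → ℕ) (p : MvPolynomial (Option σ) k) :
    MvPolynomial.aeval (shear (-c) e) (MvPolynomial.aeval (shear c e) p) = p :=
  DFunLike.congr_fun (aeval_shear_comp c e) p

theorem irreducible_aeval_shear (e : σ → ℕ) {p : MvPolynomial (Option σ) k} (hp : Irreducible p) :
    Irreducible (MvPolynomial.aeval (shear (1 : k) e) p) := by
  have h := aeval_shear_comp (-1 : k) e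
  rw [neg_neg] at h
  exact (MulEquiv.irreducible_iff
    (AlgEquiv.ofAlgHom _ _ h (aeval_shear_comp (1 : k) e))).mpr hp

theorem subst_shear_coe (c : k) (e : σ → ℕ)
    (p : MvPolynomial (Option σ) k) :
    MvPowerSeries.subst (fun i => (shear c e i : MvPowerSeries (Option σ) k))
      (p : MvPowerSeries (Option σ) k) =
      ((MvPolynomial.aeval (shear c e) p : MvPolynomial (Option σ) k) :
        MvPowerSeries (Option σ) k) := by
  rw [MvPowerSeries.subst_coe]
  exact MvPolynomial.aeval_algebraMap_apply (R := k) (MvPowerSeries (Option σ) k) (shear c e) p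

theorem subst_shear_shear [Finite σ] (c : k) {e : σ → ℕ} (he : ∀ i, e i ≠ 0)
    (f : MvPowerSeries (Option σ) k) :
    MvPowerSeries.subst (fun i => (shear (-c) e i : MvPowerSeries (Option σ) k))
      (MvPowerSeries.subst (fun i => (shear c e i : MvPowerSeries (Option σ) k)) f) = f := by
  rw [MvPowerSeries.subst_comp_subst_apply (hasSubst_shear he) (hasSubst_shear he)]
  have h : (fun i => MvPowerSeries.subst
      (fun i => (shear (-c) e i : MvPowerSeries (Option σ) k))
      (shear c e i : MvPowerSeries (Option σ) k)) = MvPowerSeries.X := by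
    ext1 i
    rw [subst_shear_coe]
    have := aeval_shear_shear c e (MvPolynomial.X i)
    rw [MvPolynomial.aeval_X] at this
    rw [this, MvPolynomial.coe_X]
  rw [h, MvPowerSeries.subst_self]
  rfl

theorem subst_shear_mem [Finite σ] (q : Quality k) (c : k) {e : σ → ℕ} (he : ∀ i, e i ≠ 0)
    {f : MvPowerSeries (Option σ) k} (hf : f ∈ seriesRing q (Option σ)) :
    MvPowerSeries.subst (fun i => (shear c e i : MvPowerSeries (Option σ) k)) f ∈
      seriesRing q (Option σ) :=
  subst_mem_seriesRing q (constantCoeff_shear he)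
    (Function.LeftInverse.injective (subst_shear_shear c he)) hf

/-- The automorphism of the ring of power series given by a shear. -/
def shearEquiv [Finite σ] (q : Quality k) (c : k) {e : σ → ℕ} (he : ∀ i, e i ≠ 0) :
    seriesRing q (Option σ) ≃+* seriesRing q (Option σ) where
  toFun f := ⟨_, subst_shear_mem q c he f.2⟩
  invFun f := ⟨_, subst_shear_mem q (-c) he f.2⟩
  left_inv f := Subtype.ext (subst_shear_shear c he f.1)
  right_inv f := Subtype.ext (by
    have := subst_shear_shear (-c) he f.1
    rwa [neg_neg] at this)
  map_mul' f g := Subtype.ext (MvPowerSeries.subst_mul (hasSubst_shear he) _ _)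
  map_add' f g := Subtype.ext (MvPowerSeries.subst_add (hasSubst_shear he) _ _)

/-- After a suitable shear a nonzero power series becomes regular in the variable `x_none`. -/
theorem exists_shear_isRegularOfOrder [Finite σ] {f : MvPowerSeries (Option σ) k} (hf : f ≠ 0)
    (p : ℕ) (hp : 0 < p) :
    ∃ e : σ → ℕ, (∀ i, p ∣ e i ∧ e i ≠ 0) ∧ ∃ d, IsRegularOfOrder
      (MvPowerSeries.subst (fun i => (shear (1 : k) e i : MvPowerSeries (Option σ) k)) f) d := by
  classical
  cases nonempty_fintype σ
  obtain ⟨n, hn⟩ : ∃ n, MvPowerSeries.coeff n f ≠ 0 := by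
    by_contra! h
    exact hf (MvPowerSeries.ext fun n => by rw [h n, map_zero])
  obtain ⟨w, hw, a, ⟨j, hj⟩, ha⟩ := exists_weight_isLeast p hp σ
    {a | ∃ j, MvPowerSeries.coeff (a.optionElim j) f ≠ 0}
    ⟨n.some, n none, by rwa [Finsupp.optionElim_some]⟩
  have hex : ∃ j, MvPowerSeries.coeff (a.optionElim j) f ≠ 0 := ⟨j, hj⟩
  set o := Nat.find hex
  set e : σ → ℕ := fun i => (o + 1) * w i with he
  have he0 : ∀ i, e i ≠ 0 := fun i => (Nat.mul_pos (Nat.succ_pos o) (hw i).2).ne'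
  refine ⟨e, fun i => ⟨(hw i).1.mul_left _, he0 i⟩,
    exists_isRegularOfOrder (j := o + (o + 1) * Finsupp.weight w a) ?_⟩
  let ev : MvPowerSeries (Option σ) k →+* PowerSeries k :=
    (PowerSeries.map MvPowerSeries.constantCoeff).comp
      (MvPowerSeries.optionEquivLeft σ k : _ →+* PowerSeries (MvPowerSeries σ k))
  have hev : ∀ (g : MvPowerSeries (Option σ) k) (D : ℕ),
      MvPowerSeries.coeff (Finsupp.single none D) g = PowerSeries.coeff D (ev g) := by
    intro g D
    rw [← constantCoeff_coeff_optionEquivLeft]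
    simp [ev]
  have hevX : ev (MvPowerSeries.X none) = PowerSeries.X := by
    simp [ev, MvPowerSeries.optionEquivLeft_X_none]
  have hevX' : ∀ i, ev (MvPowerSeries.X (some i)) = 0 := by
    intro i
    simp [ev, MvPowerSeries.optionEquivLeft_X_some]
  have hmon : ∀ n : Option σ →₀ ℕ, ev (n.prod fun i l =>
      (shear (1 : k) e i : MvPowerSeries (Option σ) k) ^ l) =
      PowerSeries.X ^ (n none + (o + 1) * Finsupp.weight w n.some) := by
    intro n
    rw [Finsupp.prod_option_index _ _ (fun _ => pow_zero _) (fun _ _ _ => pow_add _ _ _), map_mul,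
      map_pow, pow_add]
    congr 1
    · simp [shear, hevX]
    · rw [Finsupp.weight_apply, Finsupp.prod, map_prod, Finsupp.sum, Finset.mul_sum,
        ← Finset.prod_pow_eq_pow_sum]
      refine Finset.prod_congr rfl fun i _ => ?_
      simp only [shear, map_one, one_mul, MvPolynomial.coe_add, MvPolynomial.coe_pow,
        MvPolynomial.coe_X, map_add, map_pow, hevX, hevX', zero_add, he, smul_eq_mul]
      rw [← pow_mul]
      congr 1
      ring
  rw [MvPowerSeries.coeff_subst (hasSubst_shear he0), finsum_eq_single _ (a.optionElim o)]
  · rw [hev, hmon, Finsupp.optionElim_apply_none, Finsupp.some_optionElim,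
      PowerSeries.coeff_X_pow_self, smul_eq_mul, mul_one]
    exact Nat.find_spec hex
  · intro n hn
    by_cases hc : MvPowerSeries.coeff n f = 0
    · rw [hc, zero_smul]
    rw [hev, hmon, PowerSeries.coeff_X_pow, if_neg, smul_zero]
    intro heq
    have hc' : MvPowerSeries.coeff (n.some.optionElim (n none)) f ≠ 0 := by
      rwa [Finsupp.optionElim_some]
    by_cases hna : n.some = a
    · rw [hna] at heq hc'
      apply hn
      rw [← Finsupp.optionElim_some n, hna, show n none = o by lia]
    · have h1 := ha _ ⟨_, hc'⟩ hna
      have h2 : (o + 1) * (Finsupp.weight w a + 1) ≤ (o + 1) * Finsupp.weight w n.some :=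
        Nat.mul_le_mul_left _ h1
      lia

/-- An ideal containing an element `f`, such that `R / f` is finite over a Noetherian ring, is
finitely generated. -/
theorem fg_of_finite_quotient {R R' : Type*} [CommRing R] [CommRing R'] [IsNoetherianRing R']
    (φ : R' →+* R) {J : Ideal R} {f : R} (hf : f ∈ J) {d : ℕ} (x : Fin d → R)
    (h : ∀ g : R, ∃ (Q : R) (r : Fin d → R'), g = f * Q + ∑ j, φ (r j) * x j) : J.FG := by
  classical
  let _ : Algebra R' R := φ.toAlgebra
  have hfin : Module.Finite R' (R ⧸ Ideal.span {f}) := by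
    refine ⟨⟨Finset.univ.image fun j => Ideal.Quotient.mk _ (x j), ?_⟩⟩
    rw [eq_top_iff]
    rintro g -
    obtain ⟨g, rfl⟩ := Ideal.Quotient.mk_surjective g
    obtain ⟨Q, r, rfl⟩ := h g
    rw [map_add, map_mul, Ideal.Quotient.eq_zero_iff_mem.mpr (Ideal.mem_span_singleton_self f),
      zero_mul, zero_add, map_sum]
    refine Submodule.sum_mem _ fun j _ => ?_
    have : Ideal.Quotient.mk (Ideal.span {f}) (φ (r j) * x j) =
        r j • Ideal.Quotient.mk (Ideal.span {f}) (x j) := rfl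
    rw [this]
    exact Submodule.smul_mem _ _ (Submodule.subset_span (by simp))
  have hN : IsNoetherian R' (R ⧸ Ideal.span {f}) := inferInstance
  have hN2 : IsNoetherian R (R ⧸ Ideal.span {f}) := isNoetherian_of_tower R' hN
  refine Submodule.fg_of_fg_map_of_fg_inf_ker (Submodule.mkQ (Ideal.span {f}))
    (IsNoetherian.noetherian _) ?_
  rw [Submodule.ker_mkQ, inf_eq_right.mpr ((Ideal.span_singleton_le_iff_mem J).mpr hf)]
  exact ⟨{f}, by simp⟩

/-- Over a perfect field an irreducible polynomial has a nonzero partial derivative. -/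
theorem _root_.Irreducible.exists_pderiv_ne_zero [PerfectField k] {p : ℕ} [Fact p.Prime] [CharP k p]
    {F : MvPolynomial ι k} (hF : Irreducible F) : ∃ i, MvPolynomial.pderiv i F ≠ 0 := by
  classical
  by_contra! h
  have hdvd : ∀ n ∈ F.support, ∀ i, p ∣ n i := by
    intro n hn i
    rcases Nat.eq_zero_or_pos (n i) with h0 | h0
    · rw [h0]; exact dvd_zero p
    have h1 := congrArg (MvPolynomial.coeff (n - Finsupp.single i 1)) (h i)
    have h2 : n - Finsupp.single i 1 + Finsupp.single i 1 = n :=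
      tsub_add_cancel_of_le (Finsupp.single_le_iff.mpr h0)
    rw [MvPolynomial.coeff_pderiv, h2, MvPolynomial.coeff_zero, mul_eq_zero] at h1
    have h3 := h1.resolve_left (MvPolynomial.mem_support_iff.mp hn)
    have h4 : (n - Finsupp.single i 1 : ι →₀ ℕ) i + 1 = n i := by
      rw [Finsupp.tsub_apply, Finsupp.single_eq_same]
      lia
    rw [← CharP.cast_eq_zero_iff k p, ← h4]
    exact_mod_cast h3
  have hroot : ∀ c : k, ∃ b, frobenius k p b = c := (bijective_frobenius k p).2
  choose root hroot using hroot
  set H : MvPolynomial ι k := ∑ n ∈ F.support, MvPolynomial.monomial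
    (n.mapRange (fun j => j / p) (Nat.zero_div p)) (root (F.coeff n))
  have hH : H ^ p = F := by
    rw [← MvPolynomial.map_frobenius_expand, map_sum, map_sum]
    conv_rhs => rw [F.as_sum]
    refine Finset.sum_congr rfl fun n hn => ?_
    have h1 : p • n.mapRange (fun j => j / p) (Nat.zero_div p) = n := by
      ext i
      rw [Finsupp.smul_apply, Finsupp.mapRange_apply, smul_eq_mul,
        Nat.mul_div_cancel' (hdvd n hn i)]
    rw [MvPolynomial.expand_monomial, MvPolynomial.map_monomial, hroot, h1]
  rw [← hH] at hF
  exact not_irreducible_pow (Fact.out : p.Prime).ne_one hF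

theorem derivative_optionEquivLeft (F : MvPolynomial (Option σ) k) :
    Polynomial.derivative (MvPolynomial.optionEquivLeft k σ F) =
      MvPolynomial.optionEquivLeft k σ (MvPolynomial.pderiv none F) := by
  induction F using MvPolynomial.induction_on with
  | C a => simp
  | add p q hp hq => simp only [map_add, hp, hq]
  | mul_X p i hp =>
    rw [map_mul, Polynomial.derivative_mul, hp, MvPolynomial.pderiv_mul, map_add, map_mul, map_mul]
    cases i with
    | none =>
      rw [MvPolynomial.optionEquivLeft_X_none, Polynomial.derivative_X, MvPolynomial.pderiv_X_self,
        map_one]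
    | some i =>
      rw [MvPolynomial.optionEquivLeft_X_some, Polynomial.derivative_C,
        MvPolynomial.pderiv_X_of_ne (Option.some_ne_none i), map_zero]

theorem pderiv_aeval_shear (c : k) {e : σ → ℕ} (he : ∀ i, (e i : k) = 0)
    (F : MvPolynomial (Option σ) k) :
    MvPolynomial.pderiv none (MvPolynomial.aeval (shear c e) F) =
      MvPolynomial.aeval (shear c e) (MvPolynomial.pderiv none F) := by
  induction F using MvPolynomial.induction_on with
  | C a => simp
  | add p q hp hq => simp only [map_add, hp, hq]
  | mul_X p i hp =>
    rw [map_mul, MvPolynomial.pderiv_mul, hp, MvPolynomial.pderiv_mul, map_add, map_mul, map_mul,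
      MvPolynomial.aeval_X]
    congr 2
    cases i with
    | none => simp [shear]
    | some i =>
      have h : ((e i : ℕ) : MvPolynomial (Option σ) k) = 0 := by
        rw [← map_natCast (MvPolynomial.C (R := k)), he, map_zero]
      simp [shear, MvPolynomial.pderiv_X_of_ne, h]

/-- An irreducible polynomial with nonzero derivative with respect to `x_none` is separable as a
polynomial in `x_none` over any field extension of the field of fractions of the coefficients. -/
theorem separable_map_optionEquivLeft {F : MvPolynomial (Option σ) k} (hF : Irreducible F)
    (h : CharZero k ∨ MvPolynomial.pderiv none F ≠ 0) {Ω : Type*} [Field Ω]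
    (φ : MvPolynomial σ k →+* Ω) (hφ : Function.Injective φ) :
    ((MvPolynomial.optionEquivLeft k σ F).map φ).Separable := by
  classical
  set G := MvPolynomial.optionEquivLeft k σ F with hG
  have hGirr : Irreducible G := (MulEquiv.irreducible_iff
    (MvPolynomial.optionEquivLeft k σ)).mpr hF
  by_cases hdeg : G.natDegree = 0
  · rw [Polynomial.eq_C_of_natDegree_eq_zero hdeg, Polynomial.map_C, Polynomial.separable_C,
      isUnit_iff_ne_zero, Ne, map_eq_zero_iff _ hφ]
    intro h0
    apply hGirr.ne_zero
    rw [Polynomial.eq_C_of_natDegree_eq_zero hdeg, h0, Polynomial.C_0]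
  · let _ : IsGCDMonoid (MvPolynomial σ k) := inferInstance
    set K := FractionRing (MvPolynomial σ k)
    have hirr := ((hGirr.isPrimitive hdeg).irreducible_iff_irreducible_map_fraction_map
      (K := K)).mp hGirr
    have hsep : (G.map (algebraMap (MvPolynomial σ k) K)).Separable := by
      rcases h with h | h
      · have : CharZero K := charZero_of_injective_algebraMap
          (R := k) (algebraMap k K).injective
        exact hirr.separable
      · rw [Polynomial.separable_iff_derivative_ne_zero hirr, Polynomial.derivative_map, hG,
          derivative_optionEquivLeft, Ne, Polynomial.map_eq_zero_iff
            (IsFractionRing.injective _ K)]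
        simpa using h
    have h2 := hsep.map (f := IsFractionRing.lift hφ)
    have h3 : (IsFractionRing.lift hφ).comp (algebraMap (MvPolynomial σ k) K) = φ :=
      RingHom.ext fun x => IsFractionRing.lift_algebraMap hφ x
    rwa [Polynomial.map_map, h3] at h2

/-- Algebraic series can be divided by an irreducible polynomial that is regular and separable with
respect to `x_none`. -/
theorem isDivisor_coe_of_irreducible [Finite σ] {F : MvPolynomial (Option σ) k} (hF : Irreducible F)
    (h : CharZero k ∨ MvPolynomial.pderiv none F ≠ 0) {d : ℕ}
    (hd : IsRegularOfOrder (F : MvPowerSeries (Option σ) k) d) :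
    IsDivisor Quality.algebraic (F : MvPowerSeries (Option σ) k) d := by
  classical
  set A := MvPowerSeries σ k
  set P := MvPolynomial σ k
  set Ω := AlgebraicClosure (FractionRing A)
  have hAΩ : Function.Injective (algebraMap A Ω) := by
    rw [IsScalarTower.algebraMap_eq A (FractionRing A) Ω]
    exact (algebraMap (FractionRing A) Ω).injective.comp (IsFractionRing.injective _ _)
  have hPΩ : Function.Injective (algebraMap P Ω) := by
    rw [IsScalarTower.algebraMap_eq P A Ω]
    exact hAΩ.comp algebraMap_mvPowerSeries_injective
  obtain ⟨D, u, hDu⟩ := PowerSeries.exists_isWeierstrassFactorization hd.map_ne_zero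
  have hdegD : D.natDegree = d := by
    have h1 := hDu.natDegree_eq_toNat_order_map
    rw [h1]
    have h2 := hd.order_eq
    rw [h2]
    rfl
  have hdvd : D ∣ (MvPolynomial.optionEquivLeft k σ F).map (algebraMap P A) := by
    apply hDu.isDistinguishedAt.dvd_of_coe_dvd_coe
    rw [← optionEquivLeft_coe]
    exact ⟨u, hDu.eq_mul⟩
  have hdvd2 : D.map (algebraMap A Ω) ∣
      (MvPolynomial.optionEquivLeft k σ F).map (algebraMap P Ω) := by
    have h1 := Polynomial.map_dvd (algebraMap A Ω) hdvd
    rwa [Polynomial.map_map, ← IsScalarTower.algebraMap_eq] at h1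
  have hsep := (separable_map_optionEquivLeft hF h _ hPΩ).of_dvd hdvd2
  refine hd.isDivisor_algebraic (coe_mem_seriesRing _ F) hDu.isDistinguishedAt ⟨u, hDu.eq_mul⟩ hAΩ
    (s := (D.map (algebraMap A Ω)).roots.toFinset) ?_ fun a ha => ?_
  · rw [Multiset.toFinset_card_of_nodup (Polynomial.nodup_roots hsep),
      ← (IsAlgClosed.splits _).natDegree_eq_card_roots,
      hDu.isDistinguishedAt.monic.natDegree_map, hdegD]
  · have h1 := (Polynomial.mem_roots'.mp (Multiset.mem_toFinset.mp ha)).2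
    refine ⟨by rwa [Polynomial.IsRoot, ← Polynomial.eval₂_eq_eval_map] at h1,
      MvPolynomial.optionEquivLeft k σ F, ?_, ?_⟩
    · simpa using hF.ne_zero
    · rw [Polynomial.aeval_def, Polynomial.eval₂_eq_eval_map]
      exact h1.dvd hdvd2

theorem isDivisor_formal [Finite σ] {f : MvPowerSeries (Option σ) k} {d : ℕ}
    (hf : IsRegularOfOrder f d) : IsDivisor Quality.formal f d := by
  intro g _
  obtain ⟨Q, r, h⟩ := hf.exists_division g
  exact ⟨Q, mem_formal _, r, fun _ => mem_formal _, h⟩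

/-- Up to an automorphism, every nonzero prime ideal contains a series that admits Weierstrass
division. -/
theorem exists_isDivisor [PerfectField k] [Finite σ] (q : Quality k)
    {J : Ideal (seriesRing q (Option σ))} (hJ : J.IsPrime) (hJ0 : J ≠ ⊥) :
    ∃ (ψ : seriesRing q (Option σ) ≃+* seriesRing q (Option σ)) (f : seriesRing q (Option σ))
      (d : ℕ), ψ f ∈ J ∧ IsDivisor q f.1 d := by
  classical
  obtain ⟨f, hfJ, hf0⟩ := Submodule.exists_mem_ne_zero_of_ne_bot hJ0
  have hf0' : f.1 ≠ 0 := fun h => hf0 (Subtype.ext h)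
  match q, J, hJ, f, hfJ, hf0' with
  | .formal, J, hJ, f, hfJ, hf0 =>
    obtain ⟨e, he, d, hd⟩ := exists_shear_isRegularOfOrder hf0 1 one_pos
    exact ⟨(shearEquiv _ 1 fun i => (he i).2).symm, shearEquiv _ 1 (fun i => (he i).2) f, d,
      by rwa [RingEquiv.symm_apply_apply], isDivisor_formal hd⟩
  | .convergent v, J, hJ, f, hfJ, hf0 =>
    obtain ⟨e, he, d, hd⟩ := exists_shear_isRegularOfOrder hf0 1 one_pos
    exact ⟨(shearEquiv _ 1 fun i => (he i).2).symm, shearEquiv _ 1 (fun i => (he i).2) f, d,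
      by rwa [RingEquiv.symm_apply_apply], hd.isDivisor_convergent
        (shearEquiv (Quality.convergent v) 1 (fun i => (he i).2) f).2⟩
  | .algebraic, J, hJ, f, hfJ, hf0 =>
    let ι : MvPolynomial (Option σ) k →+* seriesRing (Quality.algebraic : Quality k) (Option σ) :=
      (algebraMap (MvPolynomial (Option σ) k) (MvPowerSeries (Option σ) k)).codRestrict _
        fun p => coe_mem_seriesRing _ p
    have hfalg : IsAlgebraic (MvPolynomial (Option σ) k) f.1 := f.2
    obtain ⟨r, hr0, h, hr⟩ := hfalg.exists_nonzero_dvd (mem_nonZeroDivisors_of_ne_zero hf0)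
    have hh : IsAlgebraic (MvPolynomial (Option σ) k) h := by
      refine IsAlgebraic.of_mul (mem_nonZeroDivisors_of_ne_zero hf0) hfalg ?_
      rw [← hr]
      exact isAlgebraic_algebraMap r
    have hrJ : ι r ∈ J := by
      have h1 : ι r = f * ⟨h, hh⟩ := Subtype.ext hr
      rw [h1]
      exact J.mul_mem_right _ hfJ
    have hprime : (J.comap ι).IsPrime := Ideal.comap_isPrime ι J
    obtain ⟨F, hFJ, hF⟩ := hprime.exists_mem_prime_of_ne_bot
      (fun hbot => hr0 ((Submodule.mem_bot (MvPolynomial (Option σ) k)).mp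
        (hbot ▸ (Ideal.mem_comap.mpr hrJ))))
    -- in characteristic `p`, the exponents of the shear are multiples of `p`
    obtain ⟨p, hp, hp0, i, hi⟩ : ∃ p : ℕ, 0 < p ∧ (CharZero k ∨ (p : k) = 0) ∧
        ∃ i, CharZero k ∨ MvPolynomial.pderiv i F ≠ 0 := by
      obtain ⟨p, hp⟩ := CharP.exists k
      rcases CharP.char_is_prime_or_zero k p with h1 | h1
      · have : Fact p.Prime := ⟨h1⟩
        obtain ⟨i, hi⟩ := hF.irreducible.exists_pderiv_ne_zero (p := p)
        exact ⟨p, h1.pos, Or.inr (CharP.cast_eq_zero k p), i, Or.inr hi⟩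
      · subst h1
        have : CharZero k := CharP.charP_to_charZero k
        exact ⟨1, one_pos, Or.inl this, none, Or.inl this⟩
    set τ := Equiv.swap i none
    set F₁ := MvPolynomial.renameEquiv k τ F with hF₁
    have hF₁0 : F₁ ≠ 0 := (map_ne_zero_iff _ (MvPolynomial.renameEquiv k τ).injective).mpr
      hF.ne_zero
    obtain ⟨e, he, d, hd⟩ := exists_shear_isRegularOfOrder
      (f := (F₁ : MvPowerSeries (Option σ) k)) (by simpa using hF₁0) p hp
    have he0 : ∀ i, e i ≠ 0 := fun i => (he i).2
    set F₂ := MvPolynomial.aeval (shear (1 : k) e) F₁ with hF₂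
    rw [subst_shear_coe, ← hF₂] at hd
    have hF₁irr : Irreducible F₁ := (MulEquiv.irreducible_iff
      (MvPolynomial.renameEquiv k τ)).mpr hF.irreducible
    have hF₂irr : Irreducible F₂ := irreducible_aeval_shear e hF₁irr
    have hder : CharZero k ∨ MvPolynomial.pderiv none F₂ ≠ 0 := by
      rcases hp0 with h0 | h0
      · exact Or.inl h0
      rcases hi with h1 | h1
      · exact Or.inl h1
      right
      rw [hF₂, pderiv_aeval_shear]
      · intro h2
        have h3 := aeval_shear_shear 1 e (MvPolynomial.pderiv none F₁)
        rw [h2, map_zero] at h3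
        have h4 : MvPolynomial.pderiv (τ i) F₁ = MvPolynomial.rename τ (MvPolynomial.pderiv i F) :=
          MvPolynomial.pderiv_rename τ.injective i F
        rw [Equiv.swap_apply_left, ← h3] at h4
        exact h1 (MvPolynomial.rename_injective τ τ.injective (h4.symm.trans (map_zero _).symm))
      · intro i
        obtain ⟨c, hc⟩ := (he i).1
        rw [hc, Nat.cast_mul, h0, zero_mul]
    set ψ := (seriesRingEquiv Quality.algebraic τ).trans (shearEquiv Quality.algebraic (1 : k) he0) with hψ
    refine ⟨ψ.symm, ψ (ι F), d, by rwa [RingEquiv.symm_apply_apply], ?_⟩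
    have h5 : (ψ (ι F)).1 = (F₂ : MvPowerSeries (Option σ) k) := by
      rw [hF₂, ← subst_shear_coe]
      have h6 : (seriesRingEquiv Quality.algebraic τ (ι F)).1 =
          (F₁ : MvPowerSeries (Option σ) k) := MvPowerSeries.rename_coe _ _
      rw [← h6]
      rfl
    rw [h5]
    exact isDivisor_coe_of_irreducible hF₂irr hder hd

/-- The rings of formal, convergent and algebraic power series in finitely many variables are
Noetherian (Rückert's basis theorem). -/
theorem isNoetherianRing_seriesRing [PerfectField k] (q : Quality k) (ι : Type*) [Finite ι] :
    IsNoetherianRing (seriesRing q ι) := by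
  suffices h : Finite ι → IsNoetherianRing (seriesRing q ι) from h ‹_›
  induction ι using Finite.induction_empty_option with
  | of_equiv e ih =>
    intro _
    have := Finite.of_equiv _ e.symm
    have := ih this
    exact isNoetherianRing_of_ringEquiv _ (seriesRingEquiv q e)
  | h_empty =>
    intro _
    let φ : k →+* seriesRing q PEmpty :=
      MvPowerSeries.C.codRestrict _ fun a => C_mem_seriesRing q a
    refine isNoetherianRing_of_surjective _ _ φ fun f => ⟨MvPowerSeries.constantCoeff f.1, ?_⟩
    refine Subtype.ext (MvPowerSeries.ext fun n => ?_)
    have h0 : n = 0 := Subsingleton.elim _ _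
    rw [h0]
    exact MvPowerSeries.coeff_zero_C _
  | h_option ih =>
    rename_i σ _
    intro _
    have := ih inferInstance
    refine IsNoetherianRing.of_prime_ne_bot fun J hJ hJ0 => ?_
    obtain ⟨ψ, f, d, hf, hdiv⟩ := exists_isDivisor q hJ hJ0
    let φ : seriesRing q σ →+* seriesRing q (Option σ) :=
      ((MvPowerSeries.rename (Function.Embedding.some : σ ↪ Option σ) :
        MvPowerSeries σ k →ₐ[k] MvPowerSeries (Option σ) k).toRingHom.comp
          (seriesRing q σ).subtype).codRestrict _ fun r => lift_mem q r.2
    have hfg : (J.comap ψ).FG := by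
      refine fg_of_finite_quotient φ (f := f) hf (d := d)
        (fun j => ⟨MvPowerSeries.X none ^ (j : ℕ),
          Subring.pow_mem _ (X_mem_seriesRing q none) _⟩) fun g => ?_
      obtain ⟨Q, hQ, r, hr, h⟩ := hdiv g.1 g.2
      refine ⟨⟨Q, hQ⟩, fun j => ⟨r j, hr j⟩, Subtype.ext ?_⟩
      rw [h]
      simp only [Subring.coe_add, Subring.coe_mul, AddSubmonoidClass.coe_finsetSum]
      rfl
    have h2 := hfg.map (ψ : seriesRing q (Option σ) →+* seriesRing q (Option σ))
    have h3 : (J.comap ψ).map (ψ : seriesRing q (Option σ) →+* seriesRing q (Option σ)) = J :=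
      Ideal.map_comap_of_surjective _ ψ.surjective J
    rwa [h3] at h2

end Noetherian

/-! ### Regular local rings and the Jacobian criterion -/

section Regular

open IsLocalRing

universe u

theorem exists_ringKrullDim_eq (R : Type u) [CommRing R] [IsLocalRing R] [IsNoetherianRing R] :
    ∃ n : ℕ, ringKrullDim R = n := by
  obtain ⟨n, hn⟩ := ENat.ne_top_iff_exists.mp
    (Ideal.height_ne_top (maximalIdeal.isMaximal R).ne_top)
  refine ⟨n, ?_⟩
  rw [← maximalIdeal_height_eq_ringKrullDim, ← hn]
  rfl

theorem ringKrullDim_le_card {R : Type u} [CommRing R] [IsLocalRing R] [IsNoetherianRing R]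
    {s : Finset R} (hs : maximalIdeal R = Ideal.span s) : ringKrullDim R ≤ s.card := by
  refine (ringKrullDim_le_spanFinrank_maximalIdeal R).trans ?_
  rw [hs]
  have h := Submodule.spanFinrank_span_le_ncard_of_finite (R := R) s.finite_toSet
  rw [Set.ncard_coe_finset] at h
  exact_mod_cast h

theorem isRegularLocalRing_of_card_le {R : Type u} [CommRing R] [IsLocalRing R]
    [IsNoetherianRing R] {s : Finset R} (hs : maximalIdeal R = Ideal.span s)
    (h : (s.card : WithBot ℕ∞) ≤ ringKrullDim R) : IsRegularLocalRing R := by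
  refine IsRegularLocalRing.of_spanFinrank_maximalIdeal_le R (le_trans ?_ h)
  rw [hs]
  have h := Submodule.spanFinrank_span_le_ncard_of_finite (R := R) s.finite_toSet
  rw [Set.ncard_coe_finset] at h
  exact_mod_cast h

theorem isLocalRing_quotient {R : Type u} [CommRing R] [IsLocalRing R] {I : Ideal R}
    (hI : I ≤ maximalIdeal R) : IsLocalRing (R ⧸ I) := by
  have : Nontrivial (R ⧸ I) := Ideal.Quotient.nontrivial_iff.mpr
    fun h => (maximalIdeal.isMaximal R).ne_top (top_le_iff.mp (h ▸ hI))
  exact IsLocalRing.of_surjective' (Ideal.Quotient.mk I) Ideal.Quotient.mk_surjective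

theorem maximalIdeal_quotient {R : Type u} [CommRing R] [IsLocalRing R] {I : Ideal R}
    [IsLocalRing (R ⧸ I)] (hI : I ≤ maximalIdeal R) :
    maximalIdeal (R ⧸ I) = (maximalIdeal R).map (Ideal.Quotient.mk I) := by
  symm
  refine eq_maximalIdeal ((Ideal.map_eq_top_or_isMaximal_of_surjective _
    Ideal.Quotient.mk_surjective (maximalIdeal.isMaximal R)).resolve_left fun h => ?_)
  have h1 := congrArg (Ideal.comap (Ideal.Quotient.mk I)) h
  rw [Ideal.comap_map_of_surjective' _ Ideal.Quotient.mk_surjective, Ideal.mk_ker,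
    sup_eq_left.mpr hI, Ideal.comap_top] at h1
  exact (maximalIdeal.isMaximal R).ne_top h1

/-- The quotient of a local ring by a part `s` of a system of generators of the maximal ideal with
at most `dim R` elements is again of this form. -/
theorem quotient_span {R : Type u} [CommRing R] [IsLocalRing R]
    [IsNoetherianRing R] [DecidableEq R]
    {s t : Finset R} (hst : maximalIdeal R = Ideal.span (s ∪ t : Finset R))
    (h : ((s.card + t.card : ℕ) : WithBot ℕ∞) ≤ ringKrullDim R) :
    ∃ (_ : IsLocalRing (R ⧸ Ideal.span (s : Set R))) (t' : Finset (R ⧸ Ideal.span (s : Set R))),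
      maximalIdeal (R ⧸ Ideal.span (s : Set R)) = Ideal.span t' ∧ t'.card ≤ t.card ∧
      ringKrullDim (R ⧸ Ideal.span (s : Set R)) = t.card := by
  classical
  have hs : Ideal.span (s : Set R) ≤ maximalIdeal R := by
    rw [hst]
    exact Ideal.span_mono (by simp)
  have hloc := isLocalRing_quotient hs
  have hspan : maximalIdeal (R ⧸ Ideal.span (s : Set R)) =
      Ideal.span (t.image (Ideal.Quotient.mk (Ideal.span (s : Set R))) : Finset _) := by
    rw [maximalIdeal_quotient hs, hst, Finset.coe_union, Ideal.span_union, Ideal.map_sup,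
      Ideal.map_quotient_self, bot_sup_eq, Ideal.map_span, Finset.coe_image]
  refine ⟨hloc, _, hspan, Finset.card_image_le, le_antisymm ?_ ?_⟩
  · refine (ringKrullDim_le_card hspan).trans ?_
    exact_mod_cast Finset.card_image_le
  · have h1 := ringKrullDim_le_ringKrullDim_quotient_add_card s (by
      rw [IsLocalRing.ringJacobson_eq_maximalIdeal]
      exact fun x hx => hs (Ideal.subset_span hx))
    obtain ⟨n, hn⟩ := exists_ringKrullDim_eq (R ⧸ Ideal.span (s : Set R))
    rw [hn] at h1 ⊢
    have h2 := h.trans h1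
    have h3 : s.card + t.card ≤ n + s.card := by exact_mod_cast h2
    have h4 : t.card ≤ n := by lia
    exact_mod_cast h4

/-- A regular local ring is a domain. -/
theorem isDomain_of_card_le : ∀ (n : ℕ) (R : Type u) [CommRing R] [IsLocalRing R]
    [IsNoetherianRing R] (s : Finset R), maximalIdeal R = Ideal.span s → s.card ≤ n →
    ringKrullDim R = n → IsDomain R := by
  classical
  intro n
  induction n with
  | zero =>
    intro R _ _ _ s hs hcard _
    have hs0 : s = ∅ := Finset.card_eq_zero.mp (Nat.le_zero.mp hcard)
    rw [hs0, Finset.coe_empty, Ideal.span_empty] at hs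
    have := isField_iff_maximalIdeal_eq.mpr hs
    exact this.isDomain
  | succ n ih =>
    intro R _ _ _ s hs hcard hdim
    have hne : (maximalIdeal R).height ≠ 0 := by
      intro h
      have h1 := maximalIdeal_height_eq_ringKrullDim (R := R)
      rw [h, hdim] at h1
      have h2 : 0 = n + 1 := by exact_mod_cast h1
      lia
    have hfin := Ideal.finite_minimalPrimes_of_isNoetherianRing R (⊥ : Ideal R)
    obtain ⟨x, hx, hx'⟩ : ∃ x ∈ maximalIdeal R, x ∉ ⋃ i ∈
        ((insert (maximalIdeal R ^ 2) hfin.toFinset : Finset (Ideal R)) : Set (Ideal R)),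
        ((id i : Ideal R) : Set R) := by
      by_contra! hcon
      have h1 := (Ideal.subset_union_prime (f := id) (maximalIdeal R ^ 2) (maximalIdeal R ^ 2)
        (fun i hi h2 _ => by
          rw [Finset.mem_insert, Set.Finite.mem_toFinset] at hi
          exact (hi.resolve_left h2).1.1)).mp (fun x hx => hcon x hx)
      obtain ⟨i, hi, hle⟩ := h1
      rw [Finset.mem_insert, Set.Finite.mem_toFinset] at hi
      rcases hi with rfl | hi
      · apply hne
        have h2 : maximalIdeal R = ⊥ := by
          refine Submodule.eq_bot_of_le_smul_of_le_jacobson_bot (maximalIdeal R) _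
            (IsNoetherian.noetherian _) ?_ (maximalIdeal_le_jacobson _)
          rw [smul_eq_mul, ← pow_two]
          exact hle
        have := isField_iff_maximalIdeal_eq.mpr h2
        rw [h2]
        have : IsDomain R := this.isDomain
        exact Ideal.height_bot
      · have : i.IsPrime := hi.1.1
        have h2 : maximalIdeal R = i := (maximalIdeal.isMaximal R).eq_of_le this.ne_top hle
        apply hne
        have : (maximalIdeal R).IsPrime := (maximalIdeal.isMaximal R).isPrime
        rw [Ideal.height_eq_zero_iff, h2]
        exact hi
    have hx2 : x ∉ maximalIdeal R ^ 2 := fun h => hx' (by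
      simp only [Set.mem_iUnion]
      exact ⟨_, by simp, h⟩)
    have hxmin : ∀ p ∈ minimalPrimes R, x ∉ p := fun p hp h => hx' (by
      simp only [Set.mem_iUnion]
      exact ⟨p, by simpa using Or.inr hp, h⟩)
    -- exchange `x` with one of the generators of the maximal ideal
    obtain ⟨a, ha⟩ := (Submodule.mem_span_finset.mp (show x ∈ Submodule.span R (s : Set R) by rw [hs] at hx; exact hx))
    obtain ⟨y, hy, hay⟩ : ∃ y ∈ s, IsUnit (a y) := by
      by_contra! hcon
      apply hx2
      rw [← ha.2, pow_two]
      refine Ideal.sum_mem _ fun y hy => Ideal.mul_mem_mul (hcon y hy) ?_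
      rw [hs]
      exact Ideal.subset_span hy
    have hsx : maximalIdeal R = Ideal.span (({x} ∪ s.erase y : Finset R) : Set R) := by
      apply le_antisymm
      · rw [hs, Ideal.span_le]
        intro z hz
        by_cases hzy : z = y
        · subst hzy
          have h1 : a z * z = x - ∑ w ∈ s.erase z, a w * w := by
            rw [← ha.2, ← Finset.add_sum_erase _ _ hy]
            simp
          refine (Ideal.unit_mul_mem_iff_mem _ hay).mp ?_
          rw [h1]
          refine Ideal.sub_mem _ (Ideal.subset_span (by simp)) (Ideal.sum_mem _ fun w hw =>
            Ideal.mul_mem_left _ _ (Ideal.subset_span ?_))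
          rw [Finset.mem_coe, Finset.mem_union]
          exact Or.inr hw
        · refine Ideal.subset_span ?_
          rw [Finset.mem_coe, Finset.mem_union, Finset.mem_erase]
          exact Or.inr ⟨hzy, hz⟩
      · rw [Ideal.span_le]
        intro z hz
        rw [Finset.mem_coe, Finset.mem_union, Finset.mem_singleton] at hz
        rcases hz with rfl | hz
        · exact hx
        · rw [hs]
          exact Ideal.subset_span (Finset.mem_of_mem_erase hz)
    have hcard2 : s.card = n + 1 := by
      have h1 := ringKrullDim_le_card hs
      rw [hdim] at h1
      have h2 : n + 1 ≤ s.card := by exact_mod_cast h1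
      lia
    have hcard3 : (s.erase y).card = n := by
      rw [Finset.card_erase_of_mem hy, hcard2, Nat.add_sub_cancel]
    obtain ⟨hloc, t', ht', htc, hdim'⟩ := quotient_span hsx (by
      rw [hcard3, hdim, Finset.card_singleton, add_comm])
    rw [hcard3] at htc hdim'
    have hdom := ih _ t' ht' htc hdim'
    have hprime : (Ideal.span (({x} : Finset R) : Set R)).IsPrime :=
      (Ideal.Quotient.isDomain_iff_prime _).mp hdom
    obtain ⟨p, hp, hpx⟩ := Ideal.exists_minimalPrimes_le (bot_le : ⊥ ≤ Ideal.span
      (({x} : Finset R) : Set R))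
    have hpp : p.IsPrime := hp.1.1
    have hp0 : p = ⊥ := by
      refine Submodule.eq_bot_of_le_smul_of_le_jacobson_bot (maximalIdeal R) _
        (IsNoetherian.noetherian _) (fun b hb => ?_) (maximalIdeal_le_jacobson _)
      have h1 := hpx hb
      rw [Finset.coe_singleton, Ideal.mem_span_singleton] at h1
      obtain ⟨c, rfl⟩ := h1
      exact Submodule.smul_mem_smul hx ((hpp.mem_or_mem hb).resolve_left (hxmin p hp))
    rw [hp0] at hpp
    exact IsDomain.of_bot_isPrime R

variable {R : Type u} [CommRing R] [IsLocalRing R] [IsNoetherianRing R] [DecidableEq R]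

theorem isPrime_span_of_card_le {s t : Finset R}
    (hst : maximalIdeal R = Ideal.span (s ∪ t : Finset R))
    (h : ((s.card + t.card : ℕ) : WithBot ℕ∞) ≤ ringKrullDim R) :
    (Ideal.span (s : Set R)).IsPrime := by
  obtain ⟨hloc, t', ht', htc, hdim⟩ := quotient_span hst h
  exact (Ideal.Quotient.isDomain_iff_prime _).mp (isDomain_of_card_le _ _ t' ht' htc hdim)

theorem isRegularLocalRing_quotient_span {s t : Finset R}
    (hst : maximalIdeal R = Ideal.span (s ∪ t : Finset R))
    (h : ((s.card + t.card : ℕ) : WithBot ℕ∞) ≤ ringKrullDim R) :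
    IsRegularLocalRing (R ⧸ Ideal.span (s : Set R)) := by
  obtain ⟨hloc, t', ht', htc, hdim⟩ := quotient_span hst h
  refine isRegularLocalRing_of_card_le ht' ?_
  rw [hdim]
  exact_mod_cast htc

/-- A part of a regular system of parameters generates a prime ideal whose height is the number
of its elements. -/
theorem height_span_of_card_le {s t : Finset R}
    (hst : maximalIdeal R = Ideal.span (s ∪ t : Finset R))
    (h : ((s.card + t.card : ℕ) : WithBot ℕ∞) ≤ ringKrullDim R) :
    (Ideal.span (s : Set R)).height = s.card := by
  have htop : Ideal.span (s : Set R) ≠ ⊤ := (isPrime_span_of_card_le hst h).ne_top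
  apply le_antisymm
  · refine (Ideal.height_le_spanFinrank _ htop).trans ?_
    have h := Submodule.spanFinrank_span_le_ncard_of_finite (R := R) s.finite_toSet
    rw [Set.ncard_coe_finset] at h
    exact_mod_cast h
  clear htop
  induction s using Finset.induction_on generalizing t with
  | empty => simp
  | insert x s hx ih =>
    have hst' : maximalIdeal R = Ideal.span (s ∪ insert x t : Finset R) := by
      rw [hst, Finset.insert_union, Finset.union_insert]
    have hle : s.card + (insert x t).card ≤ (insert x s).card + t.card := by
      rw [Finset.card_insert_of_notMem hx]
      have := Finset.card_insert_le x t
      lia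
    have h' : ((s.card + (insert x t).card : ℕ) : WithBot ℕ∞) ≤ ringKrullDim R :=
      le_trans (by exact_mod_cast hle) h
    have hp := isPrime_span_of_card_le hst' h'
    have hlt : Ideal.span (s : Set R) < Ideal.span ((insert x s : Finset R) : Set R) := by
      refine lt_of_le_of_ne (Ideal.span_mono (by simp)) fun heq => ?_
      obtain ⟨-, -, -, -, h1⟩ := quotient_span hst h
      obtain ⟨-, -, -, -, h2⟩ := quotient_span hst' h'
      rw [← heq, h2] at h1
      have h3 : (insert x t).card = t.card := by exact_mod_cast h1
      have h4 := ringKrullDim_le_card hst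
      have h5 := h.trans h4
      have h6 : (insert x s).card + t.card ≤ (insert x s ∪ t).card := by exact_mod_cast h5
      have h7 : x ∈ t := by
        by_contra hxt
        rw [Finset.card_insert_of_notMem hxt] at h3
        lia
      have h8 := Finset.card_union_add_card_inter (insert x s) t
      have h9 : 0 < (insert x s ∩ t).card := Finset.card_pos.mpr ⟨x, by simp [h7]⟩
      lia
    have h3 := ih hst' h'
    have h4 := Ideal.height_strict_mono_of_isPrime hlt
    rw [Finset.card_insert_of_notMem hx]
    rw [Nat.cast_add, Nat.cast_one]
    exact (add_le_add_left h3 1).trans (Order.add_one_le_of_lt h4)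

/-- A matrix over a field has an invertible submatrix whose rows span the row space. -/
theorem exists_submatrix_det_ne_zero {K : Type*} [Field K] {p m : ℕ}
    (M : Matrix (Fin p) (Fin m) K) : ∃ (r : ℕ) (a : Fin r → Fin p) (c : Fin r → Fin m),
      (M.submatrix a c).det ≠ 0 ∧ ∀ i, M.row i ∈ Submodule.span K (Set.range (M.row ∘ a)) := by
  classical
  obtain ⟨α, a, ha, hspan, hli⟩ := exists_linearIndependent' K M.row
  have hα : Finite α := Finite.of_injective a ha
  cases nonempty_fintype α
  obtain ⟨β, c, hc, hspan', hli'⟩ := exists_linearIndependent' K (M.submatrix a id).col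
  have hβ : Finite β := Finite.of_injective c hc
  cases nonempty_fintype β
  have hcard : Fintype.card β = Fintype.card α := by
    have h1 : (M.submatrix a id).rank = Fintype.card α := LinearIndependent.rank_matrix hli
    rw [Matrix.rank_eq_finrank_span_cols, ← hspan'] at h1
    rw [← h1, finrank_span_eq_card hli']
  let e : Fin (Fintype.card α) ≃ α := (Fintype.equivFin α).symm
  let e' : Fin (Fintype.card α) ≃ β := (finCongr hcard.symm).trans (Fintype.equivFin β).symm
  refine ⟨Fintype.card α, a ∘ e, c ∘ e', ?_, fun i => ?_⟩
  · have h1 : LinearIndependent K (M.submatrix (a ∘ e) (c ∘ e')).col := by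
      have h2 := hli'.comp e' e'.injective
      have h3 := h2.map' ((LinearEquiv.funCongrLeft K K e).toLinearMap) (LinearEquiv.ker _)
      exact h3
    rw [Matrix.linearIndependent_cols_iff_isUnit, Matrix.isUnit_iff_isUnit_det] at h1
    exact h1.ne_zero
  · have h1 : Set.range (M.row ∘ a ∘ e) = Set.range (M.row ∘ a) := by
      rw [← Function.comp_assoc]
      exact e.surjective.range_comp _
    rw [h1, hspan]
    exact Submodule.subset_span ⟨i, rfl⟩

/-- Elements `h` of the maximal ideal, with an invertible minor of the matrix of coefficients with
respect to a regular system of parameters, are part of a regular system of parameters. -/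
theorem exists_finset_of_isUnit_det {m r : ℕ} {z : Fin m → R}
    (hz : maximalIdeal R = Ideal.span (Set.range z)) (hdim : ringKrullDim R = m)
    {A : Fin r → Fin m → R} {c : Fin r → Fin m}
    (hA : IsUnit (Matrix.of fun a b : Fin r => A a (c b)).det) :
    ∃ s t : Finset R, Ideal.span (s : Set R) = Ideal.span (Set.range fun a => ∑ j, A a j * z j) ∧
      maximalIdeal R = Ideal.span (s ∪ t : Finset R) ∧ s.card = r ∧
      ((s.card + t.card : ℕ) : WithBot ℕ∞) ≤ ringKrullDim R := by
  classical
  set N := Matrix.of fun a b : Fin r => A a (c b) with hN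
  set h : Fin r → R := fun a => ∑ j, A a j * z j with hh
  have hc : Function.Injective c := by
    intro b b' hbb
    by_contra hne
    refine hA.ne_zero (Matrix.det_zero_of_column_eq hne fun a => ?_)
    simp [hN, hbb]
  set T : Finset (Fin m) := Finset.univ.filter fun j => j ∉ Finset.univ.image c with hT
  have hTcard : T.card + r = m := by
    have h1 : T = Finset.univ \ Finset.univ.image c := by
      ext j; simp [hT]
    have h2 := Finset.card_sdiff_add_card_eq_card (Finset.subset_univ (Finset.univ.image c))
    rw [← h1, Finset.card_image_of_injective _ hc] at h2
    simpa using h2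
  set s := Finset.univ.image h
  set t := T.image z
  have hspan : Ideal.span (s : Set R) = Ideal.span (Set.range h) := by
    simp [s]
  have hzmem : ∀ j, z j ∈ maximalIdeal R := fun j => hz ▸ Ideal.subset_span ⟨j, rfl⟩
  have hmax : maximalIdeal R = Ideal.span (s ∪ t : Finset R) := by
    set 𝔞 := Ideal.span ((s ∪ t : Finset R) : Set R)
    have hh𝔞 : ∀ a, h a ∈ 𝔞 := fun a => Ideal.subset_span (by simp [s])
    have ht𝔞 : ∀ j ∈ T, z j ∈ 𝔞 := fun j hj => Ideal.subset_span (by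
      rw [Finset.mem_coe, Finset.mem_union]
      exact Or.inr (Finset.mem_image_of_mem z hj))
    have hNz : ∀ a, ∑ b, N a b * z (c b) ∈ 𝔞 := by
      intro a
      have h1 : ∑ b, N a b * z (c b) = h a - ∑ j ∈ T, A a j * z j := by
        rw [eq_sub_iff_add_eq]
        have h2 := Finset.sum_filter_add_sum_filter_not Finset.univ
          (fun j => j ∈ Finset.univ.image c) (fun j => A a j * z j)
        refine Eq.trans ?_ h2
        congr 1
        have h3 : (Finset.univ.filter fun j => j ∈ Finset.univ.image c) = Finset.univ.image c := by
          ext j; simp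
        rw [h3, Finset.sum_image hc.injOn]
        rfl
      rw [h1]
      exact Ideal.sub_mem _ (hh𝔞 a) (Ideal.sum_mem _ fun j hj =>
        Ideal.mul_mem_left _ _ (ht𝔞 j hj))
    apply le_antisymm
    · rw [hz, Ideal.span_le]
      rintro _ ⟨j, rfl⟩
      by_cases hj : j ∈ T
      · exact ht𝔞 j hj
      · have hj' : j ∈ Finset.univ.image c := by simpa [hT] using hj
        obtain ⟨b, -, rfl⟩ := Finset.mem_image.mp hj'
        refine (Ideal.unit_mul_mem_iff_mem _ hA).mp ?_
        have h1 : N.det * z (c b) = ∑ a, N.adjugate b a * ∑ b', N a b' * z (c b') := by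
          have h2 : (N.adjugate * N).mulVec (z ∘ c) b = N.det * z (c b) := by
            rw [Matrix.adjugate_mul, Matrix.smul_mulVec, Matrix.one_mulVec]
            rfl
          rw [← h2, ← Matrix.mulVec_mulVec]
          rfl
        rw [h1]
        exact Ideal.sum_mem _ fun a _ => Ideal.mul_mem_left _ _ (hNz a)
    · rw [Ideal.span_le]
      intro x hx
      rw [Finset.mem_coe, Finset.mem_union, Finset.mem_image, Finset.mem_image] at hx
      rcases hx with ⟨a, -, rfl⟩ | ⟨j, -, rfl⟩
      · exact Ideal.sum_mem _ fun j _ => Ideal.mul_mem_left _ _ (hzmem j)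
      · exact hzmem j
  have hs : s.card ≤ r := Finset.card_image_le.trans_eq (Finset.card_fin r)
  have ht : t.card ≤ T.card := Finset.card_image_le
  refine ⟨s, t, hspan, hmax, ?_, ?_⟩
  · have h1 := ringKrullDim_le_card hmax
    rw [hdim] at h1
    have h2 : m ≤ (s ∪ t).card := by exact_mod_cast h1
    have h3 := Finset.card_union_le s t
    lia
  · rw [hdim]
    have : s.card + t.card ≤ m := by lia
    exact_mod_cast this

/-- Jacobian criterion, first half: an ideal of height `r` which contains `r` elements with an
invertible minor is generated by these elements and defines a regular quotient. -/
theorem eq_span_and_isRegularLocalRing {m r : ℕ} {z : Fin m → R}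
    (hz : maximalIdeal R = Ideal.span (Set.range z)) (hdim : ringKrullDim R = m)
    {A : Fin r → Fin m → R} {c : Fin r → Fin m}
    (hA : IsUnit (Matrix.of fun a b : Fin r => A a (c b)).det) {I : Ideal R}
    (hI : ∀ a, ∑ j, A a j * z j ∈ I) (hht : I.height = r) :
    I = Ideal.span (Set.range fun a => ∑ j, A a j * z j) ∧ IsRegularLocalRing (R ⧸ I) ∧
      I.IsPrime := by
  obtain ⟨s, t, hs, hst, hr, hle⟩ := exists_finset_of_isUnit_det hz hdim hA
  have hprime := isPrime_span_of_card_le hst hle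
  have hheight := height_span_of_card_le hst hle
  have hreg := isRegularLocalRing_quotient_span hst hle
  have heq : Ideal.span (s : Set R) = I := by
    refine Ideal.eq_of_le_of_height_le _ ?_ ?_
    · rw [hs, Ideal.span_le]
      rintro _ ⟨a, rfl⟩
      exact hI a
    · rw [hht, hheight, hr]
  rw [← heq]
  exact ⟨hs, hreg, hprime⟩

/-- Jacobian criterion, second half: if the quotient is regular, there is an invertible minor whose
size is the height of the ideal. -/
theorem exists_isUnit_det_of_isRegularLocalRing {m p : ℕ} {z : Fin m → R}
    (hz : maximalIdeal R = Ideal.span (Set.range z)) (hdim : ringKrullDim R = m)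
    {B : Fin p → Fin m → R}
    (hreg : IsRegularLocalRing (R ⧸ Ideal.span (Set.range fun a => ∑ j, B a j * z j))) :
    ∃ (r : ℕ) (a : Fin r → Fin p) (c : Fin r → Fin m),
      IsUnit (Matrix.of fun i j : Fin r => B (a i) (c j)).det ∧
      (Ideal.span (Set.range fun a => ∑ j, B a j * z j)).height = r := by
  classical
  set F : Fin p → R := fun a => ∑ j, B a j * z j with hF
  set I := Ideal.span (Set.range F) with hI
  have hzmem : ∀ j, z j ∈ maximalIdeal R := fun j => hz ▸ Ideal.subset_span ⟨j, rfl⟩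
  have hIm : I ≤ maximalIdeal R := by
    rw [hI, Ideal.span_le]
    rintro _ ⟨a, rfl⟩
    exact Ideal.sum_mem _ fun j _ => Ideal.mul_mem_left _ _ (hzmem j)
  obtain ⟨r, a, c, hdet, hrow⟩ := exists_submatrix_det_ne_zero
    (Matrix.of fun i j => residue R (B i j))
  have hunit : IsUnit (Matrix.of fun i j : Fin r => B (a i) (c j)).det := by
    by_contra h
    apply hdet
    have h1 := (IsLocalRing.residue_eq_zero_iff _).mpr ((mem_maximalIdeal _).mpr h)
    rw [RingHom.map_det] at h1
    exact h1
  obtain ⟨s, t, hs, hst, hr, hle⟩ := exists_finset_of_isUnit_det hz hdim hunit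
  have hprime := isPrime_span_of_card_le hst hle
  have hheight := height_span_of_card_le hst hle
  set P := Ideal.span (s : Set R) with hP
  have hPI : P ≤ I := by
    rw [hs, Ideal.span_le]
    rintro _ ⟨i, rfl⟩
    exact Ideal.subset_span ⟨a i, rfl⟩
  have hIP : I ≤ P ⊔ maximalIdeal R • maximalIdeal R := by
    rw [hI, Ideal.span_le]
    rintro _ ⟨b, rfl⟩
    obtain ⟨l, hl⟩ := (Submodule.mem_span_range_iff_exists_fun _).mp (hrow b)
    choose l' hl' using fun i => residue_surjective (l i)
    have h1 : F b = ∑ i, l' i * F (a i) + ∑ j, (B b j - ∑ i, l' i * B (a i) j) * z j := by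
      simp only [hF, sub_mul, Finset.sum_sub_distrib, Finset.mul_sum, Finset.sum_mul]
      rw [Finset.sum_comm (s := (Finset.univ : Finset (Fin r)))]
      simp only [mul_assoc]
      ring
    rw [SetLike.mem_coe, h1]
    refine Submodule.add_mem_sup ?_ ?_
    · rw [hs]
      exact Ideal.sum_mem _ fun i _ => Ideal.mul_mem_left _ _ (Ideal.subset_span ⟨i, rfl⟩)
    · refine Submodule.sum_mem _ fun j _ => Submodule.smul_mem_smul ?_ (hzmem j)
      rw [← IsLocalRing.residue_eq_zero_iff, map_sub, map_sum, sub_eq_zero]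
      have h2 := congrFun hl j
      simp only [Finset.sum_apply, Pi.smul_apply, smul_eq_mul] at h2
      simp only [map_mul, hl']
      exact h2.symm
  refine ⟨r, a, c, hunit, ?_⟩
  suffices hle2 : I ≤ P by
    rw [le_antisymm hle2 hPI, hheight, hr]
  intro x hx
  by_contra hxP
  -- the dimension of `R / I` is too small for the number of generators of its maximal ideal
  obtain ⟨hloc, t', ht', htc, hdimP⟩ := quotient_span hst hle
  have hlocI := isLocalRing_quotient hIm
  have hdom : IsDomain (R ⧸ P) := (Ideal.Quotient.isDomain_iff_prime _).mpr hprime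
  have hx0 : Ideal.Quotient.mk P x ∈ nonZeroDivisors (R ⧸ P) :=
    mem_nonZeroDivisors_of_ne_zero (fun h => hxP (Ideal.Quotient.eq_zero_iff_mem.mp h))
  have h1 := ringKrullDim_quotient_succ_le_of_nonZeroDivisor hx0
  have h2 : ringKrullDim (R ⧸ I) ≤
      ringKrullDim ((R ⧸ P) ⧸ Ideal.span {Ideal.Quotient.mk P x}) := by
    refine ringKrullDim_le_of_surjective (Ideal.Quotient.lift _ (Ideal.Quotient.factor hPI) ?_)
      (Ideal.Quotient.lift_surjective_of_surjective _ _ (Ideal.Quotient.factor_surjective hPI))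
    intro y hy
    obtain ⟨w, rfl⟩ := Ideal.mem_span_singleton.mp hy
    rw [map_mul, Ideal.Quotient.factor_mk, Ideal.Quotient.eq_zero_iff_mem.mpr hx, zero_mul]
  have h3 := hreg.spanFinrank_maximalIdeal
  set G := (maximalIdeal (R ⧸ I)).generators with hG
  have hGfin : G.Finite := Submodule.FG.finite_generators (IsNoetherian.noetherian _)
  have hGcard : G.ncard = (maximalIdeal (R ⧸ I)).spanFinrank :=
    Submodule.FG.generators_ncard (IsNoetherian.noetherian _)
  set W : Finset R := hGfin.toFinset.image Quotient.out with hW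
  have hWmem : ∀ w ∈ W, w ∈ maximalIdeal R := by
    intro w hw
    obtain ⟨g, hg, rfl⟩ := Finset.mem_image.mp hw
    have h4 : g ∈ maximalIdeal (R ⧸ I) := by
      rw [← Submodule.span_generators (maximalIdeal (R ⧸ I))]
      exact Submodule.subset_span ((Set.Finite.mem_toFinset _).mp hg)
    rw [maximalIdeal_quotient hIm] at h4
    have h5 : Ideal.Quotient.mk I (Quotient.out g) ∈
        (maximalIdeal R).map (Ideal.Quotient.mk I) := by
      rw [show Ideal.Quotient.mk I (Quotient.out g) = g from Quotient.out_eq g]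
      exact h4
    rw [Ideal.mem_quotient_iff_mem hIm] at h5
    exact h5
  have hmax : maximalIdeal R ≤ Ideal.span ((W ∪ s : Finset R) : Set R) := by
    refine Submodule.le_of_le_smul_of_le_jacobson_bot (IsNoetherian.noetherian _)
      (maximalIdeal_le_jacobson _) ?_
    rw [Finset.coe_union, Ideal.span_union]
    intro y hy
    have h4 : Ideal.Quotient.mk I y ∈ Ideal.span (W.image (Ideal.Quotient.mk I) : Finset _) := by
      have h5 : W.image (Ideal.Quotient.mk I) = hGfin.toFinset := by
        rw [hW, Finset.image_image]
        conv_rhs => rw [← Finset.image_id (s := hGfin.toFinset)]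
        refine Finset.image_congr fun g _ => Quotient.out_eq g
      rw [h5, Set.Finite.coe_toFinset]
      have h6 := Submodule.span_generators (maximalIdeal (R ⧸ I))
      change _ ∈ Submodule.span _ _
      rw [h6, maximalIdeal_quotient hIm]
      exact Ideal.mem_map_of_mem _ hy
    rw [Finset.coe_image, ← Ideal.map_span] at h4
    obtain ⟨w, hw, hwy⟩ := (Ideal.mem_map_iff_of_surjective _ Ideal.Quotient.mk_surjective).mp h4
    have h7 : y - w ∈ I := by rw [← Ideal.Quotient.eq, hwy]
    have h8 := Submodule.add_mem_sup hw (hIP h7)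
    rw [add_sub_cancel, ← sup_assoc] at h8
    exact h8
  have hmax' : maximalIdeal R = Ideal.span ((W ∪ s : Finset R) : Set R) := by
    refine le_antisymm hmax (Ideal.span_le.mpr fun w hw => ?_)
    rw [Finset.mem_coe, Finset.mem_union] at hw
    rcases hw with hw | hw
    · exact hWmem w hw
    · exact hIm (hPI (Ideal.subset_span hw))
  have h4 := ringKrullDim_le_card hmax'
  have h5 := (hle.trans h4)
  have h6 : s.card + t.card ≤ (W ∪ s).card := by exact_mod_cast h5
  have h7 := Finset.card_union_le W s
  have h8 : W.card ≤ G.ncard := by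
    rw [Set.ncard_eq_toFinset_card _ hGfin]
    exact Finset.card_image_le
  rw [hdimP] at h1
  have h9 := (add_le_add_left h2 1).trans h1
  rw [← h3, ← hGcard] at h9
  have h10 : G.ncard + 1 ≤ t.card := by exact_mod_cast h9
  lia

end Regular

/-! ### The prime ideal of an arc -/

section Arcs

variable {k : Type*} [Field k]

/-- A power series in one variable, as a series in the variables `Option ι`, the variable being the
one with index `none`. -/
def inc (ι : Type*) (a : MvPowerSeries Unit k) : MvPowerSeries (Option ι) k :=
  MvPowerSeries.rename (fun _ => none : Unit → Option ι) a

theorem inc_mem {ι : Type*} [Finite ι] (q : Quality k) {a : MvPowerSeries Unit k}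
    (ha : a ∈ seriesRing q Unit) : inc ι a ∈ seriesRing q (Option ι) :=
  rename_mem_seriesRing q ⟨fun _ => none, fun _ _ _ => rfl⟩ ha

/-- The series `x_none - φ`, with `φ` a series of quality `q` without constant term in the other
variables, admits division. -/
theorem isDivisor_X_sub_lift {σ : Type*} [Finite σ] (q : Quality k) {φ : MvPowerSeries σ k}
    (hφ : φ ∈ seriesRing q σ) (h0 : MvPowerSeries.constantCoeff φ = 0) :
    IsDivisor q (MvPowerSeries.X none - lift φ) 1 := by
  classical
  have hlift : lift φ = lift φ * MvPowerSeries.X none ^ 0 := by rw [pow_zero, mul_one]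
  have hreg : IsRegularOfOrder (MvPowerSeries.X none - lift φ) 1 := by
    refine ⟨?_, fun j hj => ?_⟩
    · rw [map_sub, hlift, coeff_lift_mul_X_pow, MvPowerSeries.coeff_X]
      simp
    · have hj0 : j = 0 := by lia
      subst hj0
      rw [map_sub, hlift, coeff_lift_mul_X_pow, Finsupp.single_zero]
      simp [h0]
  have hmem : MvPowerSeries.X none - lift φ ∈ seriesRing q (Option σ) :=
    Subring.sub_mem _ (X_mem_seriesRing q none) (lift_mem q hφ)
  match q, hφ, hmem with
  | .formal, _, _ => exact isDivisor_formal hreg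
  | .convergent v, _, hmem => exact hreg.isDivisor_convergent hmem
  | .algebraic, hφ, hmem =>
    have hD : (Polynomial.X - Polynomial.C φ).IsDistinguishedAt
        (IsLocalRing.maximalIdeal (MvPowerSeries σ k)) := by
      refine ⟨⟨fun {n} hn => ?_⟩, Polynomial.monic_X_sub_C φ⟩
      rw [Polynomial.natDegree_X_sub_C] at hn
      have hn0 : n = 0 := by lia
      subst hn0
      rw [Polynomial.coeff_sub, Polynomial.coeff_X_zero, Polynomial.coeff_C_zero, zero_sub,
        neg_mem_iff, ← IsLocalRing.residue_eq_zero_iff, residue_eq_zero_iff]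
      exact h0
    refine hreg.isDivisor_algebraic hmem hD (Ω := FractionRing (MvPowerSeries σ k)) ⟨1, ?_⟩
      (IsFractionRing.injective _ _) (s := {algebraMap _ _ φ}) (by simp) fun a ha => ?_
    · rw [map_sub, MvPowerSeries.optionEquivLeft_X_none, optionEquivLeft_lift, mul_one,
        Polynomial.coe_sub, Polynomial.coe_X, Polynomial.coe_C]
    · rw [Finset.mem_singleton] at ha
      subst ha
      refine ⟨by simp, ?_⟩
      exact (isAlgebraic_algebraMap_iff (IsFractionRing.injective _ _)).mpr hφ

/-- Taylor expansion of first order: every series of quality `q` in the variables `x` and `t` can be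
written as `∑ (x_i - φ_i(t)) D_i(x, t) + a(t)`. -/
theorem exists_eq_sum_mul_add_rename (q : Quality k) (ι : Type) [Finite ι] [Fintype ι] {κ : Type}
    [Finite κ] (φ : ι → MvPowerSeries κ k)
    (hφ : ∀ i, φ i ∈ seriesRing q κ ∧ MvPowerSeries.constantCoeff (φ i) = 0) :
    ∀ h ∈ seriesRing q (ι ⊕ κ), ∃ (D : ι → MvPowerSeries (ι ⊕ κ) k)
      (a : MvPowerSeries κ k), (∀ i, D i ∈ seriesRing q (ι ⊕ κ)) ∧ a ∈ seriesRing q κ ∧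
      h = ∑ i, (MvPowerSeries.X (Sum.inl i) - MvPowerSeries.rename Function.Embedding.inr (φ i)) * D i +
        MvPowerSeries.rename Function.Embedding.inr a := by
  suffices hsuff : ∀ (_ : Fintype ι) (φ : ι → MvPowerSeries κ k)
    (_ : ∀ i, φ i ∈ seriesRing q κ ∧ MvPowerSeries.constantCoeff (φ i) = 0),
    ∀ h ∈ seriesRing q (ι ⊕ κ), ∃ (D : ι → MvPowerSeries (ι ⊕ κ) k)
      (a : MvPowerSeries κ k), (∀ i, D i ∈ seriesRing q (ι ⊕ κ)) ∧ a ∈ seriesRing q κ ∧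
      h = ∑ i, (MvPowerSeries.X (Sum.inl i) - MvPowerSeries.rename Function.Embedding.inr (φ i)) * D i +
        MvPowerSeries.rename Function.Embedding.inr a from hsuff _ φ hφ
  clear hφ φ
  induction ι using Finite.induction_empty_option with
  | of_equiv e ih =>
    rename_i α β
    intro _ φ hφ h hh
    have : Fintype α := Fintype.ofEquiv _ e.symm
    let E : α ⊕ κ ≃ β ⊕ κ := e.sumCongr (Equiv.refl κ)
    have hcomp : ∀ a : MvPowerSeries κ k, MvPowerSeries.rename E (MvPowerSeries.rename
        (Function.Embedding.inr : κ ↪ α ⊕ κ) a) =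
        MvPowerSeries.rename (Function.Embedding.inr : κ ↪ β ⊕ κ) a := by
      intro a
      rw [MvPowerSeries.rename_rename]
      congr 2
    obtain ⟨D, a, hD, ha, heq⟩ := ih this (φ ∘ e) (fun i => hφ _)
      (MvPowerSeries.rename E.symm h) (rename_mem_seriesRing q E.symm.toEmbedding hh)
    refine ⟨fun i => MvPowerSeries.rename E (D (e.symm i)), a,
      fun i => rename_mem_seriesRing q E.toEmbedding (hD _), ha, ?_⟩
    have h1 := congrArg (MvPowerSeries.rename E) heq
    rw [map_add, map_sum, hcomp] at h1
    have h2 : MvPowerSeries.rename E (MvPowerSeries.rename E.symm h) = h := by simp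
    rw [h2] at h1
    rw [h1]
    congr 1
    refine Fintype.sum_equiv e _ _ fun i => ?_
    beta_reduce
    rw [map_mul, map_sub, hcomp, Equiv.symm_apply_apply]
    congr 2
    simp [E]
  | h_empty =>
    intro _ φ hφ h hh
    let E : PEmpty ⊕ κ ≃ κ := Equiv.emptySum _ _
    refine ⟨fun i => i.elim, MvPowerSeries.rename E h, fun i => i.elim,
      rename_mem_seriesRing q E.toEmbedding hh, ?_⟩
    rw [Finset.univ_eq_empty, Finset.sum_empty, zero_add, MvPowerSeries.rename_rename]
    have h1 : ((Function.Embedding.inr : κ ↪ PEmpty ⊕ κ) ∘ E) = id := by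
      funext i
      rcases i with i | i
      · exact i.elim
      · rfl
    have h2 := MvPowerSeries.rename_id_apply h
    conv_lhs => rw [← h2]
    congr 2
    exact h1.symm
  | h_option ih =>
    rename_i α _
    classical
    intro inst φ hφ h hh
    have inst' : Fintype α := Fintype.ofFinite α
    obtain rfl : inst = instFintypeOption := Subsingleton.elim _ _
    let E : Option α ⊕ κ ≃ Option (α ⊕ κ) :=
      { toFun := Sum.elim (fun i => i.elim none fun i => some (Sum.inl i)) fun j => some (Sum.inr j)
        invFun := fun x => x.elim (Sum.inl none) (Sum.elim (fun i => Sum.inl (some i)) Sum.inr)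
        left_inv := by rintro ((_ | i) | j) <;> rfl
        right_inv := by rintro (_ | (i | j)) <;> rfl }
    have hEinr : ∀ a : MvPowerSeries κ k, MvPowerSeries.rename E.symm (lift (MvPowerSeries.rename
        (Function.Embedding.inr : κ ↪ α ⊕ κ) a)) =
        MvPowerSeries.rename (Function.Embedding.inr : κ ↪ Option α ⊕ κ) a := by
      intro a
      rw [lift, MvPowerSeries.rename_rename, MvPowerSeries.rename_rename]
      congr 2
    have hEX : ∀ i : α, MvPowerSeries.rename E.symm (lift (MvPowerSeries.X (Sum.inl i) :
        MvPowerSeries (α ⊕ κ) k)) = MvPowerSeries.X (Sum.inl (some i)) := by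
      intro i
      rw [lift, MvPowerSeries.rename_X, MvPowerSeries.rename_X]
      rfl
    obtain ⟨Q, hQ, r, hr, hdiv⟩ := isDivisor_X_sub_lift q
      (rename_mem_seriesRing q (Function.Embedding.inr : κ ↪ α ⊕ κ) (hφ none).1)
      ((MvPowerSeries.constantCoeff_rename _ _).trans (hφ none).2) (MvPowerSeries.rename E h)
      (rename_mem_seriesRing q E.toEmbedding hh)
    obtain ⟨D, a, hD, ha, heq⟩ := ih inst' (fun i => φ (some i)) (fun i => hφ _) (r 0) (hr 0)
    refine ⟨fun i => i.elim (MvPowerSeries.rename E.symm Q)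
      fun i => MvPowerSeries.rename E.symm (lift (D i)), a, ?_, ha, ?_⟩
    · rintro (_ | i)
      · exact rename_mem_seriesRing q E.symm.toEmbedding hQ
      · exact rename_mem_seriesRing q E.symm.toEmbedding (lift_mem q (hD i))
    · have h1 := congrArg (MvPowerSeries.rename E.symm) hdiv
      have h2 : MvPowerSeries.rename E.symm (MvPowerSeries.rename E h) = h := by simp
      rw [h2, Fin.sum_univ_one, heq] at h1
      rw [h1, Fintype.sum_option]
      have hl : ∀ f g : MvPowerSeries (α ⊕ κ) k, lift (f + g) = lift f + lift g :=
        fun f g => map_add _ _ _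
      have hls : lift (∑ i, (MvPowerSeries.X (Sum.inl i) -
          MvPowerSeries.rename Function.Embedding.inr (φ (some i))) * D i) =
          ∑ i, (lift (MvPowerSeries.X (Sum.inl i)) -
            lift (MvPowerSeries.rename Function.Embedding.inr (φ (some i)))) * lift (D i) := by
        simp only [lift, map_sum, map_mul, map_sub]
      rw [hl, hls]
      simp only [map_add, map_mul, map_sub, map_sum, hEinr, hEX, Fin.val_zero, pow_zero,
        mul_one, MvPowerSeries.rename_X, Option.elim]
      rw [show E.symm none = Sum.inl none from rfl]
      ring

/-- Taylor expansion of first order at an arc: every series of quality `q` can be written as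
`∑ (x_i - φ_i) D_i + a` with a series `a` in the variable `x_none`. -/
theorem exists_eq_sum_mul_add_inc (q : Quality k) (ι : Type) [Fintype ι]
    (φ : ι → MvPowerSeries Unit k)
    (hφ : ∀ i, φ i ∈ seriesRing q Unit ∧ MvPowerSeries.constantCoeff (φ i) = 0)
    {h : MvPowerSeries (Option ι) k} (hh : h ∈ seriesRing q (Option ι)) :
    ∃ (D : ι → MvPowerSeries (Option ι) k)
      (a : MvPowerSeries Unit k), (∀ i, D i ∈ seriesRing q (Option ι)) ∧ a ∈ seriesRing q Unit ∧
      h = ∑ i, (MvPowerSeries.X (some i) - inc ι (φ i)) * D i + inc ι a := by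
  let E : Option ι ≃ ι ⊕ Unit := Equiv.optionEquivSumPUnit ι
  have hcomp : ∀ a : MvPowerSeries Unit k, MvPowerSeries.rename E.symm (MvPowerSeries.rename
      (Function.Embedding.inr : Unit ↪ ι ⊕ Unit) a) = inc ι a := by
    intro a
    rw [inc, MvPowerSeries.rename_rename]
    congr 2
  obtain ⟨D, a, hD, ha, heq⟩ := exists_eq_sum_mul_add_rename q ι φ hφ (MvPowerSeries.rename E h)
    (rename_mem_seriesRing q E.toEmbedding hh)
  refine ⟨fun i => MvPowerSeries.rename E.symm (D i), a,
    fun i => rename_mem_seriesRing q E.symm.toEmbedding (hD i), ha, ?_⟩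
  have h1 := congrArg (MvPowerSeries.rename E.symm) heq
  have h2 : MvPowerSeries.rename E.symm (MvPowerSeries.rename E h) = h := by simp
  rw [h2, map_add, map_sum, hcomp] at h1
  simp only [map_mul, map_sub, hcomp, MvPowerSeries.rename_X] at h1
  exact h1

/-- Partial derivatives commute with injective renamings of the variables. -/
theorem pderiv_rename {ι κ : Type*} (e : ι ↪ κ) (i : ι) (f : MvPowerSeries ι k) :
    MvPowerSeries.pderiv k (e i) (MvPowerSeries.rename e f) =
      MvPowerSeries.rename e (MvPowerSeries.pderiv k i f) := by
  classical
  ext n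
  rw [MvPowerSeries.coeff_pderiv]
  by_cases hn : n ∈ Set.range (Finsupp.embDomain e)
  · obtain ⟨x, rfl⟩ := hn
    rw [MvPowerSeries.coeff_embDomain_rename, MvPowerSeries.coeff_pderiv, Finsupp.embDomain_apply_self,
      ← Finsupp.embDomain_single, ← Finsupp.embDomain_add, MvPowerSeries.coeff_embDomain_rename]
  · have hn' : n + Finsupp.single (e i) 1 ∉ Set.range (Finsupp.embDomain e) := fun h =>
      hn (Finsupp.isLowerSet_range_embDomain e (self_le_add_right _ _) h)
    have hmap : (Finsupp.mapDomain e : (ι →₀ ℕ) → κ →₀ ℕ) = Finsupp.embDomain e := by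
      funext x
      exact (Finsupp.embDomain_eq_mapDomain e x).symm
    rw [MvPowerSeries.coeff_rename_eq_zero _ _ (by rwa [hmap]),
      MvPowerSeries.coeff_rename_eq_zero _ _ (by rwa [hmap]), zero_mul]

theorem pderiv_inc {ι : Type*} (i : ι) (a : MvPowerSeries Unit k) :
    MvPowerSeries.pderiv k (some i) (inc ι a) = 0 := by
  classical
  ext n
  rw [MvPowerSeries.coeff_pderiv, map_zero, inc, MvPowerSeries.coeff_rename_eq_zero, zero_mul]
  rintro ⟨y, hy⟩
  have h2 := DFunLike.congr_fun hy (some i)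
  rw [Finsupp.mapDomain_of_notMem_range _ _ (by simp), Finsupp.add_apply,
    Finsupp.single_eq_same] at h2
  lia

variable {q : Quality k} {m : ℕ}

theorem Arc.eval_apply (y : Arc q m) (f : MvPowerSeries (Option (Fin m)) k) :
    y.eval f = MvPowerSeries.subst y.assign f :=
  MvPowerSeries.substAlgHom_apply (R := k) y.hasSubst f

theorem Arc.eval_X_some (y : Arc q m) (i : Fin m) :
    y.eval (MvPowerSeries.X (some i)) = y.1 i := by
  rw [eval_apply, MvPowerSeries.subst_X y.hasSubst]
  rfl

theorem Arc.eval_X_none (y : Arc q m) :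
    y.eval (MvPowerSeries.X none) = (PowerSeries.X : PowerSeries k) := by
  rw [eval_apply, MvPowerSeries.subst_X y.hasSubst]
  rfl

theorem Arc.eval_inc (y : Arc q m) (a : MvPowerSeries Unit k) : y.eval (inc (Fin m) a) = a := by
  rw [eval_apply, inc, MvPowerSeries.rename_eq_subst,
    MvPowerSeries.subst_comp_subst_apply (MvPowerSeries.HasSubst.X_comp _) y.hasSubst]
  have h : (fun s : Unit => MvPowerSeries.subst y.assign
      ((MvPowerSeries.X ∘ (fun _ => none : Unit → Option (Fin m))) s : MvPowerSeries _ k)) =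
      MvPowerSeries.X := by
    funext s
    rw [Function.comp_apply, MvPowerSeries.subst_X y.hasSubst]
    rfl
  rw [h, MvPowerSeries.subst_self]
  rfl

/-- The generators `y_i - y_i(t)` of the prime ideal of an arc. -/
def Arc.param (y : Arc q m) (i : Fin m) : SeriesB q m :=
  ⟨MvPowerSeries.X (some i) - inc (Fin m) (y.1 i),
    Subring.sub_mem _ (X_mem_seriesRing q _) (inc_mem q (y.2 i).1)⟩

theorem Arc.mem_relIdeal (y : Arc q m) (h : SeriesB q m) :
    h ∈ y.relIdeal ↔ y.eval h.1 = 0 := Iff.rfl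

theorem Arc.eval_param (y : Arc q m) (i : Fin m) : y.eval (y.param i).1 = 0 := by
  change y.eval (MvPowerSeries.X (some i) - inc (Fin m) (y.1 i)) = 0
  rw [map_sub, eval_X_some, eval_inc, sub_self]

/-- A series vanishing at the arc `y` is a linear combination of the `y_i - y_i(t)`, and the values
of the coefficients at `y` are the partial derivatives. -/
theorem Arc.exists_eq_sum_mul_param (y : Arc q m) {h : SeriesB q m} (hh : h ∈ y.relIdeal) :
    ∃ D : Fin m → SeriesB q m, h = ∑ i, D i * y.param i ∧
      ∀ i, y.eval (D i).1 = y.eval (MvPowerSeries.pderiv k (some i) h.1) := by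
  classical
  obtain ⟨D, a, hD, ha, heq⟩ := exists_eq_sum_mul_add_inc q (Fin m) y.1 y.2 h.2
  have ha0 : a = 0 := by
    have h1 := congrArg y.eval heq
    rw [(y.mem_relIdeal h).mp hh, map_add, eval_inc, map_sum, Finset.sum_eq_zero, zero_add] at h1
    · exact h1.symm
    · intro i _
      have h2 := y.eval_param i
      rw [map_mul]
      exact mul_eq_zero_of_left h2 _
  have heq' : h.1 = ∑ i, D i * (y.param i).1 := by
    rw [heq, ha0, inc, map_zero, add_zero]
    exact Finset.sum_congr rfl fun i _ => mul_comm _ _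
  refine ⟨fun i => ⟨D i, hD i⟩, Subtype.ext ?_, fun i => ?_⟩
  · rw [heq', AddSubmonoidClass.coe_finsetSum]
    rfl
  · rw [heq', map_sum, map_sum]
    have h1 : ∀ j, y.eval (MvPowerSeries.pderiv k (some i) (D j * (y.param j).1)) =
        if j = i then y.eval (D j) else 0 := by
      intro j
      rw [Derivation.leibniz, map_add, smul_eq_mul, smul_eq_mul, map_mul, map_mul, y.eval_param,
        zero_mul, add_zero]
      change y.eval (D j) * y.eval (MvPowerSeries.pderiv k (some i)
        (MvPowerSeries.X (some j) - inc (Fin m) (y.1 j))) = _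
      rw [map_sub, pderiv_inc, sub_zero]
      split_ifs with hji
      · rw [hji, MvPowerSeries.pderiv_X_self, map_one, mul_one]
      · rw [MvPowerSeries.pderiv_X_of_ne, map_zero, mul_zero]
        simpa using hji
    simp only [h1]
    rw [Finset.sum_ite_eq' Finset.univ i, if_pos (Finset.mem_univ i)]

theorem Arc.relIdeal_eq_span (y : Arc q m) : y.relIdeal = Ideal.span (Set.range y.param) := by
  apply le_antisymm
  · intro h hh
    obtain ⟨D, hD, -⟩ := y.exists_eq_sum_mul_param hh
    rw [hD]
    exact Ideal.sum_mem _ fun i _ => Ideal.mul_mem_left _ _ (Ideal.subset_span ⟨i, rfl⟩)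
  · rw [Ideal.span_le]
    rintro _ ⟨i, rfl⟩
    exact y.eval_param i

/-- The assignment which replaces only the first `n` variables by the components of the arc. -/
def Arc.partialAssign (y : Arc q m) (n : ℕ) : Option (Fin m) → MvPowerSeries (Option (Fin m)) k
  | none => MvPowerSeries.X none
  | some i => if (i : ℕ) < n then inc (Fin m) (y.1 i) else MvPowerSeries.X (some i)

theorem Arc.hasSubst_partialAssign (y : Arc q m) (n : ℕ) :
    MvPowerSeries.HasSubst (y.partialAssign n) := by
  refine MvPowerSeries.hasSubst_of_constantCoeff_zero fun s => ?_
  cases s with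
  | none => exact MvPowerSeries.constantCoeff_X _
  | some i =>
    rw [partialAssign]
    split_ifs
    · exact (MvPowerSeries.constantCoeff_rename _ _).trans (y.2 i).2
    · exact MvPowerSeries.constantCoeff_X _

/-- The prime ideal of all series vanishing when the first `n` variables are replaced by the
components of the arc. -/
def Arc.partialIdeal (y : Arc q m) (n : ℕ) : Ideal (SeriesB q m) :=
  RingHom.ker ((MvPowerSeries.substAlgHom (R := k) (y.hasSubst_partialAssign n)).toRingHom.comp
    (seriesRing q (Option (Fin m))).subtype)

instance (y : Arc q m) (n : ℕ) : (y.partialIdeal n).IsPrime := RingHom.ker_isPrime _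

theorem Arc.mem_partialIdeal (y : Arc q m) (n : ℕ) (h : SeriesB q m) :
    h ∈ y.partialIdeal n ↔ MvPowerSeries.subst (y.partialAssign n) h.1 = 0 := by
  rw [← MvPowerSeries.substAlgHom_apply (y.hasSubst_partialAssign n)]
  rfl

theorem Arc.subst_partialAssign_param (y : Arc q m) (n : ℕ) (i : Fin m) :
    MvPowerSeries.subst (y.partialAssign n) (y.param i).1 =
      if (i : ℕ) < n then 0 else (y.param i).1 := by
  have hinc : ∀ a : MvPowerSeries Unit k, MvPowerSeries.subst (y.partialAssign n) (inc (Fin m) a) =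
      inc (Fin m) a := by
    intro a
    conv_rhs => rw [inc, MvPowerSeries.rename_eq_subst]
    rw [inc, MvPowerSeries.rename_eq_subst, MvPowerSeries.subst_comp_subst_apply
      (MvPowerSeries.HasSubst.X_comp _) (y.hasSubst_partialAssign n)]
    congr 1
    funext s
    rw [Function.comp_apply, MvPowerSeries.subst_X (y.hasSubst_partialAssign n)]
    rfl
  change MvPowerSeries.subst (y.partialAssign n)
    (MvPowerSeries.X (some i) - inc (Fin m) (y.1 i)) = _
  rw [← MvPowerSeries.substAlgHom_apply (y.hasSubst_partialAssign n), map_sub,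
    MvPowerSeries.substAlgHom_apply, MvPowerSeries.substAlgHom_apply, hinc,
    MvPowerSeries.subst_X (y.hasSubst_partialAssign n), partialAssign]
  split_ifs
  · exact sub_self _
  · rfl

theorem Arc.param_ne_zero (y : Arc q m) (i : Fin m) : (y.param i).1 ≠ 0 := by
  classical
  intro h
  have h1 := congrArg (MvPowerSeries.pderiv k (some i)) h
  change MvPowerSeries.pderiv k (some i) (MvPowerSeries.X (some i) - inc (Fin m) (y.1 i)) = _ at h1
  rw [map_sub, pderiv_inc, sub_zero, MvPowerSeries.pderiv_X_self, map_zero] at h1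
  exact one_ne_zero h1

theorem Arc.partialIdeal_lt (y : Arc q m) (i : Fin m) :
    y.partialIdeal i < y.partialIdeal (i + 1) := by
  refine lt_of_le_of_ne (fun h hh => ?_) fun heq => ?_
  · rw [mem_partialIdeal] at hh ⊢
    have h1 : (fun s => MvPowerSeries.subst (y.partialAssign (i + 1)) (y.partialAssign i s)) =
        y.partialAssign (i + 1) := by
      funext s
      have h2 : ∀ j, (fun s => MvPowerSeries.subst (y.partialAssign (i + 1))
          (MvPowerSeries.X s : MvPowerSeries (Option (Fin m)) k)) j = y.partialAssign (i + 1) j :=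
        fun j => MvPowerSeries.subst_X (y.hasSubst_partialAssign _) _
      cases s with
      | none => exact h2 none
      | some j =>
        rw [partialAssign]
        split_ifs with hj
        · have h3 := y.subst_partialAssign_param (i + 1) j
          rw [if_pos (by lia)] at h3
          change MvPowerSeries.subst (y.partialAssign (i + 1))
            (MvPowerSeries.X (some j) - inc (Fin m) (y.1 j)) = 0 at h3
          rw [← MvPowerSeries.substAlgHom_apply (y.hasSubst_partialAssign _), map_sub,
            MvPowerSeries.substAlgHom_apply, MvPowerSeries.substAlgHom_apply, sub_eq_zero] at h3
          rw [← h3]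
          exact h2 _
        · exact h2 _
    rw [← h1, ← MvPowerSeries.subst_comp_subst_apply (y.hasSubst_partialAssign _)
      (y.hasSubst_partialAssign _), hh, ← MvPowerSeries.substAlgHom_apply
      (y.hasSubst_partialAssign _), map_zero]
  · have h1 : y.param i ∈ y.partialIdeal (i + 1) := by
      rw [mem_partialIdeal, subst_partialAssign_param, if_pos (Nat.lt_succ_self _)]
    rw [← heq, mem_partialIdeal, subst_partialAssign_param, if_neg (lt_irrefl _)] at h1
    exact y.param_ne_zero i h1

theorem Arc.partialIdeal_le (y : Arc q m) (n : ℕ) : y.partialIdeal n ≤ y.relIdeal := by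
  intro h hh
  rw [mem_partialIdeal] at hh
  rw [mem_relIdeal]
  have h1 : (fun s => MvPowerSeries.subst y.assign (y.partialAssign n s)) = y.assign := by
    funext s
    cases s with
    | none => exact MvPowerSeries.subst_X y.hasSubst _
    | some j =>
      rw [partialAssign]
      split_ifs with hj
      · rw [← eval_apply, eval_inc]
        rfl
      · exact MvPowerSeries.subst_X y.hasSubst _
  rw [eval_apply, ← h1, ← MvPowerSeries.subst_comp_subst_apply (y.hasSubst_partialAssign _)
    y.hasSubst, hh, ← eval_apply, map_zero]

variable [PerfectField k]

instance : IsNoetherianRing (SeriesB q m) := isNoetherianRing_seriesRing q _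

theorem Arc.height_relIdeal (y : Arc q m) : y.relIdeal.height = m := by
  classical
  apply le_antisymm
  · refine (Ideal.height_le_spanFinrank _ y.relIdeal_isPrime.ne_top).trans ?_
    rw [relIdeal_eq_span]
    have h := Submodule.spanFinrank_span_le_ncard_of_finite (R := SeriesB q m)
      (Set.finite_range y.param)
    have h2 : (Set.range y.param).ncard ≤ m := by
      rw [← Set.image_univ, ← Finset.coe_univ, ← Finset.coe_image, Set.ncard_coe_finset]
      exact Finset.card_image_le.trans_eq (Finset.card_fin m)
    exact_mod_cast h.trans h2
  · have h : ∀ n ≤ m, (n : ℕ∞) ≤ (y.partialIdeal n).height := by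
      intro n
      induction n with
      | zero => exact fun _ => by simp
      | succ n ih =>
        intro hn
        have h1 := Ideal.height_strict_mono_of_isPrime (y.partialIdeal_lt ⟨n, hn⟩)
        rw [Nat.cast_add, Nat.cast_one]
        exact (add_le_add_left (ih (Nat.le_of_succ_le hn)) 1).trans (Order.add_one_le_of_lt h1)
    exact (h m le_rfl).trans (Ideal.height_mono (y.partialIdeal_le m))

end Arcs

/-! ### The regular locus of an arquile variety -/

section RegularLocus

variable {k : Type*} [Field k] [PerfectField k] {q : Quality k} {m : ℕ}

omit [PerfectField k] in
theorem Arc.maximalIdeal_eq_span (y : Arc q m) :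
    IsLocalRing.maximalIdeal (Localization.AtPrime y.relIdeal) = Ideal.span (Set.range fun i =>
      algebraMap (SeriesB q m) (Localization.AtPrime y.relIdeal) (y.param i)) := by
  have h1 : y.relIdeal.map (algebraMap (SeriesB q m) (Localization.AtPrime y.relIdeal)) =
      Ideal.span (Set.range fun i =>
        algebraMap (SeriesB q m) (Localization.AtPrime y.relIdeal) (y.param i)) := by
    refine (congrArg (Ideal.map (algebraMap (SeriesB q m) (Localization.AtPrime y.relIdeal)))
      y.relIdeal_eq_span).trans ?_
    rw [Ideal.map_span, ← Set.range_comp]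
    rfl
  rw [← h1]
  exact Localization.AtPrime.map_eq_maximalIdeal.symm

theorem Arc.ringKrullDim_localization (y : Arc q m) :
    ringKrullDim (Localization.AtPrime y.relIdeal) = m := by
  rw [IsLocalization.AtPrime.ringKrullDim_eq_height y.relIdeal, y.height_relIdeal]
  rfl

omit [PerfectField k] in
theorem Arc.isUnit_algebraMap_iff (y : Arc q m) (h : SeriesB q m) :
    IsUnit (algebraMap (SeriesB q m) (Localization.AtPrime y.relIdeal) h) ↔ y.eval h.1 ≠ 0 := by
  rw [IsLocalization.AtPrime.isUnit_to_map_iff _ y.relIdeal]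
  exact not_congr (y.mem_relIdeal h)

omit [PerfectField k] in
theorem Arc.eval_det (y : Arc q m) {r : ℕ} (M : Matrix (Fin r) (Fin r) (SeriesB q m)) :
    y.eval M.det.1 = (Matrix.of fun a b => y.eval (M a b).1).det :=
  RingHom.map_det (y.eval.comp (seriesRing q (Option (Fin m))).subtype) M

omit [PerfectField k] in
theorem Arc.eval_minor (y : Arc q m) {r : ℕ} (h : Fin r → SeriesB q m) (c : Fin r → Fin m) :
    y.eval (minor h c) = (Matrix.of fun a b : Fin r =>
      y.eval (MvPowerSeries.pderiv k (some (c b)) (h a).1)).det :=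
  RingHom.map_det y.eval _

omit [PerfectField k] in
/-- At an arc, series in its prime ideal are linear combinations of the regular system of
parameters, and the minors of the matrix of coefficients are units if and only if the corresponding
minors of the relative Jacobian matrix do not vanish at the arc. -/
theorem Arc.exists_coeff_matrix (y : Arc q m) {p : ℕ} {h : Fin p → SeriesB q m}
    (hh : ∀ a, h a ∈ y.relIdeal) :
    ∃ A : Fin p → Fin m → Localization.AtPrime y.relIdeal,
      (∀ a, algebraMap (SeriesB q m) (Localization.AtPrime y.relIdeal) (h a) =
        ∑ i, A a i * algebraMap (SeriesB q m) (Localization.AtPrime y.relIdeal) (y.param i)) ∧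
      ∀ (r : ℕ) (ρ : Fin r → Fin p) (c : Fin r → Fin m),
        IsUnit (Matrix.of fun a b : Fin r => A (ρ a) (c b)).det ↔
          y.eval (minor (h ∘ ρ) c) ≠ 0 := by
  choose D hD hDeval using fun a => y.exists_eq_sum_mul_param (hh a)
  refine ⟨fun a i => algebraMap _ _ (D a i), fun a => ?_, fun r ρ c => ?_⟩
  · conv_lhs => rw [hD a]
    rw [map_sum]
    simp only [map_mul]
  · have h1 : (Matrix.of fun a b : Fin r => algebraMap (SeriesB q m)
        (Localization.AtPrime y.relIdeal) (D (ρ a) (c b))).det = algebraMap _ _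
        (Matrix.of fun a b : Fin r => D (ρ a) (c b)).det :=
      (RingHom.map_det _ _).symm
    rw [h1, y.isUnit_algebraMap_iff, y.eval_det, y.eval_minor]
    simp only [Matrix.of_apply, hDeval, Function.comp_apply]

variable {Y : Set (Arc q m)}

omit [PerfectField k] in
theorem vanishingIdeal_le_relIdeal {y : Arc q m} (hy : y ∈ Y) : vanishingIdeal Y ≤ y.relIdeal :=
  iInf₂_le y hy

omit [PerfectField k] in
theorem range_algebraMap_eq {y : Arc q m} {p : ℕ} {h : Fin p → SeriesB q m}
    {A : Fin p → Fin m → Localization.AtPrime y.relIdeal}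
    (hA : ∀ a, algebraMap (SeriesB q m) (Localization.AtPrime y.relIdeal) (h a) =
        ∑ i, A a i * algebraMap (SeriesB q m) (Localization.AtPrime y.relIdeal) (y.param i)) :
    Ideal.span (Set.range fun a => ∑ i, A a i *
      algebraMap (SeriesB q m) (Localization.AtPrime y.relIdeal) (y.param i)) =
      (Ideal.span (Set.range h)).map (algebraMap (SeriesB q m) _) := by
  rw [Ideal.map_span, ← Set.range_comp]
  congr 2
  funext a
  exact (hA a).symm

/-- If a minor of size the height of the ideal does not vanish at a point `y`, then `y` is regular
and the rows of the minor generate the ideal locally. -/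
theorem localIdeal_eq_and_mem_arqReg {y : Arc q m} (hy : y ∈ Y) {r : ℕ} {h : Fin r → SeriesB q m}
    {c : Fin r → Fin m} (hh : ∀ a, h a ∈ vanishingIdeal Y) (hg : y.eval (minor h c) ≠ 0)
    (hht : (localIdeal Y y).height = r) :
    localIdeal Y y = (Ideal.span (Set.range h)).map (algebraMap (SeriesB q m) _) ∧
      y ∈ arqReg Y ∧ (localIdeal Y y).IsPrime := by
  classical
  obtain ⟨A, hA, hminor⟩ := y.exists_coeff_matrix
    (fun a => vanishingIdeal_le_relIdeal hy (hh a))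
  have h1 := eq_span_and_isRegularLocalRing y.maximalIdeal_eq_span y.ringKrullDim_localization
    ((hminor r id c).mpr hg) (I := localIdeal Y y) (fun a => by
      rw [id_eq, ← hA]
      exact Ideal.mem_map_of_mem _ (hh a)) hht
  exact ⟨h1.1.trans (range_algebraMap_eq hA), ⟨hy, h1.2.1⟩, h1.2.2⟩

/-- At a regular point, some minor of the Jacobian matrix of a system of generators, of size the
height of the ideal, does not vanish. -/
theorem exists_minor_ne_zero {y : Arc q m} (hy : y ∈ arqReg Y) {p : ℕ} {F : Fin p → SeriesB q m}
    (hF : Ideal.span (Set.range F) = vanishingIdeal Y) :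
    ∃ (r : ℕ) (ρ : Fin r → Fin p) (c : Fin r → Fin m), y.eval (minor (F ∘ ρ) c) ≠ 0 ∧
      (localIdeal Y y).height = r := by
  classical
  obtain ⟨A, hA, hminor⟩ := y.exists_coeff_matrix (h := F)
    (fun a => vanishingIdeal_le_relIdeal hy.1 (hF ▸ Ideal.subset_span ⟨a, rfl⟩))
  have hspan : Ideal.span (Set.range fun a => ∑ i, A a i *
      algebraMap (SeriesB q m) (Localization.AtPrime y.relIdeal) (y.param i)) = localIdeal Y y := by
    rw [range_algebraMap_eq hA, hF]
    rfl
  obtain ⟨r, ρ, c, hunit, hht⟩ := exists_isUnit_det_of_isRegularLocalRing y.maximalIdeal_eq_span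
    y.ringKrullDim_localization (B := A) (by rw [hspan]; exact hy.2)
  rw [hspan] at hht
  exact ⟨r, ρ, c, (hminor r ρ c).mp hunit, hht⟩

theorem arqSing_eq {p r : ℕ} {F : Fin p → SeriesB q m}
    (hF : Ideal.span (Set.range F) = vanishingIdeal Y)
    (hht : ∀ y ∈ Y, (localIdeal Y y).height = r) :
    arqSing Y = {y | y ∈ Y ∧ ∀ (ρ : Fin r → Fin p) (c : Fin r → Fin m),
      y.eval (minor (F ∘ ρ) c) = 0} := by
  ext y
  refine ⟨fun hy => ⟨hy.1, fun ρ c => ?_⟩, fun hy => ⟨hy.1, fun hreg => ?_⟩⟩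
  · by_contra hg
    exact hy.2 (localIdeal_eq_and_mem_arqReg hy.1
      (fun a => hF ▸ Ideal.subset_span ⟨ρ a, rfl⟩) hg (hht y hy.1)).2.1
  · obtain ⟨r', ρ, c, hg, hr'⟩ := exists_minor_ne_zero hreg hF
    rw [hht y hy.1] at hr'
    obtain rfl : r = r' := by exact_mod_cast hr'
    exact hg (hy.2 ρ c)

/-- If only one minimal prime of `I` is contained in the prime `P`, then the height of `I` in the
localization at `P` is the height of this minimal prime. -/
theorem height_map_localization {R : Type*} [CommRing R] {I P Q : Ideal R} [P.IsPrime]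
    (hIP : I ≤ P) (hQ : ∀ Q' ∈ I.minimalPrimes, Q' ≤ P → Q' = Q) :
    (I.map (algebraMap R (Localization.AtPrime P))).height = Q.height := by
  set J := I.map (algebraMap R (Localization.AtPrime P)) with hJ
  have hle : J ≤ IsLocalRing.maximalIdeal (Localization.AtPrime P) := by
    rw [← Localization.AtPrime.map_eq_maximalIdeal]
    exact Ideal.map_mono hIP
  have h1 : ∀ J' ∈ J.minimalPrimes, J'.height = Q.height := by
    intro J' hJ'
    have h2 : J'.under R ∈ I.minimalPrimes := by
      rw [hJ, IsLocalization.minimalPrimes_map P.primeCompl] at hJ'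
      exact hJ'
    have h3 : J'.IsPrime := hJ'.1.1
    have h4 : J'.under R ≤ P := by
      have h5 := IsLocalRing.le_maximalIdeal h3.ne_top
      have h6 : J'.under R ≤ (IsLocalRing.maximalIdeal (Localization.AtPrime P)).under R :=
        Ideal.comap_mono h5
      rwa [Localization.AtPrime.under_maximalIdeal] at h6
    rw [← hQ _ h2 h4]
    exact (IsLocalization.height_under P.primeCompl J').symm
  rw [Ideal.height_eq_inf_minimalPrimes]
  have hprime : (IsLocalRing.maximalIdeal (Localization.AtPrime P)).IsPrime :=
    (IsLocalRing.maximalIdeal.isMaximal _).isPrime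
  obtain ⟨J₀, hJ₀, -⟩ := Ideal.exists_minimalPrimes_le hle
  apply le_antisymm
  · exact (iInf₂_le J₀ hJ₀).trans (h1 J₀ hJ₀).le
  · exact le_iInf₂ fun J' hJ' => (h1 J' hJ').ge

/-- If `I` becomes prime in the localization at `P`, then `P` contains a unique minimal prime
of `I`. -/
theorem exists_minimalPrimes_unique {R : Type*} [CommRing R] {I P : Ideal R} [P.IsPrime]
    (h : (I.map (algebraMap R (Localization.AtPrime P))).IsPrime) :
    ∃ Q ∈ I.minimalPrimes, ∀ Q' ∈ I.minimalPrimes, Q' ≤ P → Q' = Q := by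
  set J := I.map (algebraMap R (Localization.AtPrime P)) with hJ
  have hJmin : J ∈ J.minimalPrimes := by
    rw [Ideal.minimalPrimes_eq_subsingleton_self]
    rfl
  have h2 : J.under R ∈ I.minimalPrimes := by
    rw [hJ, IsLocalization.minimalPrimes_map P.primeCompl, ← hJ] at hJmin
    exact hJmin
  refine ⟨_, h2, fun Q' hQ' hP => ?_⟩
  have hp : Q'.IsPrime := hQ'.1.1
  have h3 : (Q'.map (algebraMap R (Localization.AtPrime P))).under R = Q' := by
    refine IsLocalization.under_map_of_isPrime_disjoint P.primeCompl _ hp ?_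
    rw [Set.disjoint_left]
    exact fun x hx hx' => hx (hP hx')
  have h4 : J.under R ≤ Q' := by
    rw [← h3]
    exact Ideal.comap_mono (Ideal.map_mono hQ'.1.2)
  exact le_antisymm (hQ'.2 h2.1 h4) h4

omit [PerfectField k] in
theorem Arc.eval_minor_mul (y : Arc q m) {r : ℕ} {h : Fin r → SeriesB q m} {c : Fin r → Fin m}
    (v : SeriesB q m) (hh : ∀ a, h a ∈ y.relIdeal) :
    y.eval (minor (fun a => v * h a) c) = y.eval v.1 ^ r * y.eval (minor h c) := by
  rw [eval_minor, eval_minor]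
  have h1 : (Matrix.of fun a b : Fin r =>
      y.eval (MvPowerSeries.pderiv k (some (c b)) (v * h a).1)) = y.eval v.1 •
      (Matrix.of fun a b : Fin r => y.eval (MvPowerSeries.pderiv k (some (c b)) (h a).1)) := by
    ext1 a b
    rw [Matrix.smul_apply, Matrix.of_apply, Matrix.of_apply, smul_eq_mul, Subring.coe_mul,
      Derivation.leibniz, map_add, smul_eq_mul, smul_eq_mul, map_mul, map_mul,
      (y.mem_relIdeal (h a)).mp (hh a), zero_mul, add_zero]
  rw [h1, Matrix.det_smul, Fintype.card_fin]

/-- The regular locus is covered by the complements of finitely many adapted minors: among the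
minors of the generators multiplied by the elements of generating systems of the intersections of
all minimal primes but one, all adapted ones are taken. -/
theorem exists_adapted_minors (Y : Set (Arc q m)) :
    ∃ (p : ℕ) (F : Fin p → SeriesB q m) (N : ℕ) (r : Fin N → ℕ)
        (ρ : (j : Fin N) → Fin (r j) → Fin p) (c : (j : Fin N) → Fin (r j) → Fin m),
      Ideal.span (Set.range F) = vanishingIdeal Y ∧
      (∀ j, IsAdapted Y (F ∘ ρ j) (c j)) ∧
      arqReg Y = ⋃ j, {y | y ∈ Y ∧ y.eval (minor (F ∘ ρ j) (c j)) ≠ 0} := by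
  classical
  set I := vanishingIdeal Y with hI
  have hfin := Ideal.finite_minimalPrimes_of_isNoetherianRing _ I
  set M : Finset (Ideal (SeriesB q m)) := hfin.toFinset
  obtain ⟨G₀, hG₀⟩ : I.FG := IsNoetherian.noetherian I
  have hex : ∀ Q : Ideal (SeriesB q m), ∃ S : Finset (SeriesB q m),
      Ideal.span (S : Set (SeriesB q m)) = (M.erase Q).inf id :=
    fun Q => IsNoetherian.noetherian _
  choose S hS using hex
  set G : Finset (SeriesB q m) :=
    G₀ ∪ M.biUnion fun Q => Finset.image₂ (fun v f => v * f) (S Q) G₀ with hG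
  have hG₀I : ∀ f ∈ G₀, f ∈ I := fun f hf => by
    rw [← hG₀]
    exact Ideal.subset_span hf
  have hGI : ∀ f ∈ G, f ∈ I := by
    intro f hf
    rw [hG, Finset.mem_union, Finset.mem_biUnion] at hf
    rcases hf with hf | ⟨Q, -, hf⟩
    · exact hG₀I f hf
    · obtain ⟨v, -, f', hf', rfl⟩ := Finset.mem_image₂.mp hf
      exact Ideal.mul_mem_left _ _ (hG₀I f' hf')
  let e := G.equivFin
  let F : Fin G.card → SeriesB q m := fun a => (e.symm a).1
  have hFrange : Set.range F = G := by
    ext f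
    refine ⟨?_, fun hf => ⟨e ⟨f, hf⟩, by simp [F]⟩⟩
    rintro ⟨a, rfl⟩
    exact (e.symm a).2
  have hFspan : Ideal.span (Set.range F) = I := by
    rw [hFrange]
    apply le_antisymm
    · exact Ideal.span_le.mpr fun f hf => hGI f hf
    · rw [← hG₀]
      exact Ideal.span_mono (by simp [hG])
  let T := {x : Σ r : Fin (m + 1), (Fin (r : ℕ) → Fin G.card) × (Fin (r : ℕ) → Fin m) //
    IsAdapted Y (F ∘ x.2.1) x.2.2}
  let eT := Fintype.equivFin T
  refine ⟨G.card, F, Fintype.card T, fun j => (eT.symm j).1.1, fun j => (eT.symm j).1.2.1,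
    fun j => (eT.symm j).1.2.2, hFspan, fun j => (eT.symm j).2, ?_⟩
  ext y
  rw [Set.mem_iUnion]
  refine ⟨fun hy => ?_, ?_⟩
  · suffices hsuff : ∃ (r : ℕ) (ρ : Fin r → Fin G.card) (c : Fin r → Fin m),
        IsAdapted Y (F ∘ ρ) c ∧ y.eval (minor (F ∘ ρ) c) ≠ 0 by
      obtain ⟨r, ρ, c, hadapt, hne⟩ := hsuff
      have hr : r < m + 1 := by
        by_contra! hr
        obtain ⟨b, b', hbb, hc⟩ := Fintype.exists_ne_map_eq_of_card_lt c (by simpa using hr)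
        apply hne
        rw [y.eval_minor]
        refine Matrix.det_zero_of_column_eq hbb fun a => ?_
        simp [hc]
      refine ⟨eT ⟨⟨⟨r, hr⟩, ρ, c⟩, hadapt⟩, hy.1, ?_⟩
      beta_reduce
      rw [Equiv.symm_apply_apply]
      exact hne
    -- a nonvanishing minor of the generators `G₀`
    let e₀ := G₀.equivFin
    let F₀ : Fin G₀.card → SeriesB q m := fun a => (e₀.symm a).1
    have hF₀G : ∀ a, F₀ a ∈ G₀ := fun a => (e₀.symm a).2
    have hF₀ : Ideal.span (Set.range F₀) = I := by
      rw [← hG₀]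
      congr 1
      ext f
      refine ⟨?_, fun hf => ⟨e₀ ⟨f, hf⟩, by simp [F₀]⟩⟩
      rintro ⟨a, rfl⟩
      exact hF₀G a
    obtain ⟨r, a, c, hne, hht⟩ := exists_minor_ne_zero hy hF₀
    have hF₀rel : ∀ y' ∈ Y, ∀ i, F₀ (a i) ∈ y'.relIdeal := fun y' hy' i =>
      vanishingIdeal_le_relIdeal hy' (hG₀I _ (hF₀G _))
    obtain ⟨-, -, hprime⟩ := localIdeal_eq_and_mem_arqReg hy.1
      (fun i => hG₀I _ (hF₀G (a i))) hne hht
    obtain ⟨Q, hQ, hQu⟩ := exists_minimalPrimes_unique hprime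
    have hQht : Q.height = r := by
      rw [← hht]
      exact (height_map_localization (vanishingIdeal_le_relIdeal hy.1) hQu).symm
    -- an element of all minimal primes but `Q` that does not vanish at `y`
    obtain ⟨v, hv, hvy⟩ : ∃ v ∈ S Q, v ∉ y.relIdeal := by
      by_contra! hcon
      have h1 : (M.erase Q).inf id ≤ y.relIdeal := by
        rw [← hS]
        exact Ideal.span_le.mpr hcon
      obtain ⟨Q', hQ', hle⟩ := (Ideal.IsPrime.inf_le' y.relIdeal_isPrime).mp h1
      rw [Finset.mem_erase, Set.Finite.mem_toFinset] at hQ'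
      exact hQ'.1 (hQu Q' hQ'.2 hle)
    have hmem : ∀ f ∈ G₀, v * f ∈ G := fun f hf => by
      rw [hG, Finset.mem_union, Finset.mem_biUnion]
      exact Or.inr ⟨Q, (Set.Finite.mem_toFinset _).mpr hQ, Finset.mem_image₂.mpr ⟨v, hv, f, hf, rfl⟩⟩
    let ρ : Fin r → Fin G.card := fun i => e ⟨v * F₀ (a i), hmem _ (hF₀G _)⟩
    have hFρ : F ∘ ρ = fun i => v * (F₀ ∘ a) i := by
      funext i
      simp [F, ρ]
    refine ⟨r, ρ, c, fun y' hy' hne' => ?_, ?_⟩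
    · rw [hFρ, y'.eval_minor_mul (h := F₀ ∘ a) v (hF₀rel y' hy')] at hne'
      rcases Nat.eq_zero_or_pos r with hr | hr
      · -- for `r = 0` the ideal itself is zero
        have hI0 : I = ⊥ := by
          have hIle : I ≤ Q := hQ.1.2
          rw [hr, Nat.cast_zero, Ideal.height_eq_zero_iff_eq_bot] at hQht
          exact le_bot_iff.mp (hQht ▸ hIle)
        rw [localIdeal, ← hI, hI0, Ideal.map_bot, hr, Nat.cast_zero]
        exact Ideal.height_bot
      · rw [localIdeal, ← hQht]
        refine height_map_localization (vanishingIdeal_le_relIdeal hy') fun Q' hQ' hle => ?_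
        by_contra hQQ
        have h1 : v ∈ (M.erase Q).inf id := by
          rw [← hS]
          exact Ideal.subset_span hv
        have h2 : v ∈ Q' := (Finset.inf_le (Finset.mem_erase.mpr
          ⟨hQQ, (Set.Finite.mem_toFinset _).mpr hQ'⟩) : _ ≤ id Q') h1
        have h3 := (y'.mem_relIdeal v).mp (hle h2)
        rw [h3, zero_pow hr.ne', zero_mul] at hne'
        exact hne' rfl
    · rw [hFρ, y.eval_minor_mul (h := F₀ ∘ a) v (hF₀rel y hy.1)]
      exact mul_ne_zero (pow_ne_zero r fun h => hvy ((y.mem_relIdeal v).mpr h)) hne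
  · rintro ⟨j, hy, hne⟩
    have hadapt := (eT.symm j).2
    exact (localIdeal_eq_and_mem_arqReg hy (fun a => hGI _ (e.symm _).2) hne
      (hadapt y hy hne)).2.1

end RegularLocus

/-! ### Taylor expansion of second order -/

section Taylor

variable {k : Type*} [Field k]

/-- Divided differences: `f(x) - f(x') = ∑ A_i(x, x') (x_i - x'_i)` with series `A_i` of the same
quality, whose restrictions to the diagonal are the partial derivatives of `f`. -/
theorem exists_dividedDifference (q : Quality k) (ι : Type) [Fintype ι] {f : MvPowerSeries ι k}
    (hf : f ∈ seriesRing q ι) :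
    ∃ A : ι → MvPowerSeries (ι ⊕ ι) k, (∀ i, A i ∈ seriesRing q (ι ⊕ ι)) ∧
      MvPowerSeries.rename Function.Embedding.inl f =
        ∑ i, (MvPowerSeries.X (Sum.inl i) - MvPowerSeries.X (Sum.inr i)) * A i +
          MvPowerSeries.rename Function.Embedding.inr f ∧
      ∀ i, MvPowerSeries.rename (Sum.elim id id : ι ⊕ ι → ι) (A i) =
        MvPowerSeries.pderiv k i f := by
  classical
  obtain ⟨A, a, hA, -, heq⟩ := exists_eq_sum_mul_add_rename q ι (fun i => MvPowerSeries.X i)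
    (fun i => ⟨X_mem_seriesRing q i, MvPowerSeries.constantCoeff_X i⟩)
    (MvPowerSeries.rename (Function.Embedding.inl : ι ↪ ι ⊕ ι) f)
    (rename_mem_seriesRing q _ hf)
  simp only [MvPowerSeries.rename_X] at heq
  have hinl : ∀ g : MvPowerSeries ι k, MvPowerSeries.rename (Sum.elim id id : ι ⊕ ι → ι)
      (MvPowerSeries.rename (Function.Embedding.inl : ι ↪ ι ⊕ ι) g) = g := fun g => by
    rw [MvPowerSeries.rename_rename]
    exact MvPowerSeries.rename_id_apply g
  have hinr : ∀ g : MvPowerSeries ι k, MvPowerSeries.rename (Sum.elim id id : ι ⊕ ι → ι)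
      (MvPowerSeries.rename (Function.Embedding.inr : ι ↪ ι ⊕ ι) g) = g := fun g => by
    rw [MvPowerSeries.rename_rename]
    exact MvPowerSeries.rename_id_apply g
  have hfa : f = a := by
    have h1 := congrArg (MvPowerSeries.rename (Sum.elim id id : ι ⊕ ι → ι)) heq
    rw [hinl, map_add, hinr, map_sum, Finset.sum_eq_zero, zero_add] at h1
    · exact h1
    · intro i _
      rw [map_mul, map_sub, MvPowerSeries.rename_X, MvPowerSeries.rename_X]
      exact mul_eq_zero_of_left (sub_self _) _
  subst hfa
  refine ⟨A, hA, heq, fun i => ?_⟩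
  -- differentiate the identity in the variable `inl i` and restrict to the diagonal
  have hzero : MvPowerSeries.pderiv k (Sum.inl i)
      (MvPowerSeries.rename (Function.Embedding.inr : ι ↪ ι ⊕ ι) f) = 0 := by
    ext n
    rw [MvPowerSeries.coeff_pderiv, map_zero, MvPowerSeries.coeff_rename_eq_zero, zero_mul]
    rintro ⟨y, hy⟩
    have h2 := DFunLike.congr_fun hy (Sum.inl i)
    rw [Finsupp.mapDomain_of_notMem_range _ _ (by simp), Finsupp.add_apply,
      Finsupp.single_eq_same] at h2
    lia
  have h1 := congrArg (fun g => MvPowerSeries.rename (Sum.elim id id : ι ⊕ ι → ι)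
    (MvPowerSeries.pderiv k (Sum.inl i) g)) heq
  beta_reduce at h1
  have h2 := pderiv_rename (Function.Embedding.inl : ι ↪ ι ⊕ ι) i f
  rw [show (Function.Embedding.inl : ι ↪ ι ⊕ ι) i = Sum.inl i from rfl] at h2
  rw [h2, hinl, map_add, hzero, add_zero, map_sum, map_sum] at h1
  rw [h1]
  symm
  refine (Finset.sum_eq_single i (fun j _ hji => ?_) (by simp)).trans ?_
  · rw [Derivation.leibniz, map_add, smul_eq_mul, smul_eq_mul, map_mul, map_mul, map_sub, map_sub,
      MvPowerSeries.rename_X, MvPowerSeries.rename_X,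
      MvPowerSeries.pderiv_X_of_ne (by simpa using hji), MvPowerSeries.pderiv_X_of_ne (by simp)]
    simp
  · rw [Derivation.leibniz, map_add, smul_eq_mul, smul_eq_mul, map_mul, map_mul, map_sub, map_sub,
      MvPowerSeries.rename_X, MvPowerSeries.rename_X,
      MvPowerSeries.pderiv_X_self, MvPowerSeries.pderiv_X_of_ne (by simp)]
    simp

theorem _root_.MvPowerSeries.HasSubst.sumElim {S : Type*} [CommRing S] {σ σ' τ : Type*} [Finite σ]
    [Finite σ'] {a : σ → MvPowerSeries τ S} {b : σ' → MvPowerSeries τ S}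
    (ha : MvPowerSeries.HasSubst a) (hb : MvPowerSeries.HasSubst b) :
    MvPowerSeries.HasSubst (Sum.elim a b) := by
  refine MvPowerSeries.hasSubst_of_constantCoeff_nilpotent ?_
  rintro (i | i)
  · exact ha.const_coeff i
  · exact hb.const_coeff i

theorem subst_rename {S : Type*} [CommRing S] [Algebra k S] {σ σ' τ : Type*}
    (e : σ → σ') [Filter.TendstoCofinite e] {a : σ' → MvPowerSeries τ S}
    (ha : MvPowerSeries.HasSubst a)
    (f : MvPowerSeries σ k) :
    MvPowerSeries.subst a (MvPowerSeries.rename e f) = MvPowerSeries.subst (a ∘ e) f := by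
  rw [MvPowerSeries.rename_eq_subst,
    MvPowerSeries.subst_comp_subst_apply (MvPowerSeries.HasSubst.X_comp _) ha]
  congr 1
  funext s
  exact MvPowerSeries.subst_X ha _

variable {q : Quality k} {ι : Type} [Fintype ι]

/-- Coefficients of a divided difference of a series of quality `q`. -/
def dividedDifference (f : seriesRing q ι) (i : ι) : seriesRing q (ι ⊕ ι) :=
  ⟨(exists_dividedDifference q ι f.2).choose i, (exists_dividedDifference q ι f.2).choose_spec.1 i⟩

theorem subst_sub_subst (f : seriesRing q ι) {S : Type*} [CommRing S] [Algebra k S] {τ : Type}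
    {x y : ι → MvPowerSeries τ S} (hx : MvPowerSeries.HasSubst x) (hy : MvPowerSeries.HasSubst y) :
    MvPowerSeries.subst x f.1 - MvPowerSeries.subst y f.1 =
      ∑ i, MvPowerSeries.subst (Sum.elim x y) (dividedDifference f i).1 * (x i - y i) := by
  have hxy := MvPowerSeries.HasSubst.sumElim hx hy
  have h1 := congrArg (MvPowerSeries.substAlgHom (R := k) hxy)
    (exists_dividedDifference q ι f.2).choose_spec.2.1
  simp only [map_add, map_sum, map_mul, map_sub, MvPowerSeries.substAlgHom_apply,
    subst_rename _ hxy, MvPowerSeries.subst_X hxy] at h1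
  have e1 : Sum.elim x y ∘ (Function.Embedding.inl : ι ↪ ι ⊕ ι) = x := rfl
  have e2 : Sum.elim x y ∘ (Function.Embedding.inr : ι ↪ ι ⊕ ι) = y := rfl
  rw [e1, e2] at h1
  rw [h1, add_sub_cancel_right]
  exact Finset.sum_congr rfl fun i _ => mul_comm _ _

theorem subst_dividedDifference_self (f : seriesRing q ι) (i : ι) {S : Type*} [CommRing S]
    [Algebra k S] {τ : Type} {x : ι → MvPowerSeries τ S} (hx : MvPowerSeries.HasSubst x) :
    MvPowerSeries.subst (Sum.elim x x) (dividedDifference f i).1 =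
      MvPowerSeries.subst x (MvPowerSeries.pderiv k i f.1) := by
  rw [← (exists_dividedDifference q ι f.2).choose_spec.2.2 i, subst_rename _ hx]
  congr 1
  funext s
  rcases s with s | s <;> rfl

/-- Taylor expansion of second order, with universal coefficients of the same quality. -/
theorem subst_sub_subst_taylor (f : seriesRing q ι) {S : Type*} [CommRing S] [Algebra k S]
    {τ : Type} {x y z : ι → MvPowerSeries τ S} (hx : MvPowerSeries.HasSubst x)
    (hy : MvPowerSeries.HasSubst y) (hz : MvPowerSeries.HasSubst z) :
    MvPowerSeries.subst x f.1 - MvPowerSeries.subst y f.1 =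
      ∑ i, (MvPowerSeries.subst z (MvPowerSeries.pderiv k i f.1) + ∑ j,
        MvPowerSeries.subst (Sum.elim (Sum.elim x y) (Sum.elim z z))
          (dividedDifference (dividedDifference f i) j).1 *
          (Sum.elim x y j - Sum.elim z z j)) * (x i - y i) := by
  rw [subst_sub_subst f hx hy]
  refine Finset.sum_congr rfl fun i _ => ?_
  rw [← subst_sub_subst (dividedDifference f i) (hx.sumElim hy) (hz.sumElim hz),
    subst_dividedDifference_self f i hz, add_sub_cancel]

end Taylor

/-! ### Families of arcs -/

section Families

variable {k : Type*} [Field k] {m : ℕ} {S S' : Type*} [CommRing S] [CommRing S'] [Algebra k S]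
  [Algebra k S']

/-- The power series in `t` without constant term with given coordinates. -/
def series (x : Fin m × ℕ → S) (i : Fin m) : PowerSeries S :=
  PowerSeries.X * PowerSeries.mk fun j => x (i, j)

theorem coeff_succ_series (x : Fin m × ℕ → S) (i : Fin m) (j : ℕ) :
    PowerSeries.coeff (j + 1) (series x i) = x (i, j) := by
  rw [series, PowerSeries.coeff_succ_X_mul, PowerSeries.coeff_mk]

theorem constantCoeff_series (x : Fin m × ℕ → S) (i : Fin m) :
    PowerSeries.constantCoeff (series x i) = 0 := by
  rw [series, map_mul, PowerSeries.constantCoeff_X, zero_mul]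

/-- The assignment `t ↦ t`, `yᵢ ↦ xᵢ(t)` for a family `x` of arcs over the algebra `S`, given by its
coordinates. -/
def assign (x : Fin m × ℕ → S) : Option (Fin m) → MvPowerSeries Unit S
  | none => (PowerSeries.X : PowerSeries S)
  | some i => series x i

theorem constantCoeff_assign (x : Fin m × ℕ → S) (s : Option (Fin m)) :
    MvPowerSeries.constantCoeff (assign x s) = 0 := by
  cases s with
  | none => exact PowerSeries.constantCoeff_X
  | some i => exact constantCoeff_series x i

theorem hasSubst_assign (x : Fin m × ℕ → S) : MvPowerSeries.HasSubst (assign x) :=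
  MvPowerSeries.hasSubst_of_constantCoeff_zero (constantCoeff_assign x)

/-- The substitution homomorphism `f(t, y) ↦ f(t, x(t))` for a family `x` of arcs over `S`. -/
def evalAt (x : Fin m × ℕ → S) : MvPowerSeries (Option (Fin m)) k →ₐ[k] PowerSeries S :=
  MvPowerSeries.substAlgHom (hasSubst_assign x)

theorem evalAt_apply (x : Fin m × ℕ → S) (f : MvPowerSeries (Option (Fin m)) k) :
    evalAt x f = MvPowerSeries.subst (assign x) f :=
  MvPowerSeries.substAlgHom_apply (R := k) (hasSubst_assign x) f

theorem map_series (φ : S →+* S') (x : Fin m × ℕ → S) (i : Fin m) :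
    PowerSeries.map φ (series x i) = series (φ ∘ x) i := by
  ext n
  cases n with
  | zero => simp [constantCoeff_series]
  | succ n => rw [PowerSeries.coeff_map, coeff_succ_series, coeff_succ_series]; rfl

/-- Evaluation is compatible with base change. -/
theorem map_evalAt (φ : S →ₐ[k] S') (x : Fin m × ℕ → S) (f : MvPowerSeries (Option (Fin m)) k) :
    PowerSeries.map (φ : S →+* S') (evalAt x f) = evalAt (φ ∘ x) f := by
  have h1 : ∀ s, MvPowerSeries.map (φ : S →+* S') (assign x s) = assign (φ ∘ x) s := by
    rintro (_ | i)
    · exact PowerSeries.map_X _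
    · exact map_series _ x i
  rw [evalAt_apply, evalAt_apply]
  ext1 n
  change MvPowerSeries.coeff _ (MvPowerSeries.map (φ : S →+* S') _) = MvPowerSeries.coeff _ _
  rw [MvPowerSeries.coeff_map, MvPowerSeries.coeff_subst (hasSubst_assign x),
    MvPowerSeries.coeff_subst (hasSubst_assign (φ ∘ x))]
  rw [map_finsum (φ : S →+* S') (MvPowerSeries.coeff_subst_finite (hasSubst_assign x) f _)]
  refine finsum_congr fun e => ?_
  change φ _ = _
  rw [map_smul]
  congr 1
  change (φ : S →+* S') _ = _
  rw [← MvPowerSeries.coeff_map, Finsupp.prod, Finsupp.prod, map_prod]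
  simp only [map_pow, h1]

theorem Arc.series_coords {q : Quality k} (y : Arc q m) (i : Fin m) : series y.coords i = y.1 i := by
  ext n
  cases n with
  | zero =>
    rw [PowerSeries.coeff_zero_eq_constantCoeff_apply, constantCoeff_series,
      PowerSeries.coeff_zero_eq_constantCoeff_apply, (y.2 i).2]
  | succ n => rw [coeff_succ_series]; rfl

theorem Arc.eval_eq_evalAt {q : Quality k} (y : Arc q m) (f : MvPowerSeries (Option (Fin m)) k) :
    y.eval f = evalAt y.coords f := by
  rw [y.eval_apply, evalAt_apply]
  congr 1
  funext s
  cases s with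
  | none => rfl
  | some i => exact (y.series_coords i).symm

theorem Arc.ext_coords {q : Quality k} {y y' : Arc q m} (h : y.coords = y'.coords) : y = y' := by
  refine Subtype.ext (funext fun i => ?_)
  rw [← y.series_coords, ← y'.series_coords, h]

/-- The arc with given coordinates, if its components are of the right quality. -/
def Arc.ofCoords {q : Quality k} (x : Fin m × ℕ → k) (hx : ∀ i, series x i ∈ seriesRing q Unit) :
    Arc q m :=
  ⟨series x, fun i => ⟨hx i, constantCoeff_series x i⟩⟩

theorem Arc.coords_ofCoords {q : Quality k} (x : Fin m × ℕ → k)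
    (hx : ∀ i, series x i ∈ seriesRing q Unit) : (Arc.ofCoords x hx).coords = x :=
  funext fun p => coeff_succ_series x p.1 p.2

/-- The Taylor expansion of second order at families of arcs. -/
theorem evalAt_sub_evalAt {q : Quality k} (f : SeriesB q m) (x y z : Fin m × ℕ → S) :
    evalAt x f.1 - evalAt y f.1 = ∑ i, (evalAt z (MvPowerSeries.pderiv k (some i) f.1) +
      ∑ j, MvPowerSeries.subst (Sum.elim (Sum.elim (assign x) (assign y))
        (Sum.elim (assign z) (assign z))) (dividedDifference (dividedDifference f (some i)) j).1 *
        (Sum.elim (assign x) (assign y) j - Sum.elim (assign z) (assign z) j)) *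
        (series x i - series y i) := by
  simp only [evalAt_apply]
  rw [subst_sub_subst_taylor f (hasSubst_assign x) (hasSubst_assign y) (hasSubst_assign z),
    Fintype.sum_option]
  have h0 : assign x none - assign y none = 0 := sub_self _
  rw [h0, mul_zero, zero_add]
  rfl

/-- The Taylor expansion of first order at families of arcs. -/
theorem evalAt_sub_evalAt_eq_sum {q : Quality k} (f : SeriesB q m) (x y : Fin m × ℕ → S) :
    evalAt x f.1 - evalAt y f.1 =
      ∑ i, MvPowerSeries.subst (Sum.elim (assign x) (assign y)) (dividedDifference f (some i)).1 *
        (series x i - series y i) := by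
  simp only [evalAt_apply]
  rw [subst_sub_subst f (hasSubst_assign x) (hasSubst_assign y), Fintype.sum_option]
  have h0 : assign x none - assign y none = 0 := sub_self _
  rw [h0, mul_zero, zero_add]
  rfl

end Families

/-! ### Tougeron's implicit function theorem for families of arcs -/

section FixedPoint

variable {S : Type*} [CommRing S]

/-- Vectors of power series are congruent modulo `X^n`. -/
def CongrMod {r : ℕ} (n : ℕ) (u v : Fin r → PowerSeries S) : Prop :=
  ∀ b, PowerSeries.X ^ n ∣ u b - v b

theorem X_pow_mul_cancel {n : ℕ} {a b : PowerSeries S}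
    (h : PowerSeries.X ^ n * a = PowerSeries.X ^ n * b) : a = b := by
  ext i
  have h1 := congrArg (PowerSeries.coeff (i + n)) h
  rwa [PowerSeries.coeff_X_pow_mul, PowerSeries.coeff_X_pow_mul] at h1

theorem congrMod_iterate {r : ℕ} {Ψ : (Fin r → PowerSeries S) → Fin r → PowerSeries S}
    (hΨ : ∀ n u v, CongrMod n u v → CongrMod (n + 1) (Ψ u) (Ψ v)) {u : Fin r → PowerSeries S}
    (hu : Ψ u = u) (v : Fin r → PowerSeries S) (n : ℕ) : CongrMod n u (Ψ^[n] v) := by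
  induction n with
  | zero => exact fun b => by simp
  | succ n ih =>
    rw [Function.iterate_succ_apply']
    conv => arg 2; rw [← hu]
    exact hΨ _ _ _ ih

theorem eq_of_congrMod {r : ℕ} {u v : Fin r → PowerSeries S} (h : ∀ n, CongrMod n u v) : u = v := by
  funext b
  ext n
  have h1 := PowerSeries.X_pow_dvd_iff.mp (h (n + 1) b) n (Nat.lt_succ_self n)
  rwa [map_sub, sub_eq_zero] at h1

/-- The contraction principle for the `X`-adic topology. -/
theorem existsUnique_fixedPoint {r : ℕ} {Ψ : (Fin r → PowerSeries S) → Fin r → PowerSeries S}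
    (hΨ : ∀ n u v, CongrMod n u v → CongrMod (n + 1) (Ψ u) (Ψ v)) : ∃! u, Ψ u = u := by
  have hstep : ∀ n, CongrMod n (Ψ^[n + 1] 0) (Ψ^[n] 0) := by
    intro n
    induction n with
    | zero => exact fun b => by simp
    | succ n ih =>
      rw [Function.iterate_succ_apply' Ψ (n + 1)]
      conv => arg 3; rw [Function.iterate_succ_apply' Ψ n]
      exact hΨ _ _ _ ih
  let u : Fin r → PowerSeries S := fun b =>
    PowerSeries.mk fun n => PowerSeries.coeff n (Ψ^[n + 1] 0 b)
  have hlim : ∀ n N b, n < N → PowerSeries.coeff n (Ψ^[N] 0 b) = PowerSeries.coeff n (u b) := by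
    intro n N b hN
    induction N, hN using Nat.le_induction with
    | base => rw [PowerSeries.coeff_mk]
    | succ N hN ih =>
      have h1 := PowerSeries.X_pow_dvd_iff.mp (hstep N b) n hN
      rw [map_sub, sub_eq_zero] at h1
      rw [h1, ih]
  have hu : ∀ N, CongrMod N u (Ψ^[N] 0) := fun N b =>
    PowerSeries.X_pow_dvd_iff.mpr fun n hn => by rw [map_sub, hlim n N b hn, sub_self]
  refine ⟨u, ?_, fun v hv => ?_⟩
  · refine eq_of_congrMod fun n b => ?_
    have h1 := hΨ _ _ _ (hu n) b
    have h2 := hu (n + 1) b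
    rw [Function.iterate_succ_apply'] at h2
    exact (pow_dvd_pow _ (Nat.le_succ n)).trans
      ((dvd_sub h1 h2).trans (by rw [sub_sub_sub_cancel_right]))
  · refine eq_of_congrMod fun n b => ?_
    have h1 := congrMod_iterate hΨ hv 0 n b
    have h2 := hu n b
    exact (dvd_sub h1 h2).trans (by rw [sub_sub_sub_cancel_right])

open Matrix

/-- The Newton operator attached to a system `h` of equations with approximate Jacobian matrix `M`:
`Ψ(u) = u - λ X^{-e} adj(M) h(u)`, where `λ` is the inverse of the unit `X^{-d} det(M)`. -/
structure NewtonData (r : ℕ) (S : Type*) [CommRing S] where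
  h : (Fin r → PowerSeries S) → Fin r → PowerSeries S
  M : Matrix (Fin r) (Fin r) (PowerSeries S)
  E : (Fin r → PowerSeries S) → (Fin r → PowerSeries S) → Matrix (Fin r) (Fin r) (PowerSeries S)
  d : ℕ
  γ : PowerSeries S
  lam : PowerSeries S
  b : Fin r → PowerSeries S
  det_eq : M.det = PowerSeries.X ^ d * γ
  lam_mul : lam * γ = 1
  adj_h : M.adjugate *ᵥ h 0 = (PowerSeries.X ^ (2 * d + 1) : PowerSeries S) • b
  taylor : ∀ u v, h u - h v =
    (PowerSeries.X ^ (d + 1) : PowerSeries S) • M *ᵥ (u - v) +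
      (PowerSeries.X ^ (2 * d + 2) : PowerSeries S) • (E u v) *ᵥ (u - v)

namespace NewtonData

variable {r : ℕ} (D : NewtonData r S)

/-- The quotient of `adj(M) h(u)` by `X^(2d+1)`. -/
def G (u : Fin r → PowerSeries S) : Fin r → PowerSeries S :=
  D.b + D.γ • u + PowerSeries.X (R := S) • (D.M.adjugate * D.E u 0) *ᵥ u

theorem adjugate_mulVec_sub (u v : Fin r → PowerSeries S) :
    D.M.adjugate *ᵥ (D.h u - D.h v) = (PowerSeries.X ^ (2 * D.d + 1) : PowerSeries S) •
      (D.γ • (u - v) + PowerSeries.X (R := S) • (D.M.adjugate * D.E u v) *ᵥ (u - v)) := by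
  rw [D.taylor, Matrix.mulVec_add, Matrix.mulVec_smul, Matrix.mulVec_smul, Matrix.mulVec_mulVec,
    Matrix.mulVec_mulVec, Matrix.adjugate_mul, D.det_eq, Matrix.smul_mulVec, Matrix.one_mulVec,
    smul_add, smul_smul, smul_smul, smul_smul]
  congr 2
  ring

theorem adjugate_mulVec_h (u : Fin r → PowerSeries S) :
    D.M.adjugate *ᵥ D.h u = (PowerSeries.X ^ (2 * D.d + 1) : PowerSeries S) • D.G u := by
  have h1 := D.adjugate_mulVec_sub u 0
  rw [Matrix.mulVec_sub, D.adj_h, sub_zero, sub_eq_iff_eq_add] at h1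
  rw [h1, G, ← smul_add]
  congr 1
  abel

theorem X_pow_smul_cancel {n : ℕ} {u v : Fin r → PowerSeries S}
    (h : (PowerSeries.X ^ n : PowerSeries S) • u = (PowerSeries.X ^ n : PowerSeries S) • v) :
    u = v :=
  funext fun b => X_pow_mul_cancel (congrFun h b)

theorem G_sub (u v : Fin r → PowerSeries S) : D.G u - D.G v =
    D.γ • (u - v) + PowerSeries.X (R := S) • (D.M.adjugate * D.E u v) *ᵥ (u - v) := by
  apply X_pow_smul_cancel (n := 2 * D.d + 1)
  rw [← D.adjugate_mulVec_sub, smul_sub, ← D.adjugate_mulVec_h, ← D.adjugate_mulVec_h,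
    Matrix.mulVec_sub]

/-- The Newton operator. -/
def Ψ (u : Fin r → PowerSeries S) : Fin r → PowerSeries S := u - D.lam • D.G u

theorem Ψ_sub (u v : Fin r → PowerSeries S) : D.Ψ u - D.Ψ v =
    -((D.lam * PowerSeries.X) • (D.M.adjugate * D.E u v) *ᵥ (u - v)) := by
  have h1 : D.Ψ u - D.Ψ v = (u - v) - D.lam • (D.G u - D.G v) := by
    rw [Ψ, Ψ, smul_sub]
    abel
  rw [h1, D.G_sub, smul_add, smul_smul, smul_smul, D.lam_mul, one_smul]
  abel

theorem congrMod_Ψ (n : ℕ) (u v : Fin r → PowerSeries S) (h : CongrMod n u v) :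
    CongrMod (n + 1) (D.Ψ u) (D.Ψ v) := by
  intro b
  have h1 := congrFun (D.Ψ_sub u v) b
  rw [Pi.sub_apply] at h1
  rw [h1, Pi.neg_apply, dvd_neg, Pi.smul_apply, smul_eq_mul, pow_succ, mul_comm D.lam,
    mul_comm (_ ^ n), mul_assoc]
  refine mul_dvd_mul_left _ (Dvd.dvd.mul_left ?_ _)
  simp only [Matrix.mulVec, dotProduct]
  exact Finset.dvd_sum fun i _ => Dvd.dvd.mul_left (h i) _

theorem Ψ_eq_iff (u : Fin r → PowerSeries S) : D.Ψ u = u ↔ D.h u = 0 := by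
  have hG : D.Ψ u = u ↔ D.G u = 0 := by
    rw [Ψ, sub_eq_self]
    refine ⟨fun h => ?_, fun h => by rw [h, smul_zero]⟩
    have h1 := congrArg (fun w => D.γ • w) h
    beta_reduce at h1
    rwa [smul_smul, mul_comm, D.lam_mul, one_smul, smul_zero] at h1
  rw [hG]
  refine ⟨fun h => ?_, fun h => ?_⟩
  · -- `det(M) h(u) = M adj(M) h(u) = 0`, and `det(M)` is a power of `X` times a unit
    have h1 := D.adjugate_mulVec_h u
    rw [h, smul_zero] at h1
    have h2 := congrArg (fun w => D.lam • D.M *ᵥ w) h1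
    beta_reduce at h2
    rw [Matrix.mulVec_mulVec, Matrix.mul_adjugate, D.det_eq, Matrix.smul_mulVec, Matrix.one_mulVec,
      Matrix.mulVec_zero, smul_zero, smul_smul, mul_comm, mul_assoc, mul_comm D.γ, D.lam_mul,
      mul_one] at h2
    apply X_pow_smul_cancel (n := D.d)
    rw [h2, smul_zero]
  · have h1 := D.adjugate_mulVec_h u
    rw [h, Matrix.mulVec_zero] at h1
    apply X_pow_smul_cancel (n := 2 * D.d + 1)
    rw [← h1, smul_zero]

theorem existsUnique_h_eq_zero : ∃! u, D.h u = 0 := by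
  have h1 := existsUnique_fixedPoint D.congrMod_Ψ
  simpa only [Ψ_eq_iff] using h1

end NewtonData

end FixedPoint

/-! ### Solving equations over families of arcs -/

section Solve

open Matrix

variable {k : Type*} [Field k] {q : Quality k} {m r : ℕ} {S S' : Type*} [CommRing S] [CommRing S']
  [Algebra k S] [Algebra k S']

/-- The vector of length `m` with the entries of `u` in the positions `c`. -/
def spread {R : Type*} [AddCommMonoid R] (c : Fin r → Fin m) (u : Fin r → R) (i : Fin m) : R :=
  ∑ b, if c b = i then u b else 0

theorem spread_apply {R : Type*} [AddCommMonoid R] {c : Fin r → Fin m} (hc : Function.Injective c)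
    (u : Fin r → R) (b : Fin r) : spread c u (c b) = u b := by
  classical
  rw [spread, Finset.sum_eq_single b]
  · rw [if_pos rfl]
  · intro b' _ hb
    rw [if_neg fun h => hb (hc h)]
  · simp

theorem spread_of_notMem {R : Type*} [AddCommMonoid R] {c : Fin r → Fin m} (u : Fin r → R)
    {i : Fin m} (hi : i ∉ Set.range c) : spread c u i = 0 :=
  Finset.sum_eq_zero fun b _ => if_neg fun h => hi ⟨b, h⟩

theorem spread_sub {R : Type*} [AddCommGroup R] (c : Fin r → Fin m) (u v : Fin r → R) (i : Fin m) :
    spread c (u - v) i = spread c u i - spread c v i := by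
  rw [spread, spread, spread, ← Finset.sum_sub_distrib]
  refine Finset.sum_congr rfl fun b _ => ?_
  split_ifs
  · rfl
  · rw [sub_zero]

theorem map_spread {R R' : Type*} [AddCommMonoid R] [AddCommMonoid R'] (φ : R →+ R')
    (c : Fin r → Fin m) (u : Fin r → R) (i : Fin m) :
    φ (spread c u i) = spread c (φ ∘ u) i := by
  rw [spread, spread, map_sum]
  exact Finset.sum_congr rfl fun b _ => by split_ifs <;> simp

theorem sum_mul_spread {R : Type*} [CommRing R] (c : Fin r → Fin m) (F : Fin m → R) (u : Fin r → R) :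
    ∑ i, F i * spread c u i = ∑ b, F (c b) * u b := by
  classical
  simp only [spread, Finset.mul_sum]
  rw [Finset.sum_comm]
  refine Finset.sum_congr rfl fun b _ => ?_
  simp

/-- The family of arcs obtained from the one with coordinates `x` by adding `t^(d+1) u` to the
components with indices `c`. -/
def addTail (c : Fin r → Fin m) (d : ℕ) (x : Fin m × ℕ → S) (u : Fin r → PowerSeries S) :
    Fin m × ℕ → S :=
  fun p => x p + if d ≤ p.2 then PowerSeries.coeff (p.2 - d) (spread c u p.1) else 0

theorem series_addTail (c : Fin r → Fin m) (d : ℕ) (x : Fin m × ℕ → S) (u : Fin r → PowerSeries S)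
    (i : Fin m) :
    series (addTail c d x u) i = series x i + PowerSeries.X ^ (d + 1) * spread c u i := by
  ext n
  rw [map_add, PowerSeries.coeff_X_pow_mul']
  cases n with
  | zero => simp [constantCoeff_series]
  | succ n =>
    rw [coeff_succ_series, coeff_succ_series, addTail]
    simp only [Nat.add_le_add_iff_right, Nat.add_sub_add_right]

theorem comp_addTail (φ : S →+* S') (c : Fin r → Fin m) (d : ℕ) (x : Fin m × ℕ → S)
    (u : Fin r → PowerSeries S) :
    φ ∘ addTail c d x u = addTail c d (φ ∘ x) (fun b => PowerSeries.map φ (u b)) := by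
  funext p
  rw [Function.comp_apply, addTail, addTail, map_add]
  congr 1
  split_ifs
  · rw [← PowerSeries.coeff_map]
    congr 1
    exact map_spread (PowerSeries.map φ).toAddMonoidHom c u p.1
  · exact map_zero φ

variable (h : Fin r → SeriesB q m) (c : Fin r → Fin m)

/-- The vector `adj(M) h`, where `M` is the square submatrix of `∂_y h` with columns `c`. -/
def adjVec (a : Fin r) : MvPowerSeries (Option (Fin m)) k :=
  ((Matrix.of fun a b : Fin r =>
    MvPowerSeries.pderiv k (some (c b)) (h a).1).adjugate *ᵥ fun a => (h a).1) a

/-- The values of the square submatrix of `∂_y h` with columns `c`. -/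
def jacobian (x : Fin m × ℕ → S) : Matrix (Fin r) (Fin r) (PowerSeries S) :=
  Matrix.of fun a b => evalAt x (MvPowerSeries.pderiv k (some (c b)) (h a).1)

theorem det_jacobian (x : Fin m × ℕ → S) : (jacobian h c x).det = evalAt x (minor h c) :=
  (RingHom.map_det (evalAt x : _ →ₐ[k] PowerSeries S).toRingHom _).symm

theorem evalAt_adjVec (x : Fin m × ℕ → S) (a : Fin r) :
    evalAt x (adjVec h c a) = ((jacobian h c x).adjugate *ᵥ fun a => evalAt x (h a).1) a := by
  rw [adjVec, Matrix.mulVec, Matrix.mulVec, dotProduct, dotProduct, map_sum]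
  refine Finset.sum_congr rfl fun b _ => ?_
  rw [map_mul]
  congr 1
  exact congrFun (congrFun (RingHom.map_adjugate (evalAt x : _ →ₐ[k] PowerSeries S).toRingHom _) a) b

/-- The remainder of second order in the Taylor expansion of `h` at `x`. -/
def taylorMatrix (d : ℕ) (x : Fin m × ℕ → S) (u v : Fin r → PowerSeries S) :
    Matrix (Fin r) (Fin r) (PowerSeries S) :=
  Matrix.of fun a b => ∑ j, MvPowerSeries.subst
    (Sum.elim (Sum.elim (assign (addTail c d x u)) (assign (addTail c d x v)))
      (Sum.elim (assign x) (assign x)))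
    (dividedDifference (dividedDifference (h a) (some (c b))) j).1 *
    Sum.elim (fun s => Option.elim s 0 (spread c u)) (fun s => Option.elim s 0 (spread c v)) j

theorem evalAt_addTail_sub (d : ℕ) (x : Fin m × ℕ → S) (u v : Fin r → PowerSeries S) :
    (fun a => evalAt (addTail c d x u) (h a).1) - (fun a => evalAt (addTail c d x v) (h a).1) =
      (PowerSeries.X ^ (d + 1) : PowerSeries S) • jacobian h c x *ᵥ (u - v) +
      (PowerSeries.X ^ (2 * d + 2) : PowerSeries S) • taylorMatrix h c d x u v *ᵥ (u - v) := by
  funext a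
  have h1 : ∀ j, Sum.elim (assign (addTail c d x u)) (assign (addTail c d x v)) j -
      Sum.elim (assign x) (assign x) j = PowerSeries.X ^ (d + 1) *
        Sum.elim (fun s => Option.elim s 0 (spread c u)) (fun s => Option.elim s 0 (spread c v)) j := by
    rintro ((_ | i) | (_ | i))
    · exact (sub_self _).trans (mul_zero _).symm
    · change series _ i - series x i = _
      rw [series_addTail, add_sub_cancel_left]
      rfl
    · exact (sub_self _).trans (mul_zero _).symm
    · change series _ i - series x i = _
      rw [series_addTail, add_sub_cancel_left]
      rfl
  rw [Pi.sub_apply, evalAt_sub_evalAt (h a) _ _ x]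
  have h2 : ∀ i, series (addTail c d x u) i - series (addTail c d x v) i =
      PowerSeries.X ^ (d + 1) * spread c (u - v) i := by
    intro i
    rw [series_addTail, series_addTail, spread_sub]
    ring
  simp only [h1, h2, mul_left_comm _ (PowerSeries.X ^ (d + 1) : PowerSeries S)]
  rw [← Finset.mul_sum, sum_mul_spread c (fun i => evalAt x (MvPowerSeries.pderiv k (some i) (h a).1)
    + ∑ j, PowerSeries.X ^ (d + 1) * (MvPowerSeries.subst _
      (dividedDifference (dividedDifference (h a) (some i)) j).1 *
      Sum.elim (fun s => Option.elim s 0 (spread c u)) (fun s => Option.elim s 0 (spread c v)) j))]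
  rw [Pi.add_apply, Pi.smul_apply, Pi.smul_apply, smul_eq_mul, smul_eq_mul,
    show 2 * d + 2 = (d + 1) + (d + 1) by ring, pow_add _ (d + 1) (d + 1), mul_assoc, ← mul_add]
  congr 1
  rw [Matrix.mulVec, Matrix.mulVec, dotProduct, dotProduct, Finset.mul_sum, ← Finset.sum_add_distrib]
  refine Finset.sum_congr rfl fun b _ => ?_
  rw [← Finset.mul_sum, add_mul, mul_assoc]
  rfl

/-- The condition on the base point `x` for the equations `h = 0` to be solvable by Newton's method
with steps in the components `c`: the minor has order exactly `d`, with invertible leading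
coefficient, and the vector `adj(M) h` vanishes to order `2d + 1`. -/
structure IsAdmissible (d : ℕ) (x : Fin m × ℕ → S) : Prop where
  coeff_lt : ∀ j < d, PowerSeries.coeff j (evalAt x (minor h c)) = 0
  isUnit_coeff : IsUnit (PowerSeries.coeff d (evalAt x (minor h c)))
  coeff_adjVec : ∀ a, ∀ j < 2 * d + 1, PowerSeries.coeff j (evalAt x (adjVec h c a)) = 0

variable {h c}

theorem dvd_evalAt_sub {N : ℕ} {x y : Fin m × ℕ → S}
    (hxy : ∀ i, PowerSeries.X ^ N ∣ series x i - series y i)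
    (f : MvPowerSeries (Option (Fin m)) k) :
    PowerSeries.X ^ N ∣ evalAt x f - evalAt y f := by
  rw [evalAt_sub_evalAt_eq_sum (q := Quality.formal) ⟨f, mem_formal f⟩ x y]
  exact Finset.dvd_sum fun i _ => Dvd.dvd.mul_left (hxy i) _

theorem coeff_evalAt_congr {N : ℕ} {x y : Fin m × ℕ → S}
    (hxy : ∀ i, PowerSeries.X ^ N ∣ series x i - series y i)
    (f : MvPowerSeries (Option (Fin m)) k) {j : ℕ} (hj : j < N) :
    PowerSeries.coeff j (evalAt x f) = PowerSeries.coeff j (evalAt y f) := by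
  have h1 := PowerSeries.X_pow_dvd_iff.mp (dvd_evalAt_sub hxy f) j hj
  rwa [map_sub, sub_eq_zero] at h1

theorem IsAdmissible.congr {d : ℕ} {x y : Fin m × ℕ → S} (hx : IsAdmissible h c d x)
    (hxy : ∀ i, PowerSeries.X ^ (2 * d + 1) ∣ series x i - series y i) : IsAdmissible h c d y where
  coeff_lt j hj := by rw [← coeff_evalAt_congr hxy _ (by lia), hx.coeff_lt j hj]
  isUnit_coeff := by
    rw [← coeff_evalAt_congr hxy _ (by lia)]
    exact hx.isUnit_coeff
  coeff_adjVec a j hj := by rw [← coeff_evalAt_congr hxy _ hj, hx.coeff_adjVec a j hj]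

theorem IsAdmissible.map {d : ℕ} {x : Fin m × ℕ → S} (hx : IsAdmissible h c d x) (φ : S →ₐ[k] S') :
    IsAdmissible h c d (φ ∘ x) where
  coeff_lt j hj := by
    rw [← map_evalAt, PowerSeries.coeff_map, hx.coeff_lt j hj, map_zero]
  isUnit_coeff := by
    rw [← map_evalAt, PowerSeries.coeff_map]
    exact hx.isUnit_coeff.map _
  coeff_adjVec a j hj := by
    rw [← map_evalAt, PowerSeries.coeff_map, hx.coeff_adjVec a j hj, map_zero]

theorem exists_eq_X_pow_mul_of_coeff {d : ℕ} {g : PowerSeries S}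
    (h0 : ∀ j < d, PowerSeries.coeff j g = 0) (h1 : IsUnit (PowerSeries.coeff d g)) :
    ∃ γ lam : PowerSeries S, g = PowerSeries.X ^ d * γ ∧ lam * γ = 1 := by
  obtain ⟨γ, hγ⟩ := PowerSeries.X_pow_dvd_iff.mpr h0
  have h2 : IsUnit γ := by
    rw [PowerSeries.isUnit_iff_constantCoeff, ← PowerSeries.coeff_zero_eq_constantCoeff_apply]
    rw [hγ, PowerSeries.coeff_X_pow_mul', if_pos le_rfl, Nat.sub_self] at h1
    exact h1
  obtain ⟨lam, hlam⟩ := h2.exists_left_inv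
  exact ⟨γ, lam, hγ, hlam⟩

/-- Newton's method at an admissible base point. -/
theorem IsAdmissible.exists_newtonData {d : ℕ} {x : Fin m × ℕ → S} (hx : IsAdmissible h c d x) :
    ∃ D : NewtonData r S, D.d = d ∧ D.h = (fun u a => evalAt (addTail c d x u) (h a).1) ∧
      D.M = jacobian h c x ∧ D.E = taylorMatrix h c d x := by
  obtain ⟨γ, lam, hγ, hlam⟩ := exists_eq_X_pow_mul_of_coeff hx.coeff_lt hx.isUnit_coeff
  choose b hb using fun a => PowerSeries.X_pow_dvd_iff.mpr (hx.coeff_adjVec a)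
  refine ⟨⟨fun u a => evalAt (addTail c d x u) (h a).1, jacobian h c x, taylorMatrix h c d x, d, γ,
    lam, b, (det_jacobian h c x).trans hγ, hlam, ?_, evalAt_addTail_sub h c d x⟩, rfl, rfl, rfl, rfl⟩
  funext a
  rw [Pi.smul_apply, smul_eq_mul, ← hb, evalAt_adjVec]
  have h1 : addTail c d x 0 = x := by
    funext p
    simp [addTail, spread]
  rw [h1]

theorem IsAdmissible.existsUnique {d : ℕ} {x : Fin m × ℕ → S} (hx : IsAdmissible h c d x) :
    ∃! u : Fin r → PowerSeries S, ∀ a, evalAt (addTail c d x u) (h a).1 = 0 := by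
  obtain ⟨D, -, hD, -⟩ := hx.exists_newtonData
  have h1 := D.existsUnique_h_eq_zero
  simpa only [hD, funext_iff, Pi.zero_apply] using h1

/-- The base point of a solution is admissible. -/
theorem isAdmissible_of_evalAt_eq_zero {d : ℕ} {x : Fin m × ℕ → S} {u : Fin r → PowerSeries S}
    (hu : ∀ a, evalAt (addTail c d x u) (h a).1 = 0)
    (hlt : ∀ j < d, PowerSeries.coeff j (evalAt (addTail c d x u) (minor h c)) = 0)
    (hd : IsUnit (PowerSeries.coeff d (evalAt (addTail c d x u) (minor h c)))) :
    IsAdmissible h c d x := by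
  have hcongr : ∀ i, PowerSeries.X ^ (d + 1) ∣ series (addTail c d x u) i - series x i := by
    intro i
    rw [series_addTail, add_sub_cancel_left]
    exact dvd_mul_right _ _
  have h0 : ∀ j < d, PowerSeries.coeff j (evalAt x (minor h c)) = 0 := fun j hj => by
    rw [← coeff_evalAt_congr hcongr _ (by lia), hlt j hj]
  have h1 : IsUnit (PowerSeries.coeff d (evalAt x (minor h c))) := by
    rwa [← coeff_evalAt_congr hcongr _ (by lia)]
  refine ⟨h0, h1, fun a => PowerSeries.X_pow_dvd_iff.mp ?_⟩
  obtain ⟨γ, -, hγ, -⟩ := exists_eq_X_pow_mul_of_coeff h0 h1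
  have hx0 : addTail c d x 0 = x := by
    funext p
    simp [addTail, spread]
  have h2 := congrArg (fun w => (jacobian h c x).adjugate *ᵥ w) (evalAt_addTail_sub h c d x u 0)
  have h3 : (fun a => evalAt (addTail c d x u) (h a).1) = 0 := funext hu
  beta_reduce at h2
  rw [h3, hx0, zero_sub, sub_zero, Matrix.mulVec_neg, Matrix.mulVec_add, Matrix.mulVec_smul,
    Matrix.mulVec_smul, Matrix.mulVec_mulVec, Matrix.adjugate_mul, det_jacobian, hγ,
    Matrix.smul_mulVec, Matrix.one_mulVec, neg_eq_iff_eq_neg] at h2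
  have h4 := congrFun h2 a
  rw [evalAt_adjVec, h4, Pi.neg_apply, dvd_neg, Pi.add_apply, Pi.smul_apply, Pi.smul_apply,
    Pi.smul_apply, smul_eq_mul, smul_eq_mul, smul_eq_mul]
  refine dvd_add ?_ ?_
  · rw [← mul_assoc, ← mul_assoc, ← pow_add, mul_assoc]
    exact Dvd.dvd.mul_right (pow_dvd_pow _ (by lia)) _
  · exact Dvd.dvd.mul_right (pow_dvd_pow _ (by lia)) _

end Solve

/-! ### Formal solutions of systems of algebraic equations -/

section AlgebraicSolutions

/-- Specialization of algebraic relations: if each of the ideals `J + (F_0, …, F_{i-1})` is prime and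
does not contain `F_i`, then a nontrivial polynomial relation between the `F_i` over a domain `A`
modulo `J` yields a nonzero element of `A` that vanishes modulo `J + (F_0, …, F_{n-1})`. -/
theorem exists_ne_zero_mem_of_relation {A R : Type*} [CommRing A] [IsDomain A] [CommRing R]
    (φ : A →+* R) : ∀ (n : ℕ) (F : Fin n → R) (J : Ideal R)
      (_ : ∀ i : ℕ, (J ⊔ Ideal.span (F '' {j | (j : ℕ) < i})).IsPrime)
      (_ : ∀ i : Fin n, F i ∉ J ⊔ Ideal.span (F '' {j | j < i}))
      (P : MvPolynomial (Fin n) A), P ≠ 0 → MvPolynomial.eval₂ φ F P ∈ J →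
      ∃ a : A, a ≠ 0 ∧ φ a ∈ J ⊔ Ideal.span (Set.range F) := by
  intro n
  induction n with
  | zero =>
    intro F J _ _ P hP hJ
    rw [P.eq_C_of_isEmpty, MvPolynomial.eval₂_C] at hJ
    refine ⟨MvPolynomial.coeff 0 P, fun h => hP ?_, Ideal.mem_sup_left hJ⟩
    rw [P.eq_C_of_isEmpty, h, map_zero]
  | succ n ih =>
    intro F J hprime hnot P hP hJ
    have hJp : J.IsPrime := by simpa using hprime 0
    have hF0 : F 0 ∉ J := by simpa using hnot 0
    set p := MvPolynomial.finSuccEquiv A n P with hp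
    have hp0 : p ≠ 0 := by simpa [hp] using hP
    obtain ⟨p', hpp, hndvd⟩ := p.exists_eq_pow_rootMultiplicity_mul_and_not_dvd hp0 0
    rw [Polynomial.C_0, sub_zero] at hpp hndvd
    let ev : MvPolynomial (Fin n) A →+* R := MvPolynomial.eval₂Hom φ (F ∘ Fin.succ)
    have hev : MvPolynomial.eval₂ φ F P = p.eval₂ ev (F 0) := by
      have h1 : MvPolynomial.eval₂Hom φ F = (Polynomial.eval₂RingHom ev (F 0)).comp
          (MvPolynomial.finSuccEquiv A n).toRingEquiv.toRingHom := by
        refine MvPolynomial.ringHom_ext (fun a => ?_) (fun i => ?_)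
        · simp [ev, MvPolynomial.finSuccEquiv_apply]
        · refine Fin.cases ?_ (fun j => ?_) i
          · simp [ev, MvPolynomial.finSuccEquiv_apply]
          · simp [ev, MvPolynomial.finSuccEquiv_apply]
      exact DFunLike.congr_fun h1 P
    rw [hev, hpp, Polynomial.eval₂_mul, Polynomial.eval₂_pow, Polynomial.eval₂_X] at hJ
    have h2 : p'.eval₂ ev (F 0) ∈ J :=
      (hJp.mem_or_mem hJ).resolve_left fun h => hF0 (hJp.mem_of_pow_mem _ h)
    have h3 : ev (p'.coeff 0) ∈ J ⊔ Ideal.span {F 0} := by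
      have h4 := congrArg (Polynomial.eval₂ ev (F 0)) (Polynomial.X_mul_divX_add p')
      rw [Polynomial.eval₂_add, Polynomial.eval₂_mul, Polynomial.eval₂_X, Polynomial.eval₂_C] at h4
      rw [← eq_sub_iff_add_eq'] at h4
      rw [h4]
      exact Ideal.sub_mem _ (Ideal.mem_sup_left h2)
        (Ideal.mem_sup_right (Ideal.mul_mem_right _ _ (Ideal.subset_span rfl)))
    have himg : ∀ s : Set (Fin n), (J ⊔ Ideal.span {F 0}) ⊔ Ideal.span ((F ∘ Fin.succ) '' s) =
        J ⊔ Ideal.span (F '' (insert 0 (Fin.succ '' s))) := by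
      intro s
      rw [Set.image_insert_eq, Ideal.span_insert, sup_assoc, ← Set.image_comp]
    have hprime' : ∀ i : ℕ, ((J ⊔ Ideal.span {F 0}) ⊔
        Ideal.span ((F ∘ Fin.succ) '' {j | (j : ℕ) < i})).IsPrime := fun i => by
      have hset : insert 0 (Fin.succ '' {j : Fin n | (j : ℕ) < i}) =
          {j : Fin (n + 1) | (j : ℕ) < i + 1} := by
        ext j
        refine Fin.cases ?_ (fun j => ?_) j <;> simp
      rw [himg, hset]
      exact hprime (i + 1)
    have hnot' : ∀ i : Fin n, (F ∘ Fin.succ) i ∉ (J ⊔ Ideal.span {F 0}) ⊔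
        Ideal.span ((F ∘ Fin.succ) '' {j | j < i}) := fun i => by
      have hset : insert 0 (Fin.succ '' {j : Fin n | j < i}) = {j : Fin (n + 1) | j < i.succ} := by
        ext j
        refine Fin.cases ?_ (fun j => ?_) j <;> simp
      rw [himg, hset]
      exact hnot i.succ
    obtain ⟨a, ha, hmem⟩ := ih (F ∘ Fin.succ) (J ⊔ Ideal.span {F 0}) hprime' hnot'
      (p'.coeff 0) (fun h => hndvd (Polynomial.X_dvd_iff.mpr h)) h3
    refine ⟨a, ha, ?_⟩
    rw [← Set.image_univ, himg] at hmem
    have hle : J ⊔ Ideal.span (F '' (insert 0 (Fin.succ '' Set.univ))) ≤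
        J ⊔ Ideal.span (Set.range F) :=
      sup_le_sup_left (Ideal.span_mono (Set.image_subset_range _ _)) _
    exact hle hmem

/-- A regular system of parameters satisfies the hypotheses on chains of prime ideals. -/
theorem isPrime_and_notMem_of_regular {R : Type*} [CommRing R] [IsLocalRing R] [IsNoetherianRing R]
    {m : ℕ} {F : Fin m → R} (hF : IsLocalRing.maximalIdeal R = Ideal.span (Set.range F))
    (hdim : ringKrullDim R = m) :
    (∀ i : ℕ, (Ideal.span (F '' {j | (j : ℕ) < i})).IsPrime) ∧
      ∀ i : Fin m, F i ∉ Ideal.span (F '' {j | j < i}) := by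
  classical
  refine ⟨fun i => ?_, fun i hi => ?_⟩
  · let s : Finset (Fin m) := Finset.univ.filter fun j => (j : ℕ) < i
    have hs : F '' {j | (j : ℕ) < i} = (s.image F : Finset R) := by simp [s]
    rw [hs]
    refine isPrime_span_of_card_le (t := sᶜ.image F) ?_ ?_
    · rw [← Finset.image_union, Finset.union_compl, hF]
      simp
    · rw [hdim]
      have h1 : (s.image F).card + (sᶜ.image F).card ≤ m :=
        (add_le_add Finset.card_image_le Finset.card_image_le).trans_eq
          (by rw [Finset.card_add_card_compl, Fintype.card_fin])
      exact_mod_cast h1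
  · have h1 : IsLocalRing.maximalIdeal R = Ideal.span ((Finset.univ.erase i).image F : Finset R) := by
      rw [hF]
      apply le_antisymm
      · rw [Ideal.span_le]
        rintro _ ⟨j, rfl⟩
        by_cases hji : j = i
        · subst hji
          refine Ideal.span_mono ?_ hi
          rintro _ ⟨l, hl, rfl⟩
          simpa using ⟨l, ne_of_lt hl, rfl⟩
        · exact Ideal.subset_span (by simpa using ⟨j, hji, rfl⟩)
      · exact Ideal.span_mono (by
          rw [Finset.coe_image]
          exact Set.image_subset_range _ _)
    have h2 := ringKrullDim_le_card h1
    have h3 : ((Finset.univ.erase i).image F).card < m := by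
      refine Finset.card_image_le.trans_lt ?_
      rw [Finset.card_erase_of_mem (Finset.mem_univ i), Finset.card_fin]
      have := i.2
      lia
    rw [hdim] at h2
    have h4 : m ≤ ((Finset.univ.erase i).image F).card := by exact_mod_cast h2
    lia

variable {k : Type*} [Field k] {m : ℕ}

/-- There are at most as many algebraically independent algebraic series as variables. -/
theorem exists_relation {ι κ : Type} [Fintype ι] [Fintype κ]
    (hcard : Fintype.card ι < Fintype.card κ) (x : κ → MvPowerSeries ι k)
    (hx : ∀ i, x i ∈ seriesRing (Quality.algebraic : Quality k) ι) :
    ∃ P : MvPolynomial κ k, P ≠ 0 ∧ MvPolynomial.aeval x P = 0 := by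
  by_contra! hcon
  let E := Subalgebra.algebraicClosure (MvPolynomial ι k) (MvPowerSeries ι k)
  let x' : κ → E := fun i => ⟨x i, hx i⟩
  have hind : AlgebraicIndependent k x' := by
    rw [algebraicIndependent_iff]
    intro P hP
    by_contra hP0
    refine hcon P hP0 ?_
    have h1 := congrArg (Subalgebra.val E) hP
    rw [map_zero] at h1
    have h2 : MvPolynomial.aeval x = ((Subalgebra.val E).restrictScalars k).comp
        (MvPolynomial.aeval x') := MvPolynomial.algHom_ext fun i => by simp [x']
    rw [h2]
    exact h1
  have h1 := hind.lift_cardinalMk_le_trdeg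
  have hinj : Function.Injective (algebraMap (MvPolynomial ι k) E) := fun a b hab =>
    algebraMap_mvPowerSeries_injective (congrArg Subtype.val hab)
  have : FaithfulSMul (MvPolynomial ι k) E := (faithfulSMul_iff_algebraMap_injective _ _).mpr hinj
  have : Algebra.IsAlgebraic (MvPolynomial ι k) E :=
    ⟨fun a => (isAlgebraic_algebraMap_iff (R := MvPolynomial ι k) (S := E)
      (A := MvPowerSeries ι k) Subtype.val_injective).mp a.2⟩
  have h2 := _root_.lift_trdeg_add_eq k (MvPolynomial ι k) E
  rw [trdeg_eq_zero (R := MvPolynomial ι k) (A := E), MvPolynomial.trdeg_of_isDomain] at h2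
  rw [Cardinal.lift_zero, add_zero] at h2
  rw [Cardinal.lift_uzero, ← Cardinal.lift_id (Algebra.trdeg k E), ← h2, Cardinal.mk_fintype,
    Cardinal.mk_fintype] at h1
  simp only [Cardinal.lift_natCast, Nat.cast_le] at h1
  lia

variable [PerfectField k]

/-- A formal arc at which `m` algebraic equations with nonvanishing Jacobian determinant hold is
algebraic. Indeed, `F_1, …, F_m`, `y_i` and `t` are `m + 2` algebraic series in `m + 1` variables, so
there is a polynomial relation between them. As `F_1, …, F_m` form a regular system of parameters at
the arc, it can be specialized to a nontrivial relation between `y_i(t)` and `t`. -/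
theorem mem_algebraic_of_evalAt_eq_zero {F : Fin m → SeriesB (Quality.algebraic : Quality k) m}
    {x : Fin m × ℕ → k} (hF : ∀ a, evalAt x (F a).1 = 0) (hdet : evalAt x (minor F id) ≠ 0)
    (i : Fin m) : series x i ∈ seriesRing (Quality.algebraic : Quality k) Unit := by
  classical
  let y : Arc (Quality.formal : Quality k) m := Arc.ofCoords x fun _ => mem_formal _
  have hy : ∀ f, y.eval f = evalAt x f := fun f => by
    rw [y.eval_eq_evalAt, Arc.coords_ofCoords]
  let F' : Fin m → SeriesB (Quality.formal : Quality k) m := fun a => ⟨(F a).1, mem_formal _⟩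
  let R := Localization.AtPrime y.relIdeal
  let al : SeriesB (Quality.formal : Quality k) m →+* R := algebraMap _ _
  -- the equations form a regular system of parameters of the local ring of the formal arc
  have hmax : IsLocalRing.maximalIdeal R = Ideal.span (Set.range fun a => al (F' a)) := by
    obtain ⟨A, hA, hminor⟩ := y.exists_coeff_matrix (h := F') fun a =>
      (y.mem_relIdeal _).mpr ((hy _).trans (hF a))
    obtain ⟨s, t, hs, hst, hr, hle⟩ := exists_finset_of_isUnit_det y.maximalIdeal_eq_span
      y.ringKrullDim_localization ((hminor m id id).mpr ((hy _).symm ▸ hdet))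
    rw [y.ringKrullDim_localization, hr] at hle
    have ht : t = ∅ := by
      have h1 : m + t.card ≤ m := by exact_mod_cast hle
      exact Finset.card_eq_zero.mp (by lia)
    rw [ht, Finset.union_empty, hs] at hst
    rw [hst]
    congr 2
    funext a
    exact (hA a).symm
  obtain ⟨hprime, hnot⟩ := isPrime_and_notMem_of_regular hmax y.ringKrullDim_localization
  -- an algebraic relation between `t`, the equations, and the `i`-th variable
  let g : Fin m ⊕ Option Unit → MvPowerSeries (Option (Fin m)) k :=
    Sum.elim (fun a => (F a).1) fun s => s.elim (MvPowerSeries.X (some i)) fun _ =>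
      MvPowerSeries.X none
  obtain ⟨P, hP0, hP⟩ := exists_relation (k := k) (ι := Option (Fin m)) (κ := Fin m ⊕ Option Unit)
    (by simp) g (by
      rintro (a | _ | _)
      · exact (F a).2
      · exact X_mem_seriesRing _ _
      · exact X_mem_seriesRing _ _)
  let C' : k →+* SeriesB (Quality.formal : Quality k) m :=
    (MvPowerSeries.C : k →+* MvPowerSeries (Option (Fin m)) k).codRestrict _ fun _ => mem_formal _
  let ψ : MvPolynomial (Option Unit) k →+* SeriesB (Quality.formal : Quality k) m :=
    MvPolynomial.eval₂Hom C' fun s => ⟨g (Sum.inr s), mem_formal _⟩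
  have hrel : MvPolynomial.eval₂ (al.comp ψ) (fun a => al (F' a))
      (MvPolynomial.sumAlgEquiv k _ _ P) = 0 := by
    have h1 : (MvPolynomial.eval₂Hom (al.comp ψ) (fun a => al (F' a))).comp
        (MvPolynomial.sumAlgEquiv k (Fin m) (Option Unit)).toRingEquiv.toRingHom =
        al.comp (MvPolynomial.eval₂Hom C' fun s => ⟨g s, mem_formal _⟩) := by
      refine MvPolynomial.ringHom_ext (fun a => ?_) ?_
      · simp [ψ]
      · rintro (a | s)
        · simp [g, F']
        · simp [ψ]
    have h2 := DFunLike.congr_fun h1 P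
    refine h2.trans ?_
    have h3 : (MvPolynomial.eval₂Hom C' (fun s => ⟨g s, mem_formal _⟩)) P = 0 := by
      apply Subtype.ext
      refine Eq.trans ?_ hP
      have h4 : (seriesRing (Quality.formal : Quality k) (Option (Fin m))).subtype.comp
          (MvPolynomial.eval₂Hom C' (fun s => ⟨g s, mem_formal _⟩)) =
          (MvPolynomial.aeval (R := k) g).toRingHom := by
        refine MvPolynomial.ringHom_ext (fun a => ?_) fun s => ?_
        · simp [C', MvPowerSeries.algebraMap_apply]
        · simp
      exact DFunLike.congr_fun h4 P
    rw [RingHom.comp_apply, h3, map_zero]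
  obtain ⟨a, ha0, ha⟩ := exists_ne_zero_mem_of_relation (al.comp ψ) m (fun a => al (F' a)) ⊥
    (fun j => by rw [bot_sup_eq]; exact hprime j) (fun j => by rw [bot_sup_eq]; exact hnot j)
    (MvPolynomial.sumAlgEquiv k _ _ P) (by simpa using hP0) (by rw [hrel]; exact Ideal.zero_mem _)
  rw [bot_sup_eq, ← hmax] at ha
  have ha' : y.eval (ψ a).1 = 0 := by
    by_contra hne
    exact (IsLocalRing.mem_maximalIdeal _).mp ha ((y.isUnit_algebraMap_iff _).mpr hne)
  refine ⟨MvPolynomial.optionEquivLeft k Unit a, by simpa using ha0, ?_⟩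
  have h5 : (y.eval.comp (seriesRing (Quality.formal : Quality k) (Option (Fin m))).subtype).comp ψ =
      ((Polynomial.aeval (R := MvPolynomial Unit k) (series x i)).toRingHom.comp
        (MvPolynomial.optionEquivLeft k Unit).toRingEquiv.toRingHom) := by
    refine MvPolynomial.ringHom_ext (fun b => ?_) ?_
    · have h6 : y.eval (MvPowerSeries.C b) = PowerSeries.C b := by
        have h7 := AlgHom.commutes (MvPowerSeries.substAlgHom (R := k) y.hasSubst) b
        exact h7
      have h8 : (algebraMap (MvPolynomial Unit k) (MvPowerSeries Unit k)) (MvPolynomial.C b) =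
        PowerSeries.C b := MvPolynomial.coe_C b
      simpa [ψ, C', MvPolynomial.optionEquivLeft_C, h8] using h6
    · rintro (_ | s)
      · have h6 := y.eval_X_some i
        have h8 : y.1 i = series x i := rfl
        simpa [ψ, g, MvPolynomial.optionEquivLeft_X_none, h8] using h6
      · have h6 := y.eval_X_none
        have h8 : (algebraMap (MvPolynomial Unit k) (MvPowerSeries Unit k)) (MvPolynomial.X s) =
          PowerSeries.X := MvPolynomial.coe_X s
        simpa [ψ, g, MvPolynomial.optionEquivLeft_X_some, h8] using h6
  exact (DFunLike.congr_fun h5 a).symm.trans ha'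

/-- If a formal arc satisfies algebraic equations for which a minor of the relative Jacobian matrix
with columns `c` does not vanish, and if the components different from `c` are algebraic, then all
components are algebraic. -/
theorem mem_algebraic_of_minor_ne_zero {r : ℕ} {h : Fin r → SeriesB (Quality.algebraic : Quality k) m}
    {c : Fin r → Fin m} (hc : Function.Injective c) {x : Fin m × ℕ → k}
    (hh : ∀ a, evalAt x (h a).1 = 0) (hg : evalAt x (minor h c) ≠ 0)
    (hx : ∀ i ∉ Set.range c, series x i ∈ seriesRing (Quality.algebraic : Quality k) Unit)
    (i : Fin m) : series x i ∈ seriesRing (Quality.algebraic : Quality k) Unit := by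
  classical
  let e := Equiv.ofInjective c hc
  -- complete the system by the equations `y_i = x_i(t)` for the other components
  let F : Fin m → SeriesB (Quality.algebraic : Quality k) m := fun i =>
    if hi : i ∈ Set.range c then h (e.symm ⟨i, hi⟩) else
      ⟨MvPowerSeries.X (some i) - inc (Fin m) (series x i),
        Subring.sub_mem _ (X_mem_seriesRing _ _) (inc_mem _ (hx i hi))⟩
  refine mem_algebraic_of_evalAt_eq_zero (F := F) (fun a => ?_) ?_ i
  · by_cases ha : a ∈ Set.range c
    · simp only [F, dif_pos ha]
      exact hh _
    · simp only [F, dif_neg ha]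
      let y : Arc (Quality.formal : Quality k) m := Arc.ofCoords x fun _ => mem_formal _
      have h1 := y.eval_param a
      rw [y.eval_eq_evalAt, Arc.coords_ofCoords] at h1
      exact h1
  · rw [← det_jacobian, Matrix.twoBlockTriangular_det _ (· ∈ Set.range c)]
    · have h1 : (Matrix.toSquareBlockProp (jacobian F id x) (· ∈ Set.range c)).submatrix e e =
          jacobian h c x := by
        refine Matrix.ext fun a b => ?_
        have hF : F (e a) = h a := by
          simp only [F, Subtype.coe_prop, dif_pos, Subtype.coe_eta, Equiv.symm_apply_apply]
        change evalAt x (MvPowerSeries.pderiv k (some (c b)) (F (e a)).1) = _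
        rw [hF]
        rfl
      have h2 : Matrix.toSquareBlockProp (jacobian F id x) (fun i => i ∉ Set.range c) = 1 := by
        refine Matrix.ext fun a b => ?_
        have hF : (F a).1 = MvPowerSeries.X (some a.1) - inc (Fin m) (series x a) := by
          simp only [F, dif_neg a.2]
        change evalAt x (MvPowerSeries.pderiv k (some b.1) (F a).1) = _
        rw [hF, map_sub, pderiv_inc, sub_zero, Matrix.one_apply]
        split_ifs with hab
        · rw [hab, MvPowerSeries.pderiv_X_self, map_one]
        · rw [MvPowerSeries.pderiv_X_of_ne, map_zero]
          simpa using fun h => hab (Subtype.ext h)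
      have h3 := Matrix.det_submatrix_equiv_self e
        (Matrix.toSquareBlockProp (jacobian F id x) (· ∈ Set.range c))
      rw [h1, det_jacobian] at h3
      rw [h2, Matrix.det_one, mul_one]
      convert hg
      refine Eq.trans ?_ h3.symm
      congr!
    · intro a ha b hb
      have hF : (F a).1 = MvPowerSeries.X (some a) - inc (Fin m) (series x a) := by
        simp only [F, dif_neg ha]
      change evalAt x (MvPowerSeries.pderiv k (some b) (F a).1) = _
      rw [hF, map_sub, pderiv_inc, sub_zero, MvPowerSeries.pderiv_X_of_ne, map_zero]
      rintro hab
      rw [Option.some_inj] at hab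
      exact ha (hab ▸ hb)

end AlgebraicSolutions

/-! ### Norms of power series in one variable -/

section OneVariable

variable {k : Type*} [Field k] {v : AbsoluteValue k ℝ} {s : ℝ≥0∞}

/-- The norm `∑ |a_n| s^n` of a power series in one variable. -/
def nrm (v : AbsoluteValue k ℝ) (s : ℝ≥0∞) (f : PowerSeries k) : ℝ≥0∞ :=
  wNorm v (fun _ : Unit => s) f

theorem nrm_eq_tsum (f : PowerSeries k) :
    nrm v s f = ∑' n : ℕ, eabs v (PowerSeries.coeff n f) * s ^ n := by
  rw [nrm, wNorm, ← (Finsupp.uniqueEquiv (α := Unit) (M := ℕ) ()).symm.tsum_eq]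
  refine tsum_congr fun n => ?_
  have h1 : (Finsupp.uniqueEquiv (α := Unit) (M := ℕ) ()).symm n = Finsupp.single () n := by
    ext
    simp
  rw [h1, wMon_single]
  rfl

theorem sNorm_eq_nrm {t : ℝ} (ht : 0 < t) (f : PowerSeries k) :
    sNorm v t f = nrm v (ENNReal.ofReal t) f := by
  rw [nrm_eq_tsum, sNorm]
  refine tsum_congr fun n => ?_
  rw [ENNReal.ofReal_mul (v.nonneg _), ENNReal.ofReal_pow ht.le]
  rfl

theorem nrm_le_of_coeff {f g : PowerSeries k}
    (h : ∀ n, eabs v (PowerSeries.coeff n f) ≤ eabs v (PowerSeries.coeff n g)) :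
    nrm v s f ≤ nrm v s g := by
  rw [nrm_eq_tsum, nrm_eq_tsum]
  exact ENNReal.tsum_le_tsum fun n => mul_le_mul' (h n) le_rfl

theorem eabs_coeff_mul_le_nrm (f : PowerSeries k) (n : ℕ) :
    eabs v (PowerSeries.coeff n f) * s ^ n ≤ nrm v s f := by
  rw [nrm_eq_tsum]
  exact ENNReal.le_tsum n

theorem nrm_X_mul (f : PowerSeries k) : nrm v s (PowerSeries.X * f) = s * nrm v s f := by
  rw [nrm_eq_tsum, nrm_eq_tsum, tsum_eq_zero_add' ENNReal.summable, ← ENNReal.tsum_mul_left]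
  rw [PowerSeries.coeff_zero_X_mul, eabs_zero, zero_mul, zero_add]
  refine tsum_congr fun n => ?_
  rw [PowerSeries.coeff_succ_X_mul, pow_succ]
  ring

theorem nrm_X_pow_mul (n : ℕ) (f : PowerSeries k) :
    nrm v s (PowerSeries.X ^ n * f) = s ^ n * nrm v s f := by
  induction n with
  | zero => simp
  | succ n ih => rw [pow_succ', mul_assoc, nrm_X_mul, ih, pow_succ', mul_assoc]

theorem nrm_mono {s' : ℝ≥0∞} (h : s ≤ s') (f : PowerSeries k) : nrm v s f ≤ nrm v s' f :=
  wNorm_mono (fun _ => h) f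

theorem nrm_mul_le (f g : PowerSeries k) : nrm v s (f * g) ≤ nrm v s f * nrm v s g :=
  wNorm_mul_le f g

theorem nrm_add_le (f g : PowerSeries k) : nrm v s (f + g) ≤ nrm v s f + nrm v s g :=
  wNorm_add_le f g

theorem nrm_sub_le (f g : PowerSeries k) : nrm v s (f - g) ≤ nrm v s f + nrm v s g :=
  wNorm_sub_le f g

theorem nrm_neg (f : PowerSeries k) : nrm v s (-f) = nrm v s f := wNorm_neg f

theorem nrm_zero : nrm v s (0 : PowerSeries k) = 0 := wNorm_zero

theorem nrm_sum_le {α : Type*} (t : Finset α) (f : α → PowerSeries k) :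
    nrm v s (∑ i ∈ t, f i) ≤ ∑ i ∈ t, nrm v s (f i) := wNorm_sum_le t f

theorem nrm_sub_le_add (f g h : PowerSeries k) :
    nrm v s (f - h) ≤ nrm v s (f - g) + nrm v s (g - h) := by
  rw [← sub_add_sub_cancel f g h]
  exact nrm_add_le _ _

theorem nrm_le_add_sub (f g : PowerSeries k) : nrm v s f ≤ nrm v s g + nrm v s (f - g) := by
  conv_lhs => rw [← add_sub_cancel g f]
  exact nrm_add_le _ _

/-- Norms are bounded by those of all truncations. -/
theorem nrm_le_of_trunc {f : PowerSeries k} {C : ℝ≥0∞}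
    (h : ∀ n, ∑ i ∈ Finset.range n, eabs v (PowerSeries.coeff i f) * s ^ i ≤ C) : nrm v s f ≤ C := by
  rw [nrm_eq_tsum]
  exact ENNReal.tsum_le_of_sum_range_le h

/-- Norms are lower semicontinuous for the `X`-adic topology. -/
theorem nrm_le_of_dvd {f : PowerSeries k} {g : ℕ → PowerSeries k} {C : ℝ≥0∞}
    (hfg : ∀ n, PowerSeries.X ^ n ∣ f - g n) (hg : ∀ n, nrm v s (g n) ≤ C) : nrm v s f ≤ C := by
  refine nrm_le_of_trunc fun n => ?_
  refine le_trans (le_of_eq ?_) ((ENNReal.sum_le_tsum (Finset.range n)).trans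
    ((nrm_eq_tsum (g n)).symm.trans_le (hg n)))
  refine Finset.sum_congr rfl fun i hi => ?_
  have h1 := PowerSeries.X_pow_dvd_iff.mp (hfg n) i (Finset.mem_range.mp hi)
  rw [map_sub, sub_eq_zero] at h1
  rw [h1]

theorem le_two_mul_of_le_add_half {a b : ℝ≥0∞} (ha : a ≠ ∞) (h : a ≤ b + 2⁻¹ * a) : a ≤ 2 * b := by
  rcases eq_or_ne b ∞ with hb | hb
  · simp [hb]
  lift a to ℝ≥0 using ha
  lift b to ℝ≥0 using hb
  have h2 : (2⁻¹ : ℝ≥0∞) = ((2⁻¹ : ℝ≥0) : ℝ≥0∞) := by simp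
  rw [h2] at h
  have h1 : a ≤ b + 2⁻¹ * a := by exact_mod_cast h
  have h3 : a ≤ 2 * b := by
    rw [← NNReal.coe_le_coe] at h1 ⊢
    push_cast at h1 ⊢
    linarith
  exact_mod_cast h3

/-- The norm of the inverse of a small perturbation of an invertible series. -/
theorem nrm_inverse_le (hs : s ≠ ∞) {γ₀ l₀ γ l : PowerSeries k} (h₀ : l₀ * γ₀ = 1) (h : l * γ = 1)
    (hpert : nrm v s l₀ * nrm v s (γ - γ₀) ≤ 2⁻¹) : nrm v s l ≤ 2 * nrm v s l₀ := by
  refine nrm_le_of_trunc fun n => ?_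
  -- the estimate `‖l‖ ≤ ‖l₀‖ + ‖l‖ / 2` is only conclusive for finite norms, hence for truncations
  let l' : PowerSeries k := PowerSeries.mk fun i => if i < n then PowerSeries.coeff i l else 0
  have hl' : nrm v s l' = ∑ i ∈ Finset.range n, eabs v (PowerSeries.coeff i l) * s ^ i := by
    rw [nrm_eq_tsum, tsum_eq_sum (s := Finset.range n)]
    · refine Finset.sum_congr rfl fun i hi => ?_
      rw [PowerSeries.coeff_mk, if_pos (Finset.mem_range.mp hi)]
    · intro i hi
      rw [PowerSeries.coeff_mk, if_neg (by simpa using hi), eabs_zero, zero_mul]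
  have hdvd : PowerSeries.X ^ n ∣ l - l' := by
    refine PowerSeries.X_pow_dvd_iff.mpr fun i hi => ?_
    rw [map_sub, PowerSeries.coeff_mk, if_pos hi, sub_self]
  have hid : l = l₀ - l₀ * (γ - γ₀) * l := by linear_combination l₀ * h - l * h₀
  have hdvd' : PowerSeries.X ^ n ∣ l - (l₀ - l₀ * (γ - γ₀) * l') := by
    conv => rhs; enter [1]; rw [hid]
    have h1 : l₀ - l₀ * (γ - γ₀) * l - (l₀ - l₀ * (γ - γ₀) * l') =
        -(l₀ * (γ - γ₀)) * (l - l') := by ring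
    rw [h1]
    exact Dvd.dvd.mul_left hdvd _
  rw [← hl']
  refine le_two_mul_of_le_add_half ?_ ?_
  · rw [hl']
    exact ENNReal.sum_ne_top.mpr fun i _ =>
      ENNReal.mul_ne_top (eabs_ne_top v _) (ENNReal.pow_ne_top hs)
  · calc nrm v s l' ≤ nrm v s (l₀ - l₀ * (γ - γ₀) * l') := by
          rw [hl', nrm_eq_tsum]
          refine le_trans (le_of_eq ?_) (ENNReal.sum_le_tsum (Finset.range n))
          refine Finset.sum_congr rfl fun i hi => ?_
          have h1 := PowerSeries.X_pow_dvd_iff.mp hdvd' i (Finset.mem_range.mp hi)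
          rw [map_sub, sub_eq_zero] at h1
          rw [h1]
      _ ≤ nrm v s l₀ + nrm v s l₀ * nrm v s (γ - γ₀) * nrm v s l' :=
          (nrm_sub_le _ _).trans (add_le_add le_rfl ((nrm_mul_le _ _).trans
            (mul_le_mul' (nrm_mul_le _ _) le_rfl)))
      _ ≤ _ := by gcongr

theorem nrm_mulVec_le {r : ℕ} {M : Matrix (Fin r) (Fin r) (PowerSeries k)} {w : Fin r → PowerSeries k}
    {A t : ℝ≥0∞} (hM : ∀ a b, nrm v s (M a b) ≤ A) (hw : ∀ b, nrm v s (w b) ≤ t) (a : Fin r) :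
    nrm v s ((M.mulVec w) a) ≤ r * A * t := by
  rw [Matrix.mulVec, dotProduct]
  refine (nrm_sum_le _ _).trans ((Finset.sum_le_sum fun b _ => (nrm_mul_le _ _).trans
    (mul_le_mul' (hM a b) (hw b))).trans_eq ?_)
  rw [Finset.sum_const, Finset.card_fin, nsmul_eq_mul, mul_assoc]

theorem nrm_mul_matrix_le {r : ℕ} {M M' : Matrix (Fin r) (Fin r) (PowerSeries k)} {A A' : ℝ≥0∞}
    (hM : ∀ a b, nrm v s (M a b) ≤ A) (hM' : ∀ a b, nrm v s (M' a b) ≤ A') (a b : Fin r) :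
    nrm v s ((M * M') a b) ≤ r * A * A' := by
  rw [Matrix.mul_apply]
  refine (nrm_sum_le _ _).trans ((Finset.sum_le_sum fun j _ => (nrm_mul_le _ _).trans
    (mul_le_mul' (hM a j) (hM' j b))).trans_eq ?_)
  rw [Finset.sum_const, Finset.card_fin, nsmul_eq_mul, mul_assoc]

/-- Newton's method in the `s`-norm: if the Newton operator halves distances on the ball of radius
`2e` around `u₀`, where `e` bounds the length of the first step, then the exact solution lies in
this ball. -/
theorem NewtonData.nrm_sub_le {r : ℕ} (D : NewtonData r k) {u u₀ : Fin r → PowerSeries k}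
    (hu : D.h u = 0) {e A B L : ℝ≥0∞}
    (he : ∀ b, nrm v s (D.Ψ u₀ b - u₀ b) ≤ e)
    (hadj : ∀ a b, nrm v s (D.M.adjugate a b) ≤ A)
    (hE : ∀ u, (∀ b, nrm v s (u b - u₀ b) ≤ 2 * e) → ∀ a b, nrm v s (D.E u u₀ a b) ≤ B)
    (hlam : nrm v s D.lam ≤ L) (hcontr : L * s * (r * (r * A * B)) ≤ 2⁻¹) (b : Fin r) :
    nrm v s (u b - u₀ b) ≤ 2 * e := by
  have hstep : ∀ n b, nrm v s ((D.Ψ^[n] u₀) b - u₀ b) ≤ 2 * e := by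
    intro n
    induction n with
    | zero => intro b; simp [nrm_zero]
    | succ n ih =>
      intro b
      rw [Function.iterate_succ_apply']
      refine (nrm_sub_le_add _ (D.Ψ u₀ b) _).trans ?_
      have h1 := congrFun (D.Ψ_sub (D.Ψ^[n] u₀) u₀) b
      rw [Pi.sub_apply] at h1
      rw [h1, Pi.neg_apply, nrm_neg, Pi.smul_apply, smul_eq_mul]
      have h2 : nrm v s (D.lam * PowerSeries.X * ((D.M.adjugate * D.E (D.Ψ^[n] u₀) u₀).mulVec
          (D.Ψ^[n] u₀ - u₀)) b) ≤ e := by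
        refine (nrm_mul_le _ _).trans ?_
        calc _ ≤ L * s * (r * (r * A * B) * (2 * e)) := by
              gcongr
              · rw [mul_comm D.lam, nrm_X_mul, mul_comm]
                gcongr
              · exact nrm_mulVec_le (nrm_mul_matrix_le hadj (hE _ ih)) ih b
          _ = L * s * (r * (r * A * B)) * (2 * e) := by ring
          _ ≤ 2⁻¹ * (2 * e) := by gcongr
          _ = e := by rw [← mul_assoc, ENNReal.inv_mul_cancel two_ne_zero ENNReal.ofNat_ne_top, one_mul]
      exact (add_le_add h2 (he b)).trans_eq (two_mul e).symm
  have hfix := (D.Ψ_eq_iff u).mpr hu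
  refine nrm_le_of_dvd (g := fun n => (D.Ψ^[n] u₀) b - u₀ b) (fun n => ?_) (fun n => hstep n b)
  rw [sub_sub_sub_cancel_right]
  exact congrMod_iterate D.congrMod_Ψ hfix u₀ n b

end OneVariable

/-! ### Convergence of solutions -/

section Convergent

open Matrix

variable {k : Type*} [Field k] {v : AbsoluteValue k ℝ} {m r : ℕ}

theorem exists_wNorm_le_of_finite {α ι : Type*} [Finite α] {f : α → MvPowerSeries ι k}
    (hf : ∀ a, IsConvergent v (f a)) :
    ∃ ρ K : ℝ≥0∞, ρ ≠ 0 ∧ K ≠ ∞ ∧ ∀ a, wNorm v (fun _ => ρ) (f a) ≤ K := by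
  cases nonempty_fintype α
  choose R hR0 hR using fun a => isConvergent_iff.mp (hf a)
  obtain ⟨ρ, hρ0, hρ⟩ : ∃ ρ : ℝ≥0, 0 < ρ ∧ ∀ a, ρ ≤ R a := by
    rcases isEmpty_or_nonempty α with hα | hα
    · exact ⟨1, one_pos, fun a => (hα.false a).elim⟩
    · obtain ⟨a, ha⟩ := Finite.exists_min R
      exact ⟨R a, hR0 a, ha⟩
  refine ⟨ρ, ∑ a, wNorm v (fun _ => (R a : ℝ≥0∞)) (f a), by exact_mod_cast hρ0.ne',
    ENNReal.sum_ne_top.mpr fun a _ => (hR a).ne, fun a => ?_⟩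
  refine (wNorm_mono (fun _ => ENNReal.coe_le_coe.mpr (hρ a)) (f a)).trans ?_
  exact Finset.single_le_sum (f := fun a => wNorm v (fun _ => (R a : ℝ≥0∞)) (f a))
    (fun _ _ => zero_le) (Finset.mem_univ a)

theorem pderiv_mem_convergent {ι : Type} [Fintype ι] (i : ι)
    (f : seriesRing (Quality.convergent v) ι) :
    MvPowerSeries.pderiv k i f.1 ∈ seriesRing (Quality.convergent v) ι := by
  have h1 : MvPowerSeries.pderiv k i f.1 =
      MvPowerSeries.subst (Sum.elim MvPowerSeries.X MvPowerSeries.X) (dividedDifference f i).1 := by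
    rw [subst_dividedDifference_self f i MvPowerSeries.HasSubst.X, MvPowerSeries.subst_self]
    rfl
  rw [h1]
  refine IsConvergent.subst (dividedDifference f i).2 ?_ ?_
  · rintro (j | j) <;> exact X_mem_seriesRing (Quality.convergent v) j
  · rintro (j | j) <;> exact MvPowerSeries.constantCoeff_X j

variable (h : Fin r → SeriesB (Quality.convergent v) m) (c : Fin r → Fin m)

/-- The square submatrix of `∂_y h` with columns `c`, as a matrix of convergent series. -/
def convergentJacobian : Matrix (Fin r) (Fin r) (SeriesB (Quality.convergent v) m) :=
  Matrix.of fun a b => ⟨_, pderiv_mem_convergent (some (c b)) (h a)⟩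

theorem minor_mem_convergent :
    minor h c ∈ seriesRing (Quality.convergent v) (Option (Fin m)) := by
  have h1 : minor h c = (convergentJacobian h c).det.1 :=
    (RingHom.map_det (seriesRing (Quality.convergent v) (Option (Fin m))).subtype
      (convergentJacobian h c)).symm
  rw [h1]
  exact Subtype.prop _

theorem adjugate_jacobian {S : Type*} [CommRing S] [Algebra k S] (x : Fin m × ℕ → S) (a b : Fin r) :
    (jacobian h c x).adjugate a b = evalAt x ((convergentJacobian h c).adjugate a b).1 :=
  (congrFun (congrFun (RingHom.map_adjugate (((evalAt x : _ →ₐ[k] PowerSeries S).toRingHom).comp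
    (seriesRing (Quality.convergent v) (Option (Fin m))).subtype) (convergentJacobian h c)) a) b).symm

/-- On the polydisc of radius `ρ`, the number `K` bounds the adjugate of the Jacobian matrix, the
second divided differences of `h`, and the first ones of `h` and of the minor. -/
structure IsNewtonBound (ρ K : ℝ≥0∞) : Prop where
  adjugate : ∀ a b, wNorm v (fun _ => ρ) ((convergentJacobian h c).adjugate a b).1 ≤ K
  minor : ∀ i, wNorm v (fun _ => ρ)
    (dividedDifference (⟨_, minor_mem_convergent h c⟩ : SeriesB (Quality.convergent v) m) i).1 ≤ K
  equations : ∀ a i, wNorm v (fun _ => ρ) (dividedDifference (h a) i).1 ≤ K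
  taylor : ∀ a i j, wNorm v (fun _ => ρ) (dividedDifference (dividedDifference (h a) i) j).1 ≤ K

theorem exists_isNewtonBound : ∃ ρ K : ℝ≥0∞, ρ ≠ 0 ∧ K ≠ ∞ ∧ IsNewtonBound h c ρ K := by
  obtain ⟨ρ₁, K₁, hρ₁, hK₁, h₁⟩ := exists_wNorm_le_of_finite
    fun p : Fin r × Fin r => ((convergentJacobian h c).adjugate p.1 p.2).2
  obtain ⟨ρ₂, K₂, hρ₂, hK₂, h₂⟩ := exists_wNorm_le_of_finite fun i =>
    (dividedDifference (⟨_, minor_mem_convergent h c⟩ : SeriesB (Quality.convergent v) m) i).2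
  obtain ⟨ρ₃, K₃, hρ₃, hK₃, h₃⟩ := exists_wNorm_le_of_finite
    fun p : Fin r × Option (Fin m) => (dividedDifference (h p.1) p.2).2
  obtain ⟨ρ₄, K₄, hρ₄, hK₄, h₄⟩ := exists_wNorm_le_of_finite
    fun p : Fin r × Option (Fin m) × (Option (Fin m) ⊕ Option (Fin m)) =>
      (dividedDifference (dividedDifference (h p.1) p.2.1) p.2.2).2
  refine ⟨min (min ρ₁ ρ₂) (min ρ₃ ρ₄), (K₁ + K₂) + (K₃ + K₄), ?_, by finiteness,
    fun a b => ?_, fun i => ?_, fun a i => ?_, fun a i j => ?_⟩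
  · refine (lt_min (lt_min ?_ ?_) (lt_min ?_ ?_)).ne' <;> exact pos_iff_ne_zero.mpr ‹_›
  · exact (wNorm_mono (fun _ => (min_le_left _ _).trans (min_le_left _ _)) _).trans
      ((h₁ (a, b)).trans (le_self_add.trans le_self_add))
  · exact (wNorm_mono (fun _ => (min_le_left _ _).trans (min_le_right _ _)) _).trans
      ((h₂ i).trans (le_add_self.trans le_self_add))
  · exact (wNorm_mono (fun _ => (min_le_right _ _).trans (min_le_left _ _)) _).trans
      ((h₃ (a, i)).trans (le_self_add.trans le_add_self))
  · exact (wNorm_mono (fun _ => (min_le_right _ _).trans (min_le_right _ _)) _).trans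
      ((h₄ (a, i, j)).trans (le_add_self.trans le_add_self))

variable {s ρ K : ℝ≥0∞}

theorem nrm_subst_le {κ : Type*} [Finite κ] {a : κ → MvPowerSeries Unit k}
    (ha : MvPowerSeries.HasSubst a) (hρ : ∀ i, nrm v s (a i) ≤ ρ) {f : MvPowerSeries κ k}
    (hf : wNorm v (fun _ => ρ) f ≤ K) : nrm v s (MvPowerSeries.subst a f : MvPowerSeries Unit k) ≤ K :=
  (wNorm_subst_le ha f).trans ((wNorm_mono hρ f).trans hf)

/-- The arc with coordinates `x` stays in the polydisc of radius `ρ` for `|t| ≤ s`. -/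
def InPolydisc (v : AbsoluteValue k ℝ) (s ρ : ℝ≥0∞) (x : Fin m × ℕ → k) : Prop :=
  s ≤ ρ ∧ ∀ i, nrm v s (series x i) ≤ ρ

theorem InPolydisc.nrm_assign_le {x : Fin m × ℕ → k} (hx : InPolydisc v s ρ x) (i : Option (Fin m)) :
    nrm v s (assign x i) ≤ ρ := by
  cases i with
  | none => exact (wNorm_X ()).trans_le hx.1
  | some i => exact hx.2 i

theorem nrm_evalAt_sub_le {f : SeriesB (Quality.convergent v) m}
    (hf : ∀ i, wNorm v (fun _ => ρ) (dividedDifference f i).1 ≤ K) {x y : Fin m × ℕ → k}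
    (hx : InPolydisc v s ρ x) (hy : InPolydisc v s ρ y) :
    nrm v s (evalAt x f.1 - evalAt y f.1) ≤ K * ∑ i, nrm v s (series x i - series y i) := by
  rw [evalAt_sub_evalAt_eq_sum, Finset.mul_sum]
  refine (nrm_sum_le _ _).trans (Finset.sum_le_sum fun i _ => (nrm_mul_le _ _).trans
    (mul_le_mul' (nrm_subst_le ((hasSubst_assign x).sumElim (hasSubst_assign y)) ?_ (hf _)) le_rfl))
  rintro (j | j)
  · exact hx.nrm_assign_le j
  · exact hy.nrm_assign_le j

variable {h c}

theorem IsNewtonBound.nrm_adjugate_le (hK : IsNewtonBound h c ρ K) {x : Fin m × ℕ → k}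
    (hx : InPolydisc v s ρ x) (a b : Fin r) : nrm v s ((jacobian h c x).adjugate a b) ≤ K := by
  rw [adjugate_jacobian, evalAt_apply]
  exact nrm_subst_le (hasSubst_assign x) hx.nrm_assign_le (hK.adjugate a b)

theorem nrm_spread_le {u : Fin r → PowerSeries k} {R : ℝ≥0∞} (hu : ∀ b, nrm v s (u b) ≤ R)
    (i : Fin m) : nrm v s (spread c u i) ≤ r * R := by
  rw [spread]
  refine (nrm_sum_le _ _).trans ((Finset.sum_le_sum (g := fun _ => R) fun b _ => ?_).trans_eq ?_)
  · split_ifs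
    · exact hu b
    · rw [nrm_zero]
      exact zero_le
  · rw [Finset.sum_const, Finset.card_fin, nsmul_eq_mul]

theorem IsNewtonBound.nrm_taylorMatrix_le (hK : IsNewtonBound h c ρ K) {d : ℕ} {x : Fin m × ℕ → k}
    {u w : Fin r → PowerSeries k} {R : ℝ≥0∞} (hx : InPolydisc v s ρ x)
    (hxu : InPolydisc v s ρ (addTail c d x u)) (hxw : InPolydisc v s ρ (addTail c d x w))
    (hu : ∀ b, nrm v s (u b) ≤ R) (hw : ∀ b, nrm v s (w b) ≤ R) (a b : Fin r) :
    nrm v s (taylorMatrix h c d x u w a b) ≤ K * (2 * m * r * R) := by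
  rw [taylorMatrix, Matrix.of_apply]
  have hsub : ∀ j, nrm v s (MvPowerSeries.subst
      (Sum.elim (Sum.elim (assign (addTail c d x u)) (assign (addTail c d x w)))
        (Sum.elim (assign x) (assign x)))
      (dividedDifference (dividedDifference (h a) (some (c b))) j).1 : MvPowerSeries Unit k) ≤ K := by
    refine fun j => nrm_subst_le (((hasSubst_assign _).sumElim (hasSubst_assign _)).sumElim
      ((hasSubst_assign _).sumElim (hasSubst_assign _))) ?_ (hK.taylor a _ j)
    rintro ((i | i) | (i | i))
    exacts [hxu.nrm_assign_le i, hxw.nrm_assign_le i, hx.nrm_assign_le i, hx.nrm_assign_le i]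
  refine (nrm_sum_le _ _).trans ((Finset.sum_le_sum fun j _ => (nrm_mul_le _ _).trans
    (mul_le_mul' (hsub j) le_rfl)).trans ?_)
  rw [← Finset.mul_sum, Fintype.sum_sum_type, Fintype.sum_option, Fintype.sum_option]
  refine mul_le_mul' le_rfl ?_
  simp only [Sum.elim_inl, Sum.elim_inr, Option.elim_none, Option.elim_some, nrm_zero, zero_add]
  refine (add_le_add (Finset.sum_le_sum fun i _ => nrm_spread_le hu i)
    (Finset.sum_le_sum fun i _ => nrm_spread_le hw i)).trans_eq ?_
  rw [Finset.sum_const, Finset.card_fin, nsmul_eq_mul]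
  ring

theorem InPolydisc.addTail {d : ℕ} {x : Fin m × ℕ → k} {u : Fin r → PowerSeries k} {R : ℝ≥0∞}
    (hs : s ≤ ρ) (hx : ∀ i, nrm v s (series x i) + s ^ (d + 1) * (r * R) ≤ ρ)
    (hu : ∀ b, nrm v s (u b) ≤ R) : InPolydisc v s ρ (Arquile.addTail c d x u) := by
  refine ⟨hs, fun i => ?_⟩
  rw [series_addTail]
  refine (nrm_add_le _ _).trans (le_trans ?_ (hx i))
  rw [nrm_X_pow_mul]
  gcongr
  exact nrm_spread_le hu i

/-- Newton's method with an approximate solution `u₁` whose first Newton step has length at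
most `e`. -/
theorem IsNewtonBound.nrm_solution_sub_le (hK : IsNewtonBound h c ρ K) {d : ℕ}
    {x : Fin m × ℕ → k} {D : NewtonData r k}
    (hDM : D.M = jacobian h c x) (hDE : D.E = taylorMatrix h c d x)
    {u u₁ : Fin r → PowerSeries k} (hu : D.h u = 0) {R L e : ℝ≥0∞}
    (hs : s ≤ ρ) (hx : ∀ i, nrm v s (series x i) + s ^ (d + 1) * (r * R) ≤ ρ)
    (hlam : nrm v s D.lam ≤ L) (hcontr : L * s * (r * (r * K * (K * (2 * m * r * R)))) ≤ 2⁻¹)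
    (hR : ∀ b, nrm v s (u₁ b) + 2 * e ≤ R) (he : ∀ b, nrm v s (D.Ψ u₁ b - u₁ b) ≤ e) (b : Fin r) :
    nrm v s (u b - u₁ b) ≤ 2 * e := by
  have hx0 : InPolydisc v s ρ x := ⟨hs, fun i => le_self_add.trans (hx i)⟩
  refine D.nrm_sub_le hu he (A := K) (B := K * (2 * m * r * R)) ?_ ?_ hlam hcontr b
  · rw [hDM]
    exact hK.nrm_adjugate_le hx0
  · rw [hDE]
    intro u' hu'
    have h1 : ∀ b, nrm v s (u' b) ≤ R := fun b =>
      (nrm_le_add_sub _ (u₁ b)).trans ((add_le_add le_rfl (hu' b)).trans (hR b))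
    have h2 : ∀ b, nrm v s (u₁ b) ≤ R := fun b => le_self_add.trans (hR b)
    exact hK.nrm_taylorMatrix_le hx0 (.addTail hs hx h1) (.addTail hs hx h2) h1 h2

end Convergent

/-! ### Solutions of convergent equations depend continuously on the base point -/

section Continuity

open Matrix Filter Topology

variable {k : Type*} [Field k] {v : AbsoluteValue k ℝ} {m r : ℕ}

theorem eventually_mul_le {C ε : ℝ≥0∞} (hC : C ≠ ∞) (hε : 0 < ε) :
    ∀ᶠ s in 𝓝[>] (0 : ℝ≥0∞), s * C ≤ ε := by
  have h1 : Tendsto (fun s : ℝ≥0∞ => s * C) (𝓝 0) (𝓝 (0 * C)) :=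
    ENNReal.Tendsto.mul_const tendsto_id (Or.inr hC)
  rw [zero_mul] at h1
  exact (h1.mono_left nhdsWithin_le_nhds).eventually (Iic_mem_nhds hε)

theorem eventually_le_of_pos {ε : ℝ≥0∞} (hε : 0 < ε) : ∀ᶠ s in 𝓝[>] (0 : ℝ≥0∞), s ≤ ε :=
  mem_nhdsWithin_of_mem_nhds (Iic_mem_nhds hε)

theorem exists_of_eventually {p : ℝ≥0∞ → Prop} (h : ∀ᶠ s in 𝓝[>] (0 : ℝ≥0∞), p s) :
    ∃ s₀, 0 < s₀ ∧ ∀ s, 0 < s → s ≤ s₀ → p s := by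
  obtain ⟨s₁, hs₁, h1⟩ := (mem_nhdsGT_iff_exists_Ioo_subset' (show (0 : ℝ≥0∞) < 1 by simp)).mp h
  obtain ⟨s₀, hs₀, h2⟩ := exists_between (show 0 < s₁ from hs₁)
  exact ⟨s₀, hs₀, fun s h0 h3 => h1 ⟨h0, h3.trans_lt h2⟩⟩

theorem exists_pos_of_eventually {p : ℝ≥0∞ → Prop} (h : ∀ᶠ s in 𝓝[>] (0 : ℝ≥0∞), p s) :
    ∃ s, 0 < s ∧ p s := by
  obtain ⟨s₀, hs₀, h1⟩ := exists_of_eventually h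
  exact ⟨s₀, hs₀, h1 s₀ hs₀ le_rfl⟩

theorem IsConvergent.eventually_nrm_le {f : PowerSeries k} (hf : IsConvergent v f) :
    ∃ C : ℝ≥0∞, C ≠ ∞ ∧ ∀ᶠ s in 𝓝[>] (0 : ℝ≥0∞), nrm v s f ≤ C := by
  obtain ⟨ρ, hρ, h⟩ := isConvergent_iff.mp hf
  refine ⟨_, h.ne, ?_⟩
  filter_upwards [eventually_le_of_pos (show (0 : ℝ≥0∞) < ρ by exact_mod_cast hρ)] with s hs
  exact nrm_mono hs f

theorem exists_eventually_nrm_le {α : Type*} [Finite α] {f : α → PowerSeries k}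
    (hf : ∀ a, IsConvergent v (f a)) :
    ∃ C : ℝ≥0∞, C ≠ ∞ ∧ ∀ᶠ s in 𝓝[>] (0 : ℝ≥0∞), ∀ a, nrm v s (f a) ≤ C := by
  cases nonempty_fintype α
  choose C hC h using fun a => (hf a).eventually_nrm_le
  refine ⟨∑ a, C a, ENNReal.sum_ne_top.mpr fun a _ => hC a, ?_⟩
  filter_upwards [eventually_all.mpr h] with s hs a
  exact (hs a).trans (Finset.single_le_sum (fun _ _ => zero_le) (Finset.mem_univ a))

theorem IsConvergent.eventually_nrm_le_of_pos {f : PowerSeries k} (hf : IsConvergent v f)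
    (h0 : PowerSeries.constantCoeff f = 0) {ε : ℝ≥0∞} (hε : 0 < ε) :
    ∀ᶠ s in 𝓝[>] (0 : ℝ≥0∞), nrm v s f ≤ ε := by
  obtain ⟨ρ, hρ, h⟩ := hf.exists_wNorm_le h0 hε
  filter_upwards [eventually_le_of_pos (show (0 : ℝ≥0∞) < ρ by exact_mod_cast hρ)] with s hs
  exact (nrm_mono hs f).trans h

theorem isConvergent_of_nrm_ne_top {f : PowerSeries k} {s : ℝ≥0∞} (hs : 0 < s) (h : nrm v s f ≠ ∞) :
    IsConvergent v f :=
  isConvergent_of_wNorm_lt_top (fun _ => hs.ne') h.lt_top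

theorem le_inv_mul_of_mul_le {a b s : ℝ≥0∞} (hs : 0 < s) (hs' : s ≠ ∞) (h : s * a ≤ b) :
    a ≤ s⁻¹ * b := by
  calc a = s⁻¹ * (s * a) := by rw [← mul_assoc, ENNReal.inv_mul_cancel hs.ne' hs', one_mul]
    _ ≤ s⁻¹ * b := by gcongr

theorem IsConvergent.of_X_pow_mul {n : ℕ} {f g : PowerSeries k} (h : IsConvergent v g)
    (hfg : g = PowerSeries.X ^ n * f) : IsConvergent v f := by
  obtain ⟨C, hC, h1⟩ := h.eventually_nrm_le
  obtain ⟨s, hs, h2, h3⟩ := exists_pos_of_eventually (h1.and (eventually_le_of_pos one_pos))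
  have hs' : s ≠ ∞ := (h3.trans_lt ENNReal.one_lt_top).ne
  rw [hfg, nrm_X_pow_mul] at h2
  have h4 := le_inv_mul_of_mul_le (ENNReal.pow_pos hs n) (ENNReal.pow_ne_top hs') h2
  refine isConvergent_of_nrm_ne_top hs (ne_top_of_le_ne_top ?_ h4)
  exact ENNReal.mul_ne_top (ENNReal.inv_ne_top.mpr (pow_ne_zero _ hs.ne')) hC

theorem IsConvergent.of_mul_eq_one {γ l : PowerSeries k} (h : IsConvergent v γ) (hl : l * γ = 1) :
    IsConvergent v l := by
  have h0 : PowerSeries.constantCoeff l * PowerSeries.constantCoeff γ = 1 := by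
    rw [← map_mul, hl, map_one]
  have hC : ∀ a : k, IsConvergent v (PowerSeries.C a) := fun a =>
    C_mem_seriesRing (ι := Unit) (Quality.convergent v) a
  have hsub : IsConvergent v (γ - PowerSeries.C (PowerSeries.constantCoeff γ)) := by
    have h1 := h.add (hC (PowerSeries.constantCoeff γ)).neg
    rwa [← sub_eq_add_neg] at h1
  obtain ⟨A, hA, hA'⟩ := (hC (PowerSeries.constantCoeff l)).eventually_nrm_le
  have hε : (0 : ℝ≥0∞) < 2⁻¹ * (A + 1)⁻¹ :=
    ENNReal.mul_pos (by simp) (ENNReal.inv_ne_zero.mpr (by finiteness))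
  have h2 := hsub.eventually_nrm_le_of_pos (by simp) hε
  obtain ⟨s, hs, ⟨h3, h4⟩, h5⟩ :=
    exists_pos_of_eventually ((hA'.and h2).and (eventually_le_of_pos one_pos))
  have hs' : s ≠ ∞ := (h5.trans_lt ENNReal.one_lt_top).ne
  refine isConvergent_of_nrm_ne_top hs (ne_top_of_le_ne_top ?_ (nrm_inverse_le (v := v) hs'
    (γ₀ := PowerSeries.C (PowerSeries.constantCoeff γ))
    (l₀ := PowerSeries.C (PowerSeries.constantCoeff l)) ?_ hl ?_))
  · exact ENNReal.mul_ne_top (by simp) (ne_top_of_le_ne_top hA h3)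
  · rw [← map_mul, h0, map_one]
  · calc _ ≤ A * (2⁻¹ * (A + 1)⁻¹) := mul_le_mul' h3 h4
      _ ≤ (A + 1) * (2⁻¹ * (A + 1)⁻¹) := by gcongr; exact le_self_add
      _ = 2⁻¹ := by
        rw [mul_comm 2⁻¹, ← mul_assoc, ENNReal.mul_inv_cancel (by simp) (by finiteness), one_mul]

theorem isConvergent_evalAt {x : Fin m × ℕ → k} (hx : ∀ i, IsConvergent v (series x i))
    (f : SeriesB (Quality.convergent v) m) : IsConvergent v (evalAt x f.1) := by
  rw [evalAt_apply]
  refine IsConvergent.subst f.2 ?_ (constantCoeff_assign x)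
  rintro (_ | i)
  · exact X_mem_seriesRing (Quality.convergent v) ()
  · exact hx i

variable {h : Fin r → SeriesB (Quality.convergent v) m} {c : Fin r → Fin m} {d : ℕ}

theorem isConvergent_lam {x : Fin m × ℕ → k} (hconv : ∀ i, IsConvergent v (series x i))
    {D : NewtonData r k} (hDM : D.M = jacobian h c x) : IsConvergent v D.lam := by
  have h1 := D.det_eq
  rw [hDM, det_jacobian] at h1
  exact ((isConvergent_evalAt hconv ⟨_, minor_mem_convergent h c⟩).of_X_pow_mul h1).of_mul_eq_one
    D.lam_mul

/-- The solution of convergent equations at a convergent admissible base point is convergent. -/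
theorem IsAdmissible.isConvergent_solution {x : Fin m × ℕ → k} (hx : IsAdmissible h c d x)
    (hconv : ∀ i, IsConvergent v (series x i)) {u : Fin r → PowerSeries k}
    (hu : ∀ a, evalAt (addTail c d x u) (h a).1 = 0) (b : Fin r) : IsConvergent v (u b) := by
  obtain ⟨D, hDd, hDh, hDM, hDE⟩ := hx.exists_newtonData
  obtain ⟨ρ, K, hρ, hK, hbound⟩ := exists_isNewtonBound h c
  have hbconv : ∀ a, IsConvergent v (D.b a) := by
    intro a
    have h1 := congrFun D.adj_h a
    rw [Pi.smul_apply, smul_eq_mul] at h1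
    refine IsConvergent.of_X_pow_mul ?_ h1
    simp only [Matrix.mulVec, dotProduct]
    refine (seriesRing (Quality.convergent v) Unit).sum_mem fun j _ => ?_
    refine (seriesRing (Quality.convergent v) Unit).mul_mem ?_ ?_
    · rw [hDM, adjugate_jacobian]
      exact isConvergent_evalAt hconv _
    · rw [hDh]
      have h2 : addTail c d x 0 = x := by
        funext p
        simp [addTail, spread]
      beta_reduce
      rw [h2]
      exact isConvergent_evalAt hconv _
  obtain ⟨B, hB, hB'⟩ := exists_eventually_nrm_le hbconv
  obtain ⟨L, hL, hL'⟩ := (isConvergent_lam hconv hDM).eventually_nrm_le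
  -- the first Newton step, starting at `0`, has length at most `L * B`, and for small radii the ball
  -- of radius `2 * (L * B)` stays in the polydisc
  have hρ2 : 0 < ρ / 2 := ENNReal.div_pos hρ (by simp)
  have hx2 : ∀ᶠ s in 𝓝[>] (0 : ℝ≥0∞), ∀ i, nrm v s (series x i) ≤ ρ / 2 :=
    eventually_all.mpr fun i => (hconv i).eventually_nrm_le_of_pos (constantCoeff_series x i) hρ2
  have htail := eventually_mul_le (C := r * (2 * (L * B))) (by finiteness) hρ2
  have hcontr := eventually_mul_le (C := L * (r * (r * K * (K * (2 * m * r * (2 * (L * B)))))))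
    (ε := 2⁻¹) (by finiteness) (by simp)
  obtain ⟨s, hs, h1, h2, h3, h4, h5, h6, h7⟩ := exists_pos_of_eventually (hB'.and (hL'.and
    (hx2.and (htail.and (hcontr.and ((eventually_le_of_pos one_pos).and
      (eventually_le_of_pos (pos_iff_ne_zero.mpr hρ))))))))
  have hG : D.G 0 = D.b := by
    rw [NewtonData.G, smul_zero, Matrix.mulVec_zero, smul_zero, add_zero, add_zero]
  have h8 := hbound.nrm_solution_sub_le (s := s) (u₁ := 0) (e := L * B) (R := 2 * (L * B)) (L := L)
    hDM hDE (u := u) (by rw [hDh]; exact funext hu) h7 ?_ h2 ?_ ?_ ?_ b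
  · refine isConvergent_of_nrm_ne_top hs (ne_top_of_le_ne_top ?_ (by simpa using h8))
    finiteness
  · intro i
    refine (add_le_add (h3 i) (le_trans ?_ h4)).trans_eq (ENNReal.add_halves ρ)
    rw [pow_succ]
    exact mul_le_mul' (mul_le_of_le_one_left' (pow_le_one' h6 d)) le_rfl
  · refine le_trans (le_of_eq ?_) h5
    ring
  · intro b
    rw [Pi.zero_apply, nrm_zero, zero_add]
  · intro b
    rw [NewtonData.Ψ, Pi.zero_apply, sub_zero, zero_sub, Pi.neg_apply, nrm_neg, hG, Pi.smul_apply,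
      smul_eq_mul]
    exact (nrm_mul_le _ _).trans (mul_le_mul' h2 (h1 b))

/-- The inverse of the leading factor of the minor is bounded near a given base point. -/
theorem nrm_lam_le {s ρ K : ℝ≥0∞} (hbound : IsNewtonBound h c ρ K) (hs0 : 0 < s) (hs1 : s ≠ ∞)
    {x x₀ : Fin m × ℕ → k} {D D₀ : NewtonData r k} (hDd : D.d = d) (hDd₀ : D₀.d = d)
    (hDM : D.M = jacobian h c x) (hDM₀ : D₀.M = jacobian h c x₀)
    (hx : InPolydisc v s ρ x) (hx₀ : InPolydisc v s ρ x₀)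
    {L δ : ℝ≥0∞} (hL : nrm v s D₀.lam ≤ L)
    (hδ : ∀ i, nrm v s (series x i - series x₀ i) ≤ δ)
    (hsmall : δ * (L * ((s ^ d)⁻¹ * (K * m))) ≤ 2⁻¹) : nrm v s D.lam ≤ 2 * L := by
  refine (nrm_inverse_le hs1 D₀.lam_mul D.lam_mul ?_).trans (mul_le_mul' le_rfl hL)
  have h1 : PowerSeries.X ^ d * (D.γ - D₀.γ) = evalAt x (minor h c) - evalAt x₀ (minor h c) := by
    have e1 := D.det_eq
    have e2 := D₀.det_eq
    rw [hDM, det_jacobian, hDd] at e1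
    rw [hDM₀, det_jacobian, hDd₀] at e2
    rw [e1, e2, mul_sub]
  have h2 : s ^ d * nrm v s (D.γ - D₀.γ) ≤ K * (m * δ) := by
    rw [← nrm_X_pow_mul, h1]
    refine (nrm_evalAt_sub_le (f := ⟨_, minor_mem_convergent h c⟩) hbound.minor hx hx₀).trans ?_
    gcongr
    exact (Finset.sum_le_sum fun i _ => hδ i).trans_eq (by simp)
  calc _ ≤ L * ((s ^ d)⁻¹ * (K * (m * δ))) :=
        mul_le_mul' hL (le_inv_mul_of_mul_le (ENNReal.pow_pos hs0 d) (ENNReal.pow_ne_top hs1) h2)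
    _ = δ * (L * ((s ^ d)⁻¹ * (K * m))) := by ring
    _ ≤ _ := hsmall

/-- The first Newton step at a base point `x` is short if one starts with the exact solution for a
base point `x₁` close to `x`. -/
theorem nrm_newtonStep_le {s ρ K : ℝ≥0∞} (hbound : IsNewtonBound h c ρ K) (hs0 : 0 < s)
    (hs1 : s ≠ ∞) {x x₁ : Fin m × ℕ → k} {D : NewtonData r k} (hDd : D.d = d)
    (hDh : D.h = fun u a => evalAt (addTail c d x u) (h a).1) (hDM : D.M = jacobian h c x)
    {u₁ : Fin r → PowerSeries k} (hu₁ : ∀ a, evalAt (addTail c d x₁ u₁) (h a).1 = 0)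
    (hx : InPolydisc v s ρ x) (hxu : InPolydisc v s ρ (addTail c d x u₁))
    (hxu₁ : InPolydisc v s ρ (addTail c d x₁ u₁)) {L δ : ℝ≥0∞} (hL : nrm v s D.lam ≤ L)
    (hδ : ∀ i, nrm v s (series x i - series x₁ i) ≤ δ) (b : Fin r) :
    nrm v s (D.Ψ u₁ b - u₁ b) ≤ δ * (L * ((s ^ (2 * d + 1))⁻¹ * (r * K * (K * m)))) := by
  have h1 : ∀ a, nrm v s (D.h u₁ a) ≤ K * (m * δ) := by
    intro a
    have e1 : D.h u₁ a =
        evalAt (addTail c d x u₁) (h a).1 - evalAt (addTail c d x₁ u₁) (h a).1 := by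
      rw [hDh, hu₁, sub_zero]
    rw [e1]
    refine (nrm_evalAt_sub_le (hbound.equations a) hxu hxu₁).trans ?_
    gcongr
    refine (Finset.sum_le_sum fun i _ => ?_).trans_eq (by simp : ∑ _i : Fin m, δ = m * δ)
    rw [series_addTail, series_addTail, add_sub_add_right_eq_sub]
    exact hδ i
  have h2 : s ^ (2 * d + 1) * nrm v s (D.G u₁ b) ≤ r * K * (K * (m * δ)) := by
    have e1 := congrFun (D.adjugate_mulVec_h u₁) b
    rw [Pi.smul_apply, smul_eq_mul, hDd] at e1
    rw [← nrm_X_pow_mul, ← e1, hDM]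
    exact nrm_mulVec_le (hbound.nrm_adjugate_le hx) h1 b
  rw [NewtonData.Ψ, Pi.sub_apply, sub_sub_cancel_left, nrm_neg, Pi.smul_apply, smul_eq_mul]
  calc _ ≤ L * ((s ^ (2 * d + 1))⁻¹ * (r * K * (K * (m * δ)))) :=
        (nrm_mul_le _ _).trans (mul_le_mul' hL (le_inv_mul_of_mul_le (ENNReal.pow_pos hs0 _)
          (ENNReal.pow_ne_top hs1) h2))
    _ = _ := by ring

/-- Near a given convergent solution, and for all sufficiently small radii `s`, the solution of
convergent equations depends continuously on the base point with respect to the `s`-norm. -/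
theorem IsAdmissible.exists_continuous {x₀ : Fin m × ℕ → k} (hx₀ : IsAdmissible h c d x₀)
    (hconv : ∀ i, IsConvergent v (series x₀ i)) {u₀ : Fin r → PowerSeries k}
    (hu₀ : ∀ b, IsConvergent v (u₀ b)) :
    ∃ s₀ : ℝ≥0∞, 0 < s₀ ∧ s₀ ≤ 1 ∧ ∀ s, 0 < s → s ≤ s₀ → (∀ i, nrm v s (series x₀ i) ≠ ∞) ∧
      (∀ b, nrm v s (u₀ b) ≠ ∞) ∧ ∃ ε : ℝ≥0∞, 0 < ε ∧ ∀ (x₁ : Fin m × ℕ → k)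
      (u₁ : Fin r → PowerSeries k), (∀ a, evalAt (addTail c d x₁ u₁) (h a).1 = 0) →
      (∀ i, nrm v s (series x₁ i - series x₀ i) ≤ ε) → (∀ b, nrm v s (u₁ b - u₀ b) ≤ 1) →
      ∀ η : ℝ≥0∞, 0 < η → ∃ δ : ℝ≥0∞, 0 < δ ∧ ∀ (x : Fin m × ℕ → k) (u : Fin r → PowerSeries k),
      IsAdmissible h c d x → (∀ a, evalAt (addTail c d x u) (h a).1 = 0) →
      (∀ i, nrm v s (series x i - series x₁ i) ≤ δ) → ∀ b, nrm v s (u b - u₁ b) ≤ η := by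
  obtain ⟨D₀, hDd₀, hDh₀, hDM₀, hDE₀⟩ := hx₀.exists_newtonData
  obtain ⟨ρ, K, hρ, hK, hbound⟩ := exists_isNewtonBound h c
  obtain ⟨L, hL, hL'⟩ := (isConvergent_lam hconv hDM₀).eventually_nrm_le
  obtain ⟨R, hR, hR'⟩ := exists_eventually_nrm_le hu₀
  -- a third of `ρ` is reserved for the base point `x₀`, for its perturbation, and for the tails;
  -- these have norm at most `R + 2`, namely `1` more than `u₁`, whose distance to `u₀` is at most `1`
  have hρ3 : 0 < ρ / 3 := ENNReal.div_pos hρ (by simp)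
  have hx3 : ∀ᶠ s in 𝓝[>] (0 : ℝ≥0∞), ∀ i, nrm v s (series x₀ i) ≤ min 1 (ρ / 3) :=
    eventually_all.mpr fun i => (hconv i).eventually_nrm_le_of_pos (constantCoeff_series x₀ i)
      (lt_min one_pos hρ3)
  have htail := eventually_mul_le (C := r * (R + 2)) (by finiteness) hρ3
  have hcontr := eventually_mul_le (C := 2 * L * (r * (r * K * (K * (2 * m * r * (R + 2))))))
    (ε := 2⁻¹) (by finiteness) (by simp)
  obtain ⟨s₀, hs₀, hprop⟩ := exists_of_eventually (hL'.and (hR'.and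
    (hx3.and (htail.and (hcontr.and (eventually_le_of_pos (pos_iff_ne_zero.mpr hρ)))))))
  refine ⟨min s₀ 1, lt_min hs₀ one_pos, min_le_right _ _, fun s hs hs' => ?_⟩
  obtain ⟨h1, h2, h3, h4, h5, h7⟩ := hprop s hs (hs'.trans (min_le_left _ _))
  have hs1 : s ≤ 1 := hs'.trans (min_le_right _ _)
  have hst : s ≠ ∞ := (hs1.trans_lt ENNReal.one_lt_top).ne
  refine ⟨fun i => ne_top_of_le_ne_top ENNReal.one_ne_top ((h3 i).trans (min_le_left _ _)),
    fun b => ne_top_of_le_ne_top hR (h2 b), ?_⟩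
  have hinv : ∀ n : ℕ, (s ^ n)⁻¹ ≠ ∞ := fun n => ENNReal.inv_ne_top.mpr (pow_ne_zero _ hs.ne')
  have hinv1 := hinv d
  have hinv2 := hinv (2 * d + 1)
  have hsmall := eventually_mul_le (C := L * ((s ^ d)⁻¹ * (K * m))) (ε := 2⁻¹)
    (by finiteness) (by simp)
  obtain ⟨ε, hε, h8, h9⟩ := exists_pos_of_eventually (hsmall.and (eventually_le_of_pos hρ3))
  have hε2 : 0 < ε / 2 := ENNReal.div_pos hε.ne' (by simp)
  refine ⟨ε / 2, hε2, fun x₁ u₁ hsol₁ hx₁ hu₁ η hη => ?_⟩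
  have hstep := eventually_mul_le (C := 2 * L * ((s ^ (2 * d + 1))⁻¹ * (r * K * (K * m))))
    (ε := min 1 η / 2) (by finiteness) (ENNReal.div_pos (lt_min one_pos hη).ne' (by simp))
  obtain ⟨δ, hδ, h10, h11⟩ := exists_pos_of_eventually (hstep.and (eventually_le_of_pos hε2))
  refine ⟨δ, hδ, fun x u hx hsol hxx₁ b => ?_⟩
  obtain ⟨D, hDd, hDh, hDM, hDE⟩ := hx.exists_newtonData
  have hclose : ∀ i, nrm v s (series x i - series x₀ i) ≤ ε := fun i =>
    (nrm_sub_le_add _ (series x₁ i) _).trans ((add_le_add ((hxx₁ i).trans h11) (hx₁ i)).trans_eq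
      (ENNReal.add_halves ε))
  have hroom : ∀ z : Fin m × ℕ → k, (∀ i, nrm v s (series z i - series x₀ i) ≤ ε) → ∀ i,
      nrm v s (series z i) + s ^ (d + 1) * (r * (R + 2)) ≤ ρ := by
    intro z hz i
    refine le_trans (add_le_add (b := ρ / 3 + ρ / 3) ?_ (le_trans ?_ h4))
      (ENNReal.add_thirds ρ).le
    · exact (nrm_le_add_sub _ (series x₀ i)).trans
        (add_le_add ((h3 i).trans (min_le_right _ _)) ((hz i).trans h9))
    · rw [pow_succ]
      exact mul_le_mul' (mul_le_of_le_one_left' (pow_le_one' hs1 d)) le_rfl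
  have hu₁R : ∀ b, nrm v s (u₁ b) ≤ R + 1 := fun b =>
    (nrm_le_add_sub _ (u₀ b)).trans (add_le_add (h2 b) (hu₁ b))
  have hu₁R' : ∀ b, nrm v s (u₁ b) ≤ R + 2 := fun b =>
    (hu₁R b).trans (add_le_add le_rfl one_le_two)
  have hroom₁ := hroom x₁ fun i => (hx₁ i).trans ENNReal.half_le_self
  have hroomx := hroom x hclose
  have hroom₀ := hroom x₀ fun i => by simp [nrm_zero]
  have hdisc : InPolydisc v s ρ x := ⟨h7, fun i => le_self_add.trans (hroomx i)⟩
  have hlam : nrm v s D.lam ≤ 2 * L := nrm_lam_le hbound hs hst hDd hDd₀ hDM hDM₀ hdisc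
    ⟨h7, fun i => le_self_add.trans (hroom₀ i)⟩ h1 hclose h8
  have h12 := hbound.nrm_solution_sub_le hDM hDE (u := u) (u₁ := u₁) (R := R + 2)
    (e := min 1 η / 2) (by rw [hDh]; exact funext hsol) h7 hroomx hlam ?_ ?_
    (fun b => (nrm_newtonStep_le hbound hs hst hDd hDh hDM hsol₁ hdisc
      (.addTail h7 hroomx hu₁R') (.addTail h7 hroom₁ hu₁R') hlam hxx₁ b).trans h10) b
  · rw [ENNReal.mul_div_cancel two_ne_zero ENNReal.ofNat_ne_top] at h12
    exact h12.trans (min_le_right _ _)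
  · refine le_trans (le_of_eq ?_) h5
    ring
  · intro b
    rw [ENNReal.mul_div_cancel two_ne_zero ENNReal.ofNat_ne_top]
    refine (add_le_add (hu₁R b) (min_le_left _ _)).trans_eq ?_
    rw [add_assoc, one_add_one_eq_two]

end Continuity

/-! ### Remainders, quotients and tails of arcs -/

section Division

variable {k : Type*} [Field k] {q : Quality k} {m r n : ℕ} {S S' : Type*} [CommRing S] [CommRing S']

/-- The coordinates of the remainder of a family of arcs. -/
def remOf (c : Fin r → Fin m) (d : ℕ) (x : Fin m × ℕ → S) : RemIndex c d → S :=
  fun p => x (p.1, p.2)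

/-- The coordinates of the quotients by `t^(2d)` of the components `c'` of a family of arcs. -/
def quotOf (c' : Fin n → Fin m) (d : ℕ) (x : Fin m × ℕ → S) : Fin n × ℕ → S :=
  fun p => x (c' p.1, 2 * d + p.2)

/-- The tails of the components `c` of a family of arcs: the quotients by `t^(d+1)`. -/
def tailOf (c : Fin r → Fin m) (d : ℕ) (x : Fin m × ℕ → S) : Fin r → PowerSeries S :=
  fun b => PowerSeries.mk fun j => x (c b, d + j)

/-- The family of arcs with remainder `z`, quotients `w` in the components `c'`, and trivial tails
in the components `c`. -/
def base (c : Fin r → Fin m) (c' : Fin n → Fin m) (d : ℕ) (z : RemIndex c d → S)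
    (w : Fin n × ℕ → S) : Fin m × ℕ → S :=
  fun p => if h : p.2 < remDegree c d p.1 then z ⟨p.1, ⟨p.2, h⟩⟩
    else ∑ l, if c' l = p.1 then w (l, p.2 - 2 * d) else 0

variable {c : Fin r → Fin m} {c' : Fin n → Fin m} {d : ℕ}

theorem comp_base (φ : S →+* S') (z : RemIndex c d → S) (w : Fin n × ℕ → S) :
    φ ∘ base c c' d z w = base c c' d (φ ∘ z) (φ ∘ w) := by
  funext p
  rw [Function.comp_apply, base, base]
  split_ifs
  · rfl
  · rw [map_sum]
    exact Finset.sum_congr rfl fun l _ => by split_ifs <;> simp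

theorem base_sub (z z' : RemIndex c d → S) (w w' : Fin n × ℕ → S) :
    base c c' d z w - base c c' d z' w' = base c c' d (z - z') (w - w') := by
  funext p
  rw [Pi.sub_apply, base, base, base]
  split_ifs
  · rfl
  · rw [← Finset.sum_sub_distrib]
    exact Finset.sum_congr rfl fun l _ => by split_ifs <;> simp

theorem series_sub (x y : Fin m × ℕ → S) (i : Fin m) :
    series (x - y) i = series x i - series y i := by
  ext j
  cases j with
  | zero => simp [constantCoeff_series]
  | succ j => rw [map_sub, coeff_succ_series, coeff_succ_series, coeff_succ_series]; rfl

theorem remDegree_apply (b : Fin r) : remDegree c d (c b) = d := by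
  rw [remDegree, if_pos ⟨b, rfl⟩]

theorem remDegree_le (i : Fin m) : remDegree c d i ≤ 2 * d := by
  rw [remDegree]
  split_ifs <;> lia

theorem base_of_lt (z : RemIndex c d → S) (w : Fin n × ℕ → S) {i : Fin m} {j : ℕ}
    (h : j < remDegree c d i) : base c c' d z w (i, j) = z ⟨i, ⟨j, h⟩⟩ := dif_pos h

theorem base_of_le (z : RemIndex c d → S) (w : Fin n × ℕ → S) {i : Fin m} {j : ℕ}
    (h : remDegree c d i ≤ j) :
    base c c' d z w (i, j) = ∑ l, if c' l = i then w (l, j - 2 * d) else 0 := dif_neg h.not_gt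

theorem mem_seriesRing_of_X_pow_mul {N : ℕ} {f : PowerSeries k}
    (h : PowerSeries.X ^ N * f ∈ seriesRing q Unit) : f ∈ seriesRing q Unit := by
  match q with
  | .formal => exact mem_formal f
  | .convergent v => exact IsConvergent.of_X_pow_mul h rfl
  | .algebraic =>
    have hX : (PowerSeries.X ^ N : PowerSeries k) ∈ seriesRing (Quality.algebraic : Quality k) Unit :=
      (seriesRing _ Unit).pow_mem (X_mem_seriesRing _ ()) N
    exact IsAlgebraic.of_mul (mem_nonZeroDivisors_of_ne_zero (pow_ne_zero N PowerSeries.X_ne_zero))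
      hX h

variable (hcc : Function.Bijective (Sum.elim c c'))

include hcc

theorem injective_of_bijective_sumElim : Function.Injective c := fun a b h =>
  Sum.inl_injective (hcc.1 (a₁ := Sum.inl a) (a₂ := Sum.inl b) h)

theorem injective_right_of_bijective_sumElim : Function.Injective c' := fun a b h =>
  Sum.inr_injective (hcc.1 (a₁ := Sum.inr a) (a₂ := Sum.inr b) h)

theorem ne_of_bijective_sumElim (b : Fin r) (l : Fin n) : c b ≠ c' l := fun h => by
  simpa using hcc.1 (a₁ := Sum.inl b) (a₂ := Sum.inr l) h

theorem notMem_range_of_bijective_sumElim (l : Fin n) : c' l ∉ Set.range c := by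
  rintro ⟨b, hb⟩
  exact ne_of_bijective_sumElim hcc b l hb

theorem remDegree_apply_right (l : Fin n) : remDegree c d (c' l) = 2 * d := by
  rw [remDegree, if_neg (notMem_range_of_bijective_sumElim hcc l)]

theorem sum_ite_left {R : Type*} [AddCommMonoid R] (F : Fin n → R) (b : Fin r) :
    ∑ l, (if c' l = c b then F l else 0) = 0 :=
  Finset.sum_eq_zero fun l _ => if_neg (ne_of_bijective_sumElim hcc b l).symm

theorem sum_ite_right {R : Type*} [AddCommMonoid R] (F : Fin n → R) (l : Fin n) :
    ∑ l', (if c' l' = c' l then F l' else 0) = F l := by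
  rw [Finset.sum_eq_single l]
  · rw [if_pos rfl]
  · intro l' _ hl
    rw [if_neg fun h => hl (injective_right_of_bijective_sumElim hcc h)]
  · simp

theorem addTail_base (x : Fin m × ℕ → S) :
    addTail c d (base c c' d (remOf c d x) (quotOf c' d x)) (tailOf c d x) = x := by
  funext ⟨i, j⟩
  obtain ⟨b | l, hi⟩ := hcc.2 i
  · obtain rfl : c b = i := hi
    have hdeg := remDegree_apply (c := c) (d := d) b
    rw [addTail, spread_apply (injective_of_bijective_sumElim hcc)]
    by_cases hj : j < d
    · rw [base_of_lt _ _ (by lia), if_neg (by lia), add_zero]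
      rfl
    · rw [base_of_le _ _ (by lia), sum_ite_left hcc, if_pos (by lia), zero_add, tailOf,
        PowerSeries.coeff_mk]
      congr 2
      lia
  · obtain rfl : c' l = i := hi
    have hdeg := remDegree_apply_right (d := d) hcc l
    rw [addTail, spread_of_notMem _ (notMem_range_of_bijective_sumElim hcc l), map_zero, ite_self,
      add_zero]
    by_cases hj : j < 2 * d
    · rw [base_of_lt _ _ (by lia)]
      rfl
    · rw [base_of_le _ _ (by lia), sum_ite_right hcc, quotOf]
      congr 2
      lia

theorem remOf_addTail_base (z : RemIndex c d → S) (w : Fin n × ℕ → S) (u : Fin r → PowerSeries S) :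
    remOf c d (addTail c d (base c c' d z w) u) = z := by
  funext ⟨i, j⟩
  rw [remOf, addTail, base_of_lt _ _ j.2]
  obtain ⟨b | l, hi⟩ := hcc.2 i
  · have h1 : remDegree c d i = d := by
      rw [← hi]
      exact remDegree_apply b
    rw [if_neg (by have := j.2; dsimp only; lia), add_zero]
  · have hi' : i ∉ Set.range c := by
      rw [← hi]
      exact notMem_range_of_bijective_sumElim hcc l
    rw [spread_of_notMem _ hi', map_zero, ite_self, add_zero]

theorem quotOf_addTail_base (z : RemIndex c d → S) (w : Fin n × ℕ → S) (u : Fin r → PowerSeries S) :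
    quotOf c' d (addTail c d (base c c' d z w) u) = w := by
  funext ⟨l, j⟩
  have hdeg := remDegree_apply_right (d := d) hcc l
  rw [quotOf, addTail, base_of_le _ _ (by dsimp only; lia), sum_ite_right hcc,
    spread_of_notMem _ (notMem_range_of_bijective_sumElim hcc l), map_zero, ite_self, add_zero]
  congr 2
  simp

theorem X_pow_dvd_series_base_sub (z : RemIndex c d → S) (w w' : Fin n × ℕ → S) (i : Fin m) :
    PowerSeries.X ^ (2 * d + 1) ∣
      series (base c c' d z w) i - series (base c c' d z w') i := by
  rw [← series_sub, base_sub, sub_self, PowerSeries.X_pow_dvd_iff]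
  intro j hj
  cases j with
  | zero => rw [PowerSeries.coeff_zero_eq_constantCoeff_apply, constantCoeff_series]
  | succ j =>
    rw [coeff_succ_series, base]
    split_ifs with h
    · rfl
    · obtain ⟨b | l, hi⟩ := hcc.2 i
      · obtain rfl : c b = i := hi
        exact sum_ite_left hcc _ b
      · obtain rfl : c' l = i := hi
        have := remDegree_apply_right (d := d) hcc l
        lia

theorem series_base (z : RemIndex c d → S) (w : Fin n × ℕ → S) (i : Fin m) :
    series (base c c' d z w) i =
      ∑ j : Fin (remDegree c d i), PowerSeries.C (z ⟨i, j⟩) * PowerSeries.X ^ (j.1 + 1) +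
        ∑ l, if c' l = i then PowerSeries.X ^ (2 * d) * series w l else 0 := by
  have h1 : ∀ N, PowerSeries.coeff N (∑ j : Fin (remDegree c d i),
      PowerSeries.C (z ⟨i, j⟩) * PowerSeries.X ^ (j.1 + 1)) =
      ∑ j : Fin (remDegree c d i), if N = j.1 + 1 then z ⟨i, j⟩ else 0 := by
    intro N
    rw [map_sum]
    refine Finset.sum_congr rfl fun j _ => ?_
    rw [PowerSeries.coeff_C_mul, PowerSeries.coeff_X_pow, mul_ite, mul_one, mul_zero]
  have h2 : ∀ N, PowerSeries.coeff N (∑ l, if c' l = i then PowerSeries.X ^ (2 * d) * series w l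
      else 0) = ∑ l, if c' l = i then PowerSeries.coeff N (PowerSeries.X ^ (2 * d) * series w l)
      else 0 := by
    intro N
    rw [map_sum]
    exact Finset.sum_congr rfl fun l _ => by split_ifs <;> simp
  ext N
  rw [map_add, h1, h2]
  cases N with
  | zero =>
    rw [PowerSeries.coeff_zero_eq_constantCoeff_apply, constantCoeff_series]
    simp [constantCoeff_series]
  | succ j =>
    rw [coeff_succ_series, base]
    split_ifs with h
    · rw [Finset.sum_eq_single (⟨j, h⟩ : Fin (remDegree c d i)), if_pos rfl]
      · rw [Finset.sum_eq_zero, add_zero]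
        intro l _
        split_ifs with hl
        · rw [PowerSeries.coeff_X_pow_mul']
          split_ifs with h3
          · have h4 := remDegree_le (c := c) (d := d) i
            have h5 : j + 1 - 2 * d = 0 := by lia
            rw [h5, PowerSeries.coeff_zero_eq_constantCoeff_apply, constantCoeff_series]
          · rfl
        · rfl
      · intro j' _ hj'
        rw [if_neg]
        intro h3
        exact hj' (Fin.ext (by simpa using h3.symm))
      · simp
    · rw [Finset.sum_eq_zero (s := (Finset.univ : Finset (Fin (remDegree c d i)))), zero_add]
      · refine Finset.sum_congr rfl fun l _ => ?_
        split_ifs with hl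
        · have h4 := remDegree_apply_right (d := d) hcc l
          rw [hl] at h4
          rw [PowerSeries.coeff_X_pow_mul', if_pos (by lia),
            show j + 1 - 2 * d = (j - 2 * d) + 1 by lia, coeff_succ_series]
        · rfl
      · intro j' _
        rw [if_neg]
        have := j'.2
        lia

theorem series_base_mem (z : RemIndex c d → k) {w : Fin n × ℕ → k}
    (hw : ∀ l, series w l ∈ seriesRing q Unit) (i : Fin m) :
    series (base c c' d z w) i ∈ seriesRing q Unit := by
  have hX : (PowerSeries.X : PowerSeries k) ∈ seriesRing q Unit := X_mem_seriesRing q ()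
  have hC : ∀ a : k, (PowerSeries.C a : PowerSeries k) ∈ seriesRing q Unit := fun a =>
    C_mem_seriesRing q a
  rw [series_base hcc]
  refine (seriesRing q Unit).add_mem ((seriesRing q Unit).sum_mem fun j _ =>
    (seriesRing q Unit).mul_mem (hC _) ((seriesRing q Unit).pow_mem hX _))
    ((seriesRing q Unit).sum_mem fun l _ => ?_)
  split_ifs
  · exact (seriesRing q Unit).mul_mem ((seriesRing q Unit).pow_mem hX _) (hw l)
  · exact (seriesRing q Unit).zero_mem

theorem series_quotOf_mem {x : Fin m × ℕ → k} (hx : ∀ i, series x i ∈ seriesRing q Unit)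
    (l : Fin n) : series (quotOf c' d x) l ∈ seriesRing q Unit := by
  refine mem_seriesRing_of_X_pow_mul (N := 2 * d) ?_
  have hX : (PowerSeries.X : PowerSeries k) ∈ seriesRing q Unit := X_mem_seriesRing q ()
  have hC : ∀ a : k, (PowerSeries.C a : PowerSeries k) ∈ seriesRing q Unit := fun a =>
    C_mem_seriesRing q a
  have h1 : series x (c' l) = series (base c c' d (remOf c d x) (quotOf c' d x)) (c' l) := by
    conv_lhs => rw [← addTail_base (d := d) hcc x]
    rw [series_addTail, spread_of_notMem _ (notMem_range_of_bijective_sumElim hcc l), mul_zero,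
      add_zero]
  have h2 := hx (c' l)
  rw [h1, series_base hcc, sum_ite_right hcc (fun l => _)] at h2
  refine ((seriesRing q Unit).add_mem_cancel_left ((seriesRing q Unit).sum_mem fun j _ =>
    (seriesRing q Unit).mul_mem (hC _) ((seriesRing q Unit).pow_mem hX _))).mp h2

end Division

/-! ### Rational functions and textile maps -/

section RationalFunctions

variable {k : Type*} [Field k] {X ι : Type*}

/-- The algebra of functions on `X` that are quotients of two polynomials in the coordinates, with a
denominator vanishing nowhere on `X`. -/
def rationalFunctions (cX : X → ι → k) : Subalgebra k (X → k) where
  carrier := {φ | ∃ P Q : MvPolynomial ι k, ∀ x : X, MvPolynomial.eval (cX x) Q ≠ 0 ∧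
    φ x = MvPolynomial.eval (cX x) P / MvPolynomial.eval (cX x) Q}
  mul_mem' := by
    rintro φ ψ ⟨P, Q, h⟩ ⟨P', Q', h'⟩
    refine ⟨P * P', Q * Q', fun x => ⟨?_, ?_⟩⟩
    · rw [map_mul]
      exact mul_ne_zero (h x).1 (h' x).1
    · rw [map_mul, map_mul, Pi.mul_apply, (h x).2, (h' x).2, div_mul_div_comm]
  add_mem' := by
    rintro φ ψ ⟨P, Q, h⟩ ⟨P', Q', h'⟩
    refine ⟨P * Q' + Q * P', Q * Q', fun x => ⟨?_, ?_⟩⟩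
    · rw [map_mul]
      exact mul_ne_zero (h x).1 (h' x).1
    · rw [map_mul, map_add, map_mul, map_mul, Pi.add_apply, (h x).2, (h' x).2,
        div_add_div _ _ (h x).1 (h' x).1]
  algebraMap_mem' a := ⟨MvPolynomial.C a, 1, fun x => ⟨by simp, by simp⟩⟩

variable {cX : X → ι → k}

/-- The coordinate functions. -/
def coordFun (cX : X → ι → k) (l : ι) : rationalFunctions cX :=
  ⟨fun x => cX x l, MvPolynomial.X l, 1, fun x => ⟨by simp, by simp⟩⟩

/-- The value of rational functions at a point. -/
def valueAt (cX : X → ι → k) (x : X) : rationalFunctions cX →ₐ[k] k :=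
  (Pi.evalAlgHom k (fun _ => k) x).comp (Subalgebra.val _)

theorem isUnit_rationalFunctions {φ : rationalFunctions cX} (hφ : ∀ x, valueAt cX x φ ≠ 0) :
    IsUnit φ := by
  obtain ⟨P, Q, h⟩ := φ.2
  have hP : ∀ x, MvPolynomial.eval (cX x) P ≠ 0 := fun x hx => hφ x ((h x).2.trans (by
    rw [hx, zero_div]))
  refine IsUnit.of_mul_eq_one ⟨fun x => (φ.1 x)⁻¹, Q, P, fun x => ⟨hP x, ?_⟩⟩ ?_
  · beta_reduce
    rw [(h x).2, inv_div]
  · refine Subtype.ext (funext fun x => ?_)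
    exact mul_inv_cancel₀ (hφ x)

theorem rationalFunctions_ext {φ ψ : rationalFunctions cX}
    (h : ∀ x, valueAt cX x φ = valueAt cX x ψ) : φ = ψ :=
  Subtype.ext (funext h)

variable {q : Quality k} {m r d : ℕ} {h : Fin r → SeriesB q m} {c : Fin r → Fin m}

section Solution

variable {S S' : Type*} [CommRing S] [Algebra k S] [CommRing S'] [Algebra k S']
  {x : Fin m × ℕ → S}

/-- The tails that complete an admissible base point to a solution of `h = 0`. -/
def IsAdmissible.solution (hx : IsAdmissible h c d x) : Fin r → PowerSeries S :=
  hx.existsUnique.choose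

theorem IsAdmissible.evalAt_solution (hx : IsAdmissible h c d x) (a : Fin r) :
    evalAt (addTail c d x hx.solution) (h a).1 = 0 :=
  hx.existsUnique.choose_spec.1 a

theorem IsAdmissible.eq_solution (hx : IsAdmissible h c d x) {u : Fin r → PowerSeries S}
    (hu : ∀ a, evalAt (addTail c d x u) (h a).1 = 0) : u = hx.solution :=
  hx.existsUnique.choose_spec.2 u hu

/-- Solutions are compatible with base change. -/
theorem IsAdmissible.comp_addTail_solution (hx : IsAdmissible h c d x) (φ : S →ₐ[k] S')
    (hx' : IsAdmissible h c d (φ ∘ x)) :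
    φ ∘ addTail c d x hx.solution = addTail c d (φ ∘ x) hx'.solution := by
  have h1 : φ ∘ addTail c d x hx.solution = addTail c d (φ ∘ x)
      (fun b => PowerSeries.map (φ : S →+* S') (hx.solution b)) :=
    comp_addTail (φ : S →+* S') c d x hx.solution
  rw [h1]
  congr 1
  refine hx'.eq_solution fun a => ?_
  rw [← h1, ← map_evalAt, hx.evalAt_solution, map_zero]

end Solution

/-- If the base point depends rationally on parameters, so does the solution. -/
theorem exists_rational_solution {x : Fin m × ℕ → rationalFunctions cX}
    (hx : ∀ p, IsAdmissible h c d (valueAt cX p ∘ x)) :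
    ∃ y : Fin m × ℕ → rationalFunctions cX, ∀ p,
      valueAt cX p ∘ y = addTail c d (valueAt cX p ∘ x) (hx p).solution := by
  have hcoeff : ∀ p (f : MvPowerSeries (Option (Fin m)) k) j,
      valueAt cX p (PowerSeries.coeff j (evalAt x f)) =
      PowerSeries.coeff j (evalAt (valueAt cX p ∘ x) f) := by
    intro p f j
    rw [← map_evalAt, PowerSeries.coeff_map]
    rfl
  have hadm : IsAdmissible h c d x := by
    refine ⟨fun j hj => rationalFunctions_ext fun p => ?_, isUnit_rationalFunctions fun p => ?_,
      fun a j hj => rationalFunctions_ext fun p => ?_⟩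
    · rw [hcoeff, (hx p).coeff_lt j hj, map_zero]
    · rw [hcoeff]
      exact (hx p).isUnit_coeff.ne_zero
    · rw [hcoeff, (hx p).coeff_adjVec a j hj, map_zero]
  exact ⟨addTail c d x hadm.solution, fun p => hadm.comp_addTail_solution (valueAt cX p) (hx p)⟩

/-- Conditions on finitely many coefficients of the values of series at arcs whose coordinates are
polynomials define locally closed sets. -/
theorem isPolyLocallyClosed_of_coeff (cX : X → ι → k) (x : Fin m × ℕ → MvPolynomial ι k)
    (A : Set (MvPowerSeries (Option (Fin m)) k × ℕ)) (g : MvPowerSeries (Option (Fin m)) k) (d : ℕ)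
    (B : Set (MvPolynomial ι k)) :
    IsPolyLocallyClosed cX {p | (∀ F ∈ A, PowerSeries.coeff F.2
        (evalAt (MvPolynomial.eval (cX p) ∘ x) F.1) = 0) ∧
      PowerSeries.coeff d (evalAt (MvPolynomial.eval (cX p) ∘ x) g) ≠ 0 ∧
      ∀ P ∈ B, MvPolynomial.eval (cX p) P = 0} := by
  have hcoeff : ∀ p (f : MvPowerSeries (Option (Fin m)) k) j,
      MvPolynomial.eval (cX p) (PowerSeries.coeff j (evalAt x f)) =
      PowerSeries.coeff j (evalAt (MvPolynomial.eval (cX p) ∘ x) f) := by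
    intro p f j
    have h1 := congrArg (PowerSeries.coeff j) 
      (map_evalAt (MvPolynomial.aeval (R := k) (S₁ := k) (cX p)) x f)
    rw [PowerSeries.coeff_map] at h1
    exact h1
  refine ⟨(fun F => PowerSeries.coeff F.2 (evalAt x F.1)) '' A ∪ B,
    {PowerSeries.coeff d (evalAt x g)}, ?_⟩
  ext p
  simp only [Set.mem_ofPred_eq, Set.mem_sdiff, Set.mem_union, Set.mem_singleton_iff, forall_eq,
    or_imp, forall_and, Set.forall_mem_image, hcoeff]
  tauto

end RationalFunctions

/-! ### Factorization of sets that are unions of fibres of the remainder map -/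

section Factorization

variable {k : Type*} [Field k] {q : Quality k} {m r n d : ℕ} {h : Fin r → SeriesB q m}
  {c : Fin r → Fin m} {c' : Fin n → Fin m}

theorem mem_stratum_iff {y : Arc q m} : y ∈ stratum (variety h) (minor h c) d ↔
    (∀ a, evalAt y.coords (h a).1 = 0) ∧
      (∀ j < d, PowerSeries.coeff j (evalAt y.coords (minor h c)) = 0) ∧
      PowerSeries.coeff d (evalAt y.coords (minor h c)) ≠ 0 := by
  change (∀ a, y.eval _ = 0) ∧ _ ↔ _
  rw [PowerSeries.order_eq_nat]
  simp only [Arc.eval_eq_evalAt]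
  tauto

/-- The base point of an arc, with respect to the columns `c` and `c'`. -/
def Arc.basePoint (c : Fin r → Fin m) (c' : Fin n → Fin m) (d : ℕ) (y : Arc q m) : Fin m × ℕ → k :=
  base c c' d (remOf c d y.coords) (quotOf c' d y.coords)

theorem isAdmissible_basePoint (hcc : Function.Bijective (Sum.elim c c')) {y : Arc q m}
    (hy : y ∈ stratum (variety h) (minor h c) d) : IsAdmissible h c d (y.basePoint c c' d) := by
  obtain ⟨h1, h2, h3⟩ := mem_stratum_iff.mp hy
  rw [← addTail_base (d := d) hcc y.coords] at h1 h2 h3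
  exact isAdmissible_of_evalAt_eq_zero h1 h2 h3.isUnit

theorem tailOf_eq_solution (hcc : Function.Bijective (Sum.elim c c')) {y : Arc q m}
    (hy : y ∈ stratum (variety h) (minor h c) d) :
    tailOf c d y.coords = (isAdmissible_basePoint hcc hy).solution := by
  obtain ⟨h1, -, -⟩ := mem_stratum_iff.mp hy
  rw [← addTail_base (d := d) hcc y.coords] at h1
  exact (isAdmissible_basePoint hcc hy).eq_solution h1

theorem coords_eq_addTail_solution (hcc : Function.Bijective (Sum.elim c c')) {y : Arc q m}
    (hy : y ∈ stratum (variety h) (minor h c) d) {x : Fin m × ℕ → k} (hxy : x = y.basePoint c c' d)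
    (hx : IsAdmissible h c d x) : y.coords = addTail c d x hx.solution := by
  subst hxy
  rw [← tailOf_eq_solution hcc hy]
  exact (addTail_base hcc y.coords).symm

/-- The solution at an admissible base point of quality `q` has quality `q`. -/
theorem exists_mem_stratum [PerfectField k] (hcc : Function.Bijective (Sum.elim c c'))
    {z : RemIndex c d → k} {w : Arc q n} (hx : IsAdmissible h c d (base c c' d z w.coords)) :
    ∃ y ∈ stratum (variety h) (minor h c) d,
      remainder c d y = z ∧ quotOf c' d y.coords = w.coords := by
  have hw : ∀ l, series w.coords l ∈ seriesRing q Unit := fun l => by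
    rw [w.series_coords]
    exact (w.2 l).1
  have hbase := series_base_mem hcc z hw
  obtain ⟨y, hy⟩ : ∃ y, y = addTail c d (base c c' d z w.coords) hx.solution := ⟨_, rfl⟩
  have hsol : ∀ a, evalAt y (h a).1 = 0 := fun a => by rw [hy, hx.evalAt_solution]
  have hdvd : ∀ i, PowerSeries.X ^ (d + 1) ∣ series (base c c' d z w.coords) i - series y i := by
    intro i
    rw [hy, series_addTail, sub_add_cancel_left, dvd_neg]
    exact dvd_mul_right _ _
  have hlt : ∀ j < d, PowerSeries.coeff j (evalAt y (minor h c)) = 0 := fun j hj => by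
    rw [← coeff_evalAt_congr hdvd _ (by lia), hx.coeff_lt j hj]
  have hd : PowerSeries.coeff d (evalAt y (minor h c)) ≠ 0 := by
    rw [← coeff_evalAt_congr hdvd _ (by lia)]
    exact hx.isUnit_coeff.ne_zero
  have hmem : ∀ i, series y i ∈ seriesRing q Unit := by
    match q with
    | .formal => exact fun i => mem_formal _
    | .convergent v =>
      intro i
      rw [hy, series_addTail]
      have h1 := hx.isConvergent_solution hbase hx.evalAt_solution
      refine (seriesRing (Quality.convergent v) Unit).add_mem (hbase i)
        ((seriesRing (Quality.convergent v) Unit).mul_mem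
        ((seriesRing (Quality.convergent v) Unit).pow_mem (X_mem_seriesRing _ ()) _) ?_)
      refine (seriesRing (Quality.convergent v) Unit).sum_mem fun b _ => ?_
      split_ifs
      · exact h1 b
      · exact (seriesRing (Quality.convergent v) Unit).zero_mem
    | .algebraic =>
      refine fun i => mem_algebraic_of_minor_ne_zero (injective_of_bijective_sumElim hcc)
        hsol (fun h0 => hd ?_) (fun i hi => ?_) i
      · rw [h0, map_zero]
      · rw [hy, series_addTail, spread_of_notMem _ hi, mul_zero, add_zero]
        exact hbase i
  refine ⟨Arc.ofCoords y hmem, mem_stratum_iff.mpr ?_, ?_, ?_⟩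
  · rw [Arc.coords_ofCoords]
    exact ⟨hsol, hlt, hd⟩
  · change remOf c d (Arc.ofCoords y hmem).coords = z
    rw [Arc.coords_ofCoords, hy]
    exact remOf_addTail_base hcc z _ _
  · rw [Arc.coords_ofCoords, hy]
    exact quotOf_addTail_base hcc z _ _

theorem IsAdmissible.base_congr (hcc : Function.Bijective (Sum.elim c c')) {S : Type*} [CommRing S]
    [Algebra k S] {z : RemIndex c d → S} {w : Fin n × ℕ → S}
    (hx : IsAdmissible h c d (base c c' d z w)) (w' : Fin n × ℕ → S) :
    IsAdmissible h c d (base c c' d z w') :=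
  hx.congr (X_pow_dvd_series_base_sub hcc z w w')

variable {U : Set (Arc q m)}

/-- A union of fibres of the remainder map is the product of its image with a space of arcs. -/
theorem exists_equiv_prod [PerfectField k] (hcc : Function.Bijective (Sum.elim c c'))
    (hU : U ⊆ stratum (variety h) (minor h c) d)
    (hfib : ∀ y ∈ U, ∀ y' ∈ stratum (variety h) (minor h c) d,
      remainder c d y = remainder c d y' → y' ∈ U) :
    ∃ Φ : U ≃ (remainder c d '' U) × Arc q n, (∀ y, (Φ y).1.1 = remainder c d y.1) ∧
      ∀ y, (Φ y).2.coords = quotOf c' d y.1.coords := by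
  have hmem : ∀ (y : Arc q m) i, series y.coords i ∈ seriesRing q Unit := fun y i => by
    rw [y.series_coords]
    exact (y.2 i).1
  let Φ₀ : U → (remainder c d '' U) × Arc q n := fun y =>
    (⟨remainder c d y.1, y.1, y.2, rfl⟩,
      Arc.ofCoords (quotOf c' d y.1.coords) (series_quotOf_mem hcc (hmem y.1)))
  have hΦ₂ : ∀ y, (Φ₀ y).2.coords = quotOf c' d y.1.coords := fun y =>
    Arc.coords_ofCoords _ (series_quotOf_mem hcc (hmem y.1))
  refine ⟨Equiv.ofBijective Φ₀ ⟨fun y y' hyy => ?_, ?_⟩, fun _ => rfl, hΦ₂⟩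
  · have h1 : remainder c d y.1 = remainder c d y'.1 := congrArg (fun w => w.1.1) hyy
    have h2 : quotOf c' d y.1.coords = quotOf c' d y'.1.coords := by
      rw [← hΦ₂, ← hΦ₂, hyy]
    have h3 : y.1.basePoint c c' d = y'.1.basePoint c c' d :=
      congrArg₂ (base c c' d) h1 h2
    have hadm := isAdmissible_basePoint hcc (hU y.2)
    exact Subtype.ext (Arc.ext_coords ((coords_eq_addTail_solution hcc (hU y.2) rfl hadm).trans
      (coords_eq_addTail_solution hcc (hU y'.2) h3 hadm).symm))
  · rintro ⟨⟨z, y₀, hy₀, rfl⟩, w⟩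
    obtain ⟨y, hy, hy1, hy2⟩ := exists_mem_stratum hcc
      ((isAdmissible_basePoint hcc (hU hy₀)).base_congr hcc w.coords)
    refine ⟨⟨y, hfib y₀ hy₀ y hy hy1.symm⟩, Prod.ext (Subtype.ext hy1) (Arc.ext_coords ?_)⟩
    rw [hΦ₂, hy2]

/-- The inverse of the factorization is rationally textile, since its values are solutions of
equations with parameters in the algebra of rational functions. -/
theorem isRationallyTextile_symm (hcc : Function.Bijective (Sum.elim c c'))
    (hU : U ⊆ stratum (variety h) (minor h c) d) {Z : Set (RemIndex c d → k)} (Φ : U ≃ Z × Arc q n)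
    (hΦ₁ : ∀ y, (Φ y).1.1 = remainder c d y.1) (hΦ₂ : ∀ y, (Φ y).2.coords = quotOf c' d y.1.coords) :
    IsRationallyTextile prodCoords (fun y : U => y.1.coords) Φ.symm := by
  let cX : Z × Arc q n → RemIndex c d ⊕ Fin n × ℕ → k := prodCoords
  let x : Fin m × ℕ → rationalFunctions cX :=
    base c c' d (fun p => coordFun cX (Sum.inl p)) (fun p => coordFun cX (Sum.inr p))
  have hx : ∀ p, valueAt cX p ∘ x = (Φ.symm p).1.basePoint c c' d := by
    intro p
    refine (comp_base (valueAt cX p : rationalFunctions cX →+* k) _ _).trans ?_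
    rw [Arc.basePoint, ← hΦ₂, Equiv.apply_symm_apply]
    congr 1
    have h1 := hΦ₁ (Φ.symm p)
    rw [Equiv.apply_symm_apply] at h1
    exact h1
  have hadm : ∀ p, IsAdmissible h c d (valueAt cX p ∘ x) := fun p => by
    rw [hx]
    exact isAdmissible_basePoint hcc (hU (Φ.symm p).2)
  obtain ⟨y, hy⟩ := exists_rational_solution hadm
  intro l
  obtain ⟨P, Q, hPQ⟩ := (y l).2
  refine ⟨P, Q, fun p => ⟨(hPQ p).1, ?_⟩⟩
  change (Φ.symm p).1.coords l = _
  rw [← (hPQ p).2, coords_eq_addTail_solution hcc (hU (Φ.symm p).2) (hx p) (hadm p), ← hy]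
  rfl

theorem isRationallyTextile_of_coords {Z : Set (RemIndex c d → k)} (Φ : U → Z × Arc q n)
    (hΦ₁ : ∀ y, (Φ y).1.1 = remainder c d y.1) (hΦ₂ : ∀ y, (Φ y).2.coords = quotOf c' d y.1.coords) :
    IsRationallyTextile (fun y : U => y.1.coords) prodCoords Φ := by
  rintro (p | p)
  · refine ⟨MvPolynomial.X (p.1, p.2), 1, fun y => ⟨by simp, ?_⟩⟩
    rw [map_one, div_one, MvPolynomial.eval_X]
    exact congrFun (hΦ₁ y) p
  · refine ⟨MvPolynomial.X (c' p.1, 2 * d + p.2), 1, fun y => ⟨by simp, ?_⟩⟩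
    rw [map_one, div_one, MvPolynomial.eval_X]
    exact congrFun (hΦ₂ y) p

variable {α : Type*} (f : α → MvPowerSeries (Option (Fin m)) k)

theorem isPolyLocallyClosed_stratum :
    IsPolyLocallyClosed Arc.coords
      {y | y ∈ stratum (variety h) (minor h c) d ∧ ∀ a, y.eval (f a) = 0} := by
  have h1 := isPolyLocallyClosed_of_coeff (Arc.coords : Arc q m → _) MvPolynomial.X
    {F | (∃ a, F.1 = (h a).1) ∨ (∃ a, F.1 = f a) ∨ (F.1 = minor h c ∧ F.2 < d)} (minor h c) d ∅
  convert h1 using 1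
  ext y
  have hX : (MvPolynomial.eval y.coords : MvPolynomial (Fin m × ℕ) k → k) ∘ MvPolynomial.X =
      y.coords := funext fun l => MvPolynomial.eval_X l
  have hcoeff : ∀ g : MvPowerSeries (Option (Fin m)) k, (∀ j, PowerSeries.coeff j
      (evalAt y.coords g) = 0) ↔ evalAt y.coords g = 0 := fun g =>
    ⟨fun h => PowerSeries.ext fun j => by rw [h j, map_zero], fun h j => by rw [h, map_zero]⟩
  simp only [Set.mem_ofPred_eq, mem_stratum_iff, hX, Arc.eval_eq_evalAt]
  constructor
  · rintro ⟨⟨h2, h3, h4⟩, h5⟩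
    refine ⟨?_, h4, by simp⟩
    rintro ⟨F, j⟩ (⟨a, rfl⟩ | ⟨a, rfl⟩ | ⟨rfl, hj⟩)
    · exact (hcoeff _).mpr (h2 a) j
    · exact (hcoeff _).mpr (h5 a) j
    · exact h3 j hj
  · rintro ⟨h2, h3, -⟩
    exact ⟨⟨fun a => (hcoeff _).mp fun j => h2 (_, j) (Or.inl ⟨a, rfl⟩),
      fun j hj => h2 (_, j) (Or.inr (Or.inr ⟨rfl, hj⟩)), h3⟩,
      fun a => (hcoeff _).mp fun j => h2 (_, j) (Or.inr (Or.inl ⟨a, rfl⟩))⟩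

/-- The set of remainders is locally closed: the remainders of solutions of `h = 0` are defined by
the conditions of admissibility, and on this set the solutions with trivial quotient are given by
rational functions. -/
theorem isPolyLocallyClosed_image_remainder [PerfectField k]
    (hcc : Function.Bijective (Sum.elim c c'))
    (hfib : ∀ y ∈ stratum (variety h) (minor h c) d, ∀ y' ∈ stratum (variety h) (minor h c) d,
      remainder c d y = remainder c d y' → (∀ a, y.eval (f a) = 0) → ∀ a, y'.eval (f a) = 0) :
    IsPolyLocallyClosed id (remainder c d ''
      {y | y ∈ stratum (variety h) (minor h c) d ∧ ∀ a, y.eval (f a) = 0}) := by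
  let X : Set (RemIndex c d → k) := {z | IsAdmissible h c d (base c c' d z 0)}
  let cX : X → RemIndex c d → k := Subtype.val
  let x : Fin m × ℕ → rationalFunctions cX := base c c' d (coordFun cX) 0
  have hx : ∀ p : X, valueAt cX p ∘ x = base c c' d p.1 0 := fun p =>
    (comp_base (valueAt cX p : rationalFunctions cX →+* k) _ _).trans 
      (congrArg (base c c' d p.1) (funext fun l => map_zero (valueAt cX p)))
  have hadm : ∀ p : X, IsAdmissible h c d (valueAt cX p ∘ x) := fun p => by
    rw [hx]
    exact p.2
  obtain ⟨y, hy⟩ := exists_rational_solution hadm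
  choose P Q hPQ using fun a j => (PowerSeries.coeff j (evalAt y (f a))).2
  have hP : ∀ (p : X) a, evalAt (valueAt cX p ∘ y) (f a) = 0 ↔
      ∀ j, MvPolynomial.eval p.1 (P a j) = 0 := by
    intro p a
    rw [← map_evalAt, PowerSeries.ext_iff]
    refine forall_congr' fun j => ?_
    rw [PowerSeries.coeff_map, map_zero]
    have h1 := hPQ a j p
    change (PowerSeries.coeff j (evalAt y (f a))).1 p = 0 ↔ _
    rw [h1.2, div_eq_zero_iff, or_iff_left h1.1]
  have h0 : ∀ l, series (0 : Fin n × ℕ → k) l ∈ seriesRing q Unit := fun l => by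
    have h1 : series (0 : Fin n × ℕ → k) l = 0 := by
      rw [← sub_self (0 : Fin n × ℕ → k), series_sub, sub_self]
    rw [h1]
    exact (seriesRing q Unit).zero_mem
  let w₀ : Arc q n := Arc.ofCoords 0 h0
  have hw₀ : w₀.coords = 0 := Arc.coords_ofCoords _ _
  have h1 := isPolyLocallyClosed_of_coeff (id : (RemIndex c d → k) → _)
    (base c c' d MvPolynomial.X 0)
    {F | (F.1 = minor h c ∧ F.2 < d) ∨ ∃ a, F.1 = adjVec h c a ∧ F.2 < 2 * d + 1} (minor h c) d
    {R | ∃ a j, R = P a j}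
  convert h1 using 1
  ext z
  have hbase : (MvPolynomial.eval (id z) : MvPolynomial (RemIndex c d) k → k) ∘
      base c c' d MvPolynomial.X 0 = base c c' d z 0 :=
    (comp_base (MvPolynomial.eval (id z)) _ _).trans (congrArg₂ _
      (funext fun l => MvPolynomial.eval_X l) (funext fun l => map_zero _))
  have key : z ∈ remainder c d '' {y | y ∈ stratum (variety h) (minor h c) d ∧
      ∀ a, y.eval (f a) = 0} ↔ ∃ hz : z ∈ X, ∀ a j, MvPolynomial.eval z (P a j) = 0 := by
    have hval : ∀ (hz : z ∈ X) (y₁ : Arc q m), y₁ ∈ stratum (variety h) (minor h c) d →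
        remainder c d y₁ = z → quotOf c' d y₁.coords = 0 →
        y₁.coords = valueAt cX ⟨z, hz⟩ ∘ y := by
      intro hz y₁ hy₁ h2 h3
      rw [hy]
      refine coords_eq_addTail_solution hcc hy₁ ?_ _
      rw [hx, Arc.basePoint, h3]
      exact congrArg (fun z => base c c' d z 0) h2.symm
    constructor
    · rintro ⟨y₀, ⟨hy₀, hf⟩, hz⟩
      have hz' : z ∈ X := by
        have h2 := (isAdmissible_basePoint hcc hy₀).base_congr hcc 0
        have h3 : remOf c d y₀.coords = z := hz
        rwa [h3] at h2
      obtain ⟨y₁, hy₁, h2, h3⟩ := exists_mem_stratum (w := w₀) hcc (h := h) (z := z)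
        (by rw [hw₀]; exact hz')
      rw [hw₀] at h3
      refine ⟨hz', fun a => (hP ⟨z, hz'⟩ a).mp ?_⟩
      rw [← hval hz' y₁ hy₁ h2 h3, ← Arc.eval_eq_evalAt]
      exact hfib y₀ hy₀ y₁ hy₁ (hz.trans h2.symm) hf a
    · rintro ⟨hz, hf⟩
      obtain ⟨y₁, hy₁, h2, h3⟩ := exists_mem_stratum (w := w₀) hcc (h := h) (z := z)
        (by rw [hw₀]; exact hz)
      rw [hw₀] at h3
      refine ⟨y₁, ⟨hy₁, fun a => ?_⟩, h2⟩
      rw [Arc.eval_eq_evalAt, hval hz y₁ hy₁ h2 h3]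
      exact (hP ⟨z, hz⟩ a).mpr (hf a)
  rw [key]
  simp only [Set.mem_ofPred_eq, hbase]
  constructor
  · rintro ⟨hz, hf⟩
    refine ⟨?_, hz.isUnit_coeff.ne_zero, ?_⟩
    · rintro ⟨F, j⟩ (⟨rfl, hj⟩ | ⟨a, rfl, hj⟩)
      · exact hz.coeff_lt j hj
      · exact hz.coeff_adjVec a j hj
    · rintro R ⟨a, j, rfl⟩
      exact hf a j
  · rintro ⟨h2, h3, h4⟩
    exact ⟨⟨fun j hj => h2 (_, j) (Or.inl ⟨rfl, hj⟩), h3.isUnit,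
      fun a j hj => h2 (_, j) (Or.inr ⟨a, rfl, hj⟩)⟩, fun a j => h4 _ ⟨a, j, rfl⟩⟩

end Factorization

/-! ### The factorization is a local homeomorphism in the `s`-norms -/

section Homeo

open Filter Topology

variable {k : Type*} [Field k] {v : AbsoluteValue k ℝ} {m r n d : ℕ} {c : Fin r → Fin m}
  {c' : Fin n → Fin m} {t : ℝ≥0∞}

theorem nrm_series_base_quot_le (hcc : Function.Bijective (Sum.elim c c')) (x : Fin m × ℕ → k)
    (i : Fin m) : nrm v t (series (base c c' d (remOf c d x) (quotOf c' d x)) i) ≤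
      nrm v t (series x i) := by
  refine nrm_le_of_coeff fun N => ?_
  cases N with
  | zero =>
    rw [PowerSeries.coeff_zero_eq_constantCoeff_apply, constantCoeff_series, eabs_zero]
    exact zero_le
  | succ j =>
    rw [coeff_succ_series, coeff_succ_series]
    by_cases hj : j < remDegree c d i
    · rw [base_of_lt _ _ hj]
      rfl
    · rw [base_of_le _ _ (not_lt.mp hj)]
      obtain ⟨b | l, hi⟩ := hcc.2 i
      · obtain rfl : c b = i := hi
        rw [sum_ite_left hcc, eabs_zero]
        exact zero_le
      · obtain rfl : c' l = i := hi
        have hdeg := remDegree_apply_right (d := d) hcc l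
        rw [sum_ite_right hcc, quotOf, show 2 * d + (j - 2 * d) = j by lia]

theorem pow_mul_nrm_tailOf_le (x : Fin m × ℕ → k) (b : Fin r) :
    t ^ (d + 1) * nrm v t (tailOf c d x b) ≤ nrm v t (series x (c b)) := by
  rw [← nrm_X_pow_mul]
  refine nrm_le_of_coeff fun N => ?_
  rw [PowerSeries.coeff_X_pow_mul']
  split_ifs with hN
  · obtain ⟨j, rfl⟩ := Nat.exists_eq_add_of_le hN
    rw [show d + 1 + j - (d + 1) = j by lia, show d + 1 + j = (d + j) + 1 by lia, coeff_succ_series,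
      tailOf, PowerSeries.coeff_mk]
  · rw [eabs_zero]
    exact zero_le

theorem pow_mul_nrm_quotOf_le (x : Fin m × ℕ → k) (l : Fin n) :
    t ^ (2 * d) * nrm v t (series (quotOf c' d x) l) ≤ nrm v t (series x (c' l)) := by
  rw [← nrm_X_pow_mul]
  refine nrm_le_of_coeff fun N => ?_
  rw [PowerSeries.coeff_X_pow_mul']
  split_ifs with hN
  · obtain ⟨j, rfl⟩ := Nat.exists_eq_add_of_le hN
    rw [show 2 * d + j - 2 * d = j by lia]
    cases j with
    | zero =>
      rw [PowerSeries.coeff_zero_eq_constantCoeff_apply, constantCoeff_series, eabs_zero]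
      exact zero_le
    | succ j =>
      rw [← add_assoc, coeff_succ_series, coeff_succ_series]
      rfl
  · rw [eabs_zero]
    exact zero_le

theorem nrm_series_base_le (hcc : Function.Bijective (Sum.elim c c')) (ht : t ≤ 1)
    {z : RemIndex c d → k} {w : Fin n × ℕ → k} {M : ℝ≥0∞} (hz : ∀ p, eabs v (z p) ≤ M)
    (hw : ∀ l, nrm v t (series w l) ≤ M) (i : Fin m) :
    nrm v t (series (base c c' d z w) i) ≤ M * (2 * d + n) := by
  rw [series_base hcc]
  refine (nrm_add_le _ _).trans ?_
  rw [mul_add]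
  refine add_le_add ((nrm_sum_le _ _).trans ?_) ((nrm_sum_le _ _).trans ?_)
  · refine (Finset.sum_le_sum (g := fun _ => M) fun j _ => ?_).trans ?_
    · rw [mul_comm, nrm_X_pow_mul]
      refine (mul_le_of_le_one_left' (pow_le_one' ht _)).trans ?_
      exact (wNorm_C _).trans_le (hz _)
    · rw [Finset.sum_const, Finset.card_fin, nsmul_eq_mul, mul_comm]
      gcongr
      exact_mod_cast remDegree_le i
  · refine (Finset.sum_le_sum (g := fun _ => M) fun l _ => ?_).trans_eq ?_
    · split_ifs
      · rw [nrm_X_pow_mul]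
        exact (mul_le_of_le_one_left' (pow_le_one' ht _)).trans (hw l)
      · rw [nrm_zero]
        exact zero_le
    · rw [Finset.sum_const, Finset.card_fin, nsmul_eq_mul, mul_comm]

variable {s : ℝ}

theorem sDist_eq_sum_nrm (hs : 0 < s) {q : Quality k} (y y' : Arc q m) :
    sDist v s y y' = ∑ i, nrm v (ENNReal.ofReal s) (series (y.coords - y'.coords) i) := by
  refine Finset.sum_congr rfl fun i _ => ?_
  rw [sNorm_eq_nrm hs, series_sub, y.series_coords, y'.series_coords]

theorem arcSNorm_eq_sum_nrm (hs : 0 < s) {q : Quality k} (y : Arc q m) :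
    Arc.sNorm v s y = ∑ i, nrm v (ENNReal.ofReal s) (series y.coords i) := by
  refine Finset.sum_congr rfl fun i _ => ?_
  rw [sNorm_eq_nrm hs, y.series_coords]

theorem nrm_le_sDist (hs : 0 < s) {q : Quality k} (y y' : Arc q m) (i : Fin m) :
    nrm v (ENNReal.ofReal s) (series (y.coords - y'.coords) i) ≤ sDist v s y y' := by
  rw [sDist_eq_sum_nrm hs]
  exact Finset.single_le_sum (f := fun i => nrm v (ENNReal.ofReal s)
    (series (y.coords - y'.coords) i)) (fun _ _ => zero_le) (Finset.mem_univ i)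

variable {h : Fin r → SeriesB (Quality.convergent v) m} {U : Set (Arc (Quality.convergent v) m)}

theorem tailOf_sub {S : Type*} [CommRing S] (x x' : Fin m × ℕ → S) (b : Fin r) :
    tailOf c d (x - x') b = tailOf c d x b - tailOf c d x' b := by
  ext j
  simp [tailOf]

theorem isLocalSNormHomeo_of_subset (hcc : Function.Bijective (Sum.elim c c'))
    (hU : U ⊆ stratum (variety h) (minor h c) d) {Z : Set (RemIndex c d → k)}
    (Φ : U ≃ Z × Arc (Quality.convergent v) n) (hΦ₁ : ∀ y, (Φ y).1.1 = remainder c d y.1)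
    (hΦ₂ : ∀ y, (Φ y).2.coords = quotOf c' d y.1.coords) : IsLocalSNormHomeo v Φ := by
  intro y₀
  have hy₀conv : ∀ (w : Arc (Quality.convergent v) n) l, IsConvergent v (series w.coords l) :=
    fun w l => by
      rw [w.series_coords]
      exact (w.2 l).1
  have hadm₀ := isAdmissible_basePoint hcc (hU y₀.2)
  have hconv₀ : ∀ i, IsConvergent v (series (y₀.1.basePoint c c' d) i) :=
    series_base_mem (q := Quality.convergent v) hcc _ fun l => by
      rw [← hΦ₂]
      exact hy₀conv _ l
  have htail₀ : ∀ b, IsConvergent v (tailOf c d y₀.1.coords b) := by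
    rw [tailOf_eq_solution hcc (hU y₀.2)]
    exact hadm₀.isConvergent_solution hconv₀ hadm₀.evalAt_solution
  have hsol : ∀ (y : U) a,
      evalAt (addTail c d (y.1.basePoint c c' d) (tailOf c d y.1.coords)) (h a).1 = 0 := by
    intro y a
    rw [Arc.basePoint, addTail_base hcc]
    exact (mem_stratum_iff.mp (hU y.2)).1 a
  have hbase : ∀ y y' : U, ∀ i, series (y.1.basePoint c c' d) i - series (y'.1.basePoint c c' d) i =
      series (base c c' d (remOf c d (y.1.coords - y'.1.coords))
        (quotOf c' d (y.1.coords - y'.1.coords))) i := by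
    intro y y' i
    rw [← series_sub, Arc.basePoint, Arc.basePoint, base_sub]
    rfl
  obtain ⟨s₁, hs₁0, hs₁1, hs₁⟩ := hadm₀.exists_continuous hconv₀ htail₀
  have hs₁t : s₁ ≠ ∞ := (hs₁1.trans_lt ENNReal.one_lt_top).ne
  refine ⟨s₁.toReal, ENNReal.toReal_pos hs₁0.ne' hs₁t, fun s hs hss => ?_⟩
  obtain ⟨t, ht⟩ : ∃ t, t = ENNReal.ofReal s := ⟨_, rfl⟩
  have ht0 : 0 < t := by rwa [ht, ENNReal.ofReal_pos]
  have hts : t ≤ s₁ := by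
    rw [ht]
    exact ENNReal.ofReal_le_of_le_toReal hss
  have ht1 : t ≤ 1 := hts.trans hs₁1
  have htt : t ≠ ∞ := (ht1.trans_lt ENNReal.one_lt_top).ne
  obtain ⟨hfin₁, hfin₂, ε, hε, hcont⟩ := hs₁ t ht0 hts
  have hy₀fin : Arc.sNorm v s y₀.1 < ⊤ := by
    rw [arcSNorm_eq_sum_nrm hs, ← ht]
    refine ENNReal.sum_lt_top.mpr fun i _ => ?_
    rw [← addTail_base (d := d) hcc y₀.1.coords, series_addTail]
    refine (nrm_add_le _ _).trans_lt (ENNReal.add_lt_top.mpr ⟨(hfin₁ i).lt_top, ?_⟩)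
    rw [nrm_X_pow_mul]
    refine ENNReal.mul_lt_top (ENNReal.pow_ne_top htt).lt_top ?_
    rw [spread]
    refine (nrm_sum_le _ _).trans_lt (ENNReal.sum_lt_top.mpr fun b _ => ?_)
    split_ifs
    · exact (hfin₂ b).lt_top
    · rw [nrm_zero]
      exact ENNReal.zero_lt_top
  have htpow : t ^ (2 * d) ≠ ∞ := ENNReal.pow_ne_top htt
  have htinv : (t ^ (2 * d))⁻¹ ≠ ∞ := ENNReal.inv_ne_top.mpr (pow_ne_zero _ ht0.ne')
  refine ⟨hy₀fin, min ε (t ^ (d + 1)), lt_min hε (ENNReal.pow_pos ht0 _), fun y hy => ⟨?_, ?_, ?_⟩⟩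
  · -- the quotient of an arc of finite norm has finite norm
    rw [arcSNorm_eq_sum_nrm hs, hΦ₂, ← ht]
    refine ENNReal.sum_lt_top.mpr fun l _ => ?_
    refine (le_inv_mul_of_mul_le (ENNReal.pow_pos ht0 (2 * d)) htpow
      (pow_mul_nrm_quotOf_le _ l)).trans_lt (ENNReal.mul_lt_top htinv.lt_top ?_)
    refine (nrm_le_add_sub _ (series y₀.1.coords (c' l))).trans_lt (ENNReal.add_lt_top.mpr ⟨?_, ?_⟩)
    · rw [arcSNorm_eq_sum_nrm hs, ← ht] at hy₀fin
      exact (ENNReal.sum_lt_top.mp hy₀fin) _ (Finset.mem_univ _)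
    · rw [← series_sub, ht]
      exact (nrm_le_sDist hs _ _ _).trans_lt (hy.trans_le le_top)
  · -- `Φ` is a Lipschitz map
    intro η hη
    obtain ⟨η', hη'0, hη'⟩ := exists_between hη
    obtain ⟨δ, hδ, hδ'⟩ := exists_pos_of_eventually
      (eventually_mul_le (C := (t ^ (2 * d))⁻¹ * (n + 1)) (by finiteness) hη'0)
    refine ⟨δ, hδ, fun y' hy' => lt_of_le_of_lt ?_ hη'⟩
    have h1 : ∀ i, nrm v t (series (y'.1.coords - y.1.coords) i) ≤ δ := fun i => by
      rw [ht]
      exact (nrm_le_sDist hs _ _ _).trans hy'.le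
    refine le_trans ?_ hδ'
    refine max_le (iSup_le fun p => ?_) ?_
    · rw [hΦ₁, hΦ₁]
      change eabs v ((y'.1.coords - y.1.coords) (p.1, p.2)) ≤ _
      have h2 := (eabs_coeff_mul_le_nrm (v := v) (s := t) _ (p.2.1 + 1)).trans (h1 p.1)
      rw [coeff_succ_series, mul_comm] at h2
      have h3 : t ^ (2 * d) ≤ t ^ (p.2.1 + 1) := by
        refine pow_le_pow_right_of_le_one' ht1 ?_
        have h4 := remDegree_le (c := c) (d := d) p.1
        have h5 := p.2.2
        lia
      refine (le_inv_mul_of_mul_le (ENNReal.pow_pos ht0 (2 * d)) htpow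
        ((mul_le_mul' h3 le_rfl).trans h2)).trans ?_
      rw [mul_comm]
      gcongr
      exact le_mul_of_one_le_right' le_add_self
    · rw [sDist_eq_sum_nrm hs, hΦ₂, hΦ₂, ← ht]
      have h2 : ∀ l, nrm v t (series (quotOf c' d y'.1.coords - quotOf c' d y.1.coords) l) ≤
          (t ^ (2 * d))⁻¹ * δ := fun l =>
        le_inv_mul_of_mul_le (ENNReal.pow_pos ht0 (2 * d)) htpow
          ((pow_mul_nrm_quotOf_le (y'.1.coords - y.1.coords) l).trans (h1 _))
      refine (Finset.sum_le_sum fun l _ => h2 l).trans ?_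
      rw [Finset.sum_const, Finset.card_fin, nsmul_eq_mul]
      calc (n : ℝ≥0∞) * ((t ^ (2 * d))⁻¹ * δ) = δ * ((t ^ (2 * d))⁻¹ * n) := by ring
        _ ≤ _ := by
          gcongr
          exact le_self_add
  · -- the inverse of `Φ` is given by the solutions at the base points
    intro η hη
    obtain ⟨η', hη'0, hη'⟩ := exists_between hη
    obtain ⟨η₁, hη₁, hη₁'⟩ := exists_pos_of_eventually
      (eventually_mul_le (C := m * (1 + r)) (by finiteness) hη'0)
    have hyd : ∀ i, nrm v t (series (y.1.coords - y₀.1.coords) i) ≤ min ε (t ^ (d + 1)) := fun i => by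
      rw [ht]
      rw [ht] at hy
      exact (nrm_le_sDist hs _ _ _).trans hy.le
    obtain ⟨δ₁, hδ₁, hδ₁'⟩ := hcont (y.1.basePoint c c' d) (tailOf c d y.1.coords) (hsol y)
      (fun i => by
        rw [hbase]
        exact (nrm_series_base_quot_le hcc _ i).trans ((hyd i).trans (min_le_left _ _)))
      (fun b => by
        have h1 := le_inv_mul_of_mul_le (ENNReal.pow_pos ht0 (d + 1)) (ENNReal.pow_ne_top htt)
          ((pow_mul_nrm_tailOf_le _ b).trans ((hyd (c b)).trans (min_le_right _ _)))
        rwa [ENNReal.inv_mul_cancel (pow_ne_zero _ ht0.ne') (ENNReal.pow_ne_top htt),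
          tailOf_sub] at h1) η₁ hη₁
    obtain ⟨δ, hδ, hδ'⟩ := exists_pos_of_eventually
      (eventually_mul_le (C := 2 * d + n) (by finiteness) (lt_min hη₁ hδ₁))
    refine ⟨δ, hδ, fun w hw => lt_of_le_of_lt ?_ hη'⟩
    obtain ⟨y', rfl⟩ := Φ.surjective w
    rw [Equiv.symm_apply_apply]
    have hw' := max_lt_iff.mp hw
    have hx : ∀ i, nrm v t (series (y'.1.basePoint c c' d) i - series (y.1.basePoint c c' d) i) ≤
        min η₁ δ₁ := by
      intro i
      rw [hbase]
      refine (nrm_series_base_le hcc ht1 (fun p => ?_) (fun l => ?_) i).trans hδ'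
      · have h1 := (le_iSup (fun p => ENNReal.ofReal (v ((Φ y').1.1 p - (Φ y).1.1 p))) p).trans
          hw'.1.le
        rw [hΦ₁, hΦ₁] at h1
        exact h1
      · have h1 := (nrm_le_sDist (v := v) hs (Φ y').2 (Φ y).2 l).trans hw'.2.le
        rw [hΦ₂, hΦ₂, ← ht] at h1
        exact h1
    have htail := hδ₁' _ _ (isAdmissible_basePoint hcc (hU y'.2)) (hsol y')
      (fun i => (hx i).trans (min_le_right _ _))
    rw [sDist_eq_sum_nrm hs, ← ht]
    refine (Finset.sum_le_sum (g := fun _ => η₁ * (1 + r)) fun i _ => ?_).trans ?_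
    · rw [series_sub, ← addTail_base (d := d) hcc y'.1.coords, ← addTail_base (d := d) hcc y.1.coords,
        series_addTail, series_addTail, add_sub_add_comm, ← mul_sub, ← spread_sub, mul_add, mul_one]
      refine (nrm_add_le _ _).trans (add_le_add ((hx i).trans (min_le_left _ _)) ?_)
      rw [nrm_X_pow_mul, mul_comm η₁]
      exact (mul_le_of_le_one_left' (pow_le_one' ht1 _)).trans (nrm_spread_le htail i)
    · refine le_trans (le_of_eq ?_) hη₁'
      rw [Finset.sum_const, Finset.card_fin, nsmul_eq_mul]
      ring

end Homeo

/-! ### Factorization of the strata -/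

section Strata

variable {k : Type*} [Field k] {q : Quality k} {m r d : ℕ} {h : Fin r → SeriesB q m}
  {c : Fin r → Fin m}

theorem exists_bijective_sumElim (hc : Function.Injective c) :
    ∃ c' : Fin (m - r) → Fin m, Function.Bijective (Sum.elim c c') := by
  classical
  have hcard : Fintype.card {i // i ∉ Set.range c} = m - r := by
    rw [Fintype.card_subtype_compl, Fintype.card_fin]
    congr 1
    exact (Fintype.card_congr (Equiv.ofInjective c hc)).symm.trans (Fintype.card_fin r)
  let e := (Fintype.equivFinOfCardEq hcard).symm
  refine ⟨fun l => (e l).1, ?_, fun i => ?_⟩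
  · rw [Sum.elim_injective]
    refine ⟨hc, fun l l' hl => e.injective (Subtype.ext hl), fun b l hbl => (e l).2 ⟨b, hbl⟩⟩
  · by_cases hi : i ∈ Set.range c
    · obtain ⟨b, rfl⟩ := hi
      exact ⟨Sum.inl b, rfl⟩
    · exact ⟨Sum.inr (e.symm ⟨i, hi⟩), by simp⟩

theorem isPolyLocallyClosed_empty {X ι : Type*} (cX : X → ι → k) :
    IsPolyLocallyClosed cX (∅ : Set X) :=
  ⟨∅, ∅, by simp⟩

theorem factorizes_empty : Factorizes c d (∅ : Set (Arc q m)) :=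
  ⟨isPolyLocallyClosed_empty _, ∅, Equiv.equivOfIsEmpty _ _, isPolyLocallyClosed_empty _,
    fun y => y.2.elim, fun _ => ⟨0, 0, fun y => y.2.elim⟩, fun _ => ⟨0, 0, fun w => w.1.2.elim⟩,
    fun _ _ y => y.2.elim⟩

theorem minor_eq_zero_of_not_injective (hc : ¬ Function.Injective c) : minor h c = 0 := by
  rw [Function.Injective] at hc
  push Not at hc
  obtain ⟨b, b', hbb, hne⟩ := hc
  refine Matrix.det_zero_of_column_eq hne fun a => ?_
  rw [Matrix.of_apply, Matrix.of_apply, hbb]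

theorem stratum_zero (Y : Set (Arc q m)) : stratum Y 0 d = ∅ := by
  ext y
  simp [stratum]

/-- A subset of a stratum of `h = 0` that is defined by further equations factorizes if it is a
union of fibres of the remainder map. -/
theorem factorizes_of_fibres [PerfectField k] {α : Type*}
    {f : α → MvPowerSeries (Option (Fin m)) k} (hc : Function.Injective c)
    (hfib : ∀ y ∈ stratum (variety h) (minor h c) d, ∀ y' ∈ stratum (variety h) (minor h c) d,
      remainder c d y = remainder c d y' → (∀ a, y.eval (f a) = 0) → ∀ a, y'.eval (f a) = 0) :
    Factorizes c d {y | y ∈ stratum (variety h) (minor h c) d ∧ ∀ a, y.eval (f a) = 0} := by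
  obtain ⟨c', hcc⟩ := exists_bijective_sumElim hc
  have hU : {y | y ∈ stratum (variety h) (minor h c) d ∧ ∀ a, y.eval (f a) = 0} ⊆
      stratum (variety h) (minor h c) d := fun y hy => hy.1
  obtain ⟨Φ, hΦ₁, hΦ₂⟩ := exists_equiv_prod hcc hU
    fun y hy y' hy' hyy => ⟨hy', hfib y hy.1 y' hy' hyy hy.2⟩
  refine ⟨isPolyLocallyClosed_stratum f, _, Φ, isPolyLocallyClosed_image_remainder f hcc hfib, hΦ₁,
    isRationallyTextile_of_coords Φ hΦ₁ hΦ₂, isRationallyTextile_symm hcc hU Φ hΦ₁ hΦ₂, ?_⟩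
  rintro v rfl
  exact isLocalSNormHomeo_of_subset hcc hU Φ hΦ₁ hΦ₂

/-- The strata of the variety of `h`, for a maximal minor of `∂_y h`. -/
theorem factorizes_stratum_variety [PerfectField k] (h : Fin r → SeriesB q m) (c : Fin r → Fin m)
    (d : ℕ) : Factorizes c d (stratum (variety h) (minor h c) d) := by
  by_cases hc : Function.Injective c
  · have h1 := factorizes_of_fibres (h := h) (d := d) (α := Empty) (f := Empty.elim) hc
      fun y hy y' hy' _ _ a => a.elim
    convert h1 using 1
    ext y
    simp
  · rw [minor_eq_zero_of_not_injective hc, stratum_zero]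
    exact factorizes_empty

open Polynomial in
/-- Two points of the same fibre of the remainder map are joined by a line in the space of
quotients, over which there is a family of solutions. A series that lies in the ideal of `h` up to a
factor not vanishing at one of the points vanishes on the whole family. -/
theorem eval_eq_zero_of_mul_mem_span (hc : Function.Injective c) {y y' : Arc q m}
    (hy : y ∈ stratum (variety h) (minor h c) d) (hy' : y' ∈ stratum (variety h) (minor h c) d)
    (hyy : remainder c d y = remainder c d y') {σ f : SeriesB q m}
    (hσ : y.eval σ.1 ≠ 0) (hf : σ * f ∈ Ideal.span (Set.range h)) : y'.eval f.1 = 0 := by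
  obtain ⟨c', hcc⟩ := exists_bijective_sumElim hc
  have hyy' : remOf c d y.coords = remOf c d y'.coords := hyy
  let w : Fin (m - r) × ℕ → k[X] := fun p => C (quotOf c' d y.coords p) +
    X * C (quotOf c' d y'.coords p - quotOf c' d y.coords p)
  let x : Fin m × ℕ → k[X] := base c c' d (fun p => C (remOf c d y.coords p)) w
  have hx : IsAdmissible h c d x := by
    have h1 := (isAdmissible_basePoint hcc hy).map (CAlgHom : k →ₐ[k] k[X])
    have h2 : (CAlgHom : k →ₐ[k] k[X]) ∘ y.basePoint c c' d = base c c' d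
        (fun p => C (remOf c d y.coords p)) (fun p => C (quotOf c' d y.coords p)) :=
      comp_base (C : k →+* k[X]) _ _
    rw [h2] at h1
    exact h1.base_congr hcc w
  have hspec : ∀ a : k, aeval (R := k) a ∘ x = base c c' d (remOf c d y.coords) fun p =>
      quotOf c' d y.coords p + a * (quotOf c' d y'.coords p - quotOf c' d y.coords p) := by
    intro a
    refine (comp_base (aeval (R := k) a : k[X] →+* k) _ _).trans ?_
    congr 1
    · funext p
      exact aeval_C a _
    · funext p
      simp [w]
  -- the line of base points joins those of `y` and `y'`
  have h0 : aeval (R := k) (0 : k) ∘ x = y.basePoint c c' d := by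
    rw [hspec]
    simp only [zero_mul, add_zero]
    rfl
  have h1 : aeval (R := k) (1 : k) ∘ x = y'.basePoint c c' d := by
    rw [hspec, hyy']
    simp only [one_mul, add_sub_cancel]
    rfl
  have hsol : ∀ g ∈ Ideal.span (Set.range h), evalAt (addTail c d x hx.solution) g.1 = 0 := by
    intro g hg
    have h2 : Ideal.span (Set.range h) ≤ RingHom.ker
        ((evalAt (k := k) (addTail c d x hx.solution)).toRingHom.comp
          (seriesRing q (Option (Fin m))).subtype) := by
      rw [Ideal.span_le]
      rintro _ ⟨a, rfl⟩
      exact hx.evalAt_solution a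
    exact h2 hg
  -- `σ` does not vanish on the family since it does not vanish at `y`
  have h2 := hsol _ hf
  have h3 : evalAt (addTail c d x hx.solution) σ.1 ≠ 0 := by
    intro h4
    apply hσ
    have h5 := hx.map (aeval (R := k) (0 : k))
    rw [Arc.eval_eq_evalAt, coords_eq_addTail_solution hcc hy h0 h5,
      ← hx.comp_addTail_solution _ h5, ← map_evalAt, h4, map_zero]
  have h4 : evalAt (addTail c d x hx.solution) f.1 = 0 := by
    have h5 : evalAt (addTail c d x hx.solution) σ.1 * evalAt (addTail c d x hx.solution) f.1 = 0 := by
      rw [← map_mul]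
      exact h2
    exact (mul_eq_zero.mp h5).resolve_left h3
  have h5 := hx.map (aeval (R := k) (1 : k))
  rw [Arc.eval_eq_evalAt, coords_eq_addTail_solution hcc hy' h1 h5,
    ← hx.comp_addTail_solution _ h5, ← map_evalAt, h4, map_zero]

/-- The strata of an arquile variety, for an adapted minor. -/
theorem factorizes_stratum_of_isAdapted [PerfectField k] {N : ℕ} {f : Fin N → SeriesB q m}
    (hh : ∀ a, h a ∈ vanishingIdeal (variety f)) (hadapted : IsAdapted (variety f) h c) (d : ℕ) :
    Factorizes c d (stratum (variety f) (minor h c) d) := by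
  by_cases hc : Function.Injective c
  · have hvar : ∀ y ∈ variety f, y ∈ variety h := fun y hy a =>
      vanishingIdeal_le_relIdeal hy (hh a)
    have hset : stratum (variety f) (minor h c) d =
        {y | y ∈ stratum (variety h) (minor h c) d ∧ ∀ a, y.eval (f a).1 = 0} := by
      ext y
      exact ⟨fun hy => ⟨⟨hvar y hy.1, hy.2⟩, hy.1⟩, fun hy => ⟨hy.2, hy.1.2⟩⟩
    rw [hset]
    refine factorizes_of_fibres hc fun y hy y' hy' hyy hf a => ?_
    have hyf : y ∈ variety f := hf
    have hg : y.eval (minor h c) ≠ 0 := by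
      intro h0
      have h1 := hy.2
      rw [h0, PowerSeries.order_zero] at h1
      exact ENat.top_ne_natCast d h1
    have hloc := (localIdeal_eq_and_mem_arqReg hyf hh hg (hadapted y hyf hg)).1
    have hfa : f a ∈ vanishingIdeal (variety f) := by
      rw [vanishingIdeal, Ideal.mem_iInf]
      intro y₁
      rw [Ideal.mem_iInf]
      exact fun hy₁ => hy₁ a
    have h1 := Ideal.mem_map_of_mem (algebraMap (SeriesB q m) (Localization.AtPrime y.relIdeal)) hfa
    change _ ∈ localIdeal (variety f) y at h1
    rw [hloc, IsLocalization.algebraMap_mem_map_algebraMap_iff y.relIdeal.primeCompl] at h1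
    obtain ⟨σ, hσ, hσf⟩ := h1
    exact eval_eq_zero_of_mul_mem_span hc hy hy' hyy (σ := σ) hσ hσf
  · rw [minor_eq_zero_of_not_injective hc, stratum_zero]
    exact factorizes_empty

end Strata

end

end Arquile

theorem mainTheorem1 {k : Type*} [Field k] [PerfectField k] (q : Arquile.Quality k) (m n : ℕ)
    (f : Fin n → Arquile.SeriesB q m) (Y : Set (Arquile.Arc q m)) (hY : Y = Arquile.variety f) :
    -- the arq.regular locus is covered by finitely many sets `{g_j ≠ 0}`, with adapted minors `g_j`
    -- of the relative Jacobian matrix of suitable generators of the ideal of `Y`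
    (∃ (p : ℕ) (F : Fin p → Arquile.SeriesB q m) (N : ℕ) (r : Fin N → ℕ)
        (ρ : (j : Fin N) → Fin (r j) → Fin p) (c : (j : Fin N) → Fin (r j) → Fin m),
      Ideal.span (Set.range F) = Arquile.vanishingIdeal Y ∧
      (∀ j, Arquile.IsAdapted Y (F ∘ ρ j) (c j)) ∧
      Arquile.arqReg Y = ⋃ j, {y | y ∈ Y ∧ y.eval (Arquile.minor (F ∘ ρ j) (c j)) ≠ 0}) ∧
    -- if the ideal of `Y` has constant height `r` along `Y`, the minors of size `r` of any system
    -- of generators define the arq.singular locus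
    (∀ (p : ℕ) (F : Fin p → Arquile.SeriesB q m) (r : ℕ),
      Ideal.span (Set.range F) = Arquile.vanishingIdeal Y →
      (∀ y ∈ Y, (Arquile.localIdeal Y y).height = r) →
      Arquile.arqSing Y = {y | y ∈ Y ∧ ∀ (ρ : Fin r → Fin p) (c : Fin r → Fin m),
        y.eval (Arquile.minor (F ∘ ρ) c) = 0}) ∧
    -- for every adapted minor, all strata of `Y` factor
    (∀ (r : ℕ) (h : Fin r → Arquile.SeriesB q m) (c : Fin r → Fin m),
      (∀ a, h a ∈ Arquile.vanishingIdeal Y) → Arquile.IsAdapted Y h c →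
      ∀ d : ℕ, Arquile.Factorizes c d (Arquile.stratum Y (Arquile.minor h c) d)) ∧
    -- for every maximal minor of `∂_y f`, all strata of `Y` factor
    (∀ (c : Fin n → Fin m) (d : ℕ),
      Arquile.Factorizes c d (Arquile.stratum Y (Arquile.minor f c) d)) := by
  subst hY
  exact ⟨Arquile.exists_adapted_minors _, fun _ _ _ hF hht => Arquile.arqSing_eq hF hht,
    fun _ _ _ hh hadapted d => Arquile.factorizes_stratum_of_isAdapted hh hadapted d,
    fun c d => Arquile.factorizes_stratum_variety f c d⟩
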